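/- **Theorem ($L^p$ Serre duality on generic CR submanifolds).** Let $X$ be a Hausdorff complex manifold of dimension $n$ and let $M\subset X$ be an oriented, $\sigma$-compact, $\mathcal C^\infty$-smooth, generic CR submanifold of real codimension $k\le n$, so that $\dim_{\mathbb R}M=2n-k$ and $H_{0,1}M=T_{0,1}X\cap(\mathbb C\otimes TM)$ has complex rank $n-k$. Put $\Lambda^{r,q}M=\Lambda^r\big((\mathbb C\otimes TM)/H_{0,1}M\big)^*\otimes\Lambda^q(H_{0,1}M)^*$ (which is $0$ if $q<0$ or $q>n-k$). Let $1<p,p'<\infty$ with $\frac1p+\frac1{p'}=1$, and let $0\le r\le n$, $0\le q\le n-k$. Let $(L^p_{loc})^{r,q}(M)$ be the space of $L^p_{loc}$ sections of $\Lambda^{r,q}M$, with the topology of $L^p$ convergence on compact sets, and $(L^p_c)^{r,q}(M)$ the subspace of forms with compact support, with the inductive limit topology (the finest locally convex topology making the inclusions of the spaces of $L^p$ forms supported in a fixed compact set continuous). Let $\langle g,f\rangle=\int_M g\wedge f$ be the pairing between forms of complementary bidegrees $(r,q)$ and $(n-r,n-k-q)$, one of which has compact support. The tangential Cauchy–Riemann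 operator $\overline\partial_b$, taken in the weak sense, is an unbounded operator in each of the two scales of spaces, defined on those $f$ for which $\overline\partial_bf$ again belongs to the scale; $\overline\partial_b f=g$ means $\int_M g\wedge\varphi=(-1)^{\deg f+1}\int_M f\wedge\overline\partial_b\varphi$ for all smooth compactly supported $\varphi$ of the complementary bidegree. Denote by $Z^{r,q}_{L^p_{loc}}(M)$, $Z^{r,q}_{c,L^p}(M)$ the kernels and by $E^{r,q}_{L^p_{loc}}(M)$, $E^{r,q}_{c,L^p}(M)$ the ranges of these operators in bidegree $(r,q)$, and by $H^{r,q}_{L^p_{loc}}(M)=Z^{r,q}_{L^p_{loc}}(M)/E^{r,q}_{L^p_{loc}}(M)$ and $H^{r,q}_{c,L^p}(M)=Z^{r,q}_{c,L^p}(M)/E^{r,q}_{c,L^p}(M)$ the cohomology groups, with the quotient topologies. The following assertions are equivalent: 1. $E^{n-r,n-k-q}_{c,L^p}(M)=\{g\in (L^p_c)^{n-r,n-k-q}(M)\mid \langle g,f\rangle=0\ \ \forall f\in Z^{r,q}_{L^{p'}_{loc}}(M)\}$; 2. $H^{n-r,n-k-q}_{c,L^p}(M)$ is Hausdorff; 3.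 $E^{r,q+1}_{L^{p'}_{loc}}(M)=\{g\in (L^{p'}_{loc})^{r,q+1}(M)\mid \langle g,f\rangle=0\ \ \forall f\in Z^{n-r,n-k-q-1}_{c,L^p}(M)\}$; 4. $H^{r,q+1}_{L^{p'}_{loc}}(M)$ is Hausdorff. If these assertions hold, then the maps induced by $g\mapsto\langle g,\cdot\rangle$, $$H^{n-r,n-k-q}_{c,L^p}(M)\longrightarrow\big(H^{r,q}_{L^{p'}_{loc}}(M)\big)',\qquad H^{r,q+1}_{L^{p'}_{loc}}(M)\longrightarrow\big(H^{n-r,n-k-q-1}_{c,L^p}(M)\big)',$$ into the spaces of continuous linear functionals are linear isomorphisms. With respect to the strong topologies on the dual spaces, the inverse of the first one is continuous, and the second one is a topological isomorphism. -/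

import Mathlib

open Set Filter Topology MeasureTheory Manifold
open scoped ENNReal ContDiff

noncomputable section

namespace CRSerre

/-! ### Differential forms on a real manifold of dimension `d` -/

/-- The model space `ℝ^d`; it is also the tangent space `T_x M`, read in the preferred chart
at `x`. -/
abbrev Model (d : ℕ) : Type := EuclideanSpace ℝ (Fin d)

/-- Alternating real-multilinear `G`-valued `m`-forms on a tangent space. -/
abbrev Alt (d m : ℕ) (G : Type) [NormedAddCommGroup G] [NormedSpace ℝ G] : Type :=
  Model d [⋀^Fin m]→L[ℝ] G

/-- The standard basis of `ℝ^d`. -/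
def stdVec (d : ℕ) : Fin d → Model d := fun i => EuclideanSpace.single i 1

section Forms

variable {d : ℕ} {M : Type*} [TopologicalSpace M] [ChartedSpace (Model d) M]
  [IsManifold 𝓘(ℝ, Model d) ∞ M]
  {G : Type} [NormedAddCommGroup G] [NormedSpace ℝ G]

/-- The coordinate expression of the form `f` in the chart centred at `c`: the pull-back of `f`
under the inverse of the chart.  It is only meaningful on the target of the chart. -/
def rep (c : M) {m : ℕ} (f : M → Alt d m G) (y : Model d) : Alt d m G :=
  (f ((chartAt (Model d) c).symm y)).compContinuousLinearMap
    (tangentCoordChange 𝓘(ℝ, Model d) c ((chartAt (Model d) c).symm y)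
      ((chartAt (Model d) c).symm y))

/-- `f` is a smooth form on `M`. -/
def IsSmoothForm {m : ℕ} (f : M → Alt d m G) : Prop :=
  ∀ c : M, ContDiffOn ℝ ∞ (rep c f) (chartAt (Model d) c).target

/-- The exterior derivative, computed at `x` in the preferred chart at `x`. -/
def dForm {m : ℕ} (f : M → Alt d m G) (x : M) : Alt d (m + 1) G :=
  extDeriv (rep x f) (chartAt (Model d) x x)

/-- The coefficients of `f` are locally in `L^p`. -/
def IsLpLoc (p : ℝ≥0∞) {m : ℕ} (f : M → Alt d m G) : Prop :=
  ∀ (c : M) (K : Set (Model d)), IsCompact K → K ⊆ (chartAt (Model d) c).target →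
    MemLp (rep c f) p (volume.restrict K)

/-- `(α ∧ β)(v_1, …, v_{a+b})
  = (a! b!)⁻¹ ∑_σ sgn(σ) α(v_{σ 1}, …, v_{σ a}) β(v_{σ (a+1)}, …, v_{σ (a+b)})`. -/
def wedgeApply {a b : ℕ} (α : Alt d a ℂ) (β : Alt d b ℂ) (v : Fin (a + b) → Model d) : ℂ :=
  ((a.factorial : ℂ) * (b.factorial : ℂ))⁻¹ *
    ∑ σ : Equiv.Perm (Fin (a + b)), ((Equiv.Perm.sign σ : ℤ) : ℂ) *
      (α (fun i => v (σ (Fin.castAdd b i))) * β (fun j => v (σ (Fin.natAdd a j))))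

/-- The value of `α ∧ β` on the standard basis when it has top degree, and `0` otherwise. -/
def wedgeTop {a b : ℕ} (α : Alt d a ℂ) (β : Alt d b ℂ) : ℂ :=
  if h : a + b = d then wedgeApply α β (fun i => stdVec d (Fin.cast h i)) else 0

/-- A smooth nowhere vanishing real form of top degree.  It orients `M`: a basis `v` of `T_x M` is
positive if `Ω_x(v) > 0`. -/
def IsOrientationForm (Ω : M → Alt d d ℝ) : Prop :=
  IsSmoothForm Ω ∧ ∀ x, Ω x ≠ 0

variable (d M) in
/-- A smooth partition of unity subordinate to the domains of the charts of `M`. -/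
def unityPartition [T2Space M] [SigmaCompactSpace M] :
    SmoothPartitionOfUnity M 𝓘(ℝ, Model d) M univ :=
  Classical.choose
    (SmoothPartitionOfUnity.exists_isSubordinate_chartAt_source 𝓘(ℝ, Model d) M)

/-- `1` or `-1` according to whether the chart centred at `c` preserves the orientation at the
point with coordinates `y`. -/
def orientSign (Ω : M → Alt d d ℝ) (c : M) (y : Model d) : ℝ :=
  (SignType.sign (rep c Ω y (stdVec d)) : ℝ)

/-- The integrand of `∫_M ρ_c f ∧ g` in the chart centred at `c`. -/
def pairingIntegrand [T2Space M] [SigmaCompactSpace M] (Ω : M → Alt d d ℝ) {a b : ℕ}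
    (f : M → Alt d a ℂ) (g : M → Alt d b ℂ) (c : M) (y : Model d) : ℂ :=
  ((orientSign Ω c y * unityPartition d M c ((chartAt (Model d) c).symm y) : ℝ) : ℂ) *
    wedgeTop (rep c f y) (rep c g y)

/-- The pairing `⟨f, g⟩ = ∫_M f ∧ g` on `M` oriented by `Ω`, where the integral is computed in
charts with a partition of unity. -/
def pairing [T2Space M] [SigmaCompactSpace M] (Ω : M → Alt d d ℝ) {a b : ℕ}
    (f : M → Alt d a ℂ) (g : M → Alt d b ℂ) : ℂ :=
  ∑ᶠ c : M, ∫ y in (chartAt (Model d) c).target, pairingIntegrand Ω f g c y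

/-! ### The exterior derivative is independent of the chart -/

theorem tangentCoordChange_eq_fderiv (c x : M) {y : Model d}
    (hy : y ∈ (chartAt (Model d) c).target)
    (hx : (chartAt (Model d) c).symm y ∈ (chartAt (Model d) x).source) :
    HasFDerivAt (chartAt (Model d) x ∘ (chartAt (Model d) c).symm)
      (tangentCoordChange 𝓘(ℝ, Model d) c x ((chartAt (Model d) c).symm y)) y := by
  have h := hasFDerivWithinAt_tangentCoordChange (I := 𝓘(ℝ, Model d)) (x := c) (y := x)
    (z := (chartAt (Model d) c).symm y) (by
      simp only [extChartAt_source]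
      exact ⟨(chartAt (Model d) c).map_target hy, hx⟩)
  simpa [extChartAt, (chartAt (Model d) c).right_inv hy] using h

theorem contDiffAt_transition (c x : M) {y : Model d}
    (hy : y ∈ (chartAt (Model d) c).target)
    (hx : (chartAt (Model d) c).symm y ∈ (chartAt (Model d) x).source) :
    ContDiffAt ℝ ∞ (chartAt (Model d) x ∘ (chartAt (Model d) c).symm) y := by
  have h := contDiffWithinAt_ext_coord_change (I := 𝓘(ℝ, Model d)) (n := ∞) x c (y := y) (by
    simp [extChartAt, hy, hx])
  simpa [extChartAt, contDiffWithinAt_univ] using h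

theorem rep_eq_pullback (c x : M) {m : ℕ} (f : M → Alt d m G) {y : Model d}
    (hy : y ∈ (chartAt (Model d) c).target)
    (hx : (chartAt (Model d) c).symm y ∈ (chartAt (Model d) x).source) :
    rep c f y = (rep x f ((chartAt (Model d) x ∘ (chartAt (Model d) c).symm) y)).compContinuousLinearMap
      (fderiv ℝ (chartAt (Model d) x ∘ (chartAt (Model d) c).symm) y) := by
  rw [(tangentCoordChange_eq_fderiv c x hy hx).fderiv]
  ext v
  have e : (chartAt (Model d) x).symm (chartAt (Model d) x ((chartAt (Model d) c).symm y)) =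
      (chartAt (Model d) c).symm y := (chartAt (Model d) x).left_inv hx
  simp only [rep, Function.comp_apply, ContinuousAlternatingMap.compContinuousLinearMap_apply, e]
  congr 1
  ext1 i
  simp only [Function.comp_apply]
  rw [tangentCoordChange_comp]
  simp only [extChartAt_source]
  exact ⟨⟨(chartAt (Model d) c).map_target hy, hx⟩, mem_chart_source _ _⟩

theorem rep_dForm (c : M) {m : ℕ} {f : M → Alt d m G} (hf : IsSmoothForm f) {y : Model d}
    (hy : y ∈ (chartAt (Model d) c).target) :
    rep c (dForm f) y = extDeriv (rep c f) y := by
  set x := (chartAt (Model d) c).symm y with hxdef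
  have hx : x ∈ (chartAt (Model d) x).source := mem_chart_source _ x
  have hev : rep c f =ᶠ[𝓝 y] fun y' =>
      (rep x f ((chartAt (Model d) x ∘ (chartAt (Model d) c).symm) y')).compContinuousLinearMap
      (fderiv ℝ (chartAt (Model d) x ∘ (chartAt (Model d) c).symm) y') := by
    have h1 := (chartAt (Model d) c).open_target.mem_nhds hy
    have h2 := ((chartAt (Model d) c).continuousAt_symm hy).preimage_mem_nhds
      ((chartAt (Model d) x).open_source.mem_nhds hx)
    filter_upwards [h1, h2] with y' h1 h2
    exact rep_eq_pullback c x f h1 h2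
  have hsm : DifferentiableAt ℝ (rep x f)
      ((chartAt (Model d) x ∘ (chartAt (Model d) c).symm) y) :=
    ((hf x).contDiffAt ((chartAt (Model d) x).open_target.mem_nhds
      ((chartAt (Model d) x).map_source hx))).differentiableAt (by simp)
  rw [hev.extDeriv_eq, extDeriv_pullback hsm (contDiffAt_transition c x hy hx) (by
    rw [minSmoothness_of_isRCLikeNormedField]; exact WithTop.coe_le_coe.2 (le_top : (2 : ℕ∞) ≤ ⊤)), (tangentCoordChange_eq_fderiv c x hy hx).fderiv]
  rfl

/-- A form whose coordinate expressions are continuous. -/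
def IsContForm {m : ℕ} (f : M → Alt d m G) : Prop :=
  ∀ c : M, ContinuousOn (rep c f) (chartAt (Model d) c).target

theorem IsSmoothForm.isContForm {m : ℕ} {f : M → Alt d m G} (hf : IsSmoothForm f) :
    IsContForm f := fun c => (hf c).continuousOn

theorem IsSmoothForm.dForm {m : ℕ} {f : M → Alt d m G} (hf : IsSmoothForm f) :
    IsSmoothForm (dForm f) := by
  intro c
  have h : ContDiffOn ℝ ∞ (extDeriv (rep c f)) (chartAt (Model d) c).target := by
    have h1 : ContDiffOn ℝ ∞ (fderiv ℝ (rep c f)) (chartAt (Model d) c).target :=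
      (hf c).fderiv_of_isOpen (chartAt (Model d) c).open_target (by simp)
    exact (ContinuousAlternatingMap.alternatizeUncurryFinCLM ℝ (Model d) G).contDiff.comp_contDiffOn h1
  exact h.congr fun y hy => rep_dForm c hf hy

theorem rep_eq_zero (c : M) {m : ℕ} {f : M → Alt d m G} {y : Model d}
    (h : f ((chartAt (Model d) c).symm y) = 0) : rep c f y = 0 := by
  simp only [rep, h]
  ext v
  simp

theorem support_dForm_subset {m : ℕ} (f : M → Alt d m G) :
    Function.support (dForm f) ⊆ tsupport f := by
  intro x hx
  by_contra hn
  apply hx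
  have h0 : f =ᶠ[𝓝 x] 0 := notMem_tsupport_iff_eventuallyEq.1 hn
  have hy : chartAt (Model d) x x ∈ (chartAt (Model d) x).target := mem_chart_target _ x
  have hev : rep x f =ᶠ[𝓝 (chartAt (Model d) x x)] fun _ => 0 := by
    have hc := (chartAt (Model d) x).continuousAt_symm hy
    rw [ContinuousAt, (chartAt (Model d) x).left_inv (mem_chart_source _ x)] at hc
    filter_upwards [hc.eventually h0] with y h
    exact rep_eq_zero x h
  rw [dForm, hev.extDeriv_eq, extDeriv, fderiv_const_apply]
  exact (ContinuousAlternatingMap.alternatizeUncurryFinCLM ℝ (Model d) G).map_zero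

theorem hasCompactSupport_dForm {m : ℕ} {f : M → Alt d m G} (hf : HasCompactSupport f) :
    HasCompactSupport (dForm f) :=
  hf.mono' (support_dForm_subset f)

/-! ### Linearity of the pairing in its first argument -/

theorem rep_add (c : M) {m : ℕ} (f g : M → Alt d m G) (y : Model d) :
    rep c (f + g) y = rep c f y + rep c g y := by
  ext v; simp [rep]

theorem rep_smul (c : M) {m : ℕ} (z : ℂ) (f : M → Alt d m ℂ) (y : Model d) :
    rep c (z • f) y = z • rep c f y := by
  ext v; simp [rep]

theorem wedgeTop_add {a b : ℕ} (α α' : Alt d a ℂ) (β : Alt d b ℂ) :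
    wedgeTop (α + α') β = wedgeTop α β + wedgeTop α' β := by
  unfold wedgeTop
  split_ifs
  · simp only [wedgeApply, ContinuousAlternatingMap.add_apply, add_mul, mul_add,
      Finset.sum_add_distrib]
  · simp

theorem wedgeTop_smul {a b : ℕ} (z : ℂ) (α : Alt d a ℂ) (β : Alt d b ℂ) :
    wedgeTop (z • α) β = z * wedgeTop α β := by
  unfold wedgeTop
  split_ifs
  · simp only [wedgeApply, ContinuousAlternatingMap.smul_apply, smul_eq_mul, Finset.mul_sum]
    refine Finset.sum_congr rfl fun σ _ => ?_
    ring
  · simp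

theorem wedgeTop_zero_left {a b : ℕ} (β : Alt d b ℂ) : wedgeTop (0 : Alt d a ℂ) β = 0 := by
  simpa using wedgeTop_smul (0 : ℂ) (0 : Alt d a ℂ) β

theorem wedgeTop_zero_right {a b : ℕ} (α : Alt d a ℂ) : wedgeTop α (0 : Alt d b ℂ) = 0 := by
  unfold wedgeTop
  split_ifs
  · simp [wedgeApply]
  · rfl

section

variable [T2Space M] [SigmaCompactSpace M]

theorem tsupport_unityPartition_subset (c : M) :
    tsupport (unityPartition d M c) ⊆ (chartAt (Model d) c).source :=
  Classical.choose_spec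
    (SmoothPartitionOfUnity.exists_isSubordinate_chartAt_source 𝓘(ℝ, Model d) M) c

theorem measurable_realSign : Measurable (fun x : ℝ => (SignType.sign x : ℝ)) := by
  have : Monotone (fun x : ℝ => (SignType.sign x : ℝ)) := by
    intro x y h
    have := SignType.sign.monotone h
    have h2 : Monotone (fun s : SignType => (s : ℝ)) := by
      intro s t hst
      revert hst
      cases s <;> cases t <;> simp
    exact h2 this
  exact this.measurable

theorem pairingIntegrand_eq_zero (Ω : M → Alt d d ℝ) {a b : ℕ}
    (f : M → Alt d a ℂ) (g : M → Alt d b ℂ) (c : M) {y : Model d}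
    (h : (chartAt (Model d) c).symm y ∉ tsupport g ∩ tsupport (unityPartition d M c)) :
    pairingIntegrand Ω f g c y = 0 := by
  unfold pairingIntegrand
  by_cases h1 : (chartAt (Model d) c).symm y ∈ tsupport g
  · have h2 : (chartAt (Model d) c).symm y ∉ tsupport (unityPartition d M c) := fun h2 => h ⟨h1, h2⟩
    rw [image_eq_zero_of_notMem_tsupport h2]
    simp
  · rw [rep_eq_zero c (image_eq_zero_of_notMem_tsupport h1), wedgeTop_zero_right, mul_zero]

theorem integrableOn_pairingIntegrand {Ω : M → Alt d d ℝ} (hΩ : IsContForm Ω) {p : ℝ≥0∞}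
    (hp : 1 ≤ p) {a b : ℕ} {f : M → Alt d a ℂ} (hf : IsLpLoc p f) {g : M → Alt d b ℂ}
    (hg : IsContForm g) (hgc : HasCompactSupport g) (c : M) :
    IntegrableOn (pairingIntegrand Ω f g c) (chartAt (Model d) c).target := by
  set S : Set M := tsupport g ∩ tsupport (unityPartition d M c) with hS
  have hSc : IsCompact S := hgc.inter_right (isClosed_tsupport _)
  have hSs : S ⊆ (chartAt (Model d) c).source :=
    inter_subset_right.trans (tsupport_unityPartition_subset c)
  set K : Set (Model d) := chartAt (Model d) c '' S with hK
  have hKc : IsCompact K := hSc.image_of_continuousOn ((chartAt (Model d) c).continuousOn.mono hSs)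
  have hKt : K ⊆ (chartAt (Model d) c).target := by
    rintro _ ⟨x, hx, rfl⟩
    exact (chartAt (Model d) c).map_source (hSs hx)
  refine IntegrableOn.of_forall_sdiff_eq_zero (s := K) ?_
    (chartAt (Model d) c).open_target.measurableSet ?_
  swap
  · rintro y ⟨hy, hyK⟩
    refine pairingIntegrand_eq_zero Ω f g c fun h => hyK ⟨_, h, (chartAt (Model d) c).right_inv hy⟩
  have hfi : IntegrableOn (rep c f) K := by
    have : IsFiniteMeasure (volume.restrict K) := ⟨by simpa using hKc.measure_lt_top⟩
    exact (hf c K hKc hKt).integrable hp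
  have hgK : ContinuousOn (rep c g) K := (hg c).mono hKt
  have hw : IntegrableOn (fun y => wedgeTop (rep c f y) (rep c g y)) K := by
    unfold wedgeTop
    split_ifs with h
    · unfold wedgeApply
      refine Integrable.const_mul (integrable_finsetSum _ fun σ _ => Integrable.const_mul ?_ _) _
      refine IntegrableOn.mul_continuousOn ?_ ?_ hKc
      · exact (ContinuousAlternatingMap.apply ℝ (Model d) ℂ _).integrable_comp hfi
      · exact (ContinuousAlternatingMap.apply ℝ (Model d) ℂ _).continuous.comp_continuousOn hgK
    · exact integrableOn_zero
  refine Integrable.bdd_mul (c := 1) hw ?_ ?_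
  · have h1 : AEStronglyMeasurable (fun y => orientSign Ω c y) (volume.restrict K) := by
      have h0 : ContinuousOn (fun y => rep c Ω y (stdVec d)) K :=
        (ContinuousAlternatingMap.apply ℝ (Model d) ℝ _).continuous.comp_continuousOn
          ((hΩ c).mono hKt)
      exact (measurable_realSign.comp_aemeasurable
        (h0.aemeasurable hKc.measurableSet)).aestronglyMeasurable
    have h2 : AEStronglyMeasurable
        (fun y => unityPartition d M c ((chartAt (Model d) c).symm y)) (volume.restrict K) := by
      have h0 : ContinuousOn (fun y => unityPartition d M c ((chartAt (Model d) c).symm y)) K :=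
        (unityPartition d M c).contMDiff.continuous.comp_continuousOn
          ((chartAt (Model d) c).continuousOn_symm.mono hKt)
      exact h0.aestronglyMeasurable hKc.measurableSet
    exact Complex.continuous_ofReal.comp_aestronglyMeasurable (h1.mul h2)
  · refine Eventually.of_forall fun y => ?_
    rw [Complex.norm_real, norm_mul]
    refine mul_le_one₀ ?_ (norm_nonneg _) ?_
    · unfold orientSign
      cases SignType.sign (rep c Ω y (stdVec d)) <;> simp
    · rw [Real.norm_of_nonneg ((unityPartition d M).nonneg _ _)]
      exact (unityPartition d M).le_one _ _

theorem finite_support_pairing (Ω : M → Alt d d ℝ) {a b : ℕ}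
    (f : M → Alt d a ℂ) {g : M → Alt d b ℂ} (hgc : HasCompactSupport g) :
    (Function.support fun c : M =>
      ∫ y in (chartAt (Model d) c).target, pairingIntegrand Ω f g c y).Finite := by
  have hfin := ((unityPartition d M).locallyFinite.closure).finite_nonempty_inter_compact hgc
  refine hfin.subset fun c hc => ?_
  by_contra hne
  apply hc
  have : ∀ y, pairingIntegrand Ω f g c y = 0 := fun y =>
    pairingIntegrand_eq_zero Ω f g c fun h => hne ⟨_, h.2, h.1⟩
  simp [this]

theorem pairing_add_left {Ω : M → Alt d d ℝ} (hΩ : IsContForm Ω) {p : ℝ≥0∞}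
    (hp : 1 ≤ p) {a b : ℕ} {f f' : M → Alt d a ℂ} (hf : IsLpLoc p f) (hf' : IsLpLoc p f')
    {g : M → Alt d b ℂ} (hg : IsContForm g) (hgc : HasCompactSupport g) :
    pairing Ω (f + f') g = pairing Ω f g + pairing Ω f' g := by
  unfold pairing
  rw [← finsum_add_distrib (finite_support_pairing Ω f hgc) (finite_support_pairing Ω f' hgc)]
  refine finsum_congr fun c => ?_
  rw [← integral_add (integrableOn_pairingIntegrand hΩ hp hf hg hgc c)
    (integrableOn_pairingIntegrand hΩ hp hf' hg hgc c)]
  simp only [pairingIntegrand, rep_add, wedgeTop_add, mul_add]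

theorem pairing_smul_left (Ω : M → Alt d d ℝ) {a b : ℕ} (z : ℂ) (f : M → Alt d a ℂ)
    (g : M → Alt d b ℂ) :
    pairing Ω (z • f) g = z * pairing Ω f g := by
  unfold pairing
  rw [← smul_eq_mul, smul_finsum]
  refine finsum_congr fun c => ?_
  rw [smul_eq_mul, ← integral_const_mul]
  congr 1
  funext y
  simp only [pairingIntegrand, rep_smul, wedgeTop_smul]
  ring

theorem pairing_zero_left (Ω : M → Alt d d ℝ) {a b : ℕ} (g : M → Alt d b ℂ) :
    pairing Ω (0 : M → Alt d a ℂ) g = 0 := by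
  simpa using pairing_smul_left Ω (0 : ℂ) (0 : M → Alt d a ℂ) g

end

theorem IsLpLoc.add {p : ℝ≥0∞} {m : ℕ} {f g : M → Alt d m G} (hf : IsLpLoc p f)
    (hg : IsLpLoc p g) : IsLpLoc p (f + g) := fun c K hK hKt => by
  have : rep c (f + g) = rep c f + rep c g := funext fun y => rep_add c f g y
  rw [this]
  exact MemLp.add (ε := Alt d m G) (hf c K hK hKt) (hg c K hK hKt)

theorem IsLpLoc.smul {p : ℝ≥0∞} {m : ℕ} {f : M → Alt d m ℂ} (z : ℂ) (hf : IsLpLoc p f) :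
    IsLpLoc p (z • f) := fun c K hK hKt => by
  have : rep c (z • f) = z • rep c f := funext fun y => rep_smul c z f y
  rw [this]
  exact (hf c K hK hKt).const_smul z

theorem IsLpLoc.zero {p : ℝ≥0∞} {m : ℕ} : IsLpLoc p (0 : M → Alt d m G) := fun c K _ _ => by
  have : rep c (0 : M → Alt d m G) = 0 := funext fun y => rep_eq_zero c rfl
  rw [this]
  exact MemLp.zero (ε := Alt d m G)

end Forms

/-! ### Generic CR submanifolds and forms of bidegree `(r, q)` -/

section CR

variable {n k : ℕ} {X : Type*} [TopologicalSpace X] [ChartedSpace (EuclideanSpace ℂ (Fin n)) X]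
  {M : Type*} [TopologicalSpace M] [ChartedSpace (Model (2 * n - k)) M]
  [IsManifold 𝓘(ℝ, Model (2 * n - k)) ∞ M]

variable (n k) in
/-- The real differential of `F : M → X` at `x`, with values in `T_{F x} X`, which is a complex
vector space. -/
def tangentMap (F : M → X) (x : M) : Model (2 * n - k) →L[ℝ] EuclideanSpace ℂ (Fin n) :=
  mfderiv 𝓘(ℝ, Model (2 * n - k)) 𝓘(ℝ, EuclideanSpace ℂ (Fin n)) F x

variable (n k X M) in
/-- An oriented smooth generic CR submanifold of real codimension `k` in the complex manifold `X`
of dimension `n`: a smooth embedding `F` of a manifold `M` of real dimension `2n - k` such that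
`T_{F x} X = dF (T_x M) + i dF (T_x M)` for all `x`; equivalently, the bundle
`H_{0,1} M = T_{0,1} X ∩ ℂ ⊗ T M` has complex rank `n - k`.  The orientation of `M` is given by a
nowhere vanishing form `Ω` of top degree. -/
structure GenericCRSubmanifold where
  /-- The embedding of `M` in `X`. -/
  F : M → X
  isSmoothEmbedding : Manifold.IsSmoothEmbedding 𝓘(ℝ, Model (2 * n - k))
    𝓘(ℝ, EuclideanSpace ℂ (Fin n)) ∞ F
  generic : ∀ x, Submodule.span ℂ (range (tangentMap n k F x)) = ⊤
  /-- A form defining the orientation of `M`. -/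
  Ω : M → Alt (2 * n - k) (2 * n - k) ℝ
  isOrientationForm : IsOrientationForm Ω

/-- The fibre of `H_{0,1} M` at `x`.  A complexified tangent vector `u + i v` is written `(u, v)`;
its image in `T_{1,0} X`, identified with `T_{F x} X`, is `dF u + i dF v`, and it belongs
to `T_{0,1} X` if and only if this image vanishes. -/
def H01 (S : GenericCRSubmanifold n k X M) (x : M) :
    Set (Model (2 * n - k) × Model (2 * n - k)) :=
  {w | tangentMap n k S.F x w.1 + Complex.I • tangentMap n k S.F x w.2 = 0}

open Classical in
/-- The value of the complex-multilinear extension of `α` on complexified tangent vectors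
`ζ_j = u_j + i v_j`, expanded by multilinearity. -/
def complexEval {d m : ℕ} (α : Alt d m ℂ) (ζ : Fin m → Model d × Model d) : ℂ :=
  ∑ T : Finset (Fin m), Complex.I ^ T.card * α (fun j => if j ∈ T then (ζ j).2 else (ζ j).1)

/-- `f` is a section of the bundle of complex forms of degree `m` which vanish whenever more than
`q` of their arguments are in `H_{0,1} M`.  With `m = r + q` and `0 ≤ q`, restriction of `q`
arguments to `H_{0,1} M` maps this bundle onto
`Λ^{r,q} M = Λ^r (T_ℂ M / H_{0,1} M)^* ⊗ Λ^q (H_{0,1} M)^*`, so that such sections represent the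
forms of bidegree `(r, q)`; the kernel consists of the forms that vanish whenever `q` arguments
are in `H_{0,1} M`.  The exterior derivative induces the tangential Cauchy-Riemann operator on
these quotients, and the wedge product of representatives of complementary bidegrees `(r, q)` and
`(n - r, n - k - q)` depends only on their classes. For `q < 0` only `f = 0` is allowed. -/
def IsBidegree (S : GenericCRSubmanifold n k X M) {m : ℕ} (q : ℤ) (f : M → Alt (2 * n - k) m ℂ) : Prop :=
  ∀ (x : M) (ζ : Fin m → Model (2 * n - k) × Model (2 * n - k)),
    q < ({j | ζ j ∈ H01 S x}.ncard : ℤ) → complexEval (f x) ζ = 0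

/-- The total degree `r + q`. -/
abbrev deg (r : ℕ) (q : ℤ) : ℕ := ((r : ℤ) + q).toNat

/-- Smooth compactly supported forms of the type given by `q`. -/
structure IsTestForm (S : GenericCRSubmanifold n k X M) {m : ℕ} (q : ℤ) (φ : M → Alt (2 * n - k) m ℂ) : Prop where
  smooth : IsSmoothForm φ
  compact : HasCompactSupport φ
  bidegree : IsBidegree S q φ

theorem complexEval_add {d m : ℕ} (α α' : Alt d m ℂ) (ζ : Fin m → Model d × Model d) :
    complexEval (α + α') ζ = complexEval α ζ + complexEval α' ζ := by
  simp [complexEval, mul_add, Finset.sum_add_distrib]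

theorem complexEval_smul {d m : ℕ} (z : ℂ) (α : Alt d m ℂ) (ζ : Fin m → Model d × Model d) :
    complexEval (z • α) ζ = z * complexEval α ζ := by
  simp only [complexEval, ContinuousAlternatingMap.smul_apply, smul_eq_mul, Finset.mul_sum]
  exact Finset.sum_congr rfl fun T _ => by ring

/-! ### The spaces `(L^p_loc)^{r,q}(M)` and `(L^p_c)^{r,q}(M)`

Forms are represented by everywhere defined sections. Two sections represent the same form of
bidegree `(r, q)` if they have the same pairing with all test forms; nothing below depends on the
representatives, since the spaces of closed and of exact forms, and the annihilators, contain all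
sections that represent `0`. -/

/-- `(L^p_loc)^{r,q}(M)` as a space of sections. -/
def lpLoc (S : GenericCRSubmanifold n k X M) (p : ℝ≥0∞) (r : ℕ) (q : ℤ) :
    Submodule ℂ (M → Alt (2 * n - k) (deg r q) ℂ) where
  carrier := {f | IsBidegree S q f ∧ IsLpLoc p f}
  add_mem' := by
    rintro f g ⟨hf, hf'⟩ ⟨hg, hg'⟩
    refine ⟨fun x ζ h => ?_, hf'.add hg'⟩
    rw [Pi.add_apply, complexEval_add, hf x ζ h, hg x ζ h, add_zero]
  zero_mem' := ⟨fun x ζ _ => by simp [complexEval], IsLpLoc.zero⟩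
  smul_mem' := by
    rintro z f ⟨hf, hf'⟩
    refine ⟨fun x ζ h => ?_, hf'.smul z⟩
    rw [Pi.smul_apply, complexEval_smul, hf x ζ h, mul_zero]

/-- `(L^p_c)^{r,q}(M)` as a space of sections. -/
def lpComp (S : GenericCRSubmanifold n k X M) (p : ℝ≥0∞) (r : ℕ) (q : ℤ) :
    Submodule ℂ (M → Alt (2 * n - k) (deg r q) ℂ) where
  carrier := {f | f ∈ lpLoc S p r q ∧ HasCompactSupport f}
  add_mem' := fun hf hg => ⟨add_mem hf.1 hg.1, hf.2.add hg.2⟩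
  zero_mem' := ⟨zero_mem _, HasCompactSupport.zero⟩
  smul_mem' := fun z _ hf => ⟨Submodule.smul_mem _ z hf.1, hf.2.smul_left (f := fun _ => z)⟩

/-- The space `(L^p_loc)^{r,q}(M)`, with its own topology (see below). -/
def LpLoc (S : GenericCRSubmanifold n k X M) (p : ℝ≥0∞) (r : ℕ) (q : ℤ) : Type _ := ↥(lpLoc S p r q)

/-- The space `(L^p_c)^{r,q}(M)`, with its own topology (see below). -/
def LpComp (S : GenericCRSubmanifold n k X M) (p : ℝ≥0∞) (r : ℕ) (q : ℤ) : Type _ := ↥(lpComp S p r q)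

instance (S : GenericCRSubmanifold n k X M) (p : ℝ≥0∞) (r : ℕ) (q : ℤ) : AddCommGroup (LpLoc S p r q) :=
  inferInstanceAs (AddCommGroup ↥(lpLoc S p r q))

instance (S : GenericCRSubmanifold n k X M) (p : ℝ≥0∞) (r : ℕ) (q : ℤ) : Module ℂ (LpLoc S p r q) :=
  inferInstanceAs (Module ℂ ↥(lpLoc S p r q))

instance (S : GenericCRSubmanifold n k X M) (p : ℝ≥0∞) (r : ℕ) (q : ℤ) : AddCommGroup (LpComp S p r q) :=
  inferInstanceAs (AddCommGroup ↥(lpComp S p r q))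

instance (S : GenericCRSubmanifold n k X M) (p : ℝ≥0∞) (r : ℕ) (q : ℤ) : Module ℂ (LpComp S p r q) :=
  inferInstanceAs (Module ℂ ↥(lpComp S p r q))

/-- The underlying section. -/
def LpLoc.form {S : GenericCRSubmanifold n k X M} {p : ℝ≥0∞} {r : ℕ} {q : ℤ} (f : LpLoc S p r q) :
    M → Alt (2 * n - k) (deg r q) ℂ := Subtype.val f

/-- The underlying section. -/
def LpComp.form {S : GenericCRSubmanifold n k X M} {p : ℝ≥0∞} {r : ℕ} {q : ℤ} (f : LpComp S p r q) :
    M → Alt (2 * n - k) (deg r q) ℂ := Subtype.val f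

/-- Compact sets in the domains of the coordinate charts. -/
abbrev ChartCompact (d : ℕ) (M : Type*) [TopologicalSpace M] [ChartedSpace (Model d) M] : Type _ :=
  {i : M × Set (Model d) // IsCompact i.2 ∧ i.2 ⊆ (chartAt (Model d) i.1).target}

/-- Restriction of a form to a compact set `K` in a chart, as an element of `L^p(K)`. -/
def LpLoc.restrict {S : GenericCRSubmanifold n k X M} {p : ℝ≥0∞} {r : ℕ} {q : ℤ} (f : LpLoc S p r q)
    (i : ChartCompact (2 * n - k) M) :
    Lp (Alt (2 * n - k) (deg r q) ℂ) p (volume.restrict i.1.2) :=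
  MemLp.toLp (rep i.1.1 f.form) (f.2.2 i.1.1 i.1.2 i.2.1 i.2.2)

/-- The topology of `L^p` convergence on compact sets. -/
instance LpLoc.topologicalSpace (S : GenericCRSubmanifold n k X M) (p : ℝ≥0∞) [Fact (1 ≤ p)] (r : ℕ) (q : ℤ) :
    TopologicalSpace (LpLoc S p r q) :=
  TopologicalSpace.induced (fun f => fun i => f.restrict i) Pi.topologicalSpace

/-- Forms in `(L^p_c)^{r,q}(M)` with support in `K`, with the topology induced by
`(L^p_loc)^{r,q}(M)`, that is, of `L^p` convergence. -/
abbrev LpOn (S : GenericCRSubmanifold n k X M) (p : ℝ≥0∞) (r : ℕ) (q : ℤ) (K : Set M) : Type _ :=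
  {f : LpLoc S p r q // tsupport f.form ⊆ K}

/-- The inclusion of the forms with support in the compact set `K`. -/
def LpOn.incl (S : GenericCRSubmanifold n k X M) (p : ℝ≥0∞) (r : ℕ) (q : ℤ) {K : Set M} (hK : IsCompact K)
    (f : LpOn S p r q K) : LpComp S p r q :=
  ⟨f.1.form, f.1.2, hK.of_isClosed_subset (isClosed_tsupport _) f.2⟩

/-- The inductive limit topology on `(L^p_c)^{r,q}(M)`: the finest locally convex vector space
topology that makes the inclusions of the spaces of forms with support in a compact set
continuous. -/
instance LpComp.topologicalSpace (S : GenericCRSubmanifold n k X M) (p : ℝ≥0∞) [Fact (1 ≤ p)] (r : ℕ) (q : ℤ) :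
    TopologicalSpace (LpComp S p r q) :=
  sInf {t : TopologicalSpace (LpComp S p r q) |
    (∀ (K : Set M) (hK : IsCompact K), Continuous[_, t] (LpOn.incl S p r q hK)) ∧
    @IsTopologicalAddGroup (LpComp S p r q) t _ ∧
    @ContinuousSMul ℝ (LpComp S p r q) _ _ t ∧
    @LocallyConvexSpace ℝ (LpComp S p r q) _ _ _ _ t}

/-! ### The operator `∂̄_b` in the weak sense and its cohomology -/

section

variable [T2Space M] [SigmaCompactSpace M]

/-- `∂̄_b f = g` in the weak sense, where `g` has bidegree `(r, q)` and `f` has total degree `a`: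
`∫_M g ∧ φ = (-1)^(a+1) ∫_M f ∧ ∂̄_b φ` for all smooth compactly supported forms `φ` of bidegree
`(n - r, n - k - q)`.  Here `∂̄_b φ` is the class of `dφ`. -/
def IsWeakDbar (S : GenericCRSubmanifold n k X M) (r : ℕ) (q : ℤ) {a b : ℕ}
    (f : M → Alt (2 * n - k) a ℂ) (g : M → Alt (2 * n - k) b ℂ) : Prop :=
  ∀ φ : M → Alt (2 * n - k) (deg (n - r) ((n : ℤ) - k - q)) ℂ,
    IsTestForm S ((n : ℤ) - k - q) φ →
      pairing S.Ω g φ = (-1) ^ (a + 1) * pairing S.Ω f (dForm φ)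

theorem IsWeakDbar.add {S : GenericCRSubmanifold n k X M}
    {p : ℝ≥0∞} (hp : 1 ≤ p) {r : ℕ} {q : ℤ} {a b : ℕ}
    {f f' : M → Alt (2 * n - k) a ℂ} {g g' : M → Alt (2 * n - k) b ℂ}
    (h : IsWeakDbar S r q f g) (h' : IsWeakDbar S r q f' g')
    (hf : IsLpLoc p f) (hf' : IsLpLoc p f') (hg : IsLpLoc p g) (hg' : IsLpLoc p g') :
    IsWeakDbar S r q (f + f') (g + g') := by
  intro φ hφ
  rw [pairing_add_left S.isOrientationForm.1.isContForm hp hg hg' hφ.smooth.isContForm hφ.compact,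
    pairing_add_left S.isOrientationForm.1.isContForm hp hf hf' hφ.smooth.dForm.isContForm
      (hasCompactSupport_dForm hφ.compact), h φ hφ, h' φ hφ, mul_add]

theorem IsWeakDbar.smul {S : GenericCRSubmanifold n k X M} {r : ℕ} {q : ℤ}
    {a b : ℕ} {f : M → Alt (2 * n - k) a ℂ} {g : M → Alt (2 * n - k) b ℂ} (z : ℂ)
    (h : IsWeakDbar S r q f g) : IsWeakDbar S r q (z • f) (z • g) := by
  intro φ hφ
  rw [pairing_smul_left, pairing_smul_left, h φ hφ]
  ring

theorem IsWeakDbar.zero (S : GenericCRSubmanifold n k X M) (r : ℕ) (q : ℤ)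
    {a b : ℕ} : IsWeakDbar S r q (0 : M → Alt (2 * n - k) a ℂ)
      (0 : M → Alt (2 * n - k) b ℂ) := by
  intro φ _
  rw [pairing_zero_left, pairing_zero_left, mul_zero]

/-- `Z^{r,q}_{L^p_loc}(M)`, the space of `∂̄_b`-closed forms. -/
def ZLoc (S : GenericCRSubmanifold n k X M) (p : ℝ≥0∞) [Fact (1 ≤ p)] (r : ℕ) (q : ℤ) :
    Submodule ℂ (LpLoc S p r q) where
  carrier := {f | IsWeakDbar S r (q + 1) f.form
    (0 : M → Alt (2 * n - k) (deg r (q + 1)) ℂ)}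
  add_mem' := fun {f g} hf hg => by
    have := IsWeakDbar.add (Fact.out : 1 ≤ p) hf hg f.2.2 g.2.2 IsLpLoc.zero IsLpLoc.zero
    rwa [add_zero] at this
  zero_mem' := IsWeakDbar.zero S r (q + 1)
  smul_mem' := fun z f hf => by
    have := IsWeakDbar.smul z hf
    rwa [smul_zero] at this

/-- `E^{r,q}_{L^p_loc}(M)`, the range of `∂̄_b`. -/
def ELoc (S : GenericCRSubmanifold n k X M) (p : ℝ≥0∞) [Fact (1 ≤ p)] (r : ℕ) (q : ℤ) :
    Submodule ℂ (LpLoc S p r q) where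
  carrier := {g | ∃ f : LpLoc S p r (q - 1), IsWeakDbar S r q f.form g.form}
  add_mem' := by
    rintro g g' ⟨f, hf⟩ ⟨f', hf'⟩
    exact ⟨f + f', IsWeakDbar.add (Fact.out : 1 ≤ p) hf hf' f.2.2 f'.2.2 g.2.2 g'.2.2⟩
  zero_mem' := ⟨0, IsWeakDbar.zero S r q⟩
  smul_mem' := by
    rintro z g ⟨f, hf⟩
    exact ⟨z • f, IsWeakDbar.smul z hf⟩

/-- `Z^{r,q}_{c,L^p}(M)`, the space of `∂̄_b`-closed forms with compact support. -/
def ZComp (S : GenericCRSubmanifold n k X M) (p : ℝ≥0∞) [Fact (1 ≤ p)] (r : ℕ) (q : ℤ) :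
    Submodule ℂ (LpComp S p r q) where
  carrier := {f | IsWeakDbar S r (q + 1) f.form
    (0 : M → Alt (2 * n - k) (deg r (q + 1)) ℂ)}
  add_mem' := fun {f g} hf hg => by
    have := IsWeakDbar.add (Fact.out : 1 ≤ p) hf hg f.2.1.2 g.2.1.2 IsLpLoc.zero IsLpLoc.zero
    rwa [add_zero] at this
  zero_mem' := IsWeakDbar.zero S r (q + 1)
  smul_mem' := fun z f hf => by
    have := IsWeakDbar.smul z hf
    rwa [smul_zero] at this

/-- `E^{r,q}_{c,L^p}(M)`, the range of `∂̄_b` on forms with compact support. -/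
def EComp (S : GenericCRSubmanifold n k X M) (p : ℝ≥0∞) [Fact (1 ≤ p)] (r : ℕ) (q : ℤ) :
    Submodule ℂ (LpComp S p r q) where
  carrier := {g | ∃ f : LpComp S p r (q - 1), IsWeakDbar S r q f.form g.form}
  add_mem' := by
    rintro g g' ⟨f, hf⟩ ⟨f', hf'⟩
    exact ⟨f + f',
      IsWeakDbar.add (Fact.out : 1 ≤ p) hf hf' f.2.1.2 f'.2.1.2 g.2.1.2 g'.2.1.2⟩
  zero_mem' := ⟨0, IsWeakDbar.zero S r q⟩
  smul_mem' := by
    rintro z g ⟨f, hf⟩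
    exact ⟨z • f, IsWeakDbar.smul z hf⟩

/-- `H^{r,q}_{L^p_loc}(M) = Z^{r,q}_{L^p_loc}(M) / E^{r,q}_{L^p_loc}(M)` with the quotient
topology. -/
abbrev HLoc (S : GenericCRSubmanifold n k X M) (p : ℝ≥0∞) [Fact (1 ≤ p)] (r : ℕ) (q : ℤ) :
    Type _ :=
  ZLoc S p r q ⧸ (ELoc S p r q).submoduleOf (ZLoc S p r q)

/-- `H^{r,q}_{c,L^p}(M) = Z^{r,q}_{c,L^p}(M) / E^{r,q}_{c,L^p}(M)` with the quotient topology. -/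
abbrev HComp (S : GenericCRSubmanifold n k X M) (p : ℝ≥0∞) [Fact (1 ≤ p)] (r : ℕ) (q : ℤ) :
    Type _ :=
  ZComp S p r q ⧸ (EComp S p r q).submoduleOf (ZComp S p r q)

end

end CR

end CRSerre

end

open CRSerre

/-!
Serre duality is the closed range theorem for `∂̄_b`. The space `(L^{p'}_loc)^{r,q}(M)` is complete
and metrizable, and by the duality of `L^p` and `L^{p'}` on compact sets, glued by a partition of
unity, it and `(L^p_c)^{n-r,n-k-q}(M)` represent the continuous functionals on each other
(`RepresentsDual`, `PatchAtlas.exists_repr_loc`, `PatchAtlas.exists_repr_comp`). Sections which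
pair to zero with everything represent the form `0` and are not divided out; hence all spaces are
only seminormed, and functional analysis is done for spaces which need not be Hausdorff. A closed
subspace, such as a closed range, contains all these sections.

The weak operators on the two scales are transposes of each other up to sign
(`PatchAtlas.isWeakDbar_loc_iff`, `PatchAtlas.isWeakDbar_comp_iff`). As they are defined by smooth
test forms, this needs Green's formula `PatchAtlas.green` for `∂̄_b f = g`, `∂̄_b h = u` with
coefficients in `L^{p'}` and in `L^p`. Locally, the `n` components of the embedding in a complex
chart and `n - k` more functions form a complex coordinate system whose differentials are a closed
frame adapted to `H_{0,1} M` (`exists_frame`, `Patch`). A form of bidegree `(r, q)` is a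
combination of products of the frame with at most `q` factors that do not vanish on `H_{0,1} M`,
and testing with the multiples of such products turns the two weak equations into adjoint first
order systems. The divergence of their coefficients vanishes because the products are closed. For
such systems Green's formula holds by Friedrichs' lemma: mollifying one solution produces a
commutator with the coefficients, which converges to their divergence (`friedrichs`,
`Patch.green_local`). The cutoff terms cancel since the differentials of a partition of unity add
up to zero (`PatchAtlas.green_of_local`).

Consequently the closed forms on each side are the annihilator of the exact forms on the other
side. A quotient of closed by exact forms is Hausdorff if and only if the range is closed
(`t2Space_quotient_iff`), and by the Hahn-Banach theorem if and only if the range is the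
annihilator of its annihilator (`isClosed_iff_eq_annihilator`). The ranges on the two sides are
closed at the same time: if the range in the locally integrable scale is closed, the open mapping
theorem makes `∂̄_b f ↦ ⟨f, g⟩` continuous for `g` orthogonal to the closed forms, and a form
representing it solves the transposed equation (`exists_transpose_of_isClosed_range`); conversely,
solvability of the transposed equation makes `∂̄_b` open onto its range by the uniform boundedness
principle (`isClosed_range_of_exists_transpose`).

The pairing then induces the isomorphisms, the bipolar theorem gives continuity of the inverse for
the strong topology (`exists_equiv_quotient_dual`), and the second map itself is continuous because
the closed forms in the Fréchet space are barrelled (`PatchAtlas.barrelledSpace_ZLoc`).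
-/

set_option linter.unusedSectionVars false

noncomputable section

namespace CRSerre

theorem sum_ext {ι E : Type*} [AddCommMonoid E] {s : Finset ι} {f g : ι → E} (h : ∀ i, f i = g i) :
    ∑ i ∈ s, f i = ∑ i ∈ s, g i := Finset.sum_congr rfl (fun i _ => h i)

/-! ### Locally convex spaces -/

section FunctionalAnalysis

open scoped Pointwise

/-- A weakly bounded subset of a seminormed space is bounded (uniform boundedness in the dual). -/
theorem exists_bound_of_weakly_bounded {E : Type*} [SeminormedAddCommGroup E] [NormedSpace ℂ E]
    {D : Set E} (h : ∀ l : StrongDual ℂ E, ∃ C : ℝ, ∀ x ∈ D, ‖l x‖ ≤ C) :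
    ∃ C : ℝ, ∀ x ∈ D, ‖x‖ ≤ C := by
  obtain ⟨C, hC⟩ := banach_steinhaus (g := fun x : D => NormedSpace.inclusionInDoubleDual ℂ E x.1)
    (fun l => by
      obtain ⟨C, hC⟩ := h l
      exact ⟨C, fun x => by simpa using hC x.1 x.2⟩)
  refine ⟨C, fun x hx => ?_⟩
  obtain ⟨g, hg, hgx⟩ := exists_dual_vector'' ℂ x
  have h1 : ‖g x‖ ≤ C * ‖g‖ := by
    have := (NormedSpace.inclusionInDoubleDual ℂ E x).le_of_opNorm_le (hC ⟨x, hx⟩) g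
    simpa using this
  have h0 : 0 ≤ C := (norm_nonneg _).trans (hC ⟨x, hx⟩)
  rw [hgx] at h1
  simp only [Complex.coe_algebraMap, Complex.norm_real, norm_norm] at h1
  nlinarith

theorem exists_seminorm_bound_of_weakly_bounded {E : Type*} [AddCommGroup E] [Module ℂ E]
    (p : Seminorm ℂ E) {D : Set E}
    (h : ∀ l : E →ₗ[ℂ] ℂ, (∃ C : ℝ, ∀ x, ‖l x‖ ≤ C * p x) → ∃ C : ℝ, ∀ x ∈ D, ‖l x‖ ≤ C) :
    ∃ C : ℝ, ∀ x ∈ D, p x ≤ C := by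
  let i1 : SeminormedAddCommGroup E := p.toAddGroupSeminorm.toSeminormedAddCommGroup
  let i2 : NormedSpace ℂ E := ⟨fun a b => (map_smul_eq_mul p a b).le⟩
  exact exists_bound_of_weakly_bounded (E := E) fun l => h l ⟨‖l‖, fun x => l.le_opNorm x⟩

section

variable {E : Type*} [AddCommGroup E] [Module ℂ E]
  [TopologicalSpace E] [IsTopologicalAddGroup E] [ContinuousSMul ℂ E]
  [LocallyConvexSpace ℝ E]

/-- Real local convexity of a complex space gives complex seminorms. -/
theorem polynormableSpace_of_locallyConvexSpace : PolynormableSpace ℂ E := by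
  have hsm : ContinuousSMul ℝ E := IsScalarTower.continuousSMul ℂ
  open scoped ComplexOrder in
  have : LocallyConvexSpace ℂ E := by
    rw [locallyConvexSpace_iff_exists_convex_subset]
    intro x U hU
    obtain ⟨S, hS, hc, hSU⟩ := (locallyConvexSpace_iff_exists_convex_subset ℝ E).1 ‹_› x U hU
    refine ⟨S, hS, convex_of_nonneg_surjective_algebraMap (R := ℝ) ℂ (fun z hz => ?_) hc, hSU⟩
    obtain ⟨x, hx, rfl⟩ := RCLike.nonneg_iff_exists_ofReal.mp (mem_Ici.1 hz)
    exact ⟨x, hx, rfl⟩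
  exact LocallyConvexSpace.toPolynormableSpace

/-- Mackey's theorem: a weakly bounded subset of a locally convex space is bounded. -/
theorem isVonNBounded_of_weakly_bounded {D : Set E}
    (h : ∀ l : StrongDual ℂ E, ∃ C : ℝ, ∀ x ∈ D, ‖l x‖ ≤ C) :
    Bornology.IsVonNBounded ℂ D := by
  have := polynormableSpace_of_locallyConvexSpace (E := E)
  rw [(PolynormableSpace.withSeminorms ℂ E).isVonNBounded_iff_seminorm_bddAbove]
  rintro ⟨p, hp⟩
  suffices hs : ∃ C : ℝ, ∀ x ∈ D, p x ≤ C by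
    obtain ⟨C, hC⟩ := hs
    exact ⟨C, by rintro _ ⟨x, hx, rfl⟩; exact hC x hx⟩
  refine exists_seminorm_bound_of_weakly_bounded p fun l ⟨C, hC⟩ => h ⟨l, ?_⟩
  refine (PolynormableSpace.withSeminorms ℂ E).continuous_normedSpace_rng ℂ l
      ⟨{⟨p, hp⟩}, ⟨max C 0, le_max_right _ _⟩, fun x => ?_⟩
  have := mul_le_mul_of_nonneg_right (le_max_left C 0) (apply_nonneg p x)
  rw [Finset.sup_singleton]
  exact (hC x).trans this

instance quotient_locallyConvexSpace (N : Submodule ℂ E) : LocallyConvexSpace ℝ (E ⧸ N) := by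
  rw [locallyConvexSpace_iff_exists_convex_subset_zero]
  intro U hU
  have hq : Continuous N.mkQ := continuous_quot_mk
  have h1 : (N.mkQ ⁻¹' U) ∈ 𝓝 (0 : E) :=
    hq.continuousAt.preimage_mem_nhds (by rwa [map_zero])
  obtain ⟨S, hS, hc, hSU⟩ := (locallyConvexSpace_iff_exists_convex_subset_zero ℝ E).1 ‹_› _ h1
  refine ⟨N.mkQ '' S, ?_, hc.is_linear_image (f := N.mkQ) ⟨map_add _, fun c x => ?_⟩, ?_⟩
  · have := N.isOpenMap_mkQ.image_mem_nhds hS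
    simpa using this
  · exact (N.mkQ.restrictScalars ℝ).map_smul c x
  · rintro _ ⟨x, hx, rfl⟩
    exact hSU hx

end

/-- Series with terms in a fast decreasing basis of neighbourhoods converge. -/
theorem exists_tendsto_sum {E : Type*} [AddCommGroup E]
    [UniformSpace E] [IsUniformAddGroup E] [CompleteSpace E] {u : ℕ → Set E}
    (hu : (𝓝 (0 : E)).HasAntitoneBasis u) (hadd : ∀ n, u (n + 1) + u (n + 1) ⊆ u n)
    (x : ℕ → E) (hx : ∀ n, x n ∈ u (n + 1)) :
    ∃ y, Tendsto (fun n => ∑ i ∈ Finset.range n, x i) atTop (𝓝 y) ∧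
      ∀ n, ∑ i ∈ Finset.range n, x i ∈ u 0 := by
  set s : ℕ → E := fun n => ∑ i ∈ Finset.range n, x i with hs
  have htail : ∀ m n, s (n + m) - s n ∈ u n := by
    intro m
    induction m with
    | zero => intro n; simpa using mem_of_mem_nhds (hu.mem n)
    | succ m ih =>
      intro n
      have e : s (n + (m + 1)) - s n = (s (n + 1 + m) - s (n + 1)) + x n := by
        have : n + (m + 1) = n + 1 + m := by ring
        rw [this]
        simp only [s, Finset.sum_range_succ]
        abel
      rw [e]
      exact hadd _ (Set.add_mem_add (ih (n + 1)) (hx n))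
  have hc : CauchySeq s := by
    rw [cauchySeq_iff]
    intro W hW
    rw [uniformity_eq_comap_nhds_zero_swapped, mem_comap] at hW
    obtain ⟨O, hO, hOW⟩ := hW
    obtain ⟨V, hV, hVO⟩ := exists_nhds_half_neg hO
    obtain ⟨n, hn⟩ := hu.mem_iff.1 hV
    refine ⟨n, fun k hk l hl => hOW ?_⟩
    obtain ⟨m, rfl⟩ := Nat.exists_eq_add_of_le hk
    obtain ⟨m', rfl⟩ := Nat.exists_eq_add_of_le hl
    have := hVO _ (hn (htail m n)) _ (hn (htail m' n))
    simpa using this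
  obtain ⟨y, hy⟩ := cauchySeq_tendsto_of_complete hc
  exact ⟨y, hy, fun n => by simpa [s] using htail n 0⟩

/-- A linear functional on the image of a complete pseudo-metrizable space is continuous if its
pull-back is: a form of the open mapping theorem. -/
theorem continuous_of_comp_surjective {E F : Type*} [AddCommGroup E] [Module ℂ E]
    [UniformSpace E] [IsUniformAddGroup E] [ContinuousSMul ℂ E] [CompleteSpace E]
    [(uniformity E).IsCountablyGenerated]
    [AddCommGroup F] [Module ℂ F] [TopologicalSpace F] [IsTopologicalAddGroup F]
    [ContinuousSMul ℂ F] [BaireSpace F] [FirstCountableTopology F]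
    (f : E →L[ℂ] F) (hf : Function.Surjective f) (l : F →ₗ[ℂ] ℂ)
    (hl0 : ∀ z ∈ closure ({0} : Set F), l z = 0) (hl : Continuous fun x => l (f x)) :
    Continuous l := by
  have key : ∀ U ∈ 𝓝 (0 : E), closure (f '' U) ∈ 𝓝 (0 : F) := by
    intro U hU
    obtain ⟨V, hV, hVU⟩ := exists_nhds_half_neg hU
    have hcov : ⋃ k : ℕ, {y : F | ((k : ℂ) + 1)⁻¹ • y ∈ closure (f '' V)} = univ := by
      refine eq_univ_of_forall fun y => ?_
      obtain ⟨x, rfl⟩ := hf y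
      have ht : Tendsto (fun k : ℕ => ((k : ℂ) + 1)⁻¹ • x) atTop (𝓝 0) := by
        have h0 : Tendsto (fun k : ℕ => ((k : ℂ) + 1)⁻¹) atTop (𝓝 0) := by
          simpa using tendsto_one_div_add_atTop_nhds_zero_nat (𝕜 := ℂ)
        simpa using h0.smul_const x
      obtain ⟨k, hk⟩ := (ht.eventually hV).exists
      refine mem_iUnion.2 ⟨k, subset_closure ⟨_, hk, ?_⟩⟩
      simp
    obtain ⟨k, y₀, hy₀⟩ := nonempty_interior_of_iUnion_of_closed (fun k : ℕ =>
      isClosed_closure.preimage (continuous_const_smul (((k : ℂ) + 1)⁻¹))) hcov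
    have hk0 : ((k : ℂ) + 1) ≠ 0 := by exact_mod_cast k.succ_ne_zero
    set z₀ := ((k : ℂ) + 1)⁻¹ • y₀ with hz₀
    have h1 : closure (f '' V) ∈ 𝓝 z₀ := by
      have hc : ContinuousAt (fun z : F => ((k : ℂ) + 1) • z) z₀ :=
        (continuous_const_smul _).continuousAt
      have h2 := hc.preimage_mem_nhds (by
        rw [hz₀, smul_inv_smul₀ hk0]; exact mem_interior_iff_mem_nhds.1 hy₀)
      filter_upwards [h2] with z hz
      simpa [inv_smul_smul₀ hk0] using hz
    have h2 : (fun w => z₀ + w) ⁻¹' closure (f '' V) ∈ 𝓝 (0 : F) :=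
      (continuous_const_add z₀).continuousAt.preimage_mem_nhds (by simpa using h1)
    filter_upwards [h2] with w hw
    have h3 := map_mem_closure₂ (u := f '' U) continuous_sub hw (mem_of_mem_nhds h1) (by
      rintro _ ⟨a, ha, rfl⟩ _ ⟨b, hb, rfl⟩
      exact ⟨a - b, hVU a ha b hb, map_sub f a b⟩)
    simpa using h3
  obtain ⟨u, hu, hadd⟩ := IsTopologicalAddGroup.exists_antitone_basis_nhds_zero E
  obtain ⟨v, hv⟩ := (𝓝 (0 : F)).exists_antitone_basis
  have hlam : {x : E | ‖l (f x)‖ < 1} ∈ 𝓝 (0 : E) :=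
    (hl.norm.continuousAt (x := 0)).preimage_mem_nhds (Iio_mem_nhds (by simp))
  obtain ⟨N, hN⟩ := hu.mem_iff.1 hlam
  -- successive approximation: every `y` in the closure of the image of a small
  -- neighbourhood is, up to the closure of `0`, the image of the sum of a series
  have main : ∀ y ∈ closure (f '' u (N + 1)), ‖l y‖ ≤ 1 := by
    intro y hy
    have step : ∀ (n : ℕ) (z : F), z ∈ closure (f '' u (N + 1 + n)) →
        ∃ x ∈ u (N + 1 + n), z - f x ∈ closure (f '' u (N + 1 + (n + 1))) ∩ v n := by
      intro n z hz
      have hnb : {w : F | z - w ∈ closure (f '' u (N + 1 + (n + 1))) ∩ v n} ∈ 𝓝 z := by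
        have : ContinuousAt (fun w => z - w) z := by fun_prop
        refine this.preimage_mem_nhds ?_
        rw [sub_self]
        exact inter_mem (key _ (hu.mem _)) (hv.mem _)
      obtain ⟨_, hw, x, hx, rfl⟩ := mem_closure_iff_nhds.1 hz _ hnb
      exact ⟨x, hx, hw⟩
    choose! g hg1 hg2 using step
    let r : ℕ → F := fun n => Nat.rec y (fun n z => z - f (g n z)) n
    have hr : ∀ n, r n ∈ closure (f '' u (N + 1 + n)) := by
      intro n
      induction n with
      | zero => exact hy
      | succ n ih => exact (hg2 n _ ih).1
    let s : ℕ → E := fun n => ∑ i ∈ Finset.range n, g i (r i)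
    have hrs : ∀ n, r n = y - f (s n) := by
      intro n
      induction n with
      | zero => simp [r, s]
      | succ n ih =>
        have : r (n + 1) = r n - f (g n (r n)) := rfl
        rw [this]
        simp only [s, Finset.sum_range_succ, map_add]
        rw [← sub_sub, ← ih]
    obtain ⟨x, hx, hxN⟩ := exists_tendsto_sum (hu.comp_mono (φ := fun n => N + n)
      (fun a b h => Nat.add_le_add_left h N) (tendsto_atTop_mono (fun n => Nat.le_add_left n N) tendsto_id))
      (fun n => hadd (N + n)) (fun n => g n (r n)) (fun n => by
        have h2 := hg1 n _ (hr n)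
        have e : N + 1 + n = N + (n + 1) := by omega
        rwa [e] at h2)
    have h1 : ‖l (f x)‖ ≤ 1 := by
      refine le_of_tendsto ((hl.norm.tendsto x).comp hx) (.of_forall fun n => ?_)
      exact (hN (hxN n)).le
    have h2 : y - f x ∈ closure ({0} : Set F) := by
      have ht : Tendsto r atTop (𝓝 (y - f x)) := by
        simp only [funext hrs]
        exact tendsto_const_nhds.sub ((f.continuous.tendsto x).comp hx)
      have ht0 : Tendsto r atTop (𝓝 0) := by
        rw [← tendsto_add_atTop_iff_nat 1]
        exact hv.tendsto fun n => (hg2 n _ (hr n)).2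
      have h : Inseparable (y - f x) 0 := tendsto_nhds_unique_inseparable ht ht0
      exact h.symm.specializes.mem_closure
    have h3 := hl0 _ h2
    rw [map_sub, sub_eq_zero] at h3
    rwa [h3]
  refine continuous_of_continuousAt_zero l ?_
  rw [ContinuousAt, map_zero, Metric.nhds_basis_closedBall.tendsto_right_iff]
  intro ε hε
  have hc0 : (ε : ℂ) ≠ 0 := by exact_mod_cast hε.ne'
  have : (fun y : F => (ε : ℂ)⁻¹ • y) ⁻¹' closure (f '' u (N + 1)) ∈ 𝓝 (0 : F) :=
    (continuous_const_smul _).continuousAt.preimage_mem_nhds (by simpa using key _ (hu.mem _))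
  filter_upwards [this] with y hy
  have := main _ hy
  rw [map_smul, norm_smul, norm_inv, Complex.norm_real, Real.norm_of_nonneg hε.le] at this
  rw [mem_closedBall_zero_iff]
  field_simp at this
  linarith

/-- The bilinear form `P` identifies `B` with the continuous functionals on `A` that vanish on the
left kernel of `P`. -/
structure RepresentsDual {A B : Type*} [AddCommGroup A] [Module ℂ A] [TopologicalSpace A]
    [AddCommGroup B] [Module ℂ B] (P : A →ₗ[ℂ] B →ₗ[ℂ] ℂ) : Prop where
  cont : ∀ b, Continuous fun a => P a b
  repr : ∀ l : A →L[ℂ] ℂ, (∀ a, (∀ b, P a b = 0) → l a = 0) → ∃ b, ∀ a, l a = P a b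

theorem eq_zero_of_re_lt {z : ℂ} {u : ℝ} (h : ∀ c : ℂ, (c * z).re < u) : z = 0 := by
  by_contra hz
  have := h (((u / ‖z‖ ^ 2 : ℝ) : ℂ) * (starRingEnd ℂ) z)
  rw [mul_assoc, mul_comm ((starRingEnd ℂ) z), Complex.mul_conj, ← Complex.ofReal_mul,
    Complex.ofReal_re, Complex.normSq_eq_norm_sq] at this
  have hn : ‖z‖ ≠ 0 := norm_ne_zero_iff.2 hz
  field_simp at this
  exact lt_irrefl _ this

/-- A subspace containing the left kernel is closed iff it is the annihilator of its
annihilator. -/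
theorem isClosed_iff_eq_annihilator {A B : Type*} [AddCommGroup A] [Module ℂ A]
    [TopologicalSpace A] [IsTopologicalAddGroup A] [ContinuousSMul ℂ A] [LocallyConvexSpace ℝ A]
    [AddCommGroup B] [Module ℂ B] {P : A →ₗ[ℂ] B →ₗ[ℂ] ℂ} (hP : RepresentsDual P)
    {E : Submodule ℂ A} {Z : Submodule ℂ B} (hZ : ∀ b, b ∈ Z ↔ ∀ a ∈ E, P a b = 0)
    (hN : ∀ a, (∀ b, P a b = 0) → a ∈ E) :
    (E : Set A) = {a | ∀ b ∈ Z, P a b = 0} ↔ IsClosed (E : Set A) := by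
  have hsm : ContinuousSMul ℝ A := IsScalarTower.continuousSMul ℂ
  constructor
  · intro h
    rw [h]
    simp only [ofPred_forall]
    exact isClosed_biInter fun b _ => isClosed_eq (hP.cont b) continuous_const
  · intro h
    refine Subset.antisymm (fun a ha b hb => (hZ b).1 hb a ha) fun a ha => ?_
    by_contra hna
    obtain ⟨f, u, hf, hu⟩ := RCLike.geometric_hahn_banach_closed_point (𝕜 := ℂ)
      (E.restrictScalars ℝ).convex h hna
    have hf0 : ∀ e ∈ E, f e = 0 := fun e he => eq_zero_of_re_lt (u := u) fun c => by
      have := hf (c • e) (E.smul_mem c he)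
      simpa using this
    obtain ⟨b, hb⟩ := hP.repr f fun e he => hf0 e (hN e he)
    have hbZ : b ∈ Z := (hZ b).2 fun e he => by rw [← hb, hf0 e he]
    have h1 : f a = 0 := by rw [hb]; exact ha b hbZ
    have h2 := hf 0 E.zero_mem
    rw [map_zero] at h2
    rw [h1] at hu
    exact lt_asymm h2 hu

section ClosedRange

variable {A₀ A₁ B₀ B₁ : Type*} [AddCommGroup A₀] [Module ℂ A₀] [AddCommGroup A₁] [Module ℂ A₁]
  [AddCommGroup B₀] [Module ℂ B₀] [AddCommGroup B₁] [Module ℂ B₁]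
  [UniformSpace A₀] [IsUniformAddGroup A₀] [ContinuousSMul ℂ A₀] [LocallyConvexSpace ℝ A₀]
  [CompleteSpace A₀] [(uniformity A₀).IsCountablyGenerated]
  [UniformSpace A₁] [IsUniformAddGroup A₁] [ContinuousSMul ℂ A₁] [LocallyConvexSpace ℝ A₁]
  [CompleteSpace A₁] [(uniformity A₁).IsCountablyGenerated]
  {P₀ : A₀ →ₗ[ℂ] B₀ →ₗ[ℂ] ℂ} {P₁ : A₁ →ₗ[ℂ] B₁ →ₗ[ℂ] ℂ} {ε : ℂ}
  {T : Submodule ℂ (A₀ × A₁)} {T' : Submodule ℂ (B₁ × B₀)}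

theorem baireSpace_of_complete {E : Type*} [UniformSpace E] [CompleteSpace E]
    [(uniformity E).IsCountablyGenerated] : BaireSpace E := by
  let := UniformSpace.pseudoMetricSpace E
  infer_instance

/-- If the range of a closed linear relation between Fréchet spaces is closed, then the range of
the transposed relation is the annihilator of the kernel. -/
theorem exists_transpose_of_isClosed_range
    (hP₀ : RepresentsDual P₀) (hP₁ : RepresentsDual P₁)
    (hT : ∀ f g, (f, g) ∈ T ↔ ∀ h u, (h, u) ∈ T' → P₁ g h = ε * P₀ f u)
    (hT' : ∀ h u, (h, u) ∈ T' ↔ ∀ f g, (f, g) ∈ T → P₁ g h = ε * P₀ f u)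
    (hE : IsClosed {g | ∃ f, (f, g) ∈ T}) {b : B₀} (hb : ∀ f, (f, 0) ∈ T → P₀ f b = 0) :
    ∃ h, (h, b) ∈ T' := by
  have hTc : IsClosed (T : Set (A₀ × A₁)) := by
    have : (T : Set (A₀ × A₁)) = {x | ∀ h u, (h, u) ∈ T' → P₁ x.2 h = ε * P₀ x.1 u} := by
      ext ⟨f, g⟩; exact hT f g
    rw [this]
    simp only [ofPred_forall]
    exact isClosed_iInter fun h => isClosed_iInter fun u => isClosed_iInter fun _ =>
      isClosed_eq ((hP₁.cont h).comp continuous_snd)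
        (continuous_const.mul ((hP₀.cont u).comp continuous_fst))
  let E : Submodule ℂ A₁ := T.map (LinearMap.snd ℂ A₀ A₁)
  have hEmem : ∀ g, g ∈ E ↔ ∃ f, (f, g) ∈ T := fun g => by
    simp [E]
  have hEc : IsClosed (E : Set A₁) := by
    convert hE using 1
    ext g; exact hEmem g
  let s : T →L[ℂ] E := ((ContinuousLinearMap.snd ℂ A₀ A₁).comp T.subtypeL).codRestrict E
    fun x => (hEmem _).2 ⟨_, x.2⟩
  have hs : Function.Surjective s := by
    rintro ⟨g, hg⟩
    obtain ⟨f, hf⟩ := (hEmem g).1 hg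
    exact ⟨⟨(f, g), hf⟩, rfl⟩
  -- `g ↦ ε * P₀ f b` for `(f, g) ∈ T` is well defined on the range
  let lam : T →ₗ[ℂ] ℂ := ε • ((P₀.flip b).comp ((LinearMap.fst ℂ A₀ A₁).comp T.subtype))
  have hker : LinearMap.ker s.toLinearMap ≤ LinearMap.ker lam := by
    rintro ⟨⟨f, g⟩, hfg⟩ hx
    have hg : g = 0 := congrArg Subtype.val (LinearMap.mem_ker.1 hx)
    subst hg
    simp [lam, hb f hfg]
  let l : E →ₗ[ℂ] ℂ := ((LinearMap.ker s.toLinearMap).liftQ lam hker).comp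
    (s.toLinearMap.quotKerEquivOfSurjective hs).symm.toLinearMap
  have hl : ∀ x, l (s x) = lam x := fun x => by
    have : (s.toLinearMap.quotKerEquivOfSurjective hs).symm (s x) = Submodule.Quotient.mk x := by
      rw [LinearEquiv.symm_apply_eq]; rfl
    simp only [l, LinearMap.comp_apply, LinearEquiv.coe_coe, this]
    rfl
  have hzero : ∀ z : E, (0, z.1) ∈ T → l z = 0 := fun z hz => by
    have : z = s ⟨(0, z.1), hz⟩ := rfl
    rw [this, hl]
    simp [lam]
  have i1 : CompleteSpace T := hTc.completeSpace_coe
  have i2 : CompleteSpace E := hEc.completeSpace_coe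
  have i6 : (uniformity T).IsCountablyGenerated := by rw [uniformity_subtype]; infer_instance
  have i4 : (uniformity E).IsCountablyGenerated := by rw [uniformity_subtype]; infer_instance
  have i3 : BaireSpace E := baireSpace_of_complete
  have i5 : IsUniformAddGroup T := inferInstanceAs (IsUniformAddGroup T.toAddSubgroup)
  have hlc : Continuous l := by
    refine continuous_of_comp_surjective s hs l (fun z hz => hzero z ?_) ?_
    · refine (hT _ _).2 fun h u _ => ?_
      have hcl : IsClosed {z : E | P₁ z.1 h = 0} :=
        isClosed_eq ((hP₁.cont h).comp continuous_subtype_val) continuous_const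
      have := closure_minimal (s := {(0 : E)}) (by simp) hcl hz
      simpa using this
    · simp only [hl]
      exact continuous_const.mul
        ((hP₀.cont b).comp (continuous_fst.comp continuous_subtype_val))
  have := polynormableSpace_of_locallyConvexSpace (E := A₁)
  obtain ⟨L, hL⟩ := StrongDual.exists_extension E ⟨l, hlc⟩
  have hLT : ∀ f g, (f, g) ∈ T → L g = ε * P₀ f b := fun f g hfg => by
    have h1 := hL ⟨g, (hEmem g).2 ⟨f, hfg⟩⟩
    have h2 := hl ⟨(f, g), hfg⟩
    exact h1.trans h2
  obtain ⟨h, hh⟩ := hP₁.repr L fun g hg => by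
    have : ((0 : A₀), g) ∈ T := (hT _ _).2 fun h u _ => by simp [hg h]
    simpa using hLT _ _ this
  exact ⟨h, (hT' _ _).2 fun f g hfg => by rw [← hh, hLT f g hfg]⟩

/-- If the range of the transposed relation is the annihilator of the kernel, then the range of a
closed linear relation between Fréchet spaces is closed. -/
theorem isClosed_range_of_exists_transpose (hε : ε ≠ 0)
    (hP₀ : RepresentsDual P₀) (hP₁ : RepresentsDual P₁)
    (hT : ∀ f g, (f, g) ∈ T ↔ ∀ h u, (h, u) ∈ T' → P₁ g h = ε * P₀ f u)
    (H : ∀ b : B₀, (∀ f, (f, 0) ∈ T → P₀ f b = 0) → ∃ h, (h, b) ∈ T') :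
    IsClosed {g | ∃ f, (f, g) ∈ T} := by
  let Z : Submodule ℂ A₀ := T.comap (LinearMap.inl ℂ A₀ A₁)
  have hZ : ∀ f, f ∈ Z ↔ (f, 0) ∈ T := fun f => Iff.rfl
  obtain ⟨v, hv⟩ := (𝓝 (0 : A₁)).exists_antitone_basis
  -- the relation is open modulo its kernel
  have claim : ∀ U ∈ 𝓝 (0 : A₀), ∃ O ∈ 𝓝 (0 : A₁), ∀ f g, (f, g) ∈ T → g ∈ O →
      ∃ f' ∈ U, (f', g) ∈ T := by
    intro U hU
    by_contra! hcon
    have hO : ∀ k : ℕ, {g : A₁ | ((k : ℂ) + 1) • g ∈ v k} ∈ 𝓝 (0 : A₁) := fun k =>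
      (continuous_const_smul ((k : ℂ) + 1)).continuousAt.preimage_mem_nhds
        (by simpa using hv.mem k)
    choose f g hfg hg hf using fun k => hcon _ (hO k)
    have hbdd : Bornology.IsVonNBounded ℂ
        (range fun k : ℕ => ((k : ℂ) + 1) • Z.mkQ (f k)) := by
      refine isVonNBounded_of_weakly_bounded fun l => ?_
      have hq : Continuous Z.mkQ := continuous_quot_mk
      obtain ⟨b, hb⟩ := hP₀.repr (l.comp ⟨Z.mkQ, hq⟩) fun a ha => by
        have : a ∈ Z := (hT _ _).2 fun h u _ => by simp [ha u]
        have : Z.mkQ a = 0 := by simpa using this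
        simp [this]
      obtain ⟨h, hh⟩ := H b fun f hf => by
        rw [← hb]
        have : Z.mkQ f = 0 := by simpa using (hZ f).2 hf
        simp [this]
      have ht : Tendsto (fun k : ℕ => ε⁻¹ * P₁ (((k : ℂ) + 1) • g k) h) atTop (𝓝 0) := by
        have h1 : Tendsto (fun k : ℕ => ((k : ℂ) + 1) • g k) atTop (𝓝 0) := hv.tendsto hg
        have := ((hP₁.cont h).tendsto 0).comp h1
        simpa using this.const_mul ε⁻¹
      obtain ⟨C, hC⟩ := ht.norm.bddAbove_range
      refine ⟨C, ?_⟩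
      rintro _ ⟨k, rfl⟩
      have e : l (((k : ℂ) + 1) • Z.mkQ (f k)) = ε⁻¹ * P₁ (((k : ℂ) + 1) • g k) h := by
        have h1 : l (Z.mkQ (f k)) = P₀ (f k) b := hb (f k)
        rw [map_smul, h1, map_smul, LinearMap.smul_apply, (hT _ _).1 (hfg k) h b hh]
        simp only [smul_eq_mul]
        field_simp
      rw [e]
      exact hC ⟨k, rfl⟩
    have hU' : Z.mkQ '' U ∈ 𝓝 (0 : A₀ ⧸ Z) := by
      simpa using Z.isOpenMap_mkQ.image_mem_nhds hU
    obtain ⟨r, -, hr⟩ := (hbdd hU').exists_pos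
    obtain ⟨k, hk⟩ := exists_nat_ge r
    have hk0 : ((k : ℂ) + 1) ≠ 0 := by exact_mod_cast k.succ_ne_zero
    have hkr : r ≤ ‖(k : ℂ) + 1‖ := by
      have : ‖(k : ℂ) + 1‖ = k + 1 := by
        have := Complex.norm_natCast (k + 1)
        push_cast at this
        exact this
      rw [this]; linarith
    obtain ⟨_, ⟨f', hf', rfl⟩, he⟩ := hr _ hkr ⟨k, rfl⟩
    have he' : Z.mkQ f' = Z.mkQ (f k) := smul_right_injective _ hk0 he
    have hz : f' - f k ∈ Z := (Submodule.Quotient.eq Z).1 he'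
    refine hf k f' hf' ?_
    have := T.add_mem hz (hfg k)
    simpa using this
  obtain ⟨u, hu, hadd⟩ := IsTopologicalAddGroup.exists_antitone_basis_nhds_zero A₀
  choose O hO hOT using fun n => claim (u (n + 1)) (hu.mem _)
  let E : Submodule ℂ A₁ := T.map (LinearMap.snd ℂ A₀ A₁)
  have hEmem : ∀ g, g ∈ E ↔ ∃ f, (f, g) ∈ T := fun g => by
    simp [E]
  have hEeq : {g | ∃ f, (f, g) ∈ T} = (E : Set A₁) := by
    ext g; exact (hEmem g).symm
  rw [hEeq]
  refine isClosed_of_closure_subset fun g₀ hg₀ => ?_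
  have hsub : ∀ z ∈ closure (E : Set A₁), ∀ e ∈ E, z - e ∈ closure (E : Set A₁) := by
    intro z hz e he
    exact E.topologicalClosure.sub_mem (x := z) hz (E.le_topologicalClosure he)
  have near : ∀ z ∈ closure (E : Set A₁), ∀ W ∈ 𝓝 (0 : A₁), ∃ e ∈ E, z - e ∈ W := by
    intro z hz W hW
    have : {w | z - w ∈ W} ∈ 𝓝 z := by
      have hc : ContinuousAt (fun w => z - w) z := by fun_prop
      exact hc.preimage_mem_nhds (by simpa using hW)
    obtain ⟨e, h1, h2⟩ := mem_closure_iff_nhds.1 hz _ this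
    exact ⟨e, h2, h1⟩
  obtain ⟨e₀, he₀, hge₀⟩ := near g₀ hg₀ _ (interior_mem_nhds.2 (hO 0))
  have step : ∀ (n : ℕ) (z : A₁), z ∈ closure (E : Set A₁) ∩ interior (O n) →
      ∃ x : A₀ × A₁, x ∈ T ∧ x.1 ∈ u (n + 1) ∧ z - x.2 ∈ closure (E : Set A₁) ∩ interior (O (n + 1)) ∧
        z - x.2 ∈ v n := by
    rintro n z ⟨hz1, hz2⟩
    have hW : (interior (O (n + 1)) ∩ v n) ∩ {w | z - w ∈ interior (O n)} ∈ 𝓝 (0 : A₁) := by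
      refine inter_mem (inter_mem (interior_mem_nhds.2 (hO _)) (hv.mem n)) ?_
      have hc : ContinuousAt (fun w => z - w) (0 : A₁) := by fun_prop
      exact hc.preimage_mem_nhds (by simpa using isOpen_interior.mem_nhds hz2)
    obtain ⟨e, he, h1⟩ := near z hz1 _ hW
    obtain ⟨f, hf⟩ := (hEmem e).1 he
    have heO : e ∈ O n := by
      have := h1.2
      simp only [mem_ofPred_eq, sub_sub_cancel] at this
      exact interior_subset this
    obtain ⟨f', hf', hT'⟩ := hOT n f e hf heO
    exact ⟨(f', e), hT', hf', ⟨hsub z hz1 e he, h1.1.1⟩, h1.1.2⟩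
  choose! x hx1 hx2 hx3 hx4 using step
  let r : ℕ → A₁ := fun n => Nat.rec (g₀ - e₀) (fun n z => z - (x n z).2) n
  have hr : ∀ n, r n ∈ closure (E : Set A₁) ∩ interior (O n) := by
    intro n
    induction n with
    | zero => exact ⟨hsub _ hg₀ _ he₀, hge₀⟩
    | succ n ih => exact hx3 n _ ih
  obtain ⟨y, hy, -⟩ := exists_tendsto_sum hu hadd (fun n => (x n (r n)).1)
    fun n => hx2 n _ (hr n)
  have hsum : ∀ n, ((∑ i ∈ Finset.range n, (x i (r i)).1), g₀ - e₀ - r n) ∈ T := by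
    intro n
    induction n with
    | zero =>
      have : g₀ - e₀ - r 0 = 0 := sub_self _
      rw [this]; exact T.zero_mem
    | succ n ih =>
      have h1 := T.add_mem ih (hx1 n _ (hr n))
      have h2 : r (n + 1) = r n - (x n (r n)).2 := rfl
      rw [Finset.sum_range_succ, h2]
      convert h1 using 1
      refine Prod.ext rfl ?_
      simp only [Prod.snd_add]
      abel
  have hr0 : Tendsto r atTop (𝓝 0) := by
    rw [← tendsto_add_atTop_iff_nat 1]
    exact hv.tendsto fun n => hx4 n _ (hr n)
  have hlim : (y, g₀ - e₀) ∈ T := by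
    refine (hT _ _).2 fun h w hw => ?_
    have h1 : Tendsto (fun n => P₁ (g₀ - e₀ - r n) h) atTop (𝓝 (P₁ (g₀ - e₀) h)) := by
      refine ((hP₁.cont h).tendsto _).comp ?_
      simpa using tendsto_const_nhds.sub hr0
    have h2 := (((hP₀.cont w).tendsto _).comp hy).const_mul ε
    refine tendsto_nhds_unique h1 (h2.congr fun n => ?_)
    exact ((hT _ _).1 (hsum n) h w hw).symm
  have h1 : g₀ - e₀ ∈ E := (hEmem _).2 ⟨y, hlim⟩
  simpa using E.add_mem h1 he₀

end ClosedRange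

section Duality

variable {P Q : Type*} [AddCommGroup P] [Module ℂ P] [TopologicalSpace P]
  [IsTopologicalAddGroup P] [ContinuousSMul ℂ P] [LocallyConvexSpace ℝ P]
  [AddCommGroup Q] [Module ℂ Q] [TopologicalSpace Q]
  [IsTopologicalAddGroup Q] [ContinuousSMul ℂ Q] [LocallyConvexSpace ℝ Q]
  {φ : P →ₗ[ℂ] Q →ₗ[ℂ] ℂ} {E Z : Submodule ℂ P} {E' Z' : Submodule ℂ Q}

/-- The map from `Z'` to the dual space of `Z / E` that is induced by the pairing. -/
def toQuotientDual (hφ : ∀ b, Continuous fun a => φ a b)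
    (hZ' : ∀ q ∈ Z', ∀ p ∈ E, φ p q = 0) :
    Z' →ₗ[ℂ] (Z ⧸ E.submoduleOf Z) →L[ℂ] ℂ where
  toFun q :=
    ⟨(E.submoduleOf Z).liftQ ((φ.flip q.1).comp Z.subtype) fun p hp => by
        simpa using hZ' q.1 q.2 p.1 hp,
      (E.submoduleOf Z).isQuotientMap_mkQ.continuous_iff.2
        ((hφ q.1).comp continuous_subtype_val)⟩
  map_add' q q' := by
    ext x
    obtain ⟨x, rfl⟩ := Submodule.mkQ_surjective _ x
    simp
  map_smul' c q := by
    ext x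
    obtain ⟨x, rfl⟩ := Submodule.mkQ_surjective _ x
    simp

theorem toQuotientDual_surjective (hP : RepresentsDual φ)
    (hZ' : ∀ q, q ∈ Z' ↔ ∀ p ∈ E, φ p q = 0) (hEZ : E ≤ Z)
    (hN : ∀ p, (∀ q, φ p q = 0) → p ∈ E) :
    Function.Surjective (toQuotientDual (Z := Z) hP.cont fun q => (hZ' q).1) := by
  intro l
  have := polynormableSpace_of_locallyConvexSpace (E := P)
  have hq : Continuous (E.submoduleOf Z).mkQ := continuous_quot_mk
  obtain ⟨L, hL⟩ := StrongDual.exists_extension Z (l.comp ⟨(E.submoduleOf Z).mkQ, hq⟩)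
  have hL0 : ∀ p ∈ E, L p = 0 := fun p hp => by
    have h1 := hL ⟨p, hEZ hp⟩
    have h2 : (E.submoduleOf Z).mkQ ⟨p, hEZ hp⟩ = 0 := by
      rw [Submodule.mkQ_apply, Submodule.Quotient.mk_eq_zero]; exact hp
    have h3 : L p = l ((E.submoduleOf Z).mkQ ⟨p, hEZ hp⟩) := h1
    rw [h3, h2, map_zero]
  obtain ⟨q, hq⟩ := hP.repr L fun p hp => hL0 p (hN p hp)
  refine ⟨⟨q, (hZ' q).2 fun p hp => by rw [← hq, hL0 p hp]⟩, ?_⟩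
  ext x
  obtain ⟨x, rfl⟩ := Submodule.mkQ_surjective _ x
  have h1 := hL x
  rw [hq] at h1
  exact h1

/-- If `E' ⊆ Z'` are the annihilators of `Z ⊇ E`, and `Z` is the annihilator of `E'`, then
`Z' / E'` is the dual space of `Z / E`, and the inverse of this identification is continuous for the
strong topology. The last claim is the bipolar theorem: if `W` is a convex neighbourhood of zero, then
an element of `Z'` that is at most one on the polar set of `W` in `Z` belongs to the closure
of `W + E'`. -/
theorem exists_equiv_quotient_dual (hP : RepresentsDual φ) (hQ : RepresentsDual φ.flip)
    (hZ' : ∀ q, q ∈ Z' ↔ ∀ p ∈ E, φ p q = 0) (hE' : ∀ q, q ∈ E' ↔ ∀ p ∈ Z, φ p q = 0)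
    (hZ : ∀ p, (∀ q ∈ E', φ p q = 0) → p ∈ Z) (hEZ : E ≤ Z)
    (hN : ∀ p, (∀ q, φ p q = 0) → p ∈ E) :
    ∃ e : (Z' ⧸ E'.submoduleOf Z') ≃ₗ[ℂ] ((Z ⧸ E.submoduleOf Z) →L[ℂ] ℂ),
      Continuous e.symm ∧ (∀ (q : Z') (p : Z),
        e (Submodule.Quotient.mk q) (Submodule.Quotient.mk p) = φ p.1 q.1) ∧
      (BarrelledSpace ℂ Z' → Continuous e) := by
  have hsm : ContinuousSMul ℝ Q := IsScalarTower.continuousSMul ℂ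
  set Φ := toQuotientDual (Z := Z) hP.cont fun q => (hZ' q).1 with hΦ
  have hsurj : Function.Surjective Φ := toQuotientDual_surjective hP hZ' hEZ hN
  have hΦmk : ∀ (q : Z') (p : Z), Φ q (Submodule.Quotient.mk p) = φ p.1 q.1 := fun _ _ => rfl
  have hker : E'.submoduleOf Z' = LinearMap.ker Φ := by
    ext q
    rw [LinearMap.mem_ker]
    refine ((hE' q.1).trans ⟨fun h => ?_, fun h p hp => ?_⟩ : q.1 ∈ E' ↔ _)
    · ext x
      obtain ⟨x, rfl⟩ := Submodule.mkQ_surjective _ x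
      exact h x.1 x.2
    · rw [← hΦmk q ⟨p, hp⟩, h]; rfl
  have hE'Z' : E' ≤ Z' := fun q hq => (hZ' q).2 fun p hp => (hE' q).1 hq p (hEZ hp)
  let e := (Submodule.quotEquivOfEq _ _ hker).trans (Φ.quotKerEquivOfSurjective hsurj)
  have he : ∀ q : Z', e (Submodule.Quotient.mk q) = Φ q := fun q => rfl
  have hlc : ∀ S : Submodule ℂ P, LocallyConvexSpace ℝ S := fun S =>
    IsInducing.locallyConvexSpace (f := S.subtype.restrictScalars ℝ) .subtypeVal
  have := hlc Z
  refine ⟨e, ?_, fun q p => rfl, fun hB => ?_⟩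
  · refine continuous_of_continuousAt_zero e.symm ?_
    rw [ContinuousAt, map_zero]
    intro O hO
    have hqc : Continuous (E'.submoduleOf Z').mkQ := continuous_quot_mk
    have hO1 : (E'.submoduleOf Z').mkQ ⁻¹' O ∈ 𝓝 (0 : Z') :=
      hqc.continuousAt.preimage_mem_nhds (by rwa [map_zero])
    rw [nhds_subtype_eq_comap, mem_comap] at hO1
    obtain ⟨W₀, hW₀, hW₀O⟩ := hO1
    obtain ⟨W₁, hW₁, hW₁W₀⟩ := exists_nhds_half_neg hW₀
    obtain ⟨W, hW, hWc, hWW₁⟩ :=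
      (locallyConvexSpace_iff_exists_convex_subset_zero ℝ Q).1 ‹_› W₁ hW₁
    -- the polar set of `W`, and its image in `Z / E`
    let C : Set P := {p | ∀ w ∈ W, (φ p w).re ≤ 1}
    let D : Set (Z ⧸ E.submoduleOf Z) := (E.submoduleOf Z).mkQ '' {z | z.1 ∈ C}
    have hD : Bornology.IsVonNBounded ℂ D := by
      refine isVonNBounded_of_weakly_bounded fun l => ?_
      obtain ⟨q, rfl⟩ := hsurj l
      obtain ⟨R, hR0, hR⟩ := ((absorbent_nhds_zero (𝕜 := ℂ) hW) q.1).exists_pos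
      refine ⟨R, ?_⟩
      rintro _ ⟨z, hz, rfl⟩
      have h1 : Φ q ((E.submoduleOf Z).mkQ z) = φ z.1 q.1 := rfl
      rw [h1]
      by_cases h0 : φ z.1 q.1 = 0
      · rw [h0, norm_zero]; exact hR0.le
      have hn : ‖φ z.1 q.1‖ ≠ 0 := norm_ne_zero_iff.2 h0
      set c : ℂ := R * (φ z.1 q.1 / ‖φ z.1 q.1‖) with hc
      have hcn : ‖c‖ = R := by
        rw [hc, norm_mul, norm_div, Complex.norm_real, Complex.norm_real, norm_norm, div_self hn,
          mul_one, Real.norm_of_nonneg hR0.le]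
      obtain ⟨w, hw, hcw⟩ := hR c hcn.ge (mem_singleton _)
      have h2 := hz w hw
      have h3 : φ z.1 q.1 = c * φ z.1 w := by
        have h4 : c • w = q.1 := hcw
        rw [← h4, map_smul, smul_eq_mul]
      have h5 : φ z.1 w = (‖φ z.1 q.1‖ / R : ℝ) := by
        have hR' : (R : ℂ) ≠ 0 := by exact_mod_cast hR0.ne'
        have hn' : (‖φ z.1 q.1‖ : ℂ) ≠ 0 := by exact_mod_cast hn
        have hc0 : c ≠ 0 := by rw [← norm_ne_zero_iff, hcn]; exact hR0.ne'
        apply mul_left_cancel₀ hc0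
        rw [← h3, hc]
        push_cast
        field_simp
      rw [h5, Complex.ofReal_re, div_le_one hR0] at h2
      exact h2
    have hnb : {l : (Z ⧸ E.submoduleOf Z) →L[ℂ] ℂ | ∀ x ∈ D, l x ∈ Metric.closedBall (0 : ℂ) 1} ∈
        𝓝 0 := ContinuousLinearMap.hasBasis_nhds_zero.mem_of_mem
          (i := (D, Metric.closedBall (0 : ℂ) 1)) ⟨hD, Metric.closedBall_mem_nhds _ one_pos⟩
    refine mem_map.2 (mem_of_superset hnb fun l hl => ?_)
    obtain ⟨q, rfl⟩ := hsurj l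
    have hq1 : ∀ z ∈ Z, z ∈ C → ‖φ z q.1‖ ≤ 1 := fun z hz hzC => by
      exact mem_closedBall_zero_iff.1 (hl _ ⟨⟨z, hz⟩, hzC, rfl⟩)
    have hes : e.symm (Φ q) = Submodule.Quotient.mk q := by
      rw [LinearEquiv.symm_apply_eq]; rfl
    change e.symm (Φ q) ∈ O
    rw [hes]
    have hVc : Convex ℝ (W + (E' : Set Q)) := hWc.add (E'.restrictScalars ℝ).convex
    have hW0 : (0 : Q) ∈ W := mem_of_mem_nhds hW
    -- the bipolar theorem
    have hqV : q.1 ∈ closure (W + (E' : Set Q)) := by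
      by_contra hqV
      obtain ⟨f, u, hf, hu⟩ := RCLike.geometric_hahn_banach_closed_point (𝕜 := ℂ)
        hVc.closure isClosed_closure hqV
      have hfW : ∀ w ∈ W, ∀ x ∈ E', (f (w + x)).re < u := fun w hw x hx =>
        hf _ (subset_closure (Set.add_mem_add hw hx))
      have hf0 : ∀ x ∈ E', f x = 0 := fun x hx => eq_zero_of_re_lt (u := u) fun c => by
        have := hfW 0 hW0 (c • x) (E'.smul_mem c hx)
        simpa using this
      have hu0 : 0 < u := by simpa using hfW 0 hW0 0 E'.zero_mem
      obtain ⟨p, hp⟩ := hQ.repr f fun x hx => hf0 x ((hE' x).2 fun p _ => hx p)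
      have hp' : ∀ x, f x = φ p x := hp
      have hpZ : ((u⁻¹ : ℝ) : ℂ) • p ∈ Z :=
        Z.smul_mem _ (hZ p fun x hx => by rw [← hp', hf0 x hx])
      have hval : ∀ x, φ (((u⁻¹ : ℝ) : ℂ) • p) x = ((u⁻¹ : ℝ) : ℂ) * f x := fun x => by
        rw [map_smul, LinearMap.smul_apply, ← hp', smul_eq_mul]
      have hpC : ((u⁻¹ : ℝ) : ℂ) • p ∈ C := fun w hw => by
        have := hfW w hw 0 E'.zero_mem
        rw [add_zero] at this
        rw [hval, Complex.re_ofReal_mul, inv_mul_le_iff₀ hu0, mul_one]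
        exact this.le
      have h1 := (Complex.re_le_norm _).trans (hq1 _ hpZ hpC)
      rw [hval, Complex.re_ofReal_mul, inv_mul_le_iff₀ hu0, mul_one] at h1
      exact absurd (hu.trans_le h1) (lt_irrefl _)
    have hnq : {v | v - q.1 ∈ W₁} ∈ 𝓝 q.1 := by
      have hc : ContinuousAt (fun v => v - q.1) q.1 := by fun_prop
      exact hc.preimage_mem_nhds (by simpa using hW₁)
    obtain ⟨_, hv, w, hw, x, hx, rfl⟩ := mem_closure_iff_nhds.1 hqV _ hnq
    have hmem : q.1 - x ∈ W₀ := by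
      have := hW₁W₀ _ (hWW₁ hw) _ hv
      have e : w - (w + x - q.1) = q.1 - x := by abel
      rwa [← e]
    have h2 := @hW₀O (q - ⟨x, hE'Z' hx⟩) hmem
    have h3 : (E'.submoduleOf Z').mkQ (q - ⟨x, hE'Z' hx⟩) = Submodule.Quotient.mk q := by
      rw [map_sub]
      exact sub_eq_self.2 ((Submodule.Quotient.mk_eq_zero _).2 hx)
    rw [mem_preimage, h3] at h2
    exact h2
  · refine (E'.submoduleOf Z').isQuotientMap_mkQ.continuous_iff.2 ?_
    change Continuous Φ
    refine continuous_of_continuousAt_zero Φ ?_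
    rw [ContinuousAt, map_zero, ContinuousLinearMap.hasBasis_nhds_zero.tendsto_right_iff]
    rintro ⟨D, V⟩ ⟨hD, hV⟩
    obtain ⟨ε, hε, hεV⟩ := Metric.mem_nhds_iff.1 hV
    -- on a barrelled space a supremum of continuous seminorms is continuous
    let s : D → Seminorm ℂ Z' := fun x => (normSeminorm ℂ ℂ).comp
      ((LinearMap.applyₗ x.1).comp ((ContinuousLinearMap.coeLM ℂ).comp Φ))
    have hs : ∀ x, Continuous (s x) := by
      rintro ⟨x, hx⟩
      obtain ⟨x, rfl⟩ := Submodule.mkQ_surjective _ x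
      exact ((hQ.cont x.1).comp continuous_subtype_val).norm
    have hb : BddAbove (range s) := by
      rw [Seminorm.bddAbove_range_iff]
      intro q
      have h1 := hD.image (Φ q)
      rw [NormedSpace.isVonNBounded_iff, isBounded_iff_forall_norm_le] at h1
      obtain ⟨C, hC⟩ := h1
      refine ⟨C, ?_⟩
      rintro _ ⟨x, rfl⟩
      exact hC _ ⟨x.1, x.2, rfl⟩
    have hc := Seminorm.continuous_iSup s hs hb
    have h0 : ∀ᶠ q in 𝓝 (0 : Z'), (⨆ i, (s i : Z' → ℝ)) q < ε := by
      refine hc.continuousAt.eventually (Iio_mem_nhds ?_)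
      rw [iSup_apply]
      simpa using hε
    filter_upwards [h0] with q hq x hx
    refine hεV ?_
    rw [mem_ball_zero_iff]
    rw [iSup_apply] at hq
    refine lt_of_le_of_lt (le_ciSup (f := fun i => s i q) ?_ ⟨x, hx⟩) hq
    exact Seminorm.bddAbove_range_iff.1 hb q

end Duality

end FunctionalAnalysis

/-! ### Exterior algebra of a vector space with a complex frame -/

section Algebra

variable {d m a b : ℕ}

theorem stdVec_eq_basisFun (d : ℕ) : stdVec d = (EuclideanSpace.basisFun (Fin d) ℝ).toBasis := by
  ext i : 1
  simp [stdVec]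

theorem alt_ext {G : Type} [NormedAddCommGroup G] [NormedSpace ℝ G] {α β : Alt d m G}
    (h : ∀ κ : Fin m → Fin d, α (fun j => stdVec d (κ j)) = β (fun j => stdVec d (κ j))) :
    α = β := by
  apply ContinuousAlternatingMap.toContinuousMultilinearMap_injective
  apply ContinuousMultilinearMap.toMultilinearMap_injective
  refine Module.Basis.ext_multilinear (fun _ => (EuclideanSpace.basisFun (Fin d) ℝ).toBasis)
    fun κ => ?_
  rw [← stdVec_eq_basisFun]
  exact h κ

instance alt_finiteDimensional : FiniteDimensional ℂ (Alt d m ℂ) := by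
  let f : Alt d m ℂ →ₗ[ℂ] ((Fin m → Fin d) → ℂ) :=
    { toFun := fun α κ => α (fun j => stdVec d (κ j))
      map_add' := fun α β => rfl
      map_smul' := fun c α => rfl }
  exact FiniteDimensional.of_injective f fun α β h => alt_ext fun κ => congrFun h κ

instance alt_finiteDimensional_real : FiniteDimensional ℝ (Alt d m ℂ) :=
  FiniteDimensional.trans ℝ ℂ _

/-- The complex-multilinear extension of `α` to `ℂ^d`. -/
def cplx (α : Alt d m ℂ) : MultilinearMap ℂ (fun _ : Fin m => Fin d → ℂ) ℂ :=
  ∑ κ : Fin m → Fin d, α (fun j => stdVec d (κ j)) •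
    (MultilinearMap.mkPiAlgebra ℂ (Fin m) ℂ).compLinearMap fun j => LinearMap.proj (κ j)

theorem cplx_apply (α : Alt d m ℂ) (ζ : Fin m → Fin d → ℂ) :
    cplx α ζ = ∑ κ : Fin m → Fin d, α (fun j => stdVec d (κ j)) * ∏ j, ζ j (κ j) := by
  simp [cplx]

theorem alt_expand (α : Alt d m ℂ) (v : Fin m → Model d) :
    α v = ∑ κ : Fin m → Fin d, α (fun j => stdVec d (κ j)) * ∏ j, ((v j (κ j) : ℝ) : ℂ) := by
  have h : v = fun j => ∑ i, v j i • stdVec d i := by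
    ext1 j
    have := ((EuclideanSpace.basisFun (Fin d) ℝ).toBasis.sum_repr (v j)).symm
    rw [← stdVec_eq_basisFun] at this
    simpa using this
  have h2 := α.toMultilinearMap.map_sum (fun j i => v j i • stdVec d i)
  conv_lhs => rw [h]
  refine h2.trans (sum_ext fun κ => ?_)
  have h3 := α.toMultilinearMap.map_smul_univ (fun j => v j (κ j)) (fun j => stdVec d (κ j))
  refine h3.trans ?_
  rw [Complex.real_smul, mul_comm]
  push_cast
  rfl

theorem cplx_real (α : Alt d m ℂ) (v : Fin m → Model d) :
    cplx α (fun j i => ((v j i : ℝ) : ℂ)) = α v := by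
  rw [cplx_apply, alt_expand α v]

theorem cplx_std (α : Alt d m ℂ) (κ : Fin m → Fin d) :
    cplx α (fun j => Pi.single (κ j) 1) = α (fun j => stdVec d (κ j)) := by
  rw [← cplx_real]
  congr 1
  ext j i
  simp only [stdVec, Pi.single_apply, PiLp.single_apply]
  split_ifs <;> simp

/-- The vector `u + i v`. -/
def cvec (w : Model d × Model d) : Fin d → ℂ := fun i => (w.1 i : ℂ) + Complex.I * (w.2 i : ℂ)

theorem cvec_surjective : Function.Surjective (cvec (d := d)) := fun ζ =>
  ⟨(WithLp.toLp 2 fun i => (ζ i).re, WithLp.toLp 2 fun i => (ζ i).im), by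
    ext i; simp [cvec, mul_comm Complex.I, Complex.re_add_im]⟩

theorem complexEval_eq (α : Alt d m ℂ) (ζ : Fin m → Model d × Model d) :
    complexEval α ζ = cplx α fun j => cvec (ζ j) := by
  classical
  unfold complexEval
  rw [cplx_apply]
  have h : ∀ T : Finset (Fin m), α (fun j => if j ∈ T then (ζ j).2 else (ζ j).1) =
      ∑ κ : Fin m → Fin d, α (fun j => stdVec d (κ j)) *
        ((∏ j ∈ T, ((ζ j).2 (κ j) : ℂ)) * ∏ j ∈ Finset.univ \ T, ((ζ j).1 (κ j) : ℂ)) := by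
    intro T
    rw [alt_expand]
    refine sum_ext fun κ => ?_
    congr 1
    rw [← Finset.prod_sdiff (Finset.subset_univ T), mul_comm]
    congr 1
    · exact Finset.prod_congr rfl fun j hj => by simp [hj]
    · exact Finset.prod_congr rfl fun j hj => by simp [(Finset.mem_sdiff.1 hj).2]
  have h1 : ∀ κ : Fin m → Fin d, ∏ j, cvec (ζ j) (κ j) = ∑ T : Finset (Fin m),
      Complex.I ^ T.card *
        ((∏ j ∈ T, ((ζ j).2 (κ j) : ℂ)) * ∏ j ∈ Finset.univ \ T, ((ζ j).1 (κ j) : ℂ)) := by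
    intro κ
    simp only [cvec]
    rw [Finset.prod_congr rfl fun j _ => add_comm _ _, Finset.prod_add, Finset.powerset_univ]
    refine sum_ext fun T => ?_
    rw [Finset.prod_mul_distrib, Finset.prod_const, mul_assoc]
  simp only [h, h1, Finset.mul_sum]
  rw [Finset.sum_comm]
  refine sum_ext fun κ => sum_ext fun T => ?_
  convert (mul_left_comm _ _ _) using 3

theorem cplx_add (α β : Alt d m ℂ) (ζ : Fin m → Fin d → ℂ) :
    cplx (α + β) ζ = cplx α ζ + cplx β ζ := by
  simp [cplx_apply, add_mul, Finset.sum_add_distrib]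

theorem cplx_smul (z : ℂ) (α : Alt d m ℂ) (ζ : Fin m → Fin d → ℂ) :
    cplx (z • α) ζ = z * cplx α ζ := by
  simp [cplx_apply, Finset.mul_sum, mul_assoc]

theorem cplx_perm (α : Alt d m ℂ) (ζ : Fin m → Fin d → ℂ) (σ : Equiv.Perm (Fin m)) :
    cplx α (fun j => ζ (σ j)) = ((Equiv.Perm.sign σ : ℤ) : ℂ) * cplx α ζ := by
  rw [cplx_apply, cplx_apply, Finset.mul_sum,
    ← Equiv.sum_comp (Equiv.arrowCongr σ.symm (Equiv.refl (Fin d)))]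
  refine sum_ext fun κ => ?_
  have h1 := α.toAlternatingMap.map_perm (fun j => stdVec d (κ j)) σ
  rw [Units.smul_def, zsmul_eq_mul] at h1
  have e1 : α (fun j => stdVec d (κ (σ j))) =
      ((Equiv.Perm.sign σ : ℤ) : ℂ) * α (fun j => stdVec d (κ j)) := h1
  have e2 : ∏ j, ζ (σ j) (κ (σ j)) = ∏ j, ζ j (κ j) :=
    Equiv.prod_comp σ fun j => ζ j (κ j)
  have e3 : ∀ j, (Equiv.arrowCongr σ.symm (Equiv.refl (Fin d))) κ j = κ (σ j) := fun j => rfl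
  simp only [e3, e1, e2, mul_assoc]

theorem cplx_eq_zero_of_not_injective (α : Alt d m ℂ) (ζ : Fin m → Fin d → ℂ) {i j : Fin m}
    (h : ζ i = ζ j) (hij : i ≠ j) : cplx α ζ = 0 := by
  have h1 := cplx_perm α ζ (Equiv.swap i j)
  have h2 : (fun k => ζ (Equiv.swap i j k)) = ζ := by
    ext1 k
    rcases eq_or_ne k i with rfl | hi
    · rw [Equiv.swap_apply_left, h]
    rcases eq_or_ne k j with rfl | hj
    · rw [Equiv.swap_apply_right, h]
    rw [Equiv.swap_apply_of_ne_of_ne hi hj]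
  rw [h2, Equiv.Perm.sign_swap hij] at h1
  simp only [Units.val_neg, Units.val_one, Int.cast_neg, Int.cast_one, neg_mul, one_mul] at h1
  linear_combination h1 / 2

/-- The alternating sum `∑_σ sgn(σ) F(v ∘ σ)`. -/
def altSum {J V : Type*} [Fintype J] [DecidableEq J] (F : (J → V) → ℂ) (v : J → V) : ℂ :=
  ∑ σ : Equiv.Perm J, ((Equiv.Perm.sign σ : ℤ) : ℂ) * F (fun j => v (σ j))

theorem altSum_comp_perm {J V : Type*} [Fintype J] [DecidableEq J] (F : (J → V) → ℂ)
    (ρ : Equiv.Perm J) (v : J → V) :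
    altSum (fun u => F fun j => u (ρ j)) v = ((Equiv.Perm.sign ρ : ℤ) : ℂ) * altSum F v := by
  unfold altSum
  rw [Finset.mul_sum, ← Equiv.sum_comp (Equiv.mulRight ρ⁻¹)]
  refine sum_ext fun σ => ?_
  have h : ∀ j, (σ * ρ⁻¹) (ρ j) = σ j := fun j => by simp
  simp only [Equiv.coe_mulRight, h, Equiv.Perm.sign_mul, Equiv.Perm.sign_inv, Units.val_mul,
    Int.cast_mul]
  ring

theorem altSum_congr {J J' V : Type*} [Fintype J] [DecidableEq J] [Fintype J'] [DecidableEq J']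
    (e : J ≃ J') (F : (J' → V) → ℂ) (v : J' → V) :
    altSum F v = altSum (fun u => F fun j => u (e.symm j)) (fun j => v (e j)) := by
  unfold altSum
  rw [← Equiv.sum_comp e.permCongr]
  refine sum_ext fun σ => ?_
  simp [Equiv.Perm.sign_permCongr]

theorem wedgeApply_eq_altSum (α : Alt d a ℂ) (β : Alt d b ℂ) (v : Fin (a + b) → Model d) :
    wedgeApply α β v = ((a.factorial : ℂ) * (b.factorial : ℂ))⁻¹ *
      altSum (fun u => α (fun i => u (Fin.castAdd b i)) * β (fun j => u (Fin.natAdd a j))) v := rfl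

/-- The complex-multilinear extension of `α ∧ β`. -/
def wedgeC (α : Alt d a ℂ) (β : Alt d b ℂ) : (Fin d → ℂ) [⋀^Fin (a + b)]→ₗ[ℂ] ℂ :=
  ((a.factorial : ℂ) * (b.factorial : ℂ))⁻¹ • MultilinearMap.alternatization
    ((LinearMap.mul' ℂ ℂ).compMultilinearMap
      (((cplx α).domCoprod (cplx β)).domDomCongr finSumFinEquiv))

theorem wedgeC_apply (α : Alt d a ℂ) (β : Alt d b ℂ) (ζ : Fin (a + b) → Fin d → ℂ) :
    wedgeC α β ζ = ((a.factorial : ℂ) * (b.factorial : ℂ))⁻¹ *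
      altSum (fun u => cplx α (fun i => u (Fin.castAdd b i)) *
        cplx β (fun j => u (Fin.natAdd a j))) ζ := by
  rw [wedgeC, AlternatingMap.smul_apply, smul_eq_mul, MultilinearMap.alternatization_apply]
  congr 1
  refine sum_ext fun σ => ?_
  simp [Units.smul_def, MultilinearMap.domCoprod_apply]

theorem wedgeC_real (α : Alt d a ℂ) (β : Alt d b ℂ) (v : Fin (a + b) → Model d) :
    wedgeC α β (fun j i => ((v j i : ℝ) : ℂ)) = wedgeApply α β v := by
  rw [wedgeC_apply, wedgeApply_eq_altSum]
  unfold altSum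
  simp only [cplx_real]

/-- `α ∧ β` is determined by its value on any complex basis. -/
theorem wedgeC_eq_det (h : a + b = d) (α : Alt d a ℂ) (β : Alt d b ℂ)
    (ζ : Matrix (Fin d) (Fin d) ℂ) :
    wedgeC α β (fun i => ζ (Fin.cast h i)) = ζ.det * wedgeTop α β := by
  subst h
  have h1 := AlternatingMap.eq_smul_basis_det (Pi.basisFun ℂ (Fin (a + b))) (wedgeC α β)
  have h2 : wedgeC α β (Pi.basisFun ℂ (Fin (a + b))) = wedgeTop α β := by
    rw [wedgeTop, dif_pos rfl, ← wedgeC_real]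
    congr 1
    ext j i
    simp only [stdVec, Pi.basisFun_apply, Pi.single_apply, PiLp.single_apply, Fin.cast_eq_self]
    split_ifs <;> simp
  have h3 : wedgeC α β ζ = wedgeC α β (Pi.basisFun ℂ (Fin (a + b))) *
      (Pi.basisFun ℂ (Fin (a + b))).det ζ := congrArg (fun f => f ζ) h1
  rw [h2, mul_comm] at h3
  exact h3.trans (congrArg (· * _) (Pi.basisFun_det_apply ζ))

theorem wedgeTop_comp (α : Alt d a ℂ) (β : Alt d b ℂ) (L : Model d →L[ℝ] Model d) :
    wedgeTop (α.compContinuousLinearMap L) (β.compContinuousLinearMap L) =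
      (L.det : ℂ) * wedgeTop α β := by
  by_cases h : a + b = d
  · have h1 := wedgeC_eq_det h α β (fun j i => ((L (stdVec d j) i : ℝ) : ℂ))
    have h2 : Matrix.det (fun j i => ((L (stdVec d j) i : ℝ) : ℂ)) = (L.det : ℂ) := by
      have h3 := LinearMap.det_toMatrix (EuclideanSpace.basisFun (Fin d) ℝ).toBasis L.toLinearMap
      rw [ContinuousLinearMap.det, ← h3, ← Matrix.det_transpose, ← Complex.coe_algebraMap,
        RingHom.map_det]
      congr 1
    rw [h2] at h1
    rw [← h1, wedgeTop, dif_pos h]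
    exact (wedgeC_real α β fun i => L (stdVec d (Fin.cast h i))).symm
  · simp [wedgeTop, h]

theorem wedgeTop_eq_altSum (h : a + b = d) (α : Alt d a ℂ) (β : Alt d b ℂ) :
    wedgeTop α β = ((a.factorial : ℂ) * (b.factorial : ℂ))⁻¹ *
      altSum (fun u : Fin d → Model d => α (fun i => u (Fin.cast h (Fin.castAdd b i))) *
        β (fun j => u (Fin.cast h (Fin.natAdd a j)))) (stdVec d) := by
  subst h
  rw [wedgeTop, dif_pos rfl]
  rfl

theorem altSum_sum {J V ι : Type*} [Fintype J] [DecidableEq J] (s : Finset ι)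
    (F : ι → (J → V) → ℂ) (v : J → V) :
    altSum (fun u => ∑ i ∈ s, F i u) v = ∑ i ∈ s, altSum (F i) v := by
  unfold altSum
  simp only [Finset.mul_sum]
  rw [Finset.sum_comm]

theorem altSum_const_mul {J V : Type*} [Fintype J] [DecidableEq J] (c : ℂ)
    (F : (J → V) → ℂ) (v : J → V) :
    altSum (fun u => c * F u) v = c * altSum F v := by
  unfold altSum
  simp only [Finset.mul_sum, mul_left_comm]

/-- The exterior product of a linear form and an alternating form. -/
def wedgeLin (l : Model d →L[ℝ] ℂ) (α : Alt d a ℂ) : Alt d (a + 1) ℂ :=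
  ContinuousAlternatingMap.alternatizeUncurryFin (l.smulRight α)

theorem wedgeLin_apply (l : Model d →L[ℝ] ℂ) (α : Alt d a ℂ) (v : Fin (a + 1) → Model d) :
    wedgeLin l α v = ∑ i : Fin (a + 1), (-1) ^ (i : ℕ) * (l (v i) * α (fun j => v (i.succAbove j))) := by
  rw [wedgeLin, ContinuousAlternatingMap.alternatizeUncurryFin_apply]
  refine sum_ext fun i => ?_
  rw [zsmul_eq_mul]
  push_cast
  rfl

/-- Moving the argument of `l` from position `p` to the front of an alternating sum costs `(-1) ^ p`. -/
theorem altSum_cycle (l : Model d →L[ℝ] ℂ) (α : Alt d a ℂ) (β : Alt d b ℂ) (h : a + 1 + b = d)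
    (p : Fin d) (s : Fin a → Fin d) (t : Fin b → Fin d)
    (hs : ∀ j, ((Fin.cycleRange p (s j) : Fin d) : ℕ) = j + 1)
    (ht : ∀ j, ((Fin.cycleRange p (t j) : Fin d) : ℕ) = a + 1 + j) (v : Fin d → Model d) :
    altSum (fun u : Fin d → Model d => l (u p) * (α (fun j => u (s j)) * β (fun j => u (t j)))) v
      = (-1) ^ (p : ℕ) *
      altSum (fun u : Fin d → Model d => l (u ⟨0, by omega⟩) *
        (α (fun j => u ⟨j + 1, by omega⟩) * β (fun j => u ⟨a + 1 + j, by omega⟩))) v := by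
  have hd : NeZero d := ⟨by omega⟩
  have h1 := altSum_comp_perm (fun u : Fin d → Model d => l (u p) *
    (α (fun j => u (s j)) * β (fun j => u (t j)))) (Fin.cycleRange p) v
  have hs' : ∀ j : Fin a, Fin.cycleRange p (s j) = ⟨j + 1, by omega⟩ := fun j => Fin.ext (hs j)
  have ht' : ∀ j : Fin b, Fin.cycleRange p (t j) = ⟨a + 1 + j, by omega⟩ := fun j => Fin.ext (ht j)
  have hp : Fin.cycleRange p p = ⟨0, by omega⟩ := by
    rw [Fin.cycleRange_self]; rfl
  simp only [hs', ht', hp, Fin.sign_cycleRange] at h1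
  rw [h1]
  push_cast
  rw [← mul_assoc, ← mul_pow]
  simp

/-- A linear form can be moved from the left factor of a wedge product to the right one. -/
theorem wedgeTop_wedgeLin (l : Model d →L[ℝ] ℂ) (α : Alt d a ℂ) (β : Alt d b ℂ) :
    wedgeTop (wedgeLin l α) β = (-1) ^ a * wedgeTop α (wedgeLin l β) := by
  by_cases h : a + 1 + b = d
  swap
  · rw [wedgeTop, wedgeTop, dif_neg h, dif_neg (by omega), mul_zero]
  have h' : a + (b + 1) = d := by omega
  -- the terms of both expansions agree up to sign with `T`, where `l` has the first argument
  set T := altSum (fun u : Fin d → Model d => l (u ⟨0, by omega⟩) *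
        (α (fun j => u ⟨j + 1, by omega⟩) * β (fun j => u ⟨a + 1 + j, by omega⟩))) (stdVec d) with hT
  have e1 : altSum (fun u : Fin d → Model d =>
        wedgeLin l α (fun i => u (Fin.cast h (Fin.castAdd b i))) *
        β (fun j => u (Fin.cast h (Fin.natAdd (a + 1) j)))) (stdVec d) = (a + 1) * T := by
    have : (fun u : Fin d → Model d =>
        wedgeLin l α (fun i => u (Fin.cast h (Fin.castAdd b i))) *
        β (fun j => u (Fin.cast h (Fin.natAdd (a + 1) j)))) = fun u => ∑ i : Fin (a + 1),
          (-1) ^ (i : ℕ) * (l (u (Fin.cast h (Fin.castAdd b i))) *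
          (α (fun j => u (Fin.cast h (Fin.castAdd b (i.succAbove j)))) *
          β (fun j => u (Fin.cast h (Fin.natAdd (a + 1) j))))) := by
      ext u
      rw [wedgeLin_apply, Finset.sum_mul]
      refine sum_ext fun i => ?_
      ring
    rw [this, altSum_sum]
    have h2 : ∀ i ∈ (Finset.univ : Finset (Fin (a + 1))), altSum (fun u : Fin d → Model d =>
          (-1) ^ (i : ℕ) * (l (u (Fin.cast h (Fin.castAdd b i))) *
          (α (fun j => u (Fin.cast h (Fin.castAdd b (i.succAbove j)))) *
          β (fun j => u (Fin.cast h (Fin.natAdd (a + 1) j)))))) (stdVec d) = T := by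
      intro i _
      have hd : NeZero d := ⟨by omega⟩
      rw [altSum_const_mul, altSum_cycle l α β h _ _ _ ?_ ?_, ← mul_assoc, ← pow_add]
      · rw [Even.neg_one_pow (by simp), one_mul]
      · intro j
        rcases lt_or_ge j.castSucc i with hj | hj
        · rw [Fin.succAbove_of_castSucc_lt _ _ hj, Fin.coe_cycleRange_of_lt]
          · simp
          · simpa [Fin.lt_def] using hj
        · rw [Fin.succAbove_of_le_castSucc _ _ hj, Fin.cycleRange_of_gt]
          · simp
          · simp only [Fin.lt_def, Fin.le_def] at hj ⊢
            simp at hj ⊢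
            omega
      · intro j
        rw [Fin.cycleRange_of_gt]
        · simp
        · simp only [Fin.lt_def]
          simp
          omega
    rw [Finset.sum_congr rfl h2]
    simp
  have e2 : altSum (fun u : Fin d → Model d =>
        α (fun i => u (Fin.cast h' (Fin.castAdd (b + 1) i))) *
        wedgeLin l β (fun j => u (Fin.cast h' (Fin.natAdd a j)))) (stdVec d) =
        (b + 1) * ((-1) ^ a * T) := by
    have : (fun u : Fin d → Model d =>
        α (fun i => u (Fin.cast h' (Fin.castAdd (b + 1) i))) *
        wedgeLin l β (fun j => u (Fin.cast h' (Fin.natAdd a j)))) = fun u => ∑ i : Fin (b + 1),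
          (-1) ^ (i : ℕ) * (l (u (Fin.cast h' (Fin.natAdd a i))) *
          (α (fun j => u (Fin.cast h' (Fin.castAdd (b + 1) j))) *
          β (fun j => u (Fin.cast h' (Fin.natAdd a (i.succAbove j)))))) := by
      ext u
      rw [wedgeLin_apply, Finset.mul_sum]
      refine sum_ext fun i => ?_
      ring
    rw [this, altSum_sum]
    have h2 : ∀ i ∈ (Finset.univ : Finset (Fin (b + 1))), altSum (fun u : Fin d → Model d =>
          (-1) ^ (i : ℕ) * (l (u (Fin.cast h' (Fin.natAdd a i))) *
          (α (fun j => u (Fin.cast h' (Fin.castAdd (b + 1) j))) *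
          β (fun j => u (Fin.cast h' (Fin.natAdd a (i.succAbove j))))))) (stdVec d) =
          (-1) ^ a * T := by
      intro i _
      have hd : NeZero d := ⟨by omega⟩
      rw [altSum_const_mul, altSum_cycle l α β h _ _ _ ?_ ?_, ← mul_assoc, ← pow_add]
      · congr 1
        have : (i : ℕ) + ((Fin.cast h' (Fin.natAdd a i) : Fin d) : ℕ) = a + 2 * i := by
          simp; omega
        rw [this, pow_add, pow_mul]
        simp
      · intro j
        rw [Fin.coe_cycleRange_of_lt]
        · simp
        · simp only [Fin.lt_def]
          simp
          omega
      · intro j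
        rcases lt_or_ge j.castSucc i with hj | hj
        · rw [Fin.succAbove_of_castSucc_lt _ _ hj, Fin.coe_cycleRange_of_lt]
          · simp; omega
          · simpa [Fin.lt_def] using hj
        · rw [Fin.succAbove_of_le_castSucc _ _ hj, Fin.cycleRange_of_gt]
          · simp; omega
          · simp only [Fin.lt_def, Fin.le_def] at hj ⊢
            simp at hj ⊢
            omega
    rw [Finset.sum_congr rfl h2]
    simp
  rw [wedgeTop_eq_altSum h, wedgeTop_eq_altSum h', e1, e2, Nat.factorial_succ, Nat.factorial_succ]
  have ha : (a.factorial : ℂ) ≠ 0 := by exact_mod_cast a.factorial_ne_zero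
  have hb : (b.factorial : ℂ) ≠ 0 := by exact_mod_cast b.factorial_ne_zero
  have ha' : (a : ℂ) + 1 ≠ 0 := by exact_mod_cast a.succ_ne_zero
  have hb' : (b : ℂ) + 1 ≠ 0 := by exact_mod_cast b.succ_ne_zero
  have : ((-1 : ℂ) ^ a) * (-1) ^ a = 1 := by rw [← mul_pow]; simp
  push_cast
  field_simp
  linear_combination (-T) * this

theorem val_finRotate_pow (d : ℕ) (i : Fin d) (b : ℕ) :
    ((((finRotate d) ^ b : Equiv.Perm (Fin d)) i : Fin d) : ℕ) = (i + b) % d := by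
  have hd : NeZero d := i.neZero
  induction b with
  | zero => simp [Nat.mod_eq_of_lt i.2]
  | succ b ih =>
    rw [pow_succ', Equiv.Perm.mul_apply, finRotate_apply, Fin.val_add, ih]
    rw [Fin.val_one', Nat.add_mod_mod, Nat.mod_add_mod, add_assoc]

/-- Graded commutativity of the wedge product. -/
theorem wedgeTop_comm (α : Alt d a ℂ) (β : Alt d b ℂ) :
    wedgeTop α β = (-1) ^ (a * b) * wedgeTop β α := by
  by_cases h : a + b = d
  swap
  · rw [wedgeTop, wedgeTop, dif_neg h, dif_neg (by omega), mul_zero]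
  have h' : b + a = d := by omega
  have h1 := altSum_comp_perm (fun u : Fin d → Model d =>
    α (fun i => u (Fin.cast h (Fin.castAdd b i))) *
        β (fun j => u (Fin.cast h (Fin.natAdd a j)))) ((finRotate d) ^ b) (stdVec d)
  have h2 : ∀ i : Fin a, ((finRotate d) ^ b : Equiv.Perm (Fin d)) (Fin.cast h (Fin.castAdd b i)) =
      Fin.cast h' (Fin.natAdd b i) := by
    intro i
    ext
    rw [val_finRotate_pow]
    simp only [Fin.val_cast, Fin.val_castAdd, Fin.val_natAdd]
    rw [Nat.mod_eq_of_lt (by omega)]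
    omega
  have h3 : ∀ j : Fin b, ((finRotate d) ^ b : Equiv.Perm (Fin d)) (Fin.cast h (Fin.natAdd a j)) =
      Fin.cast h' (Fin.castAdd a j) := by
    intro j
    ext
    rw [val_finRotate_pow]
    simp only [Fin.val_cast, Fin.val_castAdd, Fin.val_natAdd]
    rw [show a + (j : ℕ) + b = j + d by omega, Nat.add_mod_right, Nat.mod_eq_of_lt (by omega)]
  simp only [h2, h3] at h1
  rw [wedgeTop_eq_altSum h, wedgeTop_eq_altSum h']
  simp only [mul_comm (β _) (α _)]
  rw [h1, map_pow, sign_finRotate]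
  push_cast
  have e : ((-1 : ℂ) ^ (d - 1)) ^ b = (-1) ^ (a * b) := by
    rw [← pow_mul]
    rcases b with _ | b
    · simp
    · have : (d - 1) * (b + 1) = a * (b + 1) + b * (b + 1) := by
        rw [← add_mul]; congr 1; omega
      rw [this, pow_add, (Nat.even_mul_succ_self b).neg_one_pow, mul_one]
  rw [e, mul_comm (a.factorial : ℂ)]
  have : ((-1 : ℂ) ^ (a * b)) * (-1) ^ (a * b) = 1 := by rw [← mul_pow]; simp
  linear_combination (-((b.factorial : ℂ) * a.factorial)⁻¹ *
    altSum (fun u : Fin d → Model d => α (fun i => u (Fin.cast h (Fin.castAdd b i))) *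
        β (fun j => u (Fin.cast h (Fin.natAdd a j)))) (stdVec d)) * this

end Algebra

/-! ### Coframes -/

section Coframe

variable {d m a b : ℕ}

/-- The constant form `dz_{κ 1} ∧ ⋯ ∧ dz_{κ m}` on `ℂ^d`. -/
def constDet (κ : Fin m → Fin d) : (Fin d → ℂ) [⋀^Fin m]→L[ℝ] ℂ :=
  { toContinuousMultilinearMap :=
      { toMultilinearMap := ((Matrix.detRowAlternating (n := Fin m) (R := ℂ)).compLinearMap
          (LinearMap.funLeft ℂ ℂ κ)).toMultilinearMap.restrictScalars ℝ
        cont := by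
          show Continuous fun v : Fin m → Fin d → ℂ => Matrix.det (fun i j => v i (κ j))
          exact Continuous.matrix_det (by fun_prop) }
    map_eq_zero_of_eq' := fun v i j h hij =>
      ((Matrix.detRowAlternating (n := Fin m) (R := ℂ)).compLinearMap
          (LinearMap.funLeft ℂ ℂ κ)).map_eq_zero_of_eq v h hij }

/-- The form `w_{κ 1} ∧ ⋯ ∧ w_{κ m}`, where `w_i` are the components of `B`. -/
def coframe (B : Model d →L[ℝ] (Fin d → ℂ)) (κ : Fin m → Fin d) : Alt d m ℂ :=
  (constDet κ).compContinuousLinearMap B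

theorem coframe_apply (B : Model d →L[ℝ] (Fin d → ℂ)) (κ : Fin m → Fin d) (v : Fin m → Model d) :
    coframe B κ v = Matrix.det (fun i j => B (v i) (κ j)) := rfl

/-- The matrix of the complex-linear extension of `B`. -/
def cplxMatrix (B : Model d →L[ℝ] (Fin d → ℂ)) : Matrix (Fin d) (Fin d) ℂ :=
  fun i j => B (stdVec d j) i

theorem cplxMatrix_mulVec (B : Model d →L[ℝ] (Fin d → ℂ)) (v : Model d) :
    (cplxMatrix B).mulVec (fun i => ((v i : ℝ) : ℂ)) = B v := by
  have h : v = ∑ i, v i • stdVec d i := by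
    have := ((EuclideanSpace.basisFun (Fin d) ℝ).toBasis.sum_repr v).symm
    rw [← stdVec_eq_basisFun] at this
    simpa using this
  conv_rhs => rw [h, map_sum]
  ext i
  simp [Matrix.mulVec, dotProduct, cplxMatrix, mul_comm]

theorem cplx_coframe (B : Model d →L[ℝ] (Fin d → ℂ)) (κ : Fin m → Fin d) (ζ : Fin m → Fin d → ℂ) :
    cplx (coframe B κ) ζ = Matrix.det (fun i j => (cplxMatrix B).mulVec (ζ i) (κ j)) := by
  have h : cplx (coframe B κ) = ((Matrix.detRowAlternating (n := Fin m) (R := ℂ)).compLinearMap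
      ((LinearMap.funLeft ℂ ℂ κ).comp (cplxMatrix B).mulVecLin)).toMultilinearMap := by
    refine Module.Basis.ext_multilinear (fun _ => Pi.basisFun ℂ (Fin d)) fun μ => ?_
    simp only [Pi.basisFun_apply]
    rw [cplx_std, coframe_apply]
    show _ = Matrix.det (fun i j => (cplxMatrix B).mulVec (Pi.single (μ i) 1) (κ j))
    congr 1
    ext i j
    simp [cplxMatrix]
  rw [h]
  rfl

/-- The complex basis of `ℂ^d` dual to the components of `B`. -/
def dualFrame (B : Model d →L[ℝ] (Fin d → ℂ)) (i : Fin d) : Fin d → ℂ :=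
  fun j => (cplxMatrix B)⁻¹ j i

theorem mulVec_dualFrame {B : Model d →L[ℝ] (Fin d → ℂ)} (hB : (cplxMatrix B).det ≠ 0) (i : Fin d) :
    (cplxMatrix B).mulVec (dualFrame B i) = Pi.single i 1 := by
  have h := Matrix.mul_nonsing_inv (cplxMatrix B) (isUnit_iff_ne_zero.2 hB)
  have h1 : (cplxMatrix B)⁻¹.mulVec (Pi.single i 1) = dualFrame B i := by
    ext j; simp [dualFrame]
  rw [← h1, Matrix.mulVec_mulVec, h, Matrix.one_mulVec]

theorem sum_dualFrame {B : Model d →L[ℝ] (Fin d → ℂ)} (hB : (cplxMatrix B).det ≠ 0)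
    (ζ : Fin d → ℂ) : ζ = ∑ i, (cplxMatrix B).mulVec ζ i • dualFrame B i := by
  have h := Matrix.nonsing_inv_mul (cplxMatrix B) (isUnit_iff_ne_zero.2 hB)
  conv_lhs => rw [← Matrix.one_mulVec ζ, ← h, ← Matrix.mulVec_mulVec]
  ext j
  simp [Matrix.mulVec, dotProduct, dualFrame, mul_comm]

theorem cplx_expand {B : Model d →L[ℝ] (Fin d → ℂ)} (hB : (cplxMatrix B).det ≠ 0) (α : Alt d m ℂ)
    (ζ : Fin m → Fin d → ℂ) :
    cplx α ζ = ∑ κ : Fin m → Fin d, (∏ j, (cplxMatrix B).mulVec (ζ j) (κ j)) *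
      cplx α (fun j => dualFrame B (κ j)) := by
  have h : ζ = fun j => ∑ i, (cplxMatrix B).mulVec (ζ j) i • dualFrame B i := by
    ext1 j; exact sum_dualFrame hB (ζ j)
  conv_lhs => rw [h]
  rw [MultilinearMap.map_sum]
  refine sum_ext fun κ => ?_
  rw [MultilinearMap.map_smul_univ, smul_eq_mul]

/-- The coefficients of a form in the coframe. -/
def coeff (B : Model d →L[ℝ] (Fin d → ℂ)) (κ : Fin m → Fin d) (α : Alt d m ℂ) : ℂ :=
  cplx α (fun j => dualFrame B (κ j))

theorem coeff_add (B : Model d →L[ℝ] (Fin d → ℂ)) (κ : Fin m → Fin d) (α β : Alt d m ℂ) :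
    coeff B κ (α + β) = coeff B κ α + coeff B κ β := cplx_add _ _ _

theorem coeff_smul (B : Model d →L[ℝ] (Fin d → ℂ)) (κ : Fin m → Fin d) (z : ℂ) (α : Alt d m ℂ) :
    coeff B κ (z • α) = z * coeff B κ α := cplx_smul _ _ _

theorem coeff_coframe {B : Model d →L[ℝ] (Fin d → ℂ)} (hB : (cplxMatrix B).det ≠ 0)
    (κ μ : Fin m → Fin d) :
    coeff B κ (coframe B μ) = Matrix.det (fun i j => if κ i = μ j then (1 : ℂ) else 0) := by
  rw [coeff, cplx_coframe]
  congr 1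
  ext i j
  rw [mulVec_dualFrame hB, Pi.single_apply]
  simp only [eq_comm]

theorem alt_sum_apply {ι : Type*} (t : Finset ι) (f : ι → Alt d m ℂ) (v : Fin m → Model d) :
    (∑ i ∈ t, f i) v = ∑ i ∈ t, f i v := by
  classical
  induction t using Finset.induction_on with
  | empty => simp
  | insert i t hi ih =>
    rw [Finset.sum_insert hi, Finset.sum_insert hi, ContinuousAlternatingMap.add_apply, ih]

theorem factorial_mul_cplx {B : Model d →L[ℝ] (Fin d → ℂ)} (hB : (cplxMatrix B).det ≠ 0)
    (α : Alt d m ℂ) (ζ : Fin m → Fin d → ℂ) :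
    (m.factorial : ℂ) * cplx α ζ =
      ∑ κ : Fin m → Fin d, coeff B κ α * cplx (coframe B κ) ζ := by
  have h2 : ∀ σ : Equiv.Perm (Fin m), cplx α ζ = ∑ κ : Fin m → Fin d,
      coeff B κ α * (((Equiv.Perm.sign σ : ℤ) : ℂ) *
        ∏ j, (cplxMatrix B).mulVec (ζ (σ j)) (κ j)) := by
    intro σ
    have h3 := cplx_expand hB α (fun j => ζ (σ j))
    rw [cplx_perm] at h3
    have h4 : ((Equiv.Perm.sign σ : ℤ) : ℂ) * ((Equiv.Perm.sign σ : ℤ) : ℂ) = 1 := by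
      exact_mod_cast Int.units_coe_mul_self _
    have h5 : cplx α ζ = ((Equiv.Perm.sign σ : ℤ) : ℂ) *
        (((Equiv.Perm.sign σ : ℤ) : ℂ) * cplx α ζ) := by rw [← mul_assoc, h4, one_mul]
    rw [h5, h3, Finset.mul_sum]
    refine sum_ext fun κ => ?_
    simp only [coeff]
    ring
  have h6 : (m.factorial : ℂ) * cplx α ζ = ∑ σ : Equiv.Perm (Fin m), cplx α ζ := by
    simp [Fintype.card_perm]
  rw [h6, sum_ext fun σ => h2 σ, Finset.sum_comm]
  refine sum_ext fun κ => ?_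
  have hdet : cplx (coframe B κ) ζ = ∑ σ : Equiv.Perm (Fin m),
      ((Equiv.Perm.sign σ : ℤ) : ℂ) * ∏ j, (cplxMatrix B).mulVec (ζ (σ j)) (κ j) :=
    (cplx_coframe B κ ζ).trans (Matrix.det_apply' _)
  rw [← Finset.mul_sum, hdet]

/-- Expansion of a form in the coframe. -/
theorem alt_eq_sum_coframe {B : Model d →L[ℝ] (Fin d → ℂ)} (hB : (cplxMatrix B).det ≠ 0)
    (α : Alt d m ℂ) :
    α = ((m.factorial : ℂ))⁻¹ • ∑ κ : Fin m → Fin d, coeff B κ α • coframe B κ := by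
  have hm : (m.factorial : ℂ) ≠ 0 := by exact_mod_cast m.factorial_ne_zero
  have h : ∀ v, (m.factorial : ℂ) * α v =
      (∑ κ : Fin m → Fin d, coeff B κ α • coframe B κ) v := by
    intro v
    rw [alt_sum_apply, ← cplx_real α v, factorial_mul_cplx hB]
    refine sum_ext fun κ => ?_
    rw [cplx_real]
    rfl
  refine ContinuousAlternatingMap.ext fun v => ?_
  rw [ContinuousAlternatingMap.smul_apply, ← h, smul_eq_mul, inv_mul_cancel_left₀ hm]

/-- The number of indices in `H`. -/
def countIn (H : Finset (Fin d)) (κ : Fin m → Fin d) : ℕ := (Finset.univ.filter fun j => κ j ∈ H).card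

/-- The form `α` vanishes if more than `s` of its arguments are in the span of the vectors `b_i`,
`i ∈ H`, of the dual frame. -/
def Bideg (B : Model d →L[ℝ] (Fin d → ℂ)) (H : Finset (Fin d)) (s : ℤ) (α : Alt d m ℂ) : Prop :=
  ∀ κ : Fin m → Fin d, s < countIn H κ → coeff B κ α = 0

/-- The components with more than `s` indices in `H` vanish if and only if the form vanishes on more
than `s` vectors annihilated by the elements of the frame outside `H`. -/
theorem bideg_iff {B : Model d →L[ℝ] (Fin d → ℂ)} (hB : (cplxMatrix B).det ≠ 0)
    (H : Finset (Fin d)) (s : ℤ) (α : Alt d m ℂ) :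
    Bideg B H s α ↔ ∀ ζ : Fin m → Fin d → ℂ,
      s < ({j | ∀ i ∉ H, (cplxMatrix B).mulVec (ζ j) i = 0}.ncard : ℤ) → cplx α ζ = 0 := by
  constructor
  · intro h ζ hζ
    rw [cplx_expand hB]
    refine Finset.sum_eq_zero fun κ _ => ?_
    by_cases hκ : ∀ j ∈ {j | ∀ i ∉ H, (cplxMatrix B).mulVec (ζ j) i = 0}, κ j ∈ H
    · have h1 : ({j | ∀ i ∉ H, (cplxMatrix B).mulVec (ζ j) i = 0}.ncard) ≤ countIn H κ := by
        rw [countIn, ← Set.ncard_coe_finset]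
        exact Set.ncard_le_ncard (fun j hj => by simpa using hκ j hj) (Set.toFinite _)
      have h2 := h κ (hζ.trans_le (by exact_mod_cast h1))
      rw [coeff] at h2
      rw [h2, mul_zero]
    · push Not at hκ
      obtain ⟨j, hj, hjH⟩ := hκ
      rw [Finset.prod_eq_zero (Finset.mem_univ j) (hj _ hjH), zero_mul]
  · intro h κ hκ
    refine h _ (hκ.trans_le ?_)
    rw [countIn, ← Set.ncard_coe_finset]
    refine Nat.cast_le.2 (Set.ncard_le_ncard (fun j hj => ?_) (Set.toFinite _))
    intro i hi
    rw [mulVec_dualFrame hB, Pi.single_apply, if_neg]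
    rintro rfl
    simp at hj
    exact hi hj

/-- On the dual frame, the product of `α` with an elementary form sees only the complementary component
of `α`. -/
theorem altSum_sum_coframe {B : Model d →L[ℝ] (Fin d → ℂ)} (hB : (cplxMatrix B).det ≠ 0)
    (τ : Fin a ⊕ Fin b ≃ Fin d) (α : Alt d a ℂ) :
    altSum (fun u : Fin a ⊕ Fin b → Fin d → ℂ => cplx α (fun i => u (Sum.inl i)) *
      cplx (coframe B fun j => τ (Sum.inr j)) (fun j => u (Sum.inr j)))
      (fun i => dualFrame B (τ i)) =
    (a.factorial * b.factorial : ℂ) * coeff B (fun i => τ (Sum.inl i)) α := by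
  unfold altSum
  set c := coeff B (fun i => τ (Sum.inl i)) α with hc
  have hterm : ∀ σ : Equiv.Perm (Fin a ⊕ Fin b),
      cplx (coframe B fun j => τ (Sum.inr j)) (fun j => dualFrame B (τ (σ (Sum.inr j)))) =
      Matrix.det (Matrix.of fun i j : Fin b => if σ (Sum.inr i) = Sum.inr j then (1 : ℂ) else 0) := by
    intro σ
    have := coeff_coframe hB (fun i => τ (σ (Sum.inr i))) (fun j => τ (Sum.inr j))
    rw [coeff] at this
    rw [this]
    congr 1
    ext i j
    simp [τ.injective.eq_iff]
  have h1 : ∀ p : Equiv.Perm (Fin a) × Equiv.Perm (Fin b),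
      ((Equiv.Perm.sign (Equiv.Perm.sumCongrHom (Fin a) (Fin b) p) : ℤ) : ℂ) *
      (cplx α (fun i => dualFrame B (τ (Equiv.Perm.sumCongrHom (Fin a) (Fin b) p (Sum.inl i)))) *
      cplx (coframe B fun j => τ (Sum.inr j))
        (fun j => dualFrame B (τ (Equiv.Perm.sumCongrHom (Fin a) (Fin b) p (Sum.inr j))))) = c := by
    rintro ⟨σ₁, σ₂⟩
    rw [hterm]
    simp only [Equiv.Perm.sumCongrHom_apply, Equiv.Perm.sign_sumCongr, Equiv.Perm.sumCongr_apply,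
      Sum.map_inl, Sum.map_inr, Sum.inr.injEq]
    have h2 := cplx_perm α (fun i => dualFrame B (τ (Sum.inl i))) σ₁
    have h3 : Matrix.det (Matrix.of fun i j : Fin b => if σ₂ i = j then (1 : ℂ) else 0) =
        ((Equiv.Perm.sign σ₂ : ℤ) : ℂ) := by
      rw [← Matrix.det_permutation]
      congr 1
      ext i j
      simp [Equiv.toPEquiv_apply, PEquiv.toMatrix_apply]
    rw [h2, h3, hc, coeff]
    have e1 : ((Equiv.Perm.sign σ₁ : ℤ) : ℂ) * ((Equiv.Perm.sign σ₁ : ℤ) : ℂ) = 1 := by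
      exact_mod_cast Int.units_coe_mul_self _
    have e2 : ((Equiv.Perm.sign σ₂ : ℤ) : ℂ) * ((Equiv.Perm.sign σ₂ : ℤ) : ℂ) = 1 := by
      exact_mod_cast Int.units_coe_mul_self _
    push_cast
    linear_combination (cplx α (fun i => dualFrame B (τ (Sum.inl i)))) *
      (((Equiv.Perm.sign σ₂ : ℤ) : ℂ) * ((Equiv.Perm.sign σ₂ : ℤ) : ℂ) * e1 + e2)
  -- only the permutations that preserve both blocks contribute
  rw [← Finset.sum_subset (Finset.subset_univ
    (Finset.univ.map ⟨Equiv.Perm.sumCongrHom (Fin a) (Fin b), Equiv.Perm.sumCongrHom_injective⟩)),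
    Finset.sum_map]
  · simp only [Function.Embedding.coeFn_mk, h1]
    simp [Fintype.card_perm]
  · intro σ _ hσ
    have hσ' : σ ∉ (Equiv.Perm.sumCongrHom (Fin a) (Fin b)).range := fun ⟨p, hp⟩ => hσ (by
      simp only [Finset.mem_map, Finset.mem_univ, true_and, Function.Embedding.coeFn_mk]
      exact ⟨p, hp⟩)
    have h4 : ¬ MapsTo σ (range Sum.inl) (range Sum.inl) :=
      fun h => hσ' (Equiv.Perm.mem_sumCongrHom_range_of_perm_mapsTo_inl h)
    obtain ⟨i, j, hij⟩ : ∃ i j, σ (Sum.inl i) = Sum.inr j := by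
      simp only [MapsTo, mem_range, forall_exists_index, forall_apply_eq_imp_iff, not_forall,
        not_exists] at h4
      obtain ⟨i, hi⟩ := h4
      rcases h : σ (Sum.inl i) with x | x
      · exact absurd h.symm (hi x)
      · exact ⟨i, x, h⟩
    refine mul_eq_zero_of_right _ (mul_eq_zero_of_right _ ((hterm σ).trans ?_))
    rw [Matrix.det_eq_zero_of_column_eq_zero j]
    intro l
    simp only [Matrix.of_apply]
    rw [if_neg]
    rw [← hij, σ.injective.eq_iff]
    simp

/-- The wedge product with an element of the coframe singles out a coefficient. -/
theorem exists_wedgeTop_coframe (h : a + b = d) (τ : Fin a ⊕ Fin b ≃ Fin d) :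
    ∃ ε : ℂ, ε ≠ 0 ∧ ∀ (B : Model d →L[ℝ] (Fin d → ℂ)), (cplxMatrix B).det ≠ 0 →
      ∀ α : Alt d a ℂ, wedgeTop α (coframe B fun j => τ (Sum.inr j)) =
        ε * (cplxMatrix B).det * coeff B (fun i => τ (Sum.inl i)) α := by
  let ρ : Equiv.Perm (Fin d) := (finCongr h).symm.trans (finSumFinEquiv.symm.trans τ)
  refine ⟨((Equiv.Perm.sign ρ : ℤ) : ℂ), by simp, fun B hB α => ?_⟩
  have h1 := wedgeC_eq_det h α (coframe B fun j => τ (Sum.inr j))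
    (Matrix.of fun i => dualFrame B (ρ i))
  have h2 : Matrix.det (Matrix.of fun i => dualFrame B (ρ i)) =
      ((Equiv.Perm.sign ρ : ℤ) : ℂ) * ((cplxMatrix B).det)⁻¹ := by
    have : (Matrix.of fun i => dualFrame B (ρ i)) = ((cplxMatrix B)⁻¹.transpose).submatrix ρ id := by
      ext i j; rfl
    rw [this, Matrix.det_permute, Matrix.det_transpose, Matrix.det_nonsing_inv,
      Ring.inverse_eq_inv']
  have h3 : (fun i => (Matrix.of fun i => dualFrame B (ρ i)) (Fin.cast h i)) =
      fun i => dualFrame B (τ (finSumFinEquiv.symm i)) := by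
    ext i j
    simp [ρ]
  rw [h3, h2, wedgeC_apply, altSum_congr finSumFinEquiv] at h1
  simp only [Equiv.symm_apply_apply, finSumFinEquiv_symm_apply_castAdd,
    finSumFinEquiv_symm_apply_natAdd] at h1
  rw [altSum_sum_coframe hB] at h1
  have ha : (a.factorial : ℂ) ≠ 0 := by exact_mod_cast a.factorial_ne_zero
  have hb : (b.factorial : ℂ) ≠ 0 := by exact_mod_cast b.factorial_ne_zero
  have e1 : ((Equiv.Perm.sign ρ : ℤ) : ℂ) * ((Equiv.Perm.sign ρ : ℤ) : ℂ) = 1 := by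
    exact_mod_cast Int.units_coe_mul_self _
  have h4 : coeff B (fun i => τ (Sum.inl i)) α = ((Equiv.Perm.sign ρ : ℤ) : ℂ) *
      ((cplxMatrix B).det)⁻¹ * wedgeTop α (coframe B fun j => τ (Sum.inr j)) := by
    rw [← h1]
    field_simp
  rw [h4]
  field_simp
  linear_combination (-wedgeTop α (coframe B fun j => τ (Sum.inr j))) * e1

/-- Every injective family of indices can be completed. -/
theorem exists_sum_equiv (h : a + b = d) (κ : Fin a → Fin d) (hκ : Function.Injective κ) :
    ∃ τ : Fin a ⊕ Fin b ≃ Fin d, ∀ i, τ (Sum.inl i) = κ i := by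
  classical
  have hc : Fintype.card (Fin b) = Fintype.card ((Set.range κ)ᶜ : Set (Fin d)) := by
    rw [Fintype.card_compl_set, Set.card_range_of_injective hκ]
    simp
    omega
  let e : Fin b ≃ ((Set.range κ)ᶜ : Set (Fin d)) := Fintype.equivOfCardEq hc
  exact ⟨((Equiv.ofInjective κ hκ).sumCongr e).trans (Equiv.Set.sumCompl (Set.range κ)),
    fun i => by simp⟩

theorem countIn_add (H : Finset (Fin d)) (τ : Fin a ⊕ Fin b ≃ Fin d) :
    countIn H (fun i => τ (Sum.inl i)) + countIn H (fun j => τ (Sum.inr j)) = H.card := by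
  classical
  simp only [countIn, Finset.card_filter]
  rw [← Fintype.sum_sum_type (f := fun i => if τ i ∈ H then 1 else 0),
    Equiv.sum_comp τ (fun i => if i ∈ H then 1 else 0)]
  simp

theorem coeff_eq_zero_of_not_injective (B : Model d →L[ℝ] (Fin d → ℂ)) {κ : Fin m → Fin d}
    (h : ¬ Function.Injective κ) (α : Alt d m ℂ) : coeff B κ α = 0 := by
  simp only [Function.Injective, not_forall] at h
  obtain ⟨i, j, hij, hne⟩ := h
  exact cplx_eq_zero_of_not_injective α _ (i := i) (j := j) (by simp [hij]) hne

theorem bideg_coframe {B : Model d →L[ℝ] (Fin d → ℂ)} (hB : (cplxMatrix B).det ≠ 0)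
    {H : Finset (Fin d)} {s : ℤ} {κ : Fin m → Fin d} (h : countIn H κ ≤ s) :
    Bideg B H s (coframe B κ) := by
  intro μ hμ
  by_cases hinj : Function.Injective μ
  swap
  · exact coeff_eq_zero_of_not_injective B hinj _
  rw [coeff_coframe hB]
  -- some index of `μ` does not occur in `κ`
  obtain ⟨i, hi⟩ : ∃ i, ∀ j, μ i ≠ κ j := by
    by_contra hcon
    push Not at hcon
    choose f hf using hcon
    have hfi : Function.Injective f := fun i j hij => hinj (by rw [hf i, hf j, hij])
    have : countIn H μ ≤ countIn H κ := by
      unfold countIn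
      refine Finset.card_le_card_of_injOn f (fun i hi => ?_) hfi.injOn
      simpa [hf i] using hi
    have : (countIn H μ : ℤ) ≤ countIn H κ := by exact_mod_cast this
    omega
  exact Matrix.det_eq_zero_of_row_eq_zero i fun j => if_neg (hi j)

theorem Bideg.add {B : Model d →L[ℝ] (Fin d → ℂ)} {H : Finset (Fin d)} {s : ℤ} {α β : Alt d m ℂ}
    (hα : Bideg B H s α) (hβ : Bideg B H s β) : Bideg B H s (α + β) := fun κ hκ => by
  rw [coeff_add, hα κ hκ, hβ κ hκ, add_zero]

theorem Bideg.smul {B : Model d →L[ℝ] (Fin d → ℂ)} {H : Finset (Fin d)} {s : ℤ} {α : Alt d m ℂ}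
    (z : ℂ) (hα : Bideg B H s α) : Bideg B H s (z • α) := fun κ hκ => by
  rw [coeff_smul, hα κ hκ, mul_zero]

theorem Bideg.zero {B : Model d →L[ℝ] (Fin d → ℂ)} {H : Finset (Fin d)} {s : ℤ} :
    Bideg B H s (0 : Alt d m ℂ) := fun κ _ => by
  simpa using coeff_smul B κ 0 (0 : Alt d m ℂ)

theorem Bideg.sum {ι : Type*} {B : Model d →L[ℝ] (Fin d → ℂ)} {H : Finset (Fin d)} {s : ℤ}
    {t : Finset ι} {f : ι → Alt d m ℂ} (h : ∀ i ∈ t, Bideg B H s (f i)) :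
    Bideg B H s (∑ i ∈ t, f i) := by
  classical
  induction t using Finset.induction_on with
  | empty => simpa using Bideg.zero
  | insert i t hi ih =>
    rw [Finset.sum_insert hi]
    exact (h i (by simp)).add (ih fun j hj => h j (by simp [hj]))

/-- Forms of complementary degrees which both vanish on too few vectors of `H` are
orthogonal. -/
theorem wedgeTop_eq_zero_of_bideg {B : Model d →L[ℝ] (Fin d → ℂ)} (hB : (cplxMatrix B).det ≠ 0)
    {H : Finset (Fin d)} {s t : ℤ} {α : Alt d a ℂ} {β : Alt d b ℂ} (hα : Bideg B H s α)
    (hβ : Bideg B H t β) (hst : s + t < H.card) : wedgeTop α β = 0 := by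
  by_cases h : a + b = d
  swap
  · rw [wedgeTop, dif_neg h]
  rw [alt_eq_sum_coframe hB β, ← mul_zero ((-1 : ℂ) ^ (a * b)), wedgeTop_comm]
  congr 1
  rw [wedgeTop_smul]
  refine mul_eq_zero_of_right _ ?_
  have hsum : ∀ t : Finset (Fin b → Fin d), (∀ κ ∈ t, wedgeTop (coeff B κ β • coframe B κ) α = 0) →
      wedgeTop (∑ κ ∈ t, coeff B κ β • coframe B κ) α = 0 := by
    intro t ht
    classical
    induction t using Finset.induction_on with
    | empty => simpa using wedgeTop_zero_left α
    | insert i t hi ih =>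
      rw [Finset.sum_insert hi, wedgeTop_add, ht i (by simp),
        ih fun j hj => ht j (by simp [hj]), add_zero]
  refine hsum _ fun κ _ => ?_
  rw [wedgeTop_smul]
  by_cases hinj : Function.Injective κ
  swap
  · rw [coeff_eq_zero_of_not_injective B hinj, zero_mul]
  by_cases hκ : t < countIn H κ
  · rw [hβ κ hκ, zero_mul]
  obtain ⟨τ, hτ⟩ := exists_sum_equiv (a := b) (b := a) (by omega) κ hinj
  let τ' : Fin a ⊕ Fin b ≃ Fin d := (Equiv.sumComm _ _).trans τ
  have hτ' : κ = fun j => τ' (Sum.inr j) := by ext1 j; simp [τ', hτ]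
  obtain ⟨ε, -, hε⟩ := exists_wedgeTop_coframe h τ'
  rw [wedgeTop_comm, hτ', hε B hB]
  have h1 := countIn_add H τ'
  rw [← hτ'] at h1
  rw [hα _ (by omega)]
  simp

end Coframe

/-! ### The dual of `L^p` of a finite measure -/

section Riesz

open scoped symmDiff

variable {α : Type*} [MeasurableSpace α] {μ : Measure α} [IsFiniteMeasure μ] {p : ℝ≥0∞}
  [Fact (1 ≤ p)]

theorem sum_indicatorConstLp (L : Lp ℂ p μ →L[ℝ] ℝ) {f : ℕ → Set α}
    (hf : ∀ i, MeasurableSet (f i)) (hd : Pairwise (Function.onFun Disjoint f)) (t : Finset ℕ) :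
    ∑ i ∈ t, L (indicatorConstLp p (hf i) (measure_ne_top μ _) (1 : ℂ)) =
      L (indicatorConstLp p (t.measurableSet_biUnion fun i _ => hf i)
        (measure_ne_top μ (⋃ i ∈ t, f i)) (1 : ℂ)) := by
  classical
  induction t using Finset.induction_on with
  | empty => simp
  | insert i t hi ih =>
    have hdis : Disjoint (f i) (⋃ j ∈ t, f j) := by
      simp only [disjoint_iUnion_right]
      exact fun j hj => hd fun h => hi (h ▸ hj)
    rw [Finset.sum_insert hi, ih, ← map_add, ← indicatorConstLp_disjoint_union _ _ _ _ hdis]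
    congr 2
    simp

/-- The signed measure `s ↦ L(1_s)`. -/
def setFunctional (hp : p ≠ ⊤) (L : Lp ℂ p μ →L[ℝ] ℝ) : SignedMeasure α := by
  classical
  exact
  { measureOf' := fun s => if hs : MeasurableSet s then
      L (indicatorConstLp p hs (measure_ne_top μ s) (1 : ℂ)) else 0
    empty' := by simp
    not_measurable' := fun s hs => by simp [hs]
    m_iUnion' := by
      intro f hf hd
      have h1 : ∀ i, (if hs : MeasurableSet (f i) then
          L (indicatorConstLp p hs (measure_ne_top μ (f i)) (1 : ℂ)) else 0) =
          L (indicatorConstLp p (hf i) (measure_ne_top μ (f i)) (1 : ℂ)) := fun i => dif_pos (hf i)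
      simp only [h1]
      rw [dif_pos (MeasurableSet.iUnion hf), HasSum, SummationFilter.unconditional_filter]
      simp only [sum_indicatorConstLp L hf hd]
      refine (L.continuous.tendsto _).comp (tendsto_indicatorConstLp_set hp ?_)
      have hfin : ∑' i, μ (f i) ≠ ⊤ := by
        rw [← measure_iUnion hd hf]
        exact measure_ne_top μ _
      refine tendsto_of_tendsto_of_tendsto_of_le_of_le tendsto_const_nhds
        (ENNReal.tendsto_tsum_compl_atTop_zero hfin) (fun t => zero_le) fun t => ?_
      refine (measure_mono ?_).trans (measure_iUnion_le fun i : {x // x ∉ t} => f i)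
      rintro x (⟨hx, hx'⟩ | ⟨hx, hx'⟩)
      · simp only [mem_iUnion] at hx hx'
        obtain ⟨i, -, hi⟩ := hx
        exact absurd ⟨i, hi⟩ hx'
      · simp only [mem_iUnion] at hx hx' ⊢
        obtain ⟨i, hi⟩ := hx
        exact ⟨⟨i, fun h => hx' ⟨i, h, hi⟩⟩, hi⟩ }

/-- The Radon-Nikodym theorem for a real functional on `L^p`, tested on indicator functions. -/
theorem exists_real_density (hp : p ≠ ⊤) (L : Lp ℂ p μ →L[ℝ] ℝ) :
    ∃ g : α → ℝ, Integrable g μ ∧ ∀ s (hs : MeasurableSet s),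
      L (indicatorConstLp p hs (measure_ne_top μ s) (1 : ℂ)) = ∫ x in s, g x ∂μ := by
  have hp0 : p ≠ 0 := (zero_lt_one.trans_le (Fact.out : 1 ≤ p)).ne'
  have hval : ∀ s (hs : MeasurableSet s), setFunctional hp L s =
      L (indicatorConstLp p hs (measure_ne_top μ s) (1 : ℂ)) := fun s hs => dif_pos hs
  have hac : setFunctional hp L ≪ᵥ μ.toENNRealVectorMeasure := by
    refine VectorMeasure.AbsolutelyContinuous.mk fun s hs h => ?_
    rw [Measure.toENNRealVectorMeasure_apply_measurable hs] at h
    rw [hval s hs]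
    have : indicatorConstLp p hs (measure_ne_top μ s) (1 : ℂ) = 0 := by
      rw [← norm_eq_zero, norm_indicatorConstLp hp0 hp, Measure.real, h]
      have : p.toReal ≠ 0 := (ENNReal.toReal_pos hp0 hp).ne'
      simp [this]
    rw [this, map_zero]
  refine ⟨(setFunctional hp L).rnDeriv μ, SignedMeasure.integrable_rnDeriv _ _, fun s hs => ?_⟩
  rw [← hval s hs]
  conv_lhs => rw [← SignedMeasure.withDensityᵥ_rnDeriv_eq _ _ hac]
  rw [withDensityᵥ_apply (SignedMeasure.integrable_rnDeriv _ _) hs]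

theorem exists_complex_density (hp : p ≠ ⊤) (l : Lp ℂ p μ →L[ℂ] ℂ) :
    ∃ g : α → ℂ, Integrable g μ ∧ ∀ s (hs : MeasurableSet s),
      l (indicatorConstLp p hs (measure_ne_top μ s) (1 : ℂ)) = ∫ x in s, g x ∂μ := by
  obtain ⟨g, hg, hgs⟩ := exists_real_density hp (Complex.reCLM.comp (l.restrictScalars ℝ))
  obtain ⟨h, hh, hhs⟩ := exists_real_density hp (Complex.imCLM.comp (l.restrictScalars ℝ))
  refine ⟨fun x => (g x : ℂ) + (h x : ℂ) * Complex.I,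
    hg.ofReal.add (hh.ofReal.mul_const _), fun s hs => ?_⟩
  have h1 := hgs s hs
  have h2 := hhs s hs
  have h3 : Integrable (fun x => (g x : ℂ)) (μ.restrict s) := hg.ofReal.integrableOn
  have h4 : Integrable (fun x => (h x : ℂ) * Complex.I) (μ.restrict s) :=
    (hh.ofReal.mul_const _).integrableOn
  rw [integral_add h3 h4, integral_mul_const, integral_complex_ofReal, integral_complex_ofReal, ← h1, ← h2]
  exact (Complex.re_add_im _).symm

/-- Two continuous linear functionals on `L^p` that agree on indicator functions are equal. -/
theorem Lp_functional_ext (hp : p ≠ ⊤) {l l' : Lp ℂ p μ →L[ℂ] ℂ}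
    (h : ∀ s (hs : MeasurableSet s), l (indicatorConstLp p hs (measure_ne_top μ s) (1 : ℂ)) =
      l' (indicatorConstLp p hs (measure_ne_top μ s) (1 : ℂ))) : l = l' := by
  ext f
  induction f using Lp.induction hp with
  | @indicatorConst c s hs hμs =>
    rw [Lp.simpleFunc.coe_indicatorConst]
    have : indicatorConstLp p hs hμs.ne c = c • indicatorConstLp p hs hμs.ne (1 : ℂ) := by
      rw [indicatorConstLp, indicatorConstLp, ← MemLp.toLp_const_smul]
      congr 1
      ext x
      by_cases hx : x ∈ s <;> simp [hx]
    rw [this, map_smul, map_smul, h]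
  | add hf hg _ ihf ihg => rw [map_add, map_add, ihf, ihg]
  | isClosed => exact isClosed_eq l.continuous l'.continuous

/-- The functional `f ↦ ∫ f g` on `L^p`. -/
def integralFunctional {p' : ℝ≥0∞} [Fact (1 ≤ p')] (hpp' : p⁻¹ + p'⁻¹ = 1) {g : α → ℂ}
    (hg : MemLp g p' μ) : Lp ℂ p μ →L[ℂ] ℂ :=
  haveI : ENNReal.HolderConjugate p p' := ⟨by simpa using hpp'⟩
  ((ContinuousLinearMap.mul ℂ ℂ).lpPairing μ p p').flip (hg.toLp g)

theorem integralFunctional_apply {p' : ℝ≥0∞} [Fact (1 ≤ p')] (hpp' : p⁻¹ + p'⁻¹ = 1) {g : α → ℂ}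
    (hg : MemLp g p' μ) (f : Lp ℂ p μ) : integralFunctional hpp' hg f = ∫ x, f x * g x ∂μ := by
  have : ENNReal.HolderConjugate p p' := ⟨by simpa using hpp'⟩
  rw [integralFunctional, ContinuousLinearMap.flip_apply, ContinuousLinearMap.lpPairing_eq_integral]
  refine integral_congr_ae ?_
  filter_upwards [hg.coeFn_toLp] with x hx
  rw [hx]
  rfl

theorem integralFunctional_toLp {p' : ℝ≥0∞} [Fact (1 ≤ p')] (hpp' : p⁻¹ + p'⁻¹ = 1) {g : α → ℂ}
    (hg : MemLp g p' μ) {f : α → ℂ} (hf : MemLp f p μ) :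
    integralFunctional hpp' hg (hf.toLp f) = ∫ x, f x * g x ∂μ := by
  rw [integralFunctional_apply]
  refine integral_congr_ae ?_
  filter_upwards [hf.coeFn_toLp] with x hx
  rw [hx]

theorem integralFunctional_indicator {p' : ℝ≥0∞} [Fact (1 ≤ p')] (hpp' : p⁻¹ + p'⁻¹ = 1) {g : α → ℂ}
    (hg : MemLp g p' μ) {s : Set α} (hs : MeasurableSet s) :
    integralFunctional hpp' hg (indicatorConstLp p hs (measure_ne_top μ s) (1 : ℂ)) =
      ∫ x in s, g x ∂μ := by
  rw [indicatorConstLp, integralFunctional_toLp, ← integral_indicator hs]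
  congr 1
  ext x
  by_cases hx : x ∈ s <;> simp [hx]

/-- If `f ↦ ∫ f g` is bounded on `L^p` by `C` and `g` is bounded, then `‖g‖_{p'} ≤ C`. -/
theorem eLpNorm_le_of_functional {p' : ℝ≥0∞} [Fact (1 ≤ p')] (hp : p ≠ ⊤) (hp' : p' ≠ ⊤)
    (hpp' : p⁻¹ + p'⁻¹ = 1) {g : α → ℂ} (hg : MemLp g ⊤ μ) {C : ℝ}
    (hC : ∀ f : α → ℂ, ∀ hf : MemLp f p μ, ‖∫ x, f x * g x ∂μ‖ ≤ C * ‖hf.toLp f‖) :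
    eLpNorm g p' μ ≤ ENNReal.ofReal C := by
  have hp0 : p ≠ 0 := (zero_lt_one.trans_le (Fact.out : 1 ≤ p)).ne'
  have hp0' : p' ≠ 0 := (zero_lt_one.trans_le (Fact.out : 1 ≤ p')).ne'
  have hP : 0 < p.toReal := ENNReal.toReal_pos hp0 hp
  have hP' : 0 < p'.toReal := ENNReal.toReal_pos hp0' hp'
  have hr : p.toReal⁻¹ + p'.toReal⁻¹ = 1 := by
    have := congrArg ENNReal.toReal hpp'
    rwa [ENNReal.toReal_add (by simpa) (by simpa), ENNReal.toReal_inv, ENNReal.toReal_inv,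
      ENNReal.toReal_one] at this
  have hr' : (p'.toReal - 1) * p.toReal = p'.toReal := by
    field_simp at hr
    linarith
  have hP1 : p'.toReal - 1 ≠ 0 := fun h => by rw [h, zero_mul] at hr'; exact hP'.ne hr'
  have hg' : MemLp g p' μ := hg.mono_exponent le_top
  -- the extremal function of Hölder's inequality
  set f : α → ℂ := fun x => ((‖g x‖ ^ (p'.toReal - 2) : ℝ) : ℂ) * (starRingEnd ℂ) (g x) with hf
  have hfn : ∀ x, ‖f x‖ = ‖g x‖ ^ (p'.toReal - 1) := by
    intro x
    rw [hf]
    simp only [norm_mul, Complex.norm_real, RCLike.norm_conj, Real.norm_eq_abs]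
    rw [abs_of_nonneg (by positivity)]
    rcases eq_or_ne (g x) 0 with h | h
    · simp [h, Real.zero_rpow hP1]
    · have h' : 0 < ‖g x‖ := norm_pos_iff.2 h
      nth_rewrite 2 [← Real.rpow_one ‖g x‖]
      rw [← Real.rpow_add h']
      congr 1
      ring
  have hfp : ∀ x, ‖f x‖ ^ p.toReal = ‖g x‖ ^ p'.toReal := by
    intro x
    rw [hfn, ← Real.rpow_mul (norm_nonneg _), hr']
  have hfg : ∀ x, f x * g x = ((‖g x‖ ^ p'.toReal : ℝ) : ℂ) := by
    intro x
    rw [hf]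
    simp only
    rw [mul_assoc, ← Complex.normSq_eq_conj_mul_self, Complex.normSq_eq_norm_sq,
      ← Complex.ofReal_mul]
    congr 1
    rcases eq_or_ne (g x) 0 with h | h
    · simp [h, Real.zero_rpow hP'.ne']
    · rw [← Real.rpow_natCast, ← Real.rpow_add (norm_pos_iff.2 h)]
      congr 1
      push_cast
      ring
  have hfm : AEStronglyMeasurable f μ := by
    refine AEStronglyMeasurable.mul ?_ (Complex.continuous_conj.comp_aestronglyMeasurable hg.1)
    exact Complex.continuous_ofReal.comp_aestronglyMeasurable
      (hg.1.norm.aemeasurable.pow_const _).aestronglyMeasurable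
  have hfL : MemLp f p μ := by
    rw [← integrable_norm_rpow_iff hfm hp0 hp]
    simp only [hfp]
    exact (integrable_norm_rpow_iff hg'.1 hp0' hp').2 hg'
  have h1 := hC f hfL
  set N : ℝ := ∫ x, ‖g x‖ ^ p'.toReal ∂μ with hN
  have hN0 : 0 ≤ N := integral_nonneg fun x => by positivity
  rw [Lp.norm_toLp, hfL.eLpNorm_eq_integral_rpow_norm hp0 hp] at h1
  simp only [hfp, hfg] at h1
  rw [integral_complex_ofReal, ← hN, Complex.norm_real, Real.norm_of_nonneg hN0,
    ENNReal.toReal_ofReal (by positivity)] at h1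
  rw [hg'.eLpNorm_eq_integral_rpow_norm hp0' hp', ← hN]
  rcases hN0.eq_or_lt with h0 | h0
  · rw [← h0, Real.zero_rpow (inv_pos.2 hP').ne']
    simp
  · refine ENNReal.ofReal_le_ofReal ?_
    have h2 : N = N ^ p'.toReal⁻¹ * N ^ p.toReal⁻¹ := by
      rw [← Real.rpow_add h0, add_comm, hr, Real.rpow_one]
    have h3 : 0 < N ^ p.toReal⁻¹ := Real.rpow_pos_of_pos h0 _
    nth_rewrite 1 [h2] at h1
    exact le_of_mul_le_mul_right h1 h3

/-- Every continuous linear functional on `L^p`, `1 < p < ∞`, of a finite measure is given by a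
function in `L^{p'}`. -/
theorem exists_memLp_eq_integral {p' : ℝ≥0∞} [Fact (1 ≤ p')] (hp : p ≠ ⊤) (hp' : p' ≠ ⊤)
    (hpp' : p⁻¹ + p'⁻¹ = 1) (l : Lp ℂ p μ →L[ℂ] ℂ) :
    ∃ g : α → ℂ, MemLp g p' μ ∧ ∀ (f : α → ℂ) (hf : MemLp f p μ),
      l (hf.toLp f) = ∫ x, f x * g x ∂μ := by
  have hc : ENNReal.HolderConjugate p p' := ⟨by simpa using hpp'⟩
  obtain ⟨g₀, hg₀, hs₀⟩ := exists_complex_density hp l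
  obtain ⟨g, hgm, hgg⟩ := hg₀.1
  have hg : Integrable g μ := hg₀.congr hgg
  have hs : ∀ s (hs : MeasurableSet s),
      l (indicatorConstLp p hs (measure_ne_top μ s) (1 : ℂ)) = ∫ x in s, g x ∂μ := fun s h => by
    rw [hs₀ s h]
    exact integral_congr_ae (ae_restrict_of_ae hgg)
  -- truncations of the density
  let E : ℕ → Set α := fun n => {x | ‖g x‖ ≤ n}
  have hE : ∀ n, MeasurableSet (E n) := fun n =>
    measurableSet_le hgm.norm.measurable measurable_const
  have hgE : ∀ n, MemLp ((E n).indicator g) ⊤ μ := fun n => by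
    refine memLp_top_of_bound (hgm.indicator (hE n)).aestronglyMeasurable n (ae_of_all _ fun x => ?_)
    by_cases hx : x ∈ E n
    · rw [indicator_of_mem hx]; exact hx
    · rw [indicator_of_notMem hx]; simp
  have hone : ∀ n, MemLp ((E n).indicator fun _ => (1 : ℂ)) ⊤ μ := fun n =>
    (memLp_const 1).indicator (hE n)
  have hn : ∀ n, eLpNorm ((E n).indicator g) p' μ ≤ ENNReal.ofReal ‖l‖ := by
    intro n
    refine eLpNorm_le_of_functional hp hp' hpp' (hgE n) fun f hf => ?_
    have hgE' : MemLp ((E n).indicator g) p' μ := (hgE n).mono_exponent le_top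
    -- the functional `f ↦ l(1_E f)`
    let M : Lp ℂ p μ →L[ℂ] Lp ℂ p μ :=
      ((ContinuousLinearMap.mul ℂ ℂ).holderL μ ⊤ p p) ((hone n).toLp _)
    have hM : ∀ (f : α → ℂ) (hf : MemLp f p μ),
        M (hf.toLp f) = (hf.indicator (hE n)).toLp _ := by
      intro f hf
      ext1
      refine (ContinuousLinearMap.coeFn_holder _ _ _).trans ?_
      filter_upwards [hf.coeFn_toLp, (hf.indicator (hE n)).coeFn_toLp, (hone n).coeFn_toLp]
        with x h1 h2 h3
      rw [h1, h2, h3]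
      by_cases hx : x ∈ E n <;> simp [hx]
    have key : l.comp M = integralFunctional hpp' hgE' := by
      refine Lp_functional_ext hp fun s hsm => ?_
      rw [integralFunctional_indicator, ContinuousLinearMap.comp_apply, indicatorConstLp, hM,
        setIntegral_indicator (hE n), ← hs _ (hsm.inter (hE n)), indicatorConstLp]
      congr 2
      ext x
      by_cases hx : x ∈ s <;> by_cases hx' : x ∈ E n <;> simp [hx, hx']
    rw [← integralFunctional_toLp hpp' hgE' hf, ← key, ContinuousLinearMap.comp_apply, hM]
    refine (l.le_opNorm _).trans (mul_le_mul_of_nonneg_left ?_ (norm_nonneg _))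
    rw [Lp.norm_toLp, Lp.norm_toLp]
    exact ENNReal.toReal_mono hf.eLpNorm_ne_top (eLpNorm_indicator_le f)
  have hgL : MemLp g p' μ := by
    refine ⟨hgm.aestronglyMeasurable, lt_of_le_of_lt ?_ (ENNReal.ofReal_lt_top (r := ‖l‖))⟩
    refine (Lp.eLpNorm_lim_le_liminf_eLpNorm (f := fun n => (E n).indicator g)
      (fun n => (hgE n).1) g (ae_of_all _ fun x => ?_)).trans ?_
    · refine tendsto_const_nhds.congr' ?_
      obtain ⟨m, hm⟩ := exists_nat_ge ‖g x‖
      filter_upwards [eventually_ge_atTop m] with n hn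
      rw [indicator_of_mem]
      exact hm.trans (by exact_mod_cast hn)
    · exact liminf_le_of_le (by isBoundedDefault) fun b hb => by
        obtain ⟨n, hbn⟩ := hb.exists
        exact hbn.trans (hn n)
  refine ⟨g, hgL, fun f hf => ?_⟩
  rw [← integralFunctional_toLp hpp' hgL hf]
  congr 1
  refine Lp_functional_ext hp fun s hsm => ?_
  rw [integralFunctional_indicator, hs]

end Riesz

/-! ### Friedrichs' lemma for weak solutions of first order systems -/

section Friedrichs

variable {d : ℕ} {p p' : ℝ≥0∞} [Fact (1 ≤ p)] [Fact (1 ≤ p')]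

theorem tendsto_eLpNorm_translate (hp : p ≠ ⊤) {f : Model d → ℂ} (hf : MemLp f p volume)
    (z : Model d) :
    Tendsto (fun ε : ℝ => eLpNorm (fun y => f (y + ε • z) - f y) p volume) (𝓝 0) (𝓝 0) := by
  let T : ℝ → C(Model d, Model d) := fun ε => ⟨fun y => y + ε • z, by fun_prop⟩
  have hT : Continuous T :=
    (ContinuousMap.curry ⟨fun q : ℝ × Model d => q.2 + q.1 • z, by fun_prop⟩).continuous
  have hmp : ∀ ε, MeasurePreserving (T ε) volume volume := fun ε =>
    measurePreserving_add_right volume (ε • z)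
  have h := Tendsto.compMeasurePreservingLp (p := p) (E := ℂ)
    (tendsto_const_nhds (x := hf.toLp f) (f := 𝓝 (0 : ℝ)))
    (hT.tendsto 0) hmp (hmp 0) hp
  rw [tendsto_iff_edist_tendsto_0] at h
  refine h.congr fun ε => ?_
  rw [Lp.edist_def]
  refine eLpNorm_congr_ae ?_
  have h1 := Lp.coeFn_compMeasurePreserving (hf.toLp f) (hmp ε)
  have h2 := Lp.coeFn_compMeasurePreserving (hf.toLp f) (hmp 0)
  filter_upwards [h1, h2, (hmp ε).quasiMeasurePreserving.ae_eq_comp hf.coeFn_toLp,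
    (hmp 0).quasiMeasurePreserving.ae_eq_comp hf.coeFn_toLp] with y h1 h2 h3 h4
  simp only [Pi.sub_apply]
  rw [h1, h2, h3, h4]
  simp [T]

theorem enorm_integral_mul_le (hpp' : p⁻¹ + p'⁻¹ = 1) {f k m : Model d → ℂ}
    (hf : AEStronglyMeasurable f volume) (hk : AEStronglyMeasurable k volume) {C : ℝ}
    (hm : ∀ y, ‖m y‖ ≤ C) :
    ∫⁻ y, ‖f y * k y * m y‖ₑ ≤ ENNReal.ofReal C * (eLpNorm f p' volume * eLpNorm k p volume) := by
  have : ENNReal.HolderConjugate p' p := ⟨by rw [add_comm]; simpa using hpp'⟩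
  have h1 := eLpNorm_smul_le_mul_eLpNorm (p := p') (q := p) (r := 1) hk hf
  rw [eLpNorm_one_eq_lintegral_enorm] at h1
  refine le_trans ?_ (mul_le_mul_right h1 (ENNReal.ofReal C))
  rw [← lintegral_const_mul'' _ (hf.smul hk).enorm]
  refine lintegral_mono fun y => ?_
  rw [enorm_mul, mul_comm]
  refine mul_le_mul_left ?_ _
  rw [← ofReal_norm]
  exact ENNReal.ofReal_le_ofReal (hm y)

theorem integrable_mul_mul (hpp' : p⁻¹ + p'⁻¹ = 1) {f k m : Model d → ℂ}
    (hf : MemLp f p' volume) (hk : MemLp k p volume) {C : ℝ}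
    (hm : ∀ y, ‖m y‖ ≤ C) (hmm : AEStronglyMeasurable m volume) :
    Integrable (fun y => f y * k y * m y) := by
  refine ⟨(hf.1.mul hk.1).mul hmm, ?_⟩
  refine (enorm_integral_mul_le hpp' hf.1 hk.1 hm).trans_lt ?_
  exact ENNReal.mul_lt_top ENNReal.ofReal_lt_top (ENNReal.mul_lt_top hf.2 hk.2)

theorem tendsto_integral_translate (hp' : p' ≠ ⊤) (hpp' : p⁻¹ + p'⁻¹ = 1) {f k : Model d → ℂ}
    (hf : MemLp f p' volume) (hk : MemLp k p volume) (z : Model d) {m : ℝ → Model d → ℂ}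
    {m₀ : Model d → ℂ} {C : ℝ} (hm : ∀ ε y, ‖m ε y‖ ≤ C)
    (hmm : ∀ ε, AEStronglyMeasurable (m ε) volume)
    (hlim : ∀ y, Tendsto (fun ε => m ε y) (𝓝[>] 0) (𝓝 (m₀ y))) :
    Tendsto (fun ε : ℝ => ∫ y, f (y + ε • z) * k y * m ε y) (𝓝[>] 0)
      (𝓝 (∫ y, f y * k y * m₀ y)) := by
  have hfz : ∀ ε : ℝ, MemLp (fun y => f (y + ε • z)) p' volume := fun ε =>
    hf.comp_measurePreserving (measurePreserving_add_right volume (ε • z))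
  have h1 : Tendsto (fun ε : ℝ => ∫ y, f y * k y * m ε y) (𝓝[>] 0)
      (𝓝 (∫ y, f y * k y * m₀ y)) := by
    refine tendsto_integral_filter_of_dominated_convergence (fun y => ‖f y * k y * (C : ℂ)‖)
      (.of_forall fun ε => (hf.1.mul hk.1).mul (hmm ε))
      (.of_forall fun ε => ae_of_all _ fun y => ?_) ?_
      (ae_of_all _ fun y => (hlim y).const_mul _)
    · rw [norm_mul, norm_mul (f y * k y)]
      refine mul_le_mul_of_nonneg_left ((hm ε y).trans ?_) (norm_nonneg _)
      rw [Complex.norm_real]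
      exact le_abs_self C
    · exact (integrable_mul_mul hpp' hf hk (C := ‖(C : ℂ)‖) (fun _ => le_rfl)
        aestronglyMeasurable_const).norm
  have h2 : Tendsto (fun ε : ℝ => ∫ y, (f (y + ε • z) - f y) * k y * m ε y) (𝓝[>] 0) (𝓝 0) := by
    have h3 : Tendsto (fun ε : ℝ => ENNReal.ofReal C *
        (eLpNorm (fun y => f (y + ε • z) - f y) p' volume * eLpNorm k p volume)) (𝓝[>] 0) (𝓝 0) := by
      have h4 := ENNReal.Tendsto.const_mul (a := ENNReal.ofReal C) (ENNReal.Tendsto.mul_const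
        (b := eLpNorm k p volume) (tendsto_eLpNorm_translate hp' hf z) (Or.inr hk.2.ne))
        (Or.inr ENNReal.ofReal_ne_top)
      simp only [zero_mul, mul_zero] at h4
      exact h4.mono_left nhdsWithin_le_nhds
    rw [tendsto_zero_iff_norm_tendsto_zero, ← ENNReal.toReal_zero]
    refine squeeze_zero' (.of_forall fun ε => norm_nonneg _)
      (.of_forall fun ε => ?_) (by
        simpa using (ENNReal.tendsto_toReal ENNReal.zero_ne_top).comp h3)
    refine (norm_integral_le_lintegral_norm _).trans ?_
    refine ENNReal.toReal_mono ?_ ?_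
    · exact (ENNReal.mul_lt_top ENNReal.ofReal_lt_top
        (ENNReal.mul_lt_top ((hfz ε).sub hf).2 hk.2)).ne
    · simp only [ofReal_norm]
      exact enorm_integral_mul_le hpp' ((hfz ε).sub hf).1 hk.1 (hm ε)
  have h5 := h2.add h1
  rw [zero_add] at h5
  refine h5.congr fun ε => ?_
  rw [← integral_add]
  · congr 1
    ext y
    ring
  · exact integrable_mul_mul hpp' ((hfz ε).sub hf) hk (hm ε) (hmm ε)
  · exact integrable_mul_mul hpp' hf hk (hm ε) (hmm ε)

theorem tendsto_integral_integral_translate (hp' : p' ≠ ⊤) (hpp' : p⁻¹ + p'⁻¹ = 1)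
    {f k : Model d → ℂ} (hfm : Measurable f) (hkm : Measurable k)
    (hf : MemLp f p' volume) (hk : MemLp k p volume) {m : ℝ → Model d → Model d → ℂ}
    {m₀ : Model d → Model d → ℂ} {C : ℝ} (hm : ∀ ε y z, ‖m ε y z‖ ≤ C)
    (hms : ∀ ε y z, 1 < ‖z‖ → m ε y z = 0)
    (hmm : ∀ ε, Measurable fun q : Model d × Model d => m ε q.1 q.2)
    (hlim : ∀ y z, Tendsto (fun ε => m ε y z) (𝓝[>] 0) (𝓝 (m₀ y z))) :
    Tendsto (fun ε : ℝ => ∫ z, ∫ y, f (y + ε • z) * k y * m ε y z) (𝓝[>] 0)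
      (𝓝 (∫ z, ∫ y, f y * k y * m₀ y z)) := by
  have hmz : ∀ ε z, AEStronglyMeasurable (fun y => m ε y z) volume := fun ε z =>
    ((hmm ε).comp (measurable_id.prodMk measurable_const)).aestronglyMeasurable
  set D : ℝ := (ENNReal.ofReal C * (eLpNorm f p' volume * eLpNorm k p volume)).toReal with hD
  refine tendsto_integral_filter_of_dominated_convergence
    ((Metric.closedBall (0 : Model d) 1).indicator fun _ => D) ?_ ?_ ?_
    (ae_of_all _ fun z => tendsto_integral_translate hp' hpp' hf hk z (fun ε y => hm ε y z)
      (fun ε => hmz ε z) fun y => hlim y z)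
  · refine Eventually.of_forall fun ε => ?_
    have : Measurable fun q : Model d × Model d => f (q.2 + ε • q.1) * k q.2 * m ε q.2 q.1 :=
      ((hfm.comp (by fun_prop)).mul (hkm.comp measurable_snd)).mul
        ((hmm ε).comp (measurable_snd.prodMk measurable_fst))
    exact this.stronglyMeasurable.integral_prod_right.aestronglyMeasurable
  · refine Eventually.of_forall fun ε => ae_of_all _ fun z => ?_
    by_cases hz : z ∈ Metric.closedBall (0 : Model d) 1
    · rw [indicator_of_mem hz]
      refine (norm_integral_le_lintegral_norm _).trans ?_
      refine ENNReal.toReal_mono ?_ ?_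
      · exact (ENNReal.mul_lt_top ENNReal.ofReal_lt_top (ENNReal.mul_lt_top hf.2 hk.2)).ne
      · simp only [ofReal_norm]
        have hfz := measurePreserving_add_right (volume : Measure (Model d)) (ε • z)
        rw [← eLpNorm_comp_measurePreserving hf.1 hfz]
        exact enorm_integral_mul_le hpp' (hf.1.comp_measurePreserving hfz) hk.1 fun y => hm ε y z
    · rw [indicator_of_notMem hz]
      have hz' : 1 < ‖z‖ := by simpa using hz
      simp [hms ε _ z hz']
  · exact (integrable_indicator_iff measurableSet_closedBall).2
      (integrableOn_const (by exact (isCompact_closedBall _ _).measure_lt_top.ne))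

theorem integrable_mul_prod {f k : Model d → ℂ} (hfi : Integrable f) (hki : Integrable k)
    {M : Model d × Model d → ℂ} (hM : Measurable M) {C : ℝ} (hC : ∀ q, ‖M q‖ ≤ C) :
    Integrable (fun q : Model d × Model d => f q.1 * k q.2 * M q) :=
  (hfi.mul_prod hki).mul_bdd hM.aestronglyMeasurable (ae_of_all _ hC)

/-- The standard coordinate derivative. -/
def pd (i : Fin d) (η : Model d → ℝ) (y : Model d) : ℝ := fderiv ℝ η y (stdVec d i)

theorem pd_eq_zero {η : Model d → ℝ} {y : Model d} (hy : y ∉ tsupport η) (i : Fin d) :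
    pd i η y = 0 := by
  rw [pd, image_eq_zero_of_notMem_tsupport fun h => hy (tsupport_fderiv_subset ℝ h)]
  rfl

/-- Integration by parts against a linear function. -/
theorem integral_linear_mul_pd {ρ : Model d → ℝ} (hρ : ContDiff ℝ ∞ ρ) (hρc : HasCompactSupport ρ)
    (hρ1 : ∫ z, ρ z = 1) (L : Model d →L[ℝ] ℂ) (i : Fin d) :
    ∫ z, L z * (pd i ρ z : ℂ) = - L (stdVec d i) := by
  have hρC : ∀ z, HasFDerivAt (fun z => (ρ z : ℂ)) (Complex.ofRealCLM.comp (fderiv ℝ ρ z)) z :=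
    fun z => Complex.ofRealCLM.hasFDerivAt.comp z (hρ.differentiable (by simp) z).hasFDerivAt
  have hcd : ContDiff ℝ ∞ (fun z => (ρ z : ℂ)) := Complex.ofRealCLM.contDiff.comp hρ
  have hcs : HasCompactSupport (fun z => (ρ z : ℂ)) := hρc.comp_left (g := Complex.ofReal) (by simp)
  have h := integral_mul_fderiv_eq_neg_fderiv_mul_of_integrable (μ := (volume : Measure (Model d)))
    (f := fun z => L z) (g := fun z => (ρ z : ℂ)) (v := stdVec d i) ?_ ?_ ?_
    (fun x _ => L.differentiableAt) (fun x _ => (hρC x).differentiableAt)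
  · have e1 : ∀ z, fderiv ℝ (fun z => L z) z = L := fun z => L.fderiv
    simp only [(hρC _).fderiv, e1] at h
    refine h.trans ?_
    rw [integral_const_mul, integral_complex_ofReal, hρ1]
    simp
  · refine Continuous.integrable_of_hasCompactSupport ?_ hcs.mul_left
    simp only [L.fderiv]
    exact continuous_const.mul hcd.continuous
  · refine Continuous.integrable_of_hasCompactSupport ?_
      (HasCompactSupport.mul_left (hcs.fderiv_apply ℝ _))
    exact L.continuous.mul ((hcd.continuous_fderiv (by simp)).clm_apply continuous_const)
  · exact (L.continuous.mul hcd.continuous).integrable_of_hasCompactSupport hcs.mul_left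

@[fun_prop]
theorem continuous_pd {η : Model d → ℝ} (hη : ContDiff ℝ ∞ η) (i : Fin d) : Continuous (pd i η) :=
  (hη.continuous_fderiv (by simp)).clm_apply continuous_const

theorem integral_prod_eq_sum {J : Type*} [Fintype J] {Φ : Model d × Model d → ℂ}
    {Ψ : J → Model d × Model d → ℂ} (hΦ : Integrable Φ (volume.prod volume))
    (hΨ : ∀ j, Integrable (Ψ j) (volume.prod volume))
    (H : ∀ x, ∫ y, Φ (x, y) = ∑ j, ∫ y, Ψ j (x, y)) :
    ∫ q, Φ q ∂(volume.prod volume) = ∑ j, ∫ q, Ψ j q ∂(volume.prod volume) := by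
  rw [integral_prod _ hΦ, integral_congr_ae (ae_of_all _ H),
    integral_finsetSum _ fun j _ => (hΨ j).integral_prod_left]
  exact sum_ext fun j => (integral_prod _ (hΨ j)).symm

theorem integral_prod_eq_sum_symm {J : Type*} [Fintype J] {Φ : Model d × Model d → ℂ}
    {Ψ : J → Model d × Model d → ℂ} (hΦ : Integrable Φ (volume.prod volume))
    (hΨ : ∀ j, Integrable (Ψ j) (volume.prod volume))
    (H : ∀ y, ∫ x, Φ (x, y) = ∑ j, ∫ x, Ψ j (x, y)) :
    ∫ q, Φ q ∂(volume.prod volume) = ∑ j, ∫ q, Ψ j q ∂(volume.prod volume) := by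
  rw [integral_prod_symm _ hΦ, integral_congr_ae (ae_of_all _ H),
    integral_finsetSum _ fun j _ => (hΨ j).integral_prod_right]
  exact sum_ext fun j => (integral_prod_symm _ (hΨ j)).symm

/-- The integral against the kernel `ε⁻ᵈ m_ε(y, (x - y) / ε)` converges to the integral of the mean
of its limit, by the substitution `x = y + ε z` and dominated convergence in `z`. -/
theorem tendsto_integral_kernel (hp' : p' ≠ ⊤) (hpp' : p⁻¹ + p'⁻¹ = 1)
    {f k : Model d → ℂ} (hfm : Measurable f) (hkm : Measurable k)
    (hf : MemLp f p' volume) (hk : MemLp k p volume) (hfi : Integrable f) (hki : Integrable k)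
    {m : ℝ → Model d → Model d → ℂ}
    {m₀ : Model d → Model d → ℂ} {C : ℝ} (hm : ∀ ε y z, ‖m ε y z‖ ≤ C)
    (hms : ∀ ε y z, 1 < ‖z‖ → m ε y z = 0)
    (hmm : ∀ ε, Measurable fun q : Model d × Model d => m ε q.1 q.2)
    (hlim : ∀ y z, Tendsto (fun ε => m ε y z) (𝓝[>] 0) (𝓝 (m₀ y z))) :
    Tendsto (fun ε : ℝ => (((ε ^ d)⁻¹ : ℝ) : ℂ) * ∫ q : Model d × Model d,
        f q.1 * k q.2 * m ε q.2 (ε⁻¹ • (q.1 - q.2))) (𝓝[>] 0)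
      (𝓝 (∫ y, f y * k y * ∫ z, m₀ y z)) := by
  have h : Tendsto (fun ε : ℝ => (((ε ^ d)⁻¹ : ℝ) : ℂ) * ∫ q : Model d × Model d,
        f q.1 * k q.2 * m ε q.2 (ε⁻¹ • (q.1 - q.2))) (𝓝[>] 0)
      (𝓝 (∫ z, ∫ y, f y * k y * m₀ y z)) := by
    refine (tendsto_integral_integral_translate hp' hpp' hfm hkm hf hk hm hms hmm hlim).congr' ?_
    filter_upwards [self_mem_nhdsWithin] with ε hε
    have hε : 0 < ε := hε
    have hMm : Measurable fun q : Model d × Model d => m ε q.2 (ε⁻¹ • (q.1 - q.2)) :=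
      (hmm ε).comp (measurable_snd.prodMk (by fun_prop))
    rw [Measure.volume_eq_prod, integral_prod_symm _ (integrable_mul_prod hfi hki hMm (C := C) fun q => hm _ _ _)]
    rw [integral_integral_swap, ← integral_const_mul]
    · congr 1
      ext y
      have h1 := Measure.integral_comp_smul (volume : Measure (Model d))
        (fun x => f (y + x) * k y * m ε y (ε⁻¹ • (y + x - y))) ε
      simp only [finrank_euclideanSpace_fin, add_sub_cancel_left, smul_smul, inv_mul_cancel₀ hε.ne',
        one_smul] at h1
      rw [h1, abs_of_nonneg (by positivity), Complex.real_smul]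
      congr 1
      have h2 := integral_add_left_eq_self (μ := (volume : Measure (Model d)))
        (fun x => f x * k y * m ε y (ε⁻¹ • (x - y))) y
      simp only [add_sub_cancel_left] at h2
      exact h2
    · have hmeas : Measurable fun q : Model d × Model d => f (q.2 + ε • q.1) * k q.2 * m ε q.2 q.1 :=
        ((hfm.comp (by fun_prop)).mul (hkm.comp measurable_snd)).mul
          ((hmm ε).comp (measurable_snd.prodMk measurable_fst))
      refine ⟨hmeas.aestronglyMeasurable, ?_⟩
      refine lt_of_eq_of_lt (lintegral_prod _ hmeas.enorm.aemeasurable) ?_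
      set D := ENNReal.ofReal C * (eLpNorm f p' volume * eLpNorm k p volume) with hD
      have hDt : D < ⊤ := ENNReal.mul_lt_top ENNReal.ofReal_lt_top (ENNReal.mul_lt_top hf.2 hk.2)
      calc ∫⁻ z, ∫⁻ y, ‖f (y + ε • z) * k y * m ε y z‖ₑ
          ≤ ∫⁻ z, (Metric.closedBall (0 : Model d) 1).indicator (fun _ => D) z := by
            refine lintegral_mono fun z => ?_
            by_cases hz : z ∈ Metric.closedBall (0 : Model d) 1
            · rw [indicator_of_mem hz]
              have hfz := measurePreserving_add_right (volume : Measure (Model d)) (ε • z)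
              rw [hD, ← eLpNorm_comp_measurePreserving hf.1 hfz]
              exact enorm_integral_mul_le hpp' (hf.1.comp_measurePreserving hfz) hk.1 fun y => hm ε y z
            · have hz' : 1 < ‖z‖ := by simpa using hz
              simp [hms ε _ z hz']
        _ = D * volume (Metric.closedBall (0 : Model d) 1) := by
            rw [lintegral_indicator measurableSet_closedBall, setLIntegral_const]
        _ < ⊤ := ENNReal.mul_lt_top hDt (isCompact_closedBall _ _).measure_lt_top
  have hm₀ : ∀ y z, ‖m₀ y z‖ ≤ C := fun y z =>
    le_of_tendsto (hlim y z).norm (.of_forall fun ε => hm ε y z)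
  have hms₀ : ∀ y z, 1 < ‖z‖ → m₀ y z = 0 := fun y z hz =>
    tendsto_nhds_unique (hlim y z) (by simp only [hms _ y z hz]; exact tendsto_const_nhds)
  have hmm₀ : Measurable fun q : Model d × Model d => m₀ q.1 q.2 :=
    measurable_of_tendsto_metrizable' (𝓝[>] (0 : ℝ)) hmm
      (tendsto_pi_nhds.2 fun q => hlim q.1 q.2)
  rw [integral_integral_swap] at h
  · simpa only [integral_const_mul] using h
  · have : ENNReal.HolderConjugate p' p := ⟨by rw [add_comm]; simpa using hpp'⟩
    have h1 : Integrable (fun y => f y * k y) := hf.integrable_mul hk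
    have h2 : Integrable ((Metric.closedBall (0 : Model d) 1).indicator fun _ => (1 : ℂ)) :=
      (integrable_indicator_iff measurableSet_closedBall).2
        (integrableOn_const (by exact (isCompact_closedBall _ _).measure_lt_top.ne))
    have h3 := (h2.mul_prod h1).mul_bdd (c := C) (hmm₀.comp
      (measurable_snd.prodMk measurable_fst)).aestronglyMeasurable (ae_of_all _ fun q => hm₀ _ _)
    refine h3.congr (ae_of_all _ fun q => ?_)
    simp only [Function.uncurry, Function.comp_apply]
    by_cases hz : q.1 ∈ Metric.closedBall (0 : Model d) 1
    · rw [indicator_of_mem hz, one_mul]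
    · have hz' : 1 < ‖q.1‖ := by simpa using hz
      rw [hms₀ _ _ hz']
      simp

set_option maxHeartbeats 1600000 in
/-- A pairing of two weak solutions of adjoint first order systems with divergence free
coefficients: the mollification of one of them gives rise to a commutator with the coefficients
whose limit is the divergence. -/
theorem friedrichs {ια ιβ : Type*} [Fintype ια] [Fintype ιβ] (hp' : p' ≠ ⊤)
    (hpp' : p⁻¹ + p'⁻¹ = 1) {V : Set (Model d)} (hV : IsOpen V)
    {χ : Model d → ℝ} (hχ : ContDiff ℝ ∞ χ) (hχc : HasCompactSupport χ) (hχV : tsupport χ ⊆ V)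
    {A : ια → ιβ → Fin d → Model d → ℂ} (hA : ∀ α β i, ContDiff ℝ ∞ (A α β i))
    (hAc : ∀ α β i, HasCompactSupport (A α β i))
    (hdiv : ∀ α β, ∀ y ∈ V, ∑ i, fderiv ℝ (A α β i) y (stdVec d i) = 0)
    {f u : ια → Model d → ℂ} {g h : ιβ → Model d → ℂ}
    (hfm : ∀ α, Measurable (f α)) (hum : ∀ α, Measurable (u α))
    (hgm : ∀ β, Measurable (g β)) (hhm : ∀ β, Measurable (h β))
    (hf : ∀ α, MemLp (f α) p' volume) (hu : ∀ α, MemLp (u α) p volume)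
    (hg : ∀ β, MemLp (g β) p' volume) (hh : ∀ β, MemLp (h β) p volume)
    (hfi : ∀ α, Integrable (f α)) (hui : ∀ α, Integrable (u α))
    (hgi : ∀ β, Integrable (g β)) (hhi : ∀ β, Integrable (h β))
    (H1 : ∀ η : Model d → ℝ, ContDiff ℝ ∞ η → HasCompactSupport η → tsupport η ⊆ V → ∀ β,
      ∫ y, (η y : ℂ) * g β y = ∑ α, ∑ i, ∫ y, f α y * A α β i y * (pd i η y : ℂ))
    (H2 : ∀ η : Model d → ℝ, ContDiff ℝ ∞ η → HasCompactSupport η → tsupport η ⊆ V → ∀ α,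
      ∫ y, (η y : ℂ) * u α y = - ∑ β, ∑ i, ∫ y, h β y * A α β i y * (pd i η y : ℂ)) :
    (∑ β, ∫ y, (χ y : ℂ) * (g β y * h β y)) - ∑ α, ∫ y, (χ y : ℂ) * (f α y * u α y) =
      ∑ α, ∑ β, ∑ i, ∫ y, f α y * h β y * (A α β i y * (pd i χ y : ℂ)) := by
  -- the mollifier
  let bump : ContDiffBump (0 : Model d) := ⟨1 / 2, 1, by norm_num, by norm_num⟩
  set ρ : Model d → ℝ := bump.normed volume with hρdef
  have hρ : ContDiff ℝ ∞ ρ := bump.contDiff_normed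
  have hρc : HasCompactSupport ρ := bump.hasCompactSupport_normed
  have hρ1 : ∫ z, ρ z = 1 := bump.integral_normed
  have hρs : ∀ z, 1 < ‖z‖ → ρ z = 0 := fun z hz => by
    by_contra hne
    have : z ∈ Function.support ρ := hne
    rw [bump.support_normed_eq] at this
    have h2 : ‖z‖ < 1 := by simpa using this
    linarith
  have hρts : tsupport ρ ⊆ Metric.closedBall 0 1 := by
    rw [bump.tsupport_normed_eq]
  have hpds : ∀ i z, 1 < ‖z‖ → pd i ρ z = 0 := fun i z hz => by
    have : z ∉ tsupport ρ := fun hz' => by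
      have := hρts hz'
      simp at this
      linarith
    exact pd_eq_zero this i
  have hpdcs : ∀ (η : Model d → ℝ), HasCompactSupport η → ∀ i, HasCompactSupport (pd i η) :=
    fun η hη i => hη.fderiv_apply ℝ _
  have hχ0 := hχ.continuous
  have hρ0 := hρ.continuous
  have hA0 := fun α β i => (hA α β i).continuous
  have hpχ := continuous_pd hχ
  have hpρ := continuous_pd hρ
  obtain ⟨Cχ, hCχ⟩ := hχc.exists_bound_of_continuous hχ0
  obtain ⟨Cρ, hCρ⟩ := hρc.exists_bound_of_continuous hρ0
  choose C1 hC1 using fun α β i => (hAc α β i).exists_bound_of_continuous (hA0 α β i)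
  choose C2 hC2 using fun i => (hpdcs ρ hρc i).exists_bound_of_continuous (hpρ i)
  choose C3 hC3 using fun i => (hpdcs χ hχc i).exists_bound_of_continuous (hpχ i)
  have hCχ0 := (norm_nonneg _).trans (hCχ 0)
  have hC10 := fun α β i => (norm_nonneg _).trans (hC1 α β i 0)
  have hC20 := fun i => (norm_nonneg _).trans (hC2 i 0)
  have hC30 := fun i => (norm_nonneg _).trans (hC3 i 0)
  -- derivatives of the test functions
  have hpdρ : ∀ (ε : ℝ) (y x : Model d) i, pd i (fun x => ρ (ε⁻¹ • (x - y))) x =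
      ε⁻¹ * pd i ρ (ε⁻¹ • (x - y)) := by
    intro ε y x i
    have h1 : HasFDerivAt (fun x : Model d => ε⁻¹ • (x - y))
        (ε⁻¹ • ContinuousLinearMap.id ℝ (Model d)) x :=
      ((hasFDerivAt_id x).sub_const y).const_smul ε⁻¹
    have h2 := (hρ.differentiable (by simp) (ε⁻¹ • (x - y))).hasFDerivAt.comp x h1
    have h3 : pd i (fun x => ρ (ε⁻¹ • (x - y))) x = fderiv ℝ (ρ ∘ fun x => ε⁻¹ • (x - y)) x
      (stdVec d i) := rfl
    rw [h3, h2.fderiv]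
    simp [pd]
  have hpdχρ : ∀ (ε : ℝ) (x y : Model d) i, pd i (fun y => χ y * ρ (ε⁻¹ • (x - y))) y =
      pd i χ y * ρ (ε⁻¹ • (x - y)) - χ y * (ε⁻¹ * pd i ρ (ε⁻¹ • (x - y))) := by
    intro ε x y i
    have h1 : HasFDerivAt (fun y : Model d => ε⁻¹ • (x - y))
        (ε⁻¹ • (- ContinuousLinearMap.id ℝ (Model d))) y :=
      ((hasFDerivAt_id y).const_sub x).const_smul ε⁻¹
    have h2 := (hρ.differentiable (by simp) (ε⁻¹ • (x - y))).hasFDerivAt.comp y h1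
    have h3 := (hχ.differentiable (by simp) y).hasFDerivAt.mul h2
    have h4 : pd i (fun y => χ y * ρ (ε⁻¹ • (x - y))) y =
      fderiv ℝ (χ * ρ ∘ fun y => ε⁻¹ • (x - y)) y (stdVec d i) := rfl
    rw [h4, h3.fderiv]
    simp [pd]
    ring
  have hηc : ∀ ε : ℝ, 0 < ε → ∀ y : Model d, tsupport (fun x => ρ (ε⁻¹ • (x - y))) ⊆
      Metric.closedBall y ε := by
    intro ε hε y
    refine closure_minimal (fun x hx => ?_) Metric.isClosed_closedBall
    by_contra hn
    apply hx
    apply hρs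
    rw [norm_smul, norm_inv, Real.norm_of_nonneg hε.le, ← dist_eq_norm]
    rw [Metric.mem_closedBall, not_le] at hn
    rw [lt_inv_mul_iff₀ hε]
    simpa using hn
  -- the kernel of the commutator
  let N : ια → ιβ → Fin d → ℝ → Model d → Model d → ℂ := fun α β i ε y z =>
    (χ y : ℂ) * ((ε⁻¹ : ℝ) • (A α β i (y + ε • z) - A α β i y)) * (pd i ρ z : ℂ) +
      A α β i y * (pd i χ y : ℂ) * (ρ z : ℂ)
  obtain ⟨δ, hδ, hδV⟩ := hχc.isCompact.exists_cthickening_subset_open hV hχV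
  have hint0 : ∀ (ε : ℝ) {f k : Model d → ℂ}, Integrable f → Integrable k →
      Integrable (fun q : Model d × Model d => f q.1 * k q.2 *
        ((χ q.2 : ℂ) * (ρ (ε⁻¹ • (q.1 - q.2)) : ℂ))) := by
    intro ε f k hf hk
    refine integrable_mul_prod hf hk (by fun_prop) (C := Cχ * Cρ) fun q => ?_
    simp only [norm_mul, Complex.norm_real]
    gcongr
    exacts [hCχ _, hCρ _]
  have hintP : ∀ (ε : ℝ) α β i, Integrable (fun q : Model d × Model d => f α q.1 * h β q.2 *
      (A α β i q.1 * ((χ q.2 : ℂ) * ((ε⁻¹ : ℝ) * (pd i ρ (ε⁻¹ • (q.1 - q.2)) : ℂ))))) := by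
    intro ε α β i
    refine integrable_mul_prod (hfi α) (hhi β) (by fun_prop)
      (C := C1 α β i * (Cχ * (‖ε⁻¹‖ * C2 i))) fun q => ?_
    have h0 := hC10 α β i
    simp only [norm_mul, Complex.norm_real]
    gcongr
    exacts [hC1 _ _ _ _, hCχ _, hC2 _ _]
  have hintQ : ∀ (ε : ℝ) α β i, Integrable (fun q : Model d × Model d => f α q.1 * h β q.2 *
      (A α β i q.2 * ((χ q.2 : ℂ) * ((ε⁻¹ : ℝ) * (pd i ρ (ε⁻¹ • (q.1 - q.2)) : ℂ)) -
        (pd i χ q.2 : ℂ) * (ρ (ε⁻¹ • (q.1 - q.2)) : ℂ)))) := by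
    intro ε α β i
    refine integrable_mul_prod (hfi α) (hhi β) (by fun_prop)
      (C := C1 α β i * (Cχ * (‖ε⁻¹‖ * C2 i) + C3 i * Cρ)) fun q => ?_
    have h3 := hC30 i
    rw [norm_mul]
    refine mul_le_mul (hC1 _ _ _ _) ((norm_sub_le _ _).trans ?_) (norm_nonneg _) (hC10 _ _ _)
    simp only [norm_mul, Complex.norm_real]
    gcongr
    exacts [hCχ _, hC2 _ _, hC3 _ _, hCρ _]
  have key : ∀ ε : ℝ, 0 < ε → ε < δ →
      (∑ β, ∫ q : Model d × Model d, g β q.1 * h β q.2 *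
        ((χ q.2 : ℂ) * (ρ (ε⁻¹ • (q.1 - q.2)) : ℂ))) -
      ∑ α, ∫ q : Model d × Model d, f α q.1 * u α q.2 *
        ((χ q.2 : ℂ) * (ρ (ε⁻¹ • (q.1 - q.2)) : ℂ)) =
      ∑ α, ∑ β, ∑ i, ∫ q : Model d × Model d, f α q.1 * h β q.2 *
        N α β i ε q.2 (ε⁻¹ • (q.1 - q.2)) := by
    intro ε hε hεδ
    have I1 : ∀ β, ∫ q : Model d × Model d, g β q.1 * h β q.2 *
        ((χ q.2 : ℂ) * (ρ (ε⁻¹ • (q.1 - q.2)) : ℂ)) =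
        ∑ j : ια × Fin d, ∫ q : Model d × Model d, f j.1 q.1 * h β q.2 *
          (A j.1 β j.2 q.1 * ((χ q.2 : ℂ) * ((ε⁻¹ : ℝ) * (pd j.2 ρ (ε⁻¹ • (q.1 - q.2)) : ℂ))))
          := by
      intro β
      refine integral_prod_eq_sum_symm (hint0 ε (hgi β) (hhi β)) (fun j => hintP ε j.1 β j.2) fun y => ?_
      by_cases hy : y ∈ tsupport χ
      swap
      · simp [image_eq_zero_of_notMem_tsupport hy]
      have hηV : tsupport (fun x => ρ (ε⁻¹ • (x - y))) ⊆ V := by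
        refine ((hηc ε hε y).trans ?_).trans hδV
        exact (Metric.closedBall_subset_cthickening hy ε).trans
          (Metric.cthickening_mono hεδ.le _)
      have h1 := H1 (fun x => ρ (ε⁻¹ • (x - y))) (hρ.comp (by fun_prop))
        ((isCompact_closedBall y ε).of_isClosed_subset (isClosed_tsupport _) (hηc ε hε y)) hηV β
      have e1 : ∀ x, g β x * h β y * ((χ y : ℂ) * (ρ (ε⁻¹ • (x - y)) : ℂ)) =
          (h β y * χ y) * ((ρ (ε⁻¹ • (x - y)) : ℂ) * g β x) := fun x => by ring
      simp only [e1]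
      rw [integral_const_mul, h1, Fintype.sum_prod_type, Finset.mul_sum]
      refine sum_ext fun α => ?_
      rw [Finset.mul_sum]
      refine sum_ext fun i => ?_
      rw [← integral_const_mul]
      congr 1
      ext x
      rw [hpdρ]
      push_cast
      ring
    have I2 : ∀ α, ∫ q : Model d × Model d, f α q.1 * u α q.2 *
        ((χ q.2 : ℂ) * (ρ (ε⁻¹ • (q.1 - q.2)) : ℂ)) =
        ∑ j : ιβ × Fin d, ∫ q : Model d × Model d, f α q.1 * h j.1 q.2 *
          (A α j.1 j.2 q.2 * ((χ q.2 : ℂ) * ((ε⁻¹ : ℝ) * (pd j.2 ρ (ε⁻¹ • (q.1 - q.2)) : ℂ)) -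
          (pd j.2 χ q.2 : ℂ) * (ρ (ε⁻¹ • (q.1 - q.2)) : ℂ))) := by
      intro α
      refine integral_prod_eq_sum (hint0 ε (hfi α) (hui α)) (fun j => hintQ ε α j.1 j.2) fun x => ?_
      have hts : tsupport (fun y => χ y * ρ (ε⁻¹ • (x - y))) ⊆ tsupport χ :=
        closure_mono (fun y hy => left_ne_zero_of_mul hy)
      have h1 := H2 (fun y => χ y * ρ (ε⁻¹ • (x - y))) (hχ.mul (hρ.comp (by fun_prop)))
        (hχc.isCompact.of_isClosed_subset (isClosed_tsupport _) hts) (hts.trans hχV) α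
      have e1 : ∀ y, f α x * u α y * ((χ y : ℂ) * (ρ (ε⁻¹ • (x - y)) : ℂ)) =
          f α x * (((χ y * ρ (ε⁻¹ • (x - y)) : ℝ) : ℂ) * u α y) := fun y => by push_cast; ring
      simp only [e1]
      rw [integral_const_mul, h1, Fintype.sum_prod_type, mul_neg, ← neg_mul, Finset.mul_sum]
      refine sum_ext fun β => ?_
      rw [Finset.mul_sum]
      refine sum_ext fun i => ?_
      rw [← integral_const_mul]
      congr 1
      ext y
      rw [hpdχρ]
      push_cast
      ring
    simp only [I1, I2, Fintype.sum_prod_type]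
    rw [Finset.sum_comm, ← Finset.sum_sub_distrib]
    refine sum_ext fun α => ?_
    rw [← Finset.sum_sub_distrib]
    refine sum_ext fun β => ?_
    rw [← Finset.sum_sub_distrib]
    refine sum_ext fun i => ?_
    rw [← integral_sub (hintP ε α β i) (hintQ ε α β i)]
    congr 1
    ext q
    have e2 : q.2 + ε • (ε⁻¹ • (q.1 - q.2)) = q.1 := by
      rw [smul_smul, mul_inv_cancel₀ hε.ne', one_smul]; abel
    simp only [N, e2, Complex.real_smul]
    ring
  -- the limits
  have L0 : ∀ {f k : Model d → ℂ}, Measurable f → Measurable k → MemLp f p' volume →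
      MemLp k p volume → Integrable f → Integrable k →
      Tendsto (fun ε : ℝ => (((ε ^ d)⁻¹ : ℝ) : ℂ) * ∫ q : Model d × Model d,
        f q.1 * k q.2 * ((χ q.2 : ℂ) * (ρ (ε⁻¹ • (q.1 - q.2)) : ℂ)))
        (𝓝[>] 0) (𝓝 (∫ y, (χ y : ℂ) * (f y * k y))) := by
    intro f k hfm hkm hf hk hfi hki
    have h1 := tendsto_integral_kernel hp' hpp' hfm hkm hf hk hfi hki
      (m := fun _ y z => (χ y : ℂ) * (ρ z : ℂ)) (m₀ := fun y z => (χ y : ℂ) * (ρ z : ℂ))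
      (C := Cχ * Cρ) (fun _ y z => by
        rw [norm_mul, Complex.norm_real, Complex.norm_real]
        exact mul_le_mul (hCχ _) (hCρ _) (norm_nonneg _) hCχ0)
      (fun _ y z hz => by simp [hρs z hz]) (fun _ => by fun_prop)
      (fun y z => tendsto_const_nhds)
    simp only [integral_const_mul, integral_complex_ofReal, hρ1, Complex.ofReal_one, mul_one] at h1
    simpa only [mul_comm] using h1
  have LN : ∀ α β i, Tendsto (fun ε : ℝ => (((ε ^ d)⁻¹ : ℝ) : ℂ) * ∫ q : Model d × Model d,
        f α q.1 * h β q.2 * N α β i ε q.2 (ε⁻¹ • (q.1 - q.2)))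
        (𝓝[>] 0) (𝓝 (∫ y, f α y * h β y *
          ((χ y : ℂ) * (- fderiv ℝ (A α β i) y (stdVec d i)) + A α β i y * (pd i χ y : ℂ)))) := by
    intro α β i
    obtain ⟨K, hK⟩ := (hA α β i).lipschitzWith_of_hasCompactSupport (hAc α β i) (by simp)
    have h10 := hC10 α β i
    have h30 := hC30 i
    have h1 := tendsto_integral_kernel hp' hpp' (hfm α) (hhm β) (hf α) (hh β) (hfi α) (hhi β)
      (m := N α β i) (m₀ := fun y z => (χ y : ℂ) * fderiv ℝ (A α β i) y z * (pd i ρ z : ℂ) +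
        A α β i y * (pd i χ y : ℂ) * (ρ z : ℂ)) (C := Cχ * K * C2 i + C1 α β i * C3 i * Cρ)
      ?_ ?_ (fun ε => by fun_prop) ?_
    · refine h1.congr' (.of_forall fun ε => rfl) |>.trans (le_of_eq ?_)
      congr 1
      refine integral_congr_ae (ae_of_all _ fun y => ?_)
      simp only
      congr 1
      have hi1 : Integrable fun z => (χ y : ℂ) * fderiv ℝ (A α β i) y z * (pd i ρ z : ℂ) := by
        exact Continuous.integrable_of_hasCompactSupport (by fun_prop) (HasCompactSupport.mul_left
          ((hpdcs ρ hρc i).comp_left (g := Complex.ofReal) (by simp)))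
      have hi2 : Integrable fun z => A α β i y * (pd i χ y : ℂ) * (ρ z : ℂ) :=
        Continuous.integrable_of_hasCompactSupport (by fun_prop) (HasCompactSupport.mul_left
          (hρc.comp_left (g := Complex.ofReal) (by simp)))
      rw [integral_add hi1 hi2, integral_const_mul, integral_complex_ofReal, hρ1]
      simp only [mul_assoc]
      rw [integral_const_mul, integral_linear_mul_pd hρ hρc hρ1]
      simp
    · intro ε y z
      have hz0 : ‖pd i ρ z‖ * ‖z‖ ≤ C2 i := by
        by_cases hz : 1 < ‖z‖
        · simpa [hpds i z hz] using hC20 i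
        · simpa using mul_le_mul (hC2 i z) (not_lt.1 hz) (norm_nonneg _) (hC20 i)
      have hs : ‖(ε⁻¹ : ℝ) • (A α β i (y + ε • z) - A α β i y)‖ ≤ K * ‖z‖ := by
        have h2 := hK.dist_le_mul (y + ε • z) y
        rw [dist_eq_norm, dist_eq_norm, add_sub_cancel_left, norm_smul] at h2
        rw [norm_smul, norm_inv]
        rcases eq_or_ne ε 0 with h0 | h0
        · rw [h0]; simp; positivity
        · rw [inv_mul_le_iff₀ (norm_pos_iff.2 h0)]
          linarith
      refine (norm_add_le _ _).trans (add_le_add ?_ ?_) <;>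
        simp only [norm_mul, Complex.norm_real]
      · calc ‖χ y‖ * ‖(ε⁻¹ : ℝ) • (A α β i (y + ε • z) - A α β i y)‖ * ‖pd i ρ z‖
            ≤ Cχ * (K * ‖z‖) * ‖pd i ρ z‖ := by
              gcongr
              exact hCχ y
          _ = Cχ * K * (‖pd i ρ z‖ * ‖z‖) := by ring
          _ ≤ Cχ * K * C2 i := by gcongr
      · gcongr
        exacts [hC1 _ _ _ _, hC3 _ _, hCρ _]
    · intro ε y z hz
      simp [N, hρs z hz, hpds i z hz]
    · intro y z
      refine ((Tendsto.const_mul _ ?_).mul_const _).add tendsto_const_nhds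
      exact (((hA α β i).differentiable (by simp) y).hasFDerivAt.hasLineDerivAt
        z).tendsto_slope_zero_right
  have hleft : Tendsto (fun ε : ℝ => (((ε ^ d)⁻¹ : ℝ) : ℂ) *
      ((∑ β, ∫ q : Model d × Model d, g β q.1 * h β q.2 *
        ((χ q.2 : ℂ) * (ρ (ε⁻¹ • (q.1 - q.2)) : ℂ))) -
      ∑ α, ∫ q : Model d × Model d, f α q.1 * u α q.2 *
        ((χ q.2 : ℂ) * (ρ (ε⁻¹ • (q.1 - q.2)) : ℂ)))) (𝓝[>] 0)
      (𝓝 ((∑ β, ∫ y, (χ y : ℂ) * (g β y * h β y)) - ∑ α, ∫ y, (χ y : ℂ) * (f α y * u α y))) := by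
    simp only [mul_sub, Finset.mul_sum]
    have h1 := tendsto_finsetSum Finset.univ fun β _ =>
        L0 (hgm β) (hhm β) (hg β) (hh β) (hgi β) (hhi β)
    have h2 := tendsto_finsetSum Finset.univ fun α _ =>
        L0 (hfm α) (hum α) (hf α) (hu α) (hfi α) (hui α)
    exact h1.sub h2
  have hright : Tendsto (fun ε : ℝ => (((ε ^ d)⁻¹ : ℝ) : ℂ) *
      ∑ α, ∑ β, ∑ i, ∫ q : Model d × Model d, f α q.1 * h β q.2 *
        N α β i ε q.2 (ε⁻¹ • (q.1 - q.2))) (𝓝[>] 0)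
      (𝓝 (∑ α, ∑ β, ∑ i, ∫ y, f α y * h β y *
          ((χ y : ℂ) * (- fderiv ℝ (A α β i) y (stdVec d i)) + A α β i y * (pd i χ y : ℂ)))) := by
    simp only [Finset.mul_sum]
    exact tendsto_finsetSum Finset.univ fun α _ => tendsto_finsetSum Finset.univ fun β _ =>
      tendsto_finsetSum Finset.univ fun i _ => LN α β i
  have heq := tendsto_nhds_unique (hleft.congr' (by
    filter_upwards [Ioo_mem_nhdsGT hδ] with ε hε
    rw [key ε hε.1 hε.2])) hright
  rw [heq]
  refine sum_ext fun α => sum_ext fun β => ?_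
  -- the divergence drops out
  have hi : ∀ {F : Model d → ℂ}, Continuous F → HasCompactSupport F →
      Integrable fun y => f α y * h β y * F y := fun hc hcs =>
    integrable_mul_mul hpp' (hf α) (hh β) (hcs.exists_bound_of_continuous hc).choose_spec
      hc.aestronglyMeasurable
  have hi1 := fun i => hi (F := fun y => (χ y : ℂ) * (- fderiv ℝ (A α β i) y (stdVec d i)))
    (by have := ((hA α β i).continuous_fderiv (by simp)).clm_apply
          (continuous_const (y := stdVec d i))
        fun_prop)
    (HasCompactSupport.mul_right (hχc.comp_left (g := Complex.ofReal) (by simp)))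
  have hi2 := fun i => hi (F := fun y => A α β i y * (pd i χ y : ℂ)) (by fun_prop)
    (HasCompactSupport.mul_right (hAc α β i))
  simp only [mul_add]
  rw [sum_ext fun i => integral_add (hi1 i) (hi2 i), Finset.sum_add_distrib,
    ← integral_finsetSum _ fun i _ => hi1 i]
  have hz : ∀ y, ∑ i, f α y * h β y * ((χ y : ℂ) * (- fderiv ℝ (A α β i) y (stdVec d i))) = 0 := by
    intro y
    rw [← Finset.mul_sum, ← Finset.mul_sum, Finset.sum_neg_distrib]
    by_cases hy : y ∈ tsupport χ
    · rw [hdiv α β y (hχV hy)]; simp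
    · simp [image_eq_zero_of_notMem_tsupport hy]
  simp only [hz, integral_zero, zero_add]

end Friedrichs

/-! ### Components of alternating forms -/

section AltCoord

variable {d m a b : ℕ}

/-- The components of an alternating form with respect to the standard basis. -/
def altCoord (d m : ℕ) : Alt d m ℂ →L[ℝ] ((Fin m → Fin d) → ℂ) :=
  LinearMap.toContinuousLinearMap
    { toFun := fun α κ => α (fun j => stdVec d (κ j))
      map_add' := fun _ _ => rfl
      map_smul' := fun _ _ => rfl }

theorem exists_leftInverse_altCoord (d m : ℕ) :
    ∃ L : ((Fin m → Fin d) → ℂ) →L[ℝ] Alt d m ℂ, ∀ α, L (altCoord d m α) = α := by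
  have hinj : Function.Injective (altCoord d m) := fun α β h => alt_ext fun κ => congrFun h κ
  obtain ⟨L, hL⟩ := (altCoord d m).toLinearMap.exists_leftInverse_of_injective
    (LinearMap.ker_eq_bot.2 hinj)
  exact ⟨LinearMap.toContinuousLinearMap L, fun α => LinearMap.congr_fun hL α⟩

theorem contDiffAt_alt {E : Type*} [NormedAddCommGroup E] [NormedSpace ℝ E] {f : E → Alt d m ℂ}
    {y : E} (h : ∀ κ : Fin m → Fin d, ContDiffAt ℝ ∞ (fun z => f z (fun j => stdVec d (κ j))) y) :
    ContDiffAt ℝ ∞ f y := by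
  obtain ⟨L, hL⟩ := exists_leftInverse_altCoord d m
  have h1 : ContDiffAt ℝ ∞ (fun z => altCoord d m (f z)) y := contDiffAt_pi.2 h
  have h2 := L.contDiff.contDiffAt.comp y h1
  exact h2.congr_of_eventuallyEq (.of_forall fun z => (hL (f z)).symm)

theorem contDiff_eval (v : Fin m → Model d) : ContDiff ℝ ∞ fun α : Alt d m ℂ => α v :=
  (ContinuousAlternatingMap.apply ℝ (Model d) ℂ v).contDiff

theorem contDiffAt_compContinuousLinearMap {E : Type*} [NormedAddCommGroup E] [NormedSpace ℝ E]
    {f : E → Alt d m ℂ} {L : E → Model d →L[ℝ] Model d} {y : E}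
    (hf : ContDiffAt ℝ ∞ f y) (hL : ContDiffAt ℝ ∞ L y) :
    ContDiffAt ℝ ∞ (fun z => (f z).compContinuousLinearMap (L z)) y := by
  refine contDiffAt_alt fun κ => ?_
  have h1 : (fun z => (f z).compContinuousLinearMap (L z) fun j => stdVec d (κ j)) = fun z =>
      ∑ μ : Fin m → Fin d, f z (fun j => stdVec d (μ j)) *
        ∏ j, ((L z (stdVec d (κ j)) (μ j) : ℝ) : ℂ) := by
    funext z
    rw [ContinuousAlternatingMap.compContinuousLinearMap_apply, alt_expand]
    rfl
  rw [h1]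
  refine ContDiffAt.sum fun μ _ => ContDiffAt.mul ((contDiff_eval _).contDiffAt.comp y hf)
    (contDiffAt_prod fun j _ => ?_)
  have h2 : ContDiffAt ℝ ∞ (fun z => L z (stdVec d (κ j))) y := hL.clm_apply contDiffAt_const
  exact (Complex.ofRealCLM.contDiff.comp (EuclideanSpace.proj (μ j)).contDiff).contDiffAt.comp y h2

theorem wedgeTop_add_right (α : Alt d a ℂ) (β β' : Alt d b ℂ) :
    wedgeTop α (β + β') = wedgeTop α β + wedgeTop α β' := by
  rw [wedgeTop_comm, wedgeTop_add, mul_add, ← wedgeTop_comm, ← wedgeTop_comm]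

theorem wedgeTop_smul_right (z : ℂ) (α : Alt d a ℂ) (β : Alt d b ℂ) :
    wedgeTop α (z • β) = z * wedgeTop α β := by
  rw [wedgeTop_comm, wedgeTop_smul, mul_left_comm, ← wedgeTop_comm]

/-- The wedge product as a continuous bilinear map. -/
def wedgeTopL (d a b : ℕ) : Alt d a ℂ →L[ℝ] Alt d b ℂ →L[ℝ] ℂ :=
  LinearMap.toContinuousLinearMap
    ((LinearMap.toContinuousLinearMap : (Alt d b ℂ →ₗ[ℝ] ℂ) ≃ₗ[ℝ] (Alt d b ℂ →L[ℝ] ℂ)).toLinearMap.comp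
      (LinearMap.mk₂ ℝ (fun (α : Alt d a ℂ) (β : Alt d b ℂ) => wedgeTop α β)
        wedgeTop_add
        (fun c α β => by
          rw [← Complex.coe_smul c α, wedgeTop_smul, ← smul_eq_mul, Complex.coe_smul])
        wedgeTop_add_right
        (fun c α β => by
          rw [← Complex.coe_smul c β, wedgeTop_smul_right, ← smul_eq_mul, Complex.coe_smul])))

theorem wedgeTopL_apply (α : Alt d a ℂ) (β : Alt d b ℂ) : wedgeTopL d a b α β = wedgeTop α β := rfl

/-- The exterior product with a linear form as a continuous bilinear map. -/
def wedgeLinL (d a : ℕ) : (Model d →L[ℝ] ℂ) →L[ℝ] Alt d a ℂ →L[ℝ] Alt d (a + 1) ℂ :=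
  LinearMap.toContinuousLinearMap
    ((LinearMap.toContinuousLinearMap :
      (Alt d a ℂ →ₗ[ℝ] Alt d (a + 1) ℂ) ≃ₗ[ℝ] (Alt d a ℂ →L[ℝ] Alt d (a + 1) ℂ)).toLinearMap.comp
      (LinearMap.mk₂ ℝ (fun (l : Model d →L[ℝ] ℂ) (α : Alt d a ℂ) => wedgeLin l α)
        (fun l l' α => by
          ext v
          simp [wedgeLin_apply, add_mul, mul_add, Finset.sum_add_distrib])
        (fun c l α => by
          ext v
          simp [wedgeLin_apply, Finset.mul_sum, mul_left_comm, mul_assoc])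
        (fun l α α' => by
          ext v
          simp [wedgeLin_apply, mul_add, Finset.sum_add_distrib])
        (fun c l α => by
          ext v
          simp [wedgeLin_apply, Finset.mul_sum, mul_left_comm])))

theorem wedgeLinL_apply (l : Model d →L[ℝ] ℂ) (α : Alt d a ℂ) :
    wedgeLinL d a l α = wedgeLin l α := rfl

theorem wedgeLin_comp (l : Model d →L[ℝ] ℂ) (α : Alt d a ℂ) (L : Model d →L[ℝ] Model d) :
    wedgeLin (l.comp L) (α.compContinuousLinearMap L) =
      (wedgeLin l α).compContinuousLinearMap L := by
  ext v
  simp [wedgeLin_apply, Function.comp_def]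

theorem memLp_wedgeTop {X : Type*} [MeasurableSpace X] {μ : Measure X} {p p' : ℝ≥0∞}
    (hpp' : p⁻¹ + p'⁻¹ = 1) {F : X → Alt d a ℂ} {K : X → Alt d b ℂ} (hF : MemLp F p μ)
    (hK : MemLp K p' μ) : Integrable (fun y => wedgeTop (F y) (K y)) μ := by
  have : ENNReal.HolderConjugate p p' := ⟨by simpa using hpp'⟩
  exact memLp_one_iff_integrable.1 ((wedgeTopL d a b).memLp_of_bilin 1 hF hK)

end AltCoord

section LinearAlgebra

/-- A surjective linear map `ℂ^d → ℂ^n` can be completed by `d - n` linear forms to an invertible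
one. -/
theorem exists_completion {d n : ℕ} (hnd : n ≤ d)
    (P : (Fin d → ℂ) →ₗ[ℂ] (Fin n → ℂ)) (hP : Function.Surjective P) :
    ∃ Q : (Fin d → ℂ) →ₗ[ℂ] (Fin (d - n) → ℂ), ∀ v, P v = 0 → Q v = 0 → v = 0 := by
  obtain ⟨π, hπ⟩ := (LinearMap.ker P).subtype.exists_leftInverse_of_injective
    (LinearMap.ker_eq_bot.2 Subtype.val_injective)
  have hdim : Module.finrank ℂ (LinearMap.ker P) = d - n := by
    have h := LinearMap.finrank_range_add_finrank_ker P
    rw [LinearMap.range_eq_top.2 hP, finrank_top, Module.finrank_fin_fun, Module.finrank_fin_fun] at h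
    omega
  let e : LinearMap.ker P ≃ₗ[ℂ] (Fin (d - n) → ℂ) :=
    LinearEquiv.ofFinrankEq _ _ (by rw [hdim, Module.finrank_fin_fun])
  refine ⟨e.toLinearMap.comp π, fun v h1 h2 => ?_⟩
  have h3 : π v = 0 := e.injective (by simpa using h2)
  have h4 := LinearMap.congr_fun hπ ⟨v, h1⟩
  have h5 : π v = ⟨v, h1⟩ := h4
  rw [h3] at h5
  exact (congrArg Subtype.val h5).symm

theorem cplxMatrix_mulVec_cvec {d : ℕ} (B : Model d →L[ℝ] (Fin d → ℂ)) (w : Model d × Model d) :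
    (cplxMatrix B).mulVec (cvec w) = B w.1 + Complex.I • B w.2 := by
  have h : cvec w = (fun i => ((w.1 i : ℝ) : ℂ)) + Complex.I • fun i => ((w.2 i : ℝ) : ℂ) := by
    ext i; simp [cvec]
  rw [h, Matrix.mulVec_add, Matrix.mulVec_smul, cplxMatrix_mulVec, cplxMatrix_mulVec]

theorem complexEval_comp {d m : ℕ} (α : Alt d m ℂ) (L : Model d →L[ℝ] Model d)
    (ζ : Fin m → Model d × Model d) :
    complexEval (α.compContinuousLinearMap L) ζ = complexEval α fun j => (L (ζ j).1, L (ζ j).2) := by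
  unfold complexEval
  refine sum_ext fun T => ?_
  rw [ContinuousAlternatingMap.compContinuousLinearMap_apply]
  congr 2
  ext1 j
  simp only [Function.comp_apply]
  split_ifs <;> rfl

end LinearAlgebra

section Manifold

variable {d m a b : ℕ} {M : Type*} [TopologicalSpace M] [ChartedSpace (Model d) M]

local notation "chart" => chartAt (Model d)

/-! ### Sections given in one chart -/

section Chart

variable [IsManifold 𝓘(ℝ, Model d) ∞ M]

open Classical in
/-- The section which is given by `u` in the chart centred at `x`, and by `0` outside of the domain
of this chart. -/
def ofChart (x : M) (u : Model d → Alt d m ℂ) (y : M) : Alt d m ℂ :=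
  if y ∈ (chart x).source then
    (u (chart x y)).compContinuousLinearMap (tangentCoordChange 𝓘(ℝ, Model d) y x y)
  else 0

theorem rep_ofChart (x : M) (u : Model d → Alt d m ℂ) {y : Model d}
    (hy : y ∈ (chart x).target) : rep x (ofChart x u) y = u y := by
  have hs := (chart x).map_target hy
  rw [rep, ofChart, if_pos hs, (chart x).right_inv hy]
  ext v
  simp only [ContinuousAlternatingMap.compContinuousLinearMap_apply, Function.comp_def]
  congr 1
  ext1 j
  rw [tangentCoordChange_comp, tangentCoordChange_self]
  · simpa [extChartAt_source] using hs
  · simp only [extChartAt_source]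
    exact ⟨⟨hs, mem_chart_source _ _⟩, hs⟩

theorem ofChart_rep (x : M) (f : M → Alt d m ℂ) {y : M} (hy : y ∈ (chart x).source) :
    ofChart x (rep x f) y = f y := by
  rw [ofChart, if_pos hy, rep, (chart x).left_inv hy]
  ext v
  simp only [ContinuousAlternatingMap.compContinuousLinearMap_apply, Function.comp_def]
  congr 1
  ext1 j
  rw [tangentCoordChange_comp, tangentCoordChange_self]
  · simp
  · simp only [extChartAt_source]
    exact ⟨⟨mem_chart_source _ _, hy⟩, mem_chart_source _ _⟩

theorem ofChart_apply_eq_zero {x : M} {u : Model d → Alt d m ℂ} {y : M}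
    (h : y ∈ (chart x).source → u (chart x y) = 0) : ofChart x u y = 0 := by
  unfold ofChart
  split_ifs with h1
  · rw [h h1]
    ext v
    simp
  · rfl

theorem rep_eq_zero_iff (x : M) (f : M → Alt d m ℂ) {y : M}
    (hy : y ∈ (chart x).source) :
    rep x f (chart x y) = 0 ↔ f y = 0 := by
  constructor
  · intro h
    rw [← ofChart_rep x f hy]
    exact ofChart_apply_eq_zero fun _ => h
  · intro h
    refine rep_eq_zero x ?_
    rwa [(chart x).left_inv hy]

theorem contDiffAt_rep_of_chart (c x : M) {f : M → Alt d m ℂ} {y : Model d}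
    (hy : y ∈ (chart c).target)
    (hx : (chart c).symm y ∈ (chart x).source)
    (hf : ContDiffAt ℝ ∞ (rep x f) (chart x ((chart c).symm y))) :
    ContDiffAt ℝ ∞ (rep c f) y := by
  have hev : rep c f =ᶠ[𝓝 y] fun y' =>
      (rep x f ((chart x ∘ (chart c).symm) y')).compContinuousLinearMap
      (fderiv ℝ (chart x ∘ (chart c).symm) y') := by
    have h1 := (chart c).open_target.mem_nhds hy
    have h2 := ((chart c).continuousAt_symm hy).preimage_mem_nhds
      ((chart x).open_source.mem_nhds hx)
    filter_upwards [h1, h2] with y' h1 h2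
    exact rep_eq_pullback c x f h1 h2
  refine ContDiffAt.congr_of_eventuallyEq ?_ hev
  have hτ := contDiffAt_transition c x hy hx
  exact contDiffAt_compContinuousLinearMap (ContDiffAt.comp (g := rep x f) y hf hτ) (hτ.fderiv_right (by simp))

theorem isSmoothForm_of_chart [T2Space M] {x : M} {f : M → Alt d m ℂ} {C : Set M}
    (hC : IsCompact C)
    (hCx : C ⊆ (chart x).source) (hf0 : ∀ y ∉ C, f y = 0)
    (hf : ∀ y ∈ C, ContDiffAt ℝ ∞ (rep x f) (chart x y)) : IsSmoothForm f := by
  intro c y hy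
  refine ContDiffAt.contDiffWithinAt ?_
  by_cases hx : (chart c).symm y ∈ C
  · exact contDiffAt_rep_of_chart c x hy (hCx hx) (hf _ hx)
  · have h2 := ((chart c).continuousAt_symm hy).preimage_mem_nhds
      (hC.isClosed.isOpen_compl.mem_nhds hx)
    have hev : rep c f =ᶠ[𝓝 y] fun _ => 0 := by
      filter_upwards [h2] with y' h2
      exact rep_eq_zero c (hf0 _ h2)
    exact contDiffAt_const.congr_of_eventuallyEq hev

end Chart

/-! ### Change of charts: norms and integrals -/

section ChangeOfChart

/-- The transition map from the chart centred at `c` to the chart centred at `x`. -/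
abbrev chartChange (c x : M) : Model d → Model d :=
  chart x ∘ (chart c).symm

/-- The set on which the transition map `chartChange c x` is defined. -/
def overlap (c x : M) : Set (Model d) :=
  (chart c).target ∩ (chart c).symm ⁻¹' (chart x).source

theorem isOpen_overlap (c x : M) : IsOpen (overlap (d := d) c x) :=
  (chart c).isOpen_inter_preimage_symm (chart x).open_source

theorem chartChange_mem {c x : M} {y : Model d} (hy : y ∈ overlap c x) :
    chartChange c x y ∈ overlap x c := by
  refine ⟨(chart x).map_source hy.2, ?_⟩
  show (chart x).symm (chart x _) ∈ (chart c).source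
  rw [(chart x).left_inv hy.2]
  exact (chart c).map_target hy.1

theorem symm_chartChange {c x : M} {y : Model d} (hy : y ∈ overlap c x) :
    (chart x).symm (chartChange c x y) = (chart c).symm y :=
  (chart x).left_inv hy.2

theorem chartChange_chartChange {c x : M} {y : Model d} (hy : y ∈ overlap c x) :
    chartChange x c (chartChange c x y) = y := by
  show chart c ((chart x).symm (chartChange c x y)) = y
  rw [symm_chartChange hy, (chart c).right_inv hy.1]

theorem injOn_chartChange (c x : M) : InjOn (chartChange (d := d) c x) (overlap c x) :=
  fun y hy z hz h => by rw [← chartChange_chartChange hy, h, chartChange_chartChange hz]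

theorem isCompact_chart_image {x : M} {C : Set M} (hC : IsCompact C)
    (hCx : C ⊆ (chart x).source) : IsCompact (chart x '' C) :=
  hC.image_of_continuousOn ((chart x).continuousOn.mono hCx)

theorem chart_image_subset {x : M} {C : Set M} (hCx : C ⊆ (chart x).source) :
    chart x '' C ⊆ (chart x).target := by
  rintro _ ⟨y, hy, rfl⟩
  exact (chart x).map_source (hCx hy)

theorem mem_chart_image {x : M} {C : Set M} (hCx : C ⊆ (chart x).source) {y : Model d}
    (hy : y ∈ (chart x).target) :
    y ∈ chart x '' C ↔ (chart x).symm y ∈ C := by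
  constructor
  · rintro ⟨z, hz, rfl⟩
    rwa [(chart x).left_inv (hCx hz)]
  · exact fun h => ⟨_, h, (chart x).right_inv hy⟩

variable [IsManifold 𝓘(ℝ, Model d) ∞ M]

theorem hasFDerivAt_chartChange {c x : M} {y : Model d} (hy : y ∈ overlap c x) :
    HasFDerivAt (chartChange c x) (fderiv ℝ (chartChange c x) y) y :=
  (tangentCoordChange_eq_fderiv c x hy.1 hy.2).differentiableAt.hasFDerivAt

theorem continuousOn_chartChange (c x : M) : ContinuousOn (chartChange (d := d) c x) (overlap c x) :=
  fun _ hy => (hasFDerivAt_chartChange hy).continuousAt.continuousWithinAt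

theorem continuousOn_fderiv_chartChange (c x : M) :
    ContinuousOn (fderiv ℝ (chartChange (d := d) c x)) (overlap c x) := fun _ hy =>
  ((contDiffAt_transition c x hy.1 hy.2).fderiv_right (m := ∞) (by simp)).continuousAt.continuousWithinAt

theorem det_fderiv_chartChange_ne_zero {c x : M} {y : Model d} (hy : y ∈ overlap c x) :
    (fderiv ℝ (chartChange c x) y).det ≠ 0 := by
  have h1 : HasFDerivAt (chartChange x c ∘ chartChange c x)
      ((fderiv ℝ (chartChange x c) (chartChange c x y)).comp (fderiv ℝ (chartChange c x) y)) y :=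
    (hasFDerivAt_chartChange (chartChange_mem hy)).comp y (hasFDerivAt_chartChange hy)
  have h2 : HasFDerivAt (chartChange x c ∘ chartChange c x) (ContinuousLinearMap.id ℝ (Model d)) y := by
    refine (hasFDerivAt_id y).congr_of_eventuallyEq ?_
    filter_upwards [(isOpen_overlap c x).mem_nhds hy] with z hz
    exact chartChange_chartChange hz
  have h3 := h1.unique h2
  intro h0
  have h4 := congrArg (fun L : Model d →L[ℝ] Model d => L.det) h3
  simp only [ContinuousLinearMap.det, ContinuousLinearMap.toLinearMap_comp, LinearMap.det_comp] at h4
  rw [ContinuousLinearMap.det] at h0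
  rw [h0, mul_zero] at h4
  simp at h4

/-- The `L^p` norm of a form with support in `C`, computed in another chart. -/
theorem exists_eLpNorm_rep_le [T2Space M] {p : ℝ≥0∞} (hp : p ≠ ⊤) (c x : M) {K : Set (Model d)}
    (hK : IsCompact K) (hKc : K ⊆ (chart c).target) {C : Set M} (hC : IsCompact C)
    (hCx : C ⊆ (chart x).source) (m : ℕ) :
    ∃ A : ℝ≥0∞, A ≠ ⊤ ∧ ∀ f : M → Alt d m ℂ, (∀ y ∉ C, f y = 0) →
      AEStronglyMeasurable (rep x f) (volume.restrict (chart x '' C)) →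
      AEStronglyMeasurable (rep c f) (volume.restrict K) ∧
      eLpNorm (rep c f) p (volume.restrict K) ≤
        A * eLpNorm (rep x f) p (volume.restrict (chart x '' C)) := by
  set L : Set (Model d) := chart c '' ((chart c).symm '' K ∩ C) with hL
  have hsymK : (chart c).symm '' K ⊆ (chart c).source := by
    rintro _ ⟨y, hy, rfl⟩
    exact (chart c).map_target (hKc hy)
  have hLc : IsCompact L := isCompact_chart_image
    ((hK.image_of_continuousOn ((chart c).continuousOn_symm.mono hKc)).inter_right
      hC.isClosed) (inter_subset_left.trans hsymK)
  have hLmem : ∀ y, y ∈ L ↔ y ∈ K ∧ (chart c).symm y ∈ C := by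
    intro y
    constructor
    · rintro ⟨_, ⟨⟨z, hz, rfl⟩, hz2⟩, rfl⟩
      rw [(chart c).right_inv (hKc hz)]
      exact ⟨hz, hz2⟩
    · rintro ⟨h1, h2⟩
      exact ⟨_, ⟨⟨y, h1, rfl⟩, h2⟩, (chart c).right_inv (hKc h1)⟩
  have hLo : L ⊆ overlap c x := fun y hy =>
    ⟨hKc ((hLmem y).1 hy).1, hCx ((hLmem y).1 hy).2⟩
  have hLK : L ⊆ K := fun y hy => ((hLmem y).1 hy).1
  have hDc : ContinuousOn (fderiv ℝ (chartChange (d := d) c x)) L :=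
    (continuousOn_fderiv_chartChange c x).mono hLo
  obtain ⟨B, hB⟩ := hLc.exists_bound_of_continuousOn hDc
  obtain ⟨δ, hδ0, hδ⟩ : ∃ δ : ℝ, 0 < δ ∧ ∀ y ∈ L, δ ≤ |(fderiv ℝ (chartChange (d := d) c x) y).det| := by
    rcases L.eq_empty_or_nonempty with h | h
    · exact ⟨1, one_pos, by simp [h]⟩
    · have hcont : ContinuousOn (fun y => |(fderiv ℝ (chartChange (d := d) c x) y).det|) L :=
        (ContinuousLinearMap.continuous_det.comp_continuousOn hDc).abs
      obtain ⟨y₀, hy₀, hmin⟩ := hLc.exists_isMinOn h hcont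
      exact ⟨_, abs_pos.2 (det_fderiv_chartChange_ne_zero (hLo hy₀)), fun y hy => hmin hy⟩
  -- the Jacobian of the change of charts is at least `δ` on `L`
  set ν : Measure (Model d) := (volume.restrict L).withDensity
    fun y => ENNReal.ofReal |(fderiv ℝ (chartChange (d := d) c x) y).det| with hν
  have hmap : Measure.map (chartChange c x) ν = volume.restrict (chartChange c x '' L) :=
    map_withDensity_abs_det_fderiv_eq_addHaar volume hLc.measurableSet.nullMeasurableSet
      (fun y hy => (hasFDerivAt_chartChange (hLo hy)).hasFDerivWithinAt)
      ((injOn_chartChange c x).mono hLo)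
  have hle : ENNReal.ofReal δ • volume.restrict L ≤ ν := by
    rw [← withDensity_const]
    refine withDensity_mono ?_
    filter_upwards [ae_restrict_mem hLc.measurableSet] with y hy
    exact ENNReal.ofReal_le_ofReal (hδ y hy)
  have hδ' : ENNReal.ofReal δ ≠ 0 := by simpa using hδ0
  have hle' : volume.restrict L ≤ (ENNReal.ofReal δ)⁻¹ • ν := by
    refine Measure.le_iff.2 fun s _ => ?_
    have h : ENNReal.ofReal δ * volume.restrict L s ≤ ν s := by
      simpa only [Measure.smul_apply, smul_eq_mul] using hle s
    rw [Measure.smul_apply, smul_eq_mul]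
    calc volume.restrict L s
        = (ENNReal.ofReal δ)⁻¹ * (ENNReal.ofReal δ * volume.restrict L s) := by
          rw [← mul_assoc, ENNReal.inv_mul_cancel hδ' ENNReal.ofReal_ne_top, one_mul]
      _ ≤ _ := mul_le_mul_right h _
  have hac : volume.restrict L ≪ ν :=
    (Measure.absolutelyContinuous_of_le hle').trans (Measure.smul_absolutelyContinuous)
  have hτm : AEMeasurable (chartChange (d := d) c x) ν :=
    (((continuousOn_chartChange c x).mono hLo).aemeasurable hLc.measurableSet).mono_ac
      (withDensity_absolutelyContinuous _ _)
  have himg : chartChange c x '' L ⊆ chart x '' C := by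
    rintro _ ⟨y, hy, rfl⟩
    exact ⟨_, ((hLmem y).1 hy).2, rfl⟩
  refine ⟨ENNReal.ofReal (B ^ m) * (ENNReal.ofReal δ)⁻¹ ^ (1 / p).toReal, ?_, ?_⟩
  · exact ENNReal.mul_ne_top ENNReal.ofReal_ne_top
      (ENNReal.rpow_ne_top_of_nonneg ENNReal.toReal_nonneg (ENNReal.inv_ne_top.2 hδ'))
  intro f hf0 hfm
  have hind : ∀ᵐ y ∂volume.restrict K, rep c f y = L.indicator (rep c f) y := by
    filter_upwards [ae_restrict_mem hK.measurableSet] with y hy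
    by_cases h : y ∈ L
    · rw [indicator_of_mem h]
    · rw [indicator_of_notMem h]
      exact rep_eq_zero c (hf0 _ fun h2 => h ((hLmem y).2 ⟨hy, h2⟩))
  have hrr : (volume.restrict K).restrict L = volume.restrict L := by
    rw [Measure.restrict_restrict hLc.measurableSet, inter_eq_left.2 hLK]
  -- the coordinate expression of `f` at `x`, read on `L`
  have hm1 : AEStronglyMeasurable (rep x f) (Measure.map (chartChange c x) ν) := by
    rw [hmap]
    exact hfm.mono_measure (Measure.restrict_mono himg le_rfl)
  have hm2 : AEStronglyMeasurable (fun y => rep x f (chartChange c x y)) (volume.restrict L) :=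
    (hm1.comp_aemeasurable hτm).mono_ac hac
  have hpull : ∀ᵐ y ∂volume.restrict L, rep c f y =
      ContinuousAlternatingMap.compContinuousLinearMapCLM (fderiv ℝ (chartChange c x) y)
        (rep x f (chartChange c x y)) := by
    filter_upwards [ae_restrict_mem hLc.measurableSet] with y hy
    exact rep_eq_pullback c x f (hLo hy).1 (hLo hy).2
  have hm3 : AEStronglyMeasurable (rep c f) (volume.restrict L) := by
    refine AEStronglyMeasurable.congr ?_ (hpull.mono fun _ h => h.symm)
    have hj : Continuous fun q : (Model d →L[ℝ] Model d) × Alt d m ℂ =>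
        (ContinuousAlternatingMap.compContinuousLinearMapCLM q.1 : Alt d m ℂ →L[ℝ] Alt d m ℂ) q.2 :=
      (ContinuousAlternatingMap.continuous_compContinuousLinearMapCLM.comp continuous_fst).clm_apply
        continuous_snd
    exact hj.comp_aestronglyMeasurable ((hDc.aestronglyMeasurable hLc.measurableSet).prodMk hm2)
  constructor
  · refine AEStronglyMeasurable.congr ?_ (hind.mono fun _ h => h.symm)
    rw [aestronglyMeasurable_indicator_iff hLc.measurableSet, hrr]
    exact hm3
  have e1 : eLpNorm (rep c f) p (volume.restrict K) = eLpNorm (rep c f) p (volume.restrict L) := by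
    rw [eLpNorm_congr_ae hind]
    refine (eLpNorm_indicator_eq_eLpNorm_restrict (ε := Alt d m ℂ) hLc.measurableSet).trans ?_
    rw [hrr]
  have e2 : eLpNorm (rep c f) p (volume.restrict L) ≤ ENNReal.ofReal (B ^ m) *
      eLpNorm (fun y => rep x f (chartChange c x y)) p (volume.restrict L) := by
    refine eLpNorm_le_mul_eLpNorm_of_ae_le_mul ?_ p
    filter_upwards [hpull, ae_restrict_mem hLc.measurableSet] with y hy hyL
    rw [hy, mul_comm]
    refine (ContinuousAlternatingMap.norm_compContinuousLinearMap_le _ _).trans ?_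
    rw [Fintype.card_fin]
    gcongr
    exact hB y hyL
  have e3 : eLpNorm (fun y => rep x f (chartChange c x y)) p (volume.restrict L) ≤
      (ENNReal.ofReal δ)⁻¹ ^ (1 / p).toReal *
        eLpNorm (rep x f) p (volume.restrict (chart x '' C)) := by
    refine (eLpNorm_mono_measure _ hle').trans ?_
    rw [eLpNorm_smul_measure_of_ne_top hp, smul_eq_mul]
    gcongr
    have h := eLpNorm_map_measure (p := p) hm1 hτm
    rw [hmap] at h
    exact (h.symm.le).trans (eLpNorm_mono_measure _ (Measure.restrict_mono himg le_rfl))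
  rw [e1, mul_assoc]
  exact e2.trans (mul_le_mul_right e3 _)

theorem isLpLoc_of_chart [T2Space M] {p : ℝ≥0∞} (hp : p ≠ ⊤) {x : M} {C : Set M} (hC : IsCompact C)
    (hCx : C ⊆ (chart x).source) {f : M → Alt d m ℂ} (hf0 : ∀ y ∉ C, f y = 0)
    (hf : MemLp (rep x f) p (volume.restrict (chart x '' C))) : IsLpLoc p f := by
  intro c K hK hKc
  obtain ⟨A, hA, h⟩ := exists_eLpNorm_rep_le hp c x hK hKc hC hCx m
  obtain ⟨h1, h2⟩ := h f hf0 hf.1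
  exact ⟨h1, h2.trans_lt (ENNReal.mul_lt_top hA.lt_top hf.2)⟩

end ChangeOfChart

section PairingInChart

variable [IsManifold 𝓘(ℝ, Model d) ∞ M]

theorem compContinuousLinearMap_top (θ : Alt d d ℝ) (L : Model d →L[ℝ] Model d) :
    θ.compContinuousLinearMap L (stdVec d) = L.det * θ (stdVec d) := by
  have h1 := AlternatingMap.eq_smul_basis_det (EuclideanSpace.basisFun (Fin d) ℝ).toBasis
    θ.toAlternatingMap
  have h2 : θ (fun i => L (stdVec d i)) = θ.toAlternatingMap (fun i => L (stdVec d i)) := rfl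
  have h3 : θ.compContinuousLinearMap L (stdVec d) = θ (fun i => L (stdVec d i)) := rfl
  have h4 : (fun i => L (stdVec d i)) =
      (L : Model d →ₗ[ℝ] Model d) ∘ (EuclideanSpace.basisFun (Fin d) ℝ).toBasis := by
    rw [← stdVec_eq_basisFun]; rfl
  rw [h3, h2, h1, AlternatingMap.smul_apply, h4, Module.Basis.det_comp, Module.Basis.det_self,
    mul_one, ← stdVec_eq_basisFun, smul_eq_mul, mul_comm]
  rfl

theorem orientSign_chartChange (Ω : M → Alt d d ℝ) {c x : M} {y : Model d} (hy : y ∈ overlap x c) :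
    orientSign Ω x y = (SignType.sign (fderiv ℝ (chartChange x c) y).det : ℝ) *
      orientSign Ω c (chartChange x c y) := by
  unfold orientSign
  rw [rep_eq_pullback x c Ω hy.1 hy.2, compContinuousLinearMap_top, sign_mul, SignType.coe_mul]

theorem abs_orientSign_le (Ω : M → Alt d d ℝ) (c : M) (y : Model d) : |orientSign Ω c y| ≤ 1 := by
  unfold orientSign
  cases SignType.sign (rep c Ω y (stdVec d)) <;> simp

theorem aestronglyMeasurable_orientSign {Ω : M → Alt d d ℝ} (hΩ : IsContForm Ω) (c : M)
    {K : Set (Model d)} (hK : MeasurableSet K) (hKc : K ⊆ (chart c).target) :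
    AEStronglyMeasurable (orientSign Ω c) (volume.restrict K) := by
  have h0 : ContinuousOn (fun y => rep c Ω y (stdVec d)) K :=
    (ContinuousAlternatingMap.apply ℝ (Model d) ℝ _).continuous.comp_continuousOn ((hΩ c).mono hKc)
  exact (measurable_realSign.comp_aemeasurable (h0.aemeasurable hK)).aestronglyMeasurable

variable [T2Space M] [SigmaCompactSpace M]

/-- If the integrand is supported in the domain of one chart, no partition of unity is needed to
compute the pairing. -/
theorem pairing_eq_chart {Ω : M → Alt d d ℝ} (hΩ : IsContForm Ω) {x : M} {C : Set M}
    (hC : IsCompact C) (hCx : C ⊆ (chart x).source)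
    {f : M → Alt d a ℂ} {g : M → Alt d b ℂ} (h0 : ∀ y ∉ C, f y = 0 ∨ g y = 0)
    (hint : IntegrableOn (fun y => wedgeTop (rep x f y) (rep x g y)) (chart x '' C)) :
    pairing Ω f g = ∫ y in chart x '' C,
      (orientSign Ω x y : ℂ) * wedgeTop (rep x f y) (rep x g y) := by
  set K := chart x '' C with hKdef
  have hK : IsCompact K := isCompact_chart_image hC hCx
  have hKx : K ⊆ (chart x).target := chart_image_subset hCx
  have hW0 : ∀ c : M, ∀ y, (chart c).symm y ∉ C →
      wedgeTop (rep c f y) (rep c g y) = 0 := by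
    intro c y hy
    rcases h0 _ hy with h | h
    · rw [rep_eq_zero c h, wedgeTop_zero_left]
    · rw [rep_eq_zero c h, wedgeTop_zero_right]
  -- the integral over the chart at `c`, transformed to the chart at `x`
  have hc : ∀ c : M, ∫ y in (chart c).target, pairingIntegrand Ω f g c y =
      ∫ y in K, (unityPartition d M c ((chart x).symm y) : ℂ) *
        ((orientSign Ω x y : ℂ) * wedgeTop (rep x f y) (rep x g y)) := by
    intro c
    have hU : MeasurableSet (K ∩ overlap x c) :=
      hK.measurableSet.inter (isOpen_overlap x c).measurableSet
    rw [setIntegral_eq_of_subset_of_forall_sdiff_eq_zero (s := chartChange x c '' (K ∩ overlap x c))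
      (chart c).open_target.measurableSet]
    · rw [integral_image_eq_integral_abs_det_fderiv_smul volume hU
        (fun y hy => (hasFDerivAt_chartChange hy.2).hasFDerivWithinAt)
        ((injOn_chartChange x c).mono inter_subset_right)]
      rw [setIntegral_eq_of_subset_of_forall_sdiff_eq_zero (s := K ∩ overlap x c) hK.measurableSet
        inter_subset_left]
      · refine setIntegral_congr_fun hU fun y hy => ?_
        have h1 := rep_eq_pullback x c f hy.2.1 hy.2.2
        have h2 := rep_eq_pullback x c g hy.2.1 hy.2.2
        simp only [pairingIntegrand]
        rw [h1, h2, wedgeTop_comp, orientSign_chartChange Ω hy.2, symm_chartChange hy.2,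
          Complex.real_smul]
        have h3 : |(fderiv ℝ (chartChange x c) y).det| =
            (SignType.sign (fderiv ℝ (chartChange x c) y).det : ℝ) *
              (fderiv ℝ (chartChange x c) y).det := (sign_mul_self _).symm
        rw [h3]
        push_cast
        ring
      · rintro y ⟨hy, hy2⟩
        have h4 : unityPartition d M c ((chart x).symm y) = 0 := by
          refine image_eq_zero_of_notMem_tsupport fun h => hy2 ⟨hy, hKx hy, ?_⟩
          exact tsupport_unityPartition_subset c h
        simp [h4]
    · rintro _ ⟨y, hy, rfl⟩
      exact (chartChange_mem hy.2).1
    · rintro z ⟨hz, hz2⟩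
      rw [pairingIntegrand, hW0 c z, mul_zero]
      intro hzC
      have hzo : z ∈ overlap c x := ⟨hz, hCx hzC⟩
      exact hz2 ⟨chartChange c x z, ⟨⟨_, hzC, rfl⟩, chartChange_mem hzo⟩, chartChange_chartChange hzo⟩
  have hfin := ((unityPartition d M).locallyFinite.closure).finite_nonempty_inter_compact hC
  have hTi : ∀ c, c ∉ hfin.toFinset → ∀ y ∈ K,
      unityPartition d M c ((chart x).symm y) = 0 := by
    intro c hcT y hy
    refine image_eq_zero_of_notMem_tsupport fun h => hcT ?_
    rw [Set.Finite.mem_toFinset]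
    exact ⟨_, h, (mem_chart_image hCx (hKx hy)).1 hy⟩
  unfold pairing
  rw [finsum_congr hc, finsum_eq_sum_of_support_subset (s := hfin.toFinset)]
  · have hsi : IntegrableOn (fun y => (orientSign Ω x y : ℂ) * wedgeTop (rep x f y) (rep x g y)) K := by
      refine Integrable.bdd_mul (c := 1) hint ?_ (.of_forall fun y => ?_)
      · exact Complex.continuous_ofReal.comp_aestronglyMeasurable
          (aestronglyMeasurable_orientSign hΩ x hK.measurableSet hKx)
      · rw [Complex.norm_real]
        exact abs_orientSign_le Ω x y
    rw [← integral_finsetSum]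
    · refine setIntegral_congr_fun hK.measurableSet fun y hy => ?_
      simp only [← Finset.sum_mul]
      have h1 : ∑ c ∈ hfin.toFinset, unityPartition d M c ((chart x).symm y) = 1 := by
        rw [← (unityPartition d M).sum_eq_one (mem_univ ((chart x).symm y))]
        refine (finsum_eq_sum_of_support_subset _ fun c hc => ?_).symm
        by_contra hcT
        exact hc (hTi c hcT y hy)
      rw [← Complex.ofReal_sum, h1, Complex.ofReal_one, one_mul]
    · intro c _
      refine Integrable.bdd_mul (c := 1) hsi ?_ (.of_forall fun y => ?_)
      · exact Complex.continuous_ofReal.comp_aestronglyMeasurable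
          (((unityPartition d M c).contMDiff.continuous.comp_continuousOn
            ((chart x).continuousOn_symm.mono hKx)).aestronglyMeasurable hK.measurableSet)
      · rw [Complex.norm_real, Real.norm_of_nonneg ((unityPartition d M).nonneg _ _)]
        exact (unityPartition d M).le_one _ _
  · intro c hc
    by_contra hcT
    apply hc
    refine setIntegral_eq_zero_of_forall_eq_zero fun y hy => ?_
    rw [hTi c hcT y hy]
    simp

end PairingInChart

/-! ### Bilinearity of the pairing, multiplication by functions -/

section Sections

theorem memLp_clm_apply {d : ℕ} {E F : Type*} [NormedAddCommGroup E] [NormedSpace ℝ E]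
    [NormedAddCommGroup F] [NormedSpace ℝ F] {p : ℝ≥0∞} {K : Set (Model d)}
    (hK : IsCompact K) {L : Model d → E →L[ℝ] F} (hL : ContinuousOn L K) {f : Model d → E}
    (hf : MemLp f p (volume.restrict K)) : MemLp (fun y => L y (f y)) p (volume.restrict K) := by
  obtain ⟨C, hC⟩ := hK.exists_bound_of_continuousOn hL
  have hj : Continuous fun q : (E →L[ℝ] F) × E => q.1 q.2 := continuous_fst.clm_apply continuous_snd
  refine hf.of_le_mul (c := C)
    (hj.comp_aestronglyMeasurable ((hL.aestronglyMeasurable_of_isCompact hK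
      hK.measurableSet).prodMk hf.1)) ?_
  filter_upwards [ae_restrict_mem hK.measurableSet] with y hy
  exact (L y).le_of_opNorm_le (hC y hy) _

variable [IsManifold 𝓘(ℝ, Model d) ∞ M]

/-- The product of a function and a form. -/
def mulSec (χ : M → ℝ) (f : M → Alt d m ℂ) (y : M) : Alt d m ℂ := (χ y : ℂ) • f y

theorem rep_mulSec (c : M) (χ : M → ℝ) (f : M → Alt d m ℂ) (y : Model d) :
    rep c (mulSec χ f) y = (χ ((chart c).symm y) : ℂ) • rep c f y := by
  ext v; simp [rep, mulSec]

theorem mulSec_eq_zero {χ : M → ℝ} {f : M → Alt d m ℂ} {y : M} (h : χ y = 0 ∨ f y = 0) :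
    mulSec χ f y = 0 := by
  rcases h with h | h <;> simp [mulSec, h]

theorem IsLpLoc.mulSec {p : ℝ≥0∞} {χ : M → ℝ} (hχ : Continuous χ) {f : M → Alt d m ℂ}
    (hf : IsLpLoc p f) : IsLpLoc p (mulSec χ f) := by
  intro c K hK hKc
  have h1 : ContinuousOn (fun y => χ ((chart c).symm y) •
      (ContinuousLinearMap.id ℝ (Alt d m ℂ))) K :=
    ((hχ.comp_continuousOn ((chart c).continuousOn_symm.mono hKc))).smul
      continuousOn_const
  refine (memLp_clm_apply hK h1 (hf c K hK hKc)).ae_eq (.of_forall fun y => ?_)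
  rw [rep_mulSec]
  simp

/-- The form `dχ ∧ f`. -/
def dWedge (χ : M → ℝ) (f : M → Alt d m ℂ) (y : M) : Alt d (m + 1) ℂ :=
  wedgeLin (Complex.ofRealCLM.comp
    (fderiv ℝ (χ ∘ (chart y).symm) (chart y y))) (f y)

theorem contDiffOn_chart {χ : M → ℝ} (hχ : ContMDiff 𝓘(ℝ, Model d) 𝓘(ℝ) ∞ χ) (c : M) :
    ContDiffOn ℝ ∞ (χ ∘ (chart c).symm) (chart c).target := by
  have h := contMDiffOn_chart_symm (I := 𝓘(ℝ, Model d)) (n := ∞) (x := c)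
  exact contMDiffOn_iff_contDiffOn.1 (hχ.comp_contMDiffOn h)

theorem rep_dWedge {χ : M → ℝ} (hχ : ContMDiff 𝓘(ℝ, Model d) 𝓘(ℝ) ∞ χ) (f : M → Alt d m ℂ) (c : M)
    {y : Model d} (hy : y ∈ (chart c).target) :
    rep c (dWedge χ f) y = wedgeLin (Complex.ofRealCLM.comp
      (fderiv ℝ (χ ∘ (chart c).symm) y)) (rep c f y) := by
  set z := (chart c).symm y with hz
  have hzs : z ∈ (chart z).source := mem_chart_source _ z
  have h1 : HasFDerivAt (χ ∘ (chart z).symm)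
      (fderiv ℝ (χ ∘ (chart z).symm) (chart z z))
      ((chart z ∘ (chart c).symm) y) :=
    (((contDiffOn_chart hχ z).contDiffAt ((chart z).open_target.mem_nhds
      (mem_chart_target _ z))).differentiableAt (by simp)).hasFDerivAt
  have h2 := h1.comp y (tangentCoordChange_eq_fderiv c z hy hzs)
  have hev : χ ∘ (chart c).symm =ᶠ[𝓝 y] (χ ∘ (chart z).symm) ∘
      (chart z ∘ (chart c).symm) := by
    have h3 := ((chart c).continuousAt_symm hy).preimage_mem_nhds
      ((chart z).open_source.mem_nhds hzs)
    filter_upwards [h3] with y' h3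
    simp only [Function.comp_apply]
    rw [(chart z).left_inv h3]
  rw [(h2.congr_of_eventuallyEq hev).fderiv, ← ContinuousLinearMap.comp_assoc]
  unfold rep
  rw [wedgeLin_comp]
  rfl

theorem IsLpLoc.dWedge {p : ℝ≥0∞} {χ : M → ℝ} (hχ : ContMDiff 𝓘(ℝ, Model d) 𝓘(ℝ) ∞ χ)
    {f : M → Alt d m ℂ} (hf : IsLpLoc p f) : IsLpLoc p (dWedge χ f) := by
  intro c K hK hKc
  have h0 : ContinuousOn (fderiv ℝ (χ ∘ (chart c).symm)) K :=
    ((contDiffOn_chart hχ c).continuousOn_fderiv_of_isOpen (chart c).open_target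
      (by simp)).mono hKc
  have h1 : ContinuousOn (fun y => wedgeLinL d m (Complex.ofRealCLM.comp
      (fderiv ℝ (χ ∘ (chart c).symm) y))) K :=
    (wedgeLinL d m).continuous.comp_continuousOn (continuousOn_const.clm_comp h0)
  refine (memLp_clm_apply hK h1 (hf c K hK hKc)).ae_eq ?_
  filter_upwards [ae_restrict_mem hK.measurableSet] with y hy
  rw [rep_dWedge hχ f c (hKc hy)]
  rfl

theorem dWedge_eq_zero {χ : M → ℝ} {f : M → Alt d m ℂ} {y : M} (h : f y = 0) :
    dWedge χ f y = 0 := by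
  rw [dWedge, h, ← wedgeLinL_apply, map_zero]

theorem dWedge_eq_zero_of_notMem_tsupport {χ : M → ℝ} {f : M → Alt d m ℂ} {y : M}
    (h : y ∉ tsupport χ) : dWedge χ f y = 0 := by
  have h0 : χ =ᶠ[𝓝 y] 0 := notMem_tsupport_iff_eventuallyEq.1 h
  have hc := (chart y).continuousAt_symm (mem_chart_target _ y)
  rw [ContinuousAt, (chart y).left_inv (mem_chart_source _ y)] at hc
  have hev : χ ∘ (chart y).symm =ᶠ[𝓝 (chart y y)] fun _ => 0 :=
    hc.eventually h0
  rw [dWedge, hev.fderiv_eq, fderiv_const_apply, ContinuousLinearMap.comp_zero, ← wedgeLinL_apply,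
    map_zero, zero_apply]

/-- The differentials of a family of functions with sum `1` add up to `0`. -/
theorem sum_dWedge_eq_zero {ι : Type*} (T : Finset ι) {χ : ι → M → ℝ}
    (hχ : ∀ i ∈ T, ContMDiff 𝓘(ℝ, Model d) 𝓘(ℝ) ∞ (χ i)) {f : M → Alt d m ℂ} {y : M}
    (h : ∀ᶠ z in 𝓝 y, ∑ i ∈ T, χ i z = 1) : ∑ i ∈ T, dWedge (χ i) f y = 0 := by
  have hc := (chart y).continuousAt_symm (mem_chart_target _ y)
  rw [ContinuousAt, (chart y).left_inv (mem_chart_source _ y)] at hc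
  have hev : (fun z => ∑ i ∈ T, (χ i ∘ (chart y).symm) z)
      =ᶠ[𝓝 (chart y y)] fun _ => 1 := hc.eventually h
  have h1 : ∑ i ∈ T, fderiv ℝ (χ i ∘ (chart y).symm) (chart y y) = 0 := by
    rw [← fderiv_fun_sum, hev.fderiv_eq, fderiv_const_apply]
    intro i hi
    exact ((contDiffOn_chart (hχ i hi) y).contDiffAt ((chart y).open_target.mem_nhds
      (mem_chart_target _ y))).differentiableAt (by simp)
  have h2 : ∀ i ∈ T, dWedge (χ i) f y = ((wedgeLinL d m).flip (f y)).comp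
      (ContinuousLinearMap.compL ℝ (Model d) ℝ ℂ Complex.ofRealCLM)
      (fderiv ℝ (χ i ∘ (chart y).symm) (chart y y)) := fun i _ => rfl
  rw [Finset.sum_congr rfl h2, ← map_sum, h1, map_zero]

/-- The integrand of the pairing of `f` and `g` has compact support. -/
def CompactlyPaired (f : M → Alt d a ℂ) (g : M → Alt d b ℂ) : Prop :=
  ∃ C, IsCompact C ∧ ∀ y ∉ C, f y = 0 ∨ g y = 0

theorem compactlyPaired_left {f : M → Alt d a ℂ} (hf : HasCompactSupport f) (g : M → Alt d b ℂ) :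
    CompactlyPaired f g := ⟨_, hf, fun _ hy => Or.inl (image_eq_zero_of_notMem_tsupport hy)⟩

theorem compactlyPaired_right (f : M → Alt d a ℂ) {g : M → Alt d b ℂ} (hg : HasCompactSupport g) :
    CompactlyPaired f g := ⟨_, hg, fun _ hy => Or.inr (image_eq_zero_of_notMem_tsupport hy)⟩

theorem CompactlyPaired.symm {f : M → Alt d a ℂ} {g : M → Alt d b ℂ} (h : CompactlyPaired f g) :
    CompactlyPaired g f := by
  obtain ⟨C, hC, h⟩ := h
  exact ⟨C, hC, fun y hy => (h y hy).symm⟩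

theorem CompactlyPaired.mono {a' b' : ℕ} {f : M → Alt d a ℂ} {g : M → Alt d b ℂ}
    {f' : M → Alt d a' ℂ} {g' : M → Alt d b' ℂ}
    (h : CompactlyPaired f g) (hf : ∀ y, f y = 0 → f' y = 0) (hg : ∀ y, g y = 0 → g' y = 0) :
    CompactlyPaired f' g' := by
  obtain ⟨C, hC, h⟩ := h
  exact ⟨C, hC, fun y hy => (h y hy).imp (hf y) (hg y)⟩

theorem CompactlyPaired.sum_left {ι : Type*} (T : Finset ι) {f : ι → M → Alt d a ℂ}
    {g : M → Alt d b ℂ} (h : ∀ i ∈ T, CompactlyPaired (f i) g) :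
    CompactlyPaired (∑ i ∈ T, f i) g := by
  classical
  induction T using Finset.induction_on with
  | empty => exact ⟨∅, isCompact_empty, fun y _ => Or.inl (by simp)⟩
  | insert i T hi ih =>
    obtain ⟨C, hC, h1⟩ := h i (Finset.mem_insert_self _ _)
    obtain ⟨C', hC', h2⟩ := ih fun j hj => h j (Finset.mem_insert_of_mem hj)
    refine ⟨C ∪ C', hC.union hC', fun y hy => ?_⟩
    rw [mem_union, not_or] at hy
    rw [Finset.sum_insert hi, Pi.add_apply]
    rcases h1 y hy.1 with h1 | h1
    · rcases h2 y hy.2 with h2 | h2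
      · exact Or.inl (by rw [h1, h2, add_zero])
      · exact Or.inr h2
    · exact Or.inr h1

theorem IsLpLoc.sum {p : ℝ≥0∞} {ι : Type*} (T : Finset ι) {f : ι → M → Alt d a ℂ}
    (h : ∀ i ∈ T, IsLpLoc p (f i)) : IsLpLoc p (∑ i ∈ T, f i) := by
  classical
  induction T using Finset.induction_on with
  | empty => exact IsLpLoc.zero
  | insert i T hi ih =>
    rw [Finset.sum_insert hi]
    exact (h i (Finset.mem_insert_self _ _)).add (ih fun j hj => h j (Finset.mem_insert_of_mem hj))

variable [T2Space M] [SigmaCompactSpace M] {Ω : M → Alt d d ℝ} {p p' : ℝ≥0∞}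

theorem integrableOn_pairingIntegrand_of_memLp (hΩ : IsContForm Ω) (hpp' : p⁻¹ + p'⁻¹ = 1)
    {f : M → Alt d a ℂ} (hf : IsLpLoc p f) {g : M → Alt d b ℂ} (hg : IsLpLoc p' g)
    (h : CompactlyPaired f g) (c : M) :
    IntegrableOn (pairingIntegrand Ω f g c) (chart c).target := by
  obtain ⟨C, hC, h0⟩ := h
  set S : Set M := C ∩ tsupport (unityPartition d M c) with hS
  have hSc : IsCompact S := hC.inter_right (isClosed_tsupport _)
  have hSs : S ⊆ (chart c).source :=
    inter_subset_right.trans (tsupport_unityPartition_subset c)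
  have hK := isCompact_chart_image hSc hSs
  have hKt := chart_image_subset hSs
  set K : Set (Model d) := chart c '' S
  refine IntegrableOn.of_forall_sdiff_eq_zero (s := K) ?_
    (chart c).open_target.measurableSet ?_
  · refine Integrable.bdd_mul (c := 1) (memLp_wedgeTop hpp' (hf c K hK hKt) (hg c K hK hKt)) ?_
      (.of_forall fun y => ?_)
    · have h2 : AEStronglyMeasurable
          (fun y => unityPartition d M c ((chart c).symm y)) (volume.restrict K) :=
        ((unityPartition d M c).contMDiff.continuous.comp_continuousOn
            ((chart c).continuousOn_symm.mono hKt)).aestronglyMeasurable hK.measurableSet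
      exact Complex.continuous_ofReal.comp_aestronglyMeasurable
        ((aestronglyMeasurable_orientSign hΩ c hK.measurableSet hKt).mul h2)
    · rw [Complex.norm_real, norm_mul]
      refine mul_le_one₀ (abs_orientSign_le Ω c y) (norm_nonneg _) ?_
      rw [Real.norm_of_nonneg ((unityPartition d M).nonneg _ _)]
      exact (unityPartition d M).le_one _ _
  · rintro y ⟨hy, hyK⟩
    have hyS : (chart c).symm y ∉ S := fun hS => hyK ⟨_, hS, (chart c).right_inv hy⟩
    unfold pairingIntegrand
    by_cases h1 : (chart c).symm y ∈ C
    · have h2 : (chart c).symm y ∉ tsupport (unityPartition d M c) := fun h2 => hyS ⟨h1, h2⟩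
      rw [image_eq_zero_of_notMem_tsupport h2]
      simp
    · rcases h0 _ h1 with h | h
      · rw [rep_eq_zero c h, wedgeTop_zero_left, mul_zero]
      · rw [rep_eq_zero c h, wedgeTop_zero_right, mul_zero]

theorem CompactlyPaired.finite_support {f : M → Alt d a ℂ} {g : M → Alt d b ℂ}
    (h : CompactlyPaired f g) (Ω : M → Alt d d ℝ) :
    (Function.support fun c : M =>
      ∫ y in (chart c).target, pairingIntegrand Ω f g c y).Finite := by
  obtain ⟨C, hC, h0⟩ := h
  have hfin := ((unityPartition d M).locallyFinite.closure).finite_nonempty_inter_compact hC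
  refine hfin.subset fun c hc => ?_
  by_contra hne
  apply hc
  refine setIntegral_eq_zero_of_forall_eq_zero fun y _ => ?_
  unfold pairingIntegrand
  by_cases h1 : (chart c).symm y ∈ C
  · have h2 : (chart c).symm y ∉ tsupport (unityPartition d M c) := fun h2 => hne ⟨_, h2, h1⟩
    rw [image_eq_zero_of_notMem_tsupport h2]
    simp
  · rcases h0 _ h1 with h | h
    · rw [rep_eq_zero c h, wedgeTop_zero_left, mul_zero]
    · rw [rep_eq_zero c h, wedgeTop_zero_right, mul_zero]

theorem pairing_comm (Ω : M → Alt d d ℝ) (f : M → Alt d a ℂ) (g : M → Alt d b ℂ) :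
    pairing Ω f g = (-1) ^ (a * b) * pairing Ω g f := by
  unfold pairing
  rw [← smul_eq_mul, smul_finsum]
  refine finsum_congr fun c => ?_
  rw [smul_eq_mul, ← integral_const_mul]
  congr 1
  funext y
  unfold pairingIntegrand
  rw [wedgeTop_comm]
  ring

theorem pairing_add_left_of_memLp (hΩ : IsContForm Ω) (hpp' : p⁻¹ + p'⁻¹ = 1)
    {f f' : M → Alt d a ℂ} (hf : IsLpLoc p f) (hf' : IsLpLoc p f') {g : M → Alt d b ℂ}
    (hg : IsLpLoc p' g) (h : CompactlyPaired f g) (h' : CompactlyPaired f' g) :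
    pairing Ω (f + f') g = pairing Ω f g + pairing Ω f' g := by
  unfold pairing
  rw [← finsum_add_distrib (h.finite_support Ω) (h'.finite_support Ω)]
  refine finsum_congr fun c => ?_
  rw [← integral_add (integrableOn_pairingIntegrand_of_memLp hΩ hpp' hf hg h c)
    (integrableOn_pairingIntegrand_of_memLp hΩ hpp' hf' hg h' c)]
  simp only [pairingIntegrand, rep_add, wedgeTop_add, mul_add]

theorem pairing_add_right_of_memLp (hΩ : IsContForm Ω) (hpp' : p⁻¹ + p'⁻¹ = 1)
    {f : M → Alt d a ℂ} (hf : IsLpLoc p f) {g g' : M → Alt d b ℂ}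
    (hg : IsLpLoc p' g) (hg' : IsLpLoc p' g') (h : CompactlyPaired f g) (h' : CompactlyPaired f g') :
    pairing Ω f (g + g') = pairing Ω f g + pairing Ω f g' := by
  rw [pairing_comm, pairing_add_left_of_memLp hΩ (by rwa [add_comm] at hpp') hg hg' hf h.symm h'.symm,
    mul_add, ← pairing_comm, ← pairing_comm]

theorem pairing_smul_right (Ω : M → Alt d d ℝ) (z : ℂ) (f : M → Alt d a ℂ)
    (g : M → Alt d b ℂ) : pairing Ω f (z • g) = z * pairing Ω f g := by
  rw [pairing_comm, pairing_smul_left, mul_left_comm, ← pairing_comm]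

theorem pairing_zero_right (Ω : M → Alt d d ℝ) (f : M → Alt d a ℂ) :
    pairing Ω f (0 : M → Alt d b ℂ) = 0 := by
  simpa using pairing_smul_right Ω (0 : ℂ) f (0 : M → Alt d b ℂ)

theorem pairing_sum_left (hΩ : IsContForm Ω) (hpp' : p⁻¹ + p'⁻¹ = 1) {ι : Type*} (T : Finset ι)
    {f : ι → M → Alt d a ℂ} (hf : ∀ i ∈ T, IsLpLoc p (f i)) {g : M → Alt d b ℂ} (hg : IsLpLoc p' g)
    (h : ∀ i ∈ T, CompactlyPaired (f i) g) :
    pairing Ω (∑ i ∈ T, f i) g = ∑ i ∈ T, pairing Ω (f i) g := by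
  classical
  induction T using Finset.induction_on with
  | empty => exact pairing_zero_left Ω g
  | insert i T hi ih =>
    have h1 : ∀ j ∈ T, CompactlyPaired (f j) g := fun j hj => h j (Finset.mem_insert_of_mem hj)
    have h2 : ∀ j ∈ T, IsLpLoc p (f j) := fun j hj => hf j (Finset.mem_insert_of_mem hj)
    rw [Finset.sum_insert hi, Finset.sum_insert hi,
      pairing_add_left_of_memLp hΩ hpp' (hf i (Finset.mem_insert_self _ _)) (IsLpLoc.sum T h2) hg
      (h i (Finset.mem_insert_self _ _)) (CompactlyPaired.sum_left T h1), ih h2 h1]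

theorem pairing_sum_right (hΩ : IsContForm Ω) (hpp' : p⁻¹ + p'⁻¹ = 1) {ι : Type*} (T : Finset ι)
    {f : M → Alt d a ℂ} (hf : IsLpLoc p f) {g : ι → M → Alt d b ℂ} (hg : ∀ i ∈ T, IsLpLoc p' (g i))
    (h : ∀ i ∈ T, CompactlyPaired f (g i)) :
    pairing Ω f (∑ i ∈ T, g i) = ∑ i ∈ T, pairing Ω f (g i) := by
  rw [pairing_comm, pairing_sum_left hΩ (by rwa [add_comm] at hpp') T hg hf fun i hi => (h i hi).symm,
    Finset.mul_sum]
  exact sum_ext fun i => (pairing_comm Ω f (g i)).symm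

/-- The pairing only depends on the forms near the points where both do not vanish. -/
theorem pairing_congr (Ω : M → Alt d d ℝ) {f f' : M → Alt d a ℂ} {g g' : M → Alt d b ℂ}
    (h : ∀ c y, wedgeTop (rep c f y) (rep c g y) = wedgeTop (rep c f' y) (rep c g' y)) :
    pairing Ω f g = pairing Ω f' g' := by
  unfold pairing pairingIntegrand
  simp only [h]

end Sections

/-! ### Exterior derivative and bidegree -/

section LocalCalculus

variable {d m a b : ℕ}

theorem contDiffAt_det {E : Type*} [NormedAddCommGroup E] [NormedSpace ℝ E] {r : ℕ}
    {f : E → Matrix (Fin r) (Fin r) ℂ} {y : E} (h : ∀ i j, ContDiffAt ℝ ∞ (fun z => f z i j) y) :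
    ContDiffAt ℝ ∞ (fun z => (f z).det) y := by
  have h1 : (fun z => (f z).det) = fun z => ∑ σ : Equiv.Perm (Fin r),
      ((Equiv.Perm.sign σ : ℤ) : ℂ) * ∏ i, f z (σ i) i := by
    funext z
    exact Matrix.det_apply' (f z)
  rw [h1]
  exact ContDiffAt.sum fun σ _ => contDiffAt_const.mul (contDiffAt_prod fun i _ => h _ _)

/-- The wedge product as a continuous bilinear map, with the arguments exchanged. -/
def wedgeTopR (d a b : ℕ) : Alt d b ℂ →L[ℝ] Alt d a ℂ →L[ℝ] ℂ := (wedgeTopL d a b).flip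

/-- The differential of the `i`-th coordinate. -/
def dCoord (i : Fin d) : Model d →L[ℝ] ℂ := Complex.ofRealCLM.comp (EuclideanSpace.proj i)

theorem dCoord_apply (i : Fin d) (v : Model d) : dCoord i v = ((v i : ℝ) : ℂ) := rfl

theorem clm_eq_sum_dCoord {G : Type*} [NormedAddCommGroup G] [NormedSpace ℝ G]
    (L : Model d →L[ℝ] G) (v : Model d) : L v = ∑ i, v i • L (stdVec d i) := by
  have h : v = ∑ i, v i • stdVec d i := by
    have := ((EuclideanSpace.basisFun (Fin d) ℝ).toBasis.sum_repr v).symm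
    rw [← stdVec_eq_basisFun] at this
    simpa using this
  conv_lhs => rw [h, map_sum]
  simp

theorem linearForm_eq_sum (l : Model d →L[ℝ] ℂ) : l = ∑ i, l (stdVec d i) • dCoord i := by
  ext v
  rw [clm_eq_sum_dCoord l v]
  simp [dCoord_apply, mul_comm]

theorem extDeriv_eq_sum (f : Model d → Alt d m ℂ) (y : Model d) :
    extDeriv f y = ∑ i, wedgeLin (dCoord i) (fderiv ℝ f y (stdVec d i)) := by
  have h : fderiv ℝ f y = ∑ i, (dCoord i).smulRight (fderiv ℝ f y (stdVec d i)) := by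
    ext1 v
    rw [clm_eq_sum_dCoord (fderiv ℝ f y) v]
    simp [dCoord_apply]
  unfold extDeriv wedgeLin
  conv_lhs => rw [h]
  exact map_sum (ContinuousAlternatingMap.alternatizeUncurryFinCLM ℝ (Model d) ℂ) _ _

theorem wedgeLin_smul (z : ℂ) (l : Model d →L[ℝ] ℂ) (α : Alt d m ℂ) :
    wedgeLin l (z • α) = z • wedgeLin l α := by
  ext v
  simp [wedgeLin_apply, Finset.mul_sum, mul_left_comm]

theorem extDeriv_smul_form {c : Model d → ℂ} {f : Model d → Alt d m ℂ} {y : Model d}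
    (hc : DifferentiableAt ℝ c y) (hf : DifferentiableAt ℝ f y) :
    extDeriv (fun z => c z • f z) y = wedgeLin (fderiv ℝ c y) (f y) + c y • extDeriv f y := by
  rw [extDeriv_eq_sum, extDeriv_eq_sum, fderiv_fun_smul hc hf, Finset.smul_sum]
  have h1 : wedgeLin (fderiv ℝ c y) (f y) =
      ∑ i, wedgeLin (dCoord i) (fderiv ℝ c y (stdVec d i) • f y) := by
    simp only [wedgeLin_smul]
    conv_lhs => rw [linearForm_eq_sum (fderiv ℝ c y)]
    rw [← wedgeLinL_apply, map_sum, sum_apply]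
    refine sum_ext fun i => ?_
    ext v
    simp [wedgeLinL_apply, wedgeLin_apply, Finset.mul_sum, mul_left_comm, mul_assoc]
  rw [h1, ← Finset.sum_add_distrib]
  refine sum_ext fun i => ?_
  have h2 : (c y • fderiv ℝ f y + (fderiv ℝ c y).smulRight (f y)) (stdVec d i) =
      c y • fderiv ℝ f y (stdVec d i) + fderiv ℝ c y (stdVec d i) • f y := rfl
  rw [h2, ← wedgeLinL_apply, map_add, wedgeLinL_apply, wedgeLinL_apply, wedgeLin_smul]
  exact add_comm _ _

/-- The divergence of the vector field with components `f ∧ dx_i ∧ g`. -/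
theorem sum_fderiv_wedgeTop {f : Model d → Alt d a ℂ} {g : Model d → Alt d b ℂ} {y : Model d}
    (hf : DifferentiableAt ℝ f y) (hg : DifferentiableAt ℝ g y) :
    ∑ i, fderiv ℝ (fun z => wedgeTop (f z) (wedgeLin (dCoord i) (g z))) y (stdVec d i) =
      (-1) ^ a * wedgeTop (extDeriv f y) (g y) + wedgeTop (f y) (extDeriv g y) := by
  have h1 : ∀ i, fderiv ℝ (fun z => wedgeTop (f z) (wedgeLin (dCoord i) (g z))) y (stdVec d i) =
      wedgeTop (fderiv ℝ f y (stdVec d i)) (wedgeLin (dCoord i) (g y)) +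
        wedgeTop (f y) (wedgeLin (dCoord i) (fderiv ℝ g y (stdVec d i))) := by
    intro i
    have h2 : HasFDerivAt (fun z => wedgeLinL d b (dCoord i) (g z))
        ((wedgeLinL d b (dCoord i)).comp (fderiv ℝ g y)) y :=
      (wedgeLinL d b (dCoord i)).hasFDerivAt.comp y hg.hasFDerivAt
    have h3 := (wedgeTopL d a (b + 1)).hasFDerivAt_of_bilinear hf.hasFDerivAt h2
    have h4 : (fun z => wedgeTop (f z) (wedgeLin (dCoord i) (g z))) =
      fun z => wedgeTopL d a (b + 1) (f z) (wedgeLinL d b (dCoord i) (g z)) := rfl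
    rw [h4, h3.fderiv]
    exact add_comm _ _
  rw [sum_ext fun i => h1 i, Finset.sum_add_distrib]
  congr 1
  · rw [extDeriv_eq_sum f y, ← wedgeTopL_apply, map_sum, sum_apply,
      Finset.mul_sum]
    refine sum_ext fun i => ?_
    rw [wedgeTopL_apply, wedgeTop_wedgeLin, ← mul_assoc, ← mul_pow]
    simp
  · rw [extDeriv_eq_sum g y, ← wedgeTopL_apply, map_sum]
    rfl

theorem cplx_wedgeLin (l : Model d →L[ℝ] ℂ) (α : Alt d m ℂ) (ζ : Fin (m + 1) → Fin d → ℂ) :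
    cplx (wedgeLin l α) ζ = ∑ i : Fin (m + 1), (-1) ^ (i : ℕ) *
      ((∑ j, l (stdVec d j) * ζ i j) * cplx α (fun j => ζ (i.succAbove j))) := by
  rw [cplx_apply]
  simp only [wedgeLin_apply, Finset.sum_mul]
  rw [Finset.sum_comm]
  refine sum_ext fun i => ?_
  rw [← Equiv.sum_comp (Fin.insertNthEquiv (fun _ => Fin d) i), Fintype.sum_prod_type]
  simp only [Finset.mul_sum]
  refine sum_ext fun j => ?_
  rw [cplx_apply]
  simp only [Finset.mul_sum]
  refine sum_ext fun κ => ?_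
  rw [Fin.prod_univ_succAbove _ i]
  simp only [Fin.insertNthEquiv_apply, Fin.insertNth_apply_same, Fin.insertNth_apply_succAbove]
  ring

theorem countIn_succAbove (H : Finset (Fin d)) (κ : Fin (m + 1) → Fin d) (i : Fin (m + 1)) :
    countIn H κ ≤ countIn H (fun j => κ (i.succAbove j)) + 1 := by
  unfold countIn
  rw [Finset.card_filter, Finset.card_filter, Fin.sum_univ_succAbove _ i, add_comm]
  gcongr
  split_ifs <;> simp

theorem Bideg.wedgeLin {B : Model d →L[ℝ] (Fin d → ℂ)} {H : Finset (Fin d)} {s : ℤ} {α : Alt d m ℂ}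
    (l : Model d →L[ℝ] ℂ) (hα : Bideg B H s α) : Bideg B H (s + 1) (wedgeLin l α) := by
  intro κ hκ
  rw [coeff, cplx_wedgeLin]
  refine Finset.sum_eq_zero fun i _ => ?_
  have h := hα (fun j => κ (i.succAbove j)) (by have := countIn_succAbove H κ i; omega)
  rw [coeff] at h
  rw [h, mul_zero, mul_zero]

end LocalCalculus

theorem dForm_dForm [IsManifold 𝓘(ℝ, Model d) ∞ M] {f : M → Alt d m ℂ} (hf : IsSmoothForm f) :
    dForm (dForm f) = 0 := by
  funext z
  have hz := mem_chart_target (Model d) z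
  have hev : rep z (dForm f) =ᶠ[𝓝 (chart z z)] extDeriv (rep z f) := by
    filter_upwards [(chart z).open_target.mem_nhds hz] with y hy
    exact rep_dForm z hf hy
  show extDeriv (rep z (dForm f)) (chart z z) = 0
  rw [hev.extDeriv_eq]
  exact extDeriv_extDeriv_apply ((hf z).contDiffAt ((chart z).open_target.mem_nhds hz)) (by
    rw [minSmoothness_of_isRCLikeNormedField]
    exact WithTop.coe_le_coe.2 (le_top : (2 : ℕ∞) ≤ ⊤))

end Manifold

section CR

variable {n k : ℕ} {X : Type*} [TopologicalSpace X] [ChartedSpace (EuclideanSpace ℂ (Fin n)) X]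
  {M : Type*} [TopologicalSpace M] [ChartedSpace (Model (2 * n - k)) M]
  [IsManifold 𝓘(ℝ, Model (2 * n - k)) ∞ M] {S : GenericCRSubmanifold n k X M} {x : M}
  {a b m : ℕ} {p p' : ℝ≥0∞} {r r' : ℕ} {s s₀ t t₀ : ℤ}

local notation "dM" => 2 * n - k
local notation "chart" => chartAt (Model dM)
local notation "ℂⁿ" => EuclideanSpace ℂ (Fin n)
local notation "chartX" => chartAt ℂⁿ
local notation "coordChange" => tangentCoordChange 𝓘(ℝ, Model dM)

/-! ### Local frames adapted to the CR structure -/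

/-- The condition defining `IsBidegree` at one point. -/
def BidegAt (S : GenericCRSubmanifold n k X M) (x : M) {m : ℕ} (q : ℤ)
    (α : Alt dM m ℂ) : Prop :=
  ∀ ζ : Fin m → Model dM × Model dM,
    q < ({j | ζ j ∈ H01 S x}.ncard : ℤ) → complexEval α ζ = 0

/-- The indices `i` such that the form `w_i` of an adapted frame does not come from the complex
coordinates of `X`; the corresponding vectors of the dual frame span `H_{0,1} M`. -/
def frameH (n k : ℕ) : Finset (Fin (2 * n - k)) :=
  Finset.univ.filter fun i : Fin (2 * n - k) => n ≤ (i : ℕ)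

/-- The index tuples `κ` with at most `q` entries in `frameH n k`: the forms `w_κ` of an adapted
frame with `κ` in this set span the forms of bidegree given by `q`. -/
abbrev FrameIdx (n k m : ℕ) (q : ℤ) :=
  {κ : Fin m → Fin (2 * n - k) // countIn (frameH n k) κ ≤ q}

local notation "countH" => countIn (frameH n k)

theorem card_frameH (hk : k ≤ n) : (frameH n k).card = n - k := by
  have h : ((Finset.univ : Finset (Fin dM)).filter fun i : Fin dM => ¬ n ≤ (i : ℕ)).card = n := by
    simp only [not_le]
    rw [Fin.card_filter_val_lt]
    omega
  have h2 := Finset.card_filter_add_card_filter_not (s := (Finset.univ : Finset (Fin dM)))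
    (p := fun i : Fin dM => n ≤ (i : ℕ))
  rw [h, Finset.card_univ, Fintype.card_fin] at h2
  unfold frameH
  omega

section Patch

variable [IsManifold 𝓘(ℂ, EuclideanSpace ℂ (Fin n)) ω X]

theorem isManifold_real : IsManifold 𝓘(ℝ, ℂⁿ) ∞ X := by
  refine isManifold_of_contDiffOn _ _ _ fun e e' he he' => ?_
  have h := (contDiffGroupoid ω 𝓘(ℂ, ℂⁿ)).compatible he he'
  have h1 := (contDiffPregroupoid ω 𝓘(ℂ, ℂⁿ))
  have h2 := (mem_groupoid_of_pregroupoid.1 h).1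
  have h3 : ContDiffOn ℂ ω (e.symm ≫ₕ e') (e.symm ≫ₕ e').source := by
    simpa [contDiffPregroupoid, contDiffPregroupoid] using h2
  simpa using (h3.restrict_scalars ℝ).of_le le_top

theorem smooth_F (S : GenericCRSubmanifold n k X M) :
    ContMDiff 𝓘(ℝ, Model dM) 𝓘(ℝ, ℂⁿ) ∞ S.F := by
  have := isManifold_real (n := n) (X := X)
  exact S.isSmoothEmbedding.contMDiff

/-- `F` in the charts centred at `x` and `F x`. -/
def chartF (S : GenericCRSubmanifold n k X M) (x : M) :
    Model dM → ℂⁿ :=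
  chartX (S.F x) ∘ S.F ∘ (chart x).symm

/-- The domain of `chartF`. -/
def domF (S : GenericCRSubmanifold n k X M) (x : M) : Set (Model dM) :=
  (chart x).target ∩
    (chart x).symm ⁻¹' (S.F ⁻¹' (chartX (S.F x)).source)

theorem isOpen_domF (S : GenericCRSubmanifold n k X M) (x : M) : IsOpen (domF S x) :=
  (chart x).isOpen_inter_preimage_symm
    ((chartX (S.F x)).open_source.preimage (smooth_F S).continuous)

theorem mem_domF (S : GenericCRSubmanifold n k X M) (x : M) :
    chart x x ∈ domF S x := by
  refine ⟨mem_chart_target _ x, ?_⟩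
  rw [mem_preimage, (chart x).left_inv (mem_chart_source _ x)]
  exact mem_chart_source _ _

theorem chartF_self (S : GenericCRSubmanifold n k X M) (x : M) :
    ContDiffAt ℝ ∞ (chartF S x) (chart x x) ∧
    HasFDerivAt (chartF S x) (tangentMap n k S.F x) (chart x x) := by
  have h := smooth_F S x
  constructor
  · have h1 := (contMDiffAt_iff.1 h).2
    simpa [contDiffWithinAt_univ, extChartAt, chartF] using h1
  · have h1 := (h.mdifferentiableAt (by simp)).hasMFDerivAt.2
    have h2 : HasFDerivWithinAt (chartF S x) (tangentMap n k S.F x) univ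
        (chart x x) := by
      simp only [writtenInExtChartAt, extChartAt, mfld_simps] at h1
      exact h1
    exact hasFDerivWithinAt_univ.1 h2

/-- Near every point of its domain, `chartF S x` is smooth, and its differential is the tangent
map of `F`, up to the complex-linear change of coordinates of `X`. -/
theorem chartF_at (S : GenericCRSubmanifold n k X M) (x : M) {y : Model dM}
    (hy : y ∈ domF S x) : ContDiffAt ℝ ∞ (chartF S x) y ∧
    ∃ Θ : ℂⁿ →L[ℂ] ℂⁿ, Function.Injective Θ ∧
      ∀ v, fderiv ℝ (chartF S x) y v =
        Θ (tangentMap n k S.F ((chart x).symm y)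
          (coordChange x ((chart x).symm y) ((chart x).symm y) v)) := by
  set m := (chart x).symm y with hm
  have hms : m ∈ (chart m).source := mem_chart_source _ _
  have h1 := tangentCoordChange_eq_fderiv x m hy.1 hms
  have h2 := contDiffAt_transition x m hy.1 hms
  obtain ⟨h3, h4⟩ := chartF_self S m
  set z := S.F m with hz
  have hzs : z ∈ (chartX z).source := mem_chart_source _ _
  have hzx : z ∈ (chartX (S.F x)).source := hy.2
  have hext : z ∈ (extChartAt 𝓘(ℂ, ℂⁿ) z).source ∩
      (extChartAt 𝓘(ℂ, ℂⁿ) (S.F x)).source := by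
    simpa only [extChartAt_source] using ⟨hzs, hzx⟩
  have : IsManifold 𝓘(ℂ, ℂⁿ) 1 X := IsManifold.of_le (n := ω) le_top
  have h5 := hasFDerivWithinAt_tangentCoordChange (I := 𝓘(ℂ, ℂⁿ)) hext
  have h5' : HasFDerivAt (𝕜 := ℂ) (chartX (S.F x) ∘ (chartX z).symm)
      (tangentCoordChange 𝓘(ℂ, ℂⁿ) z (S.F x) z)
      (chartX z z) := by
    simpa [extChartAt, hasFDerivWithinAt_univ] using h5
  have h6 : ContDiffAt ℂ ω (chartX (S.F x) ∘ (chartX z).symm) (chartX z z) := by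
    have h := contDiffWithinAt_ext_coord_change (I := 𝓘(ℂ, ℂⁿ)) (n := ω)
      (S.F x) z (y := chartX z z) (by simp [extChartAt, hzx])
    simpa [extChartAt, contDiffWithinAt_univ] using h
  have hev : chartF S x =ᶠ[𝓝 y] (chartX (S.F x) ∘ (chartX z).symm) ∘ (chartF S m ∘
        (chart m ∘ (chart x).symm)) := by
    have hc : ContinuousAt (chart x).symm y :=
      (chart x).continuousAt_symm hy.1
    have e1 := hc.preimage_mem_nhds ((chart m).open_source.mem_nhds hms)
    have e2 := hc.preimage_mem_nhds (((chartX z).open_source.preimage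
      (smooth_F S).continuous).mem_nhds hzs)
    filter_upwards [e1, e2] with y' e1 e2
    simp only [chartF, Function.comp_apply]
    rw [(chart m).left_inv e1]
    rw [(chartX z).left_inv e2]
  have hFm : chartF S m (chart m m) =
      chartX z z := by
    simp only [chartF, Function.comp_apply]
    rw [(chart m).left_inv hms]
  have h3' : ContDiffAt ℝ ∞ (chartF S m ∘
      (chart m ∘ (chart x).symm)) y :=
    ContDiffAt.comp (g := chartF S m) y h3 h2
  have h4' : HasFDerivAt (chartF S m ∘
      (chart m ∘ (chart x).symm)) _ y :=
    HasFDerivAt.comp (g := chartF S m) y h4 h1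
  have hval : (chartF S m ∘
      (chart m ∘ (chart x).symm)) y =
      chartX z z := hFm
  rw [← hval] at h5' h6
  constructor
  · refine ContDiffAt.congr_of_eventuallyEq ?_ hev
    exact ContDiffAt.comp y ((h6.restrict_scalars ℝ).of_le le_top) h3'
  · refine ⟨tangentCoordChange 𝓘(ℂ, ℂⁿ) z (S.F x) z, ?_, fun v => ?_⟩
    · intro u v huv
      have hu : ∀ u, tangentCoordChange 𝓘(ℂ, ℂⁿ) (S.F x) z z
          (tangentCoordChange 𝓘(ℂ, ℂⁿ) z (S.F x) z u) = u := by
        intro u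
        rw [tangentCoordChange_comp, tangentCoordChange_self]
        · exact hext.1
        · exact ⟨⟨hext.1, hext.2⟩, hext.1⟩
      rw [← hu u, huv, hu v]
    · have h7 := ((h5'.restrictScalars ℝ).comp y h4').congr_of_eventuallyEq hev
      rw [h7.fderiv]
      rfl

/-- The differentials of the components of `F` in a chart, completed by constant forms, are a frame
which is adapted to `H_{0,1} M`. -/
theorem exists_frame (hk : k ≤ n) (S : GenericCRSubmanifold n k X M) (x : M) :
    ∃ w : Model dM → Fin dM → ℂ,
      ContDiffOn ℝ ∞ w (domF S x) ∧
      (cplxMatrix (fderiv ℝ w (chart x x))).det ≠ 0 ∧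
      ∀ y ∈ domF S x, ∀ u : Model dM × Model dM,
        (∀ i ∉ frameH n k, (cplxMatrix (fderiv ℝ w y)).mulVec (cvec u) i = 0) ↔
          fderiv ℝ (chartF S x) y u.1 + Complex.I • fderiv ℝ (chartF S x) y u.2 = 0 := by
  have hnd : n ≤ 2 * n - k := by omega
  set A : Model dM →L[ℝ] ℂⁿ := tangentMap n k S.F x with hA
  -- the complex-linear extension of the differential of `F` at `x`
  let P : (Fin dM → ℂ) →ₗ[ℂ] (Fin n → ℂ) :=
    Matrix.mulVecLin (fun (i : Fin n) (j : Fin dM) => A (stdVec dM j) i)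
  have hPreal : ∀ v : Model dM, P (fun j => ((v j : ℝ) : ℂ)) = fun i => A v i := by
    intro v
    have h : v = ∑ i, v i • stdVec dM i := by
      have := ((EuclideanSpace.basisFun (Fin dM) ℝ).toBasis.sum_repr v).symm
      rw [← stdVec_eq_basisFun] at this
      simpa using this
    conv_rhs => rw [h, map_sum]
    ext i
    rw [show P (fun j => ((v j : ℝ) : ℂ)) i = ∑ j, A (stdVec dM j) i * ((v j : ℝ) : ℂ) from rfl]
    simp [mul_comm]
  have hP : Function.Surjective P := by
    have h1 : (⊤ : Submodule ℂ ℂⁿ) ≤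
        (LinearMap.range P).comap (WithLp.linearEquiv 2 ℂ (Fin n → ℂ)).toLinearMap := by
      rw [← S.generic x, Submodule.span_le]
      rintro _ ⟨v, rfl⟩
      exact ⟨_, hPreal v⟩
    intro u
    exact h1 (x := WithLp.toLp 2 u) trivial
  obtain ⟨Q, hQ⟩ := exists_completion hnd P hP
  let ofR : Model dM →L[ℝ] (Fin dM → ℂ) :=
    ContinuousLinearMap.pi fun j => Complex.ofRealCLM.comp (EuclideanSpace.proj j)
  let Qr : Model dM →L[ℝ] (Fin (2 * n - k - n) → ℂ) :=
    ((LinearMap.toContinuousLinearMap Q).restrictScalars ℝ).comp ofR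
  -- the frame formed by `L : ℝ^d → ℂ^n` and the remaining forms
  let glue : ℂⁿ →L[ℝ] (Fin dM → ℂ) :=
    ContinuousLinearMap.pi fun i : Fin dM => if h : (i : ℕ) < n then
      ((EuclideanSpace.proj (𝕜 := ℂ) (⟨i, h⟩ : Fin n)).restrictScalars ℝ) else 0
  let glue' : (Fin (2 * n - k - n) → ℂ) →L[ℝ] (Fin dM → ℂ) :=
    ContinuousLinearMap.pi fun i : Fin dM => if h : (i : ℕ) < n then 0 else
      ContinuousLinearMap.proj (⟨i - n, by omega⟩ : Fin (2 * n - k - n))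
  have hglue : ∀ (u : ℂⁿ) (v : Fin (2 * n - k - n) → ℂ) (i : Fin dM),
      (glue u + glue' v) i = if h : (i : ℕ) < n then u ⟨i, h⟩ else v ⟨i - n, by omega⟩ := by
    intro u v i
    by_cases h : (i : ℕ) < n
    · simp [glue, glue', h]
    · simp [glue, glue', h]
  let w : Model dM → Fin dM → ℂ := fun y => glue (chartF S x y) + glue' (Qr y)
  have hw : ∀ y ∈ domF S x, HasFDerivAt w (glue.comp (fderiv ℝ (chartF S x) y) + glue'.comp Qr) y := by
    intro y hy
    exact (glue.hasFDerivAt.comp y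
      ((chartF_at S x hy).1.differentiableAt (by simp)).hasFDerivAt).add
      (glue'.hasFDerivAt.comp y Qr.hasFDerivAt)
  have hmul : ∀ y ∈ domF S x, ∀ (u : Model dM × Model dM) (i : Fin dM),
      (cplxMatrix (fderiv ℝ w y)).mulVec (cvec u) i = if h : (i : ℕ) < n then
        (fderiv ℝ (chartF S x) y u.1 + Complex.I • fderiv ℝ (chartF S x) y u.2) ⟨i, h⟩ else
        (Qr u.1 + Complex.I • Qr u.2) ⟨i - n, by omega⟩ := by
    intro y hy u i
    rw [cplxMatrix_mulVec_cvec, (hw y hy).fderiv]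
    have e : ∀ u, (glue.comp (fderiv ℝ (chartF S x) y) + glue'.comp Qr) u =
      glue (fderiv ℝ (chartF S x) y u) + glue' (Qr u) := fun _ => rfl
    rw [e, e, Pi.add_apply, Pi.smul_apply, hglue, hglue]
    by_cases h : (i : ℕ) < n
    · simp [h]
    · simp [h]
  have hx : chart x x ∈ domF S x := mem_domF S x
  refine ⟨w, fun y hy => ?_, ?_, fun y hy u => ?_⟩
  · exact ((glue.contDiff.contDiffAt.comp y (chartF_at S x hy).1).add
      (glue'.contDiff.comp Qr.contDiff).contDiffAt).contDiffWithinAt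
  · intro hdet
    obtain ⟨v, hv0, hv⟩ := Matrix.exists_mulVec_eq_zero_iff.2 hdet
    obtain ⟨u, rfl⟩ := cvec_surjective v
    apply hv0
    have hc : cvec u = (fun i => ((u.1 i : ℝ) : ℂ)) + Complex.I • fun i => ((u.2 i : ℝ) : ℂ) := by
      ext i; simp [cvec]
    refine hQ _ ?_ ?_
    · rw [hc, map_add, map_smul, hPreal, hPreal]
      ext i
      have h := congrFun hv ⟨i, by omega⟩
      rw [hmul _ hx, dif_pos i.2, (chartF_self S x).2.fderiv] at h
      simpa using h
    · have hQr : ∀ v : Model dM, Q (fun i => ((v i : ℝ) : ℂ)) = Qr v := fun v => rfl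
      rw [hc, map_add, map_smul, hQr, hQr]
      ext i
      have h := congrFun hv ⟨i + n, by omega⟩
      rw [hmul _ hx, dif_neg (by simp)] at h
      simpa using h
  · constructor
    · intro h
      ext i
      have h1 := h ⟨i, by omega⟩ (by simp [frameH])
      rw [hmul y hy, dif_pos i.2] at h1
      simpa using h1
    · intro h i hi
      have hin : (i : ℕ) < n := by simpa [frameH] using hi
      rw [hmul y hy, dif_pos hin, h]
      rfl

/-- `H_{0,1} M` is the kernel of the complexified differential of `F` in charts. -/
theorem mem_H01_iff (S : GenericCRSubmanifold n k X M) (x : M) {y : Model dM}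
    (hy : y ∈ domF S x) (u : Model dM × Model dM) :
    (coordChange x ((chart x).symm y) ((chart x).symm y) u.1,
      coordChange x ((chart x).symm y) ((chart x).symm y) u.2) ∈
      H01 S ((chart x).symm y) ↔
    fderiv ℝ (chartF S x) y u.1 + Complex.I • fderiv ℝ (chartF S x) y u.2 = 0 := by
  obtain ⟨Θ, hΘ, h⟩ := (chartF_at S x hy).2
  rw [h, h, ← map_smul, ← map_add, map_eq_zero_iff Θ hΘ]
  rfl

theorem tangentCoordChange_inverse {d : ℕ} {M : Type*} [TopologicalSpace M] [ChartedSpace (Model d) M]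
    [IsManifold 𝓘(ℝ, Model d) ∞ M] {x m : M} (hm : m ∈ (chartAt (Model d) x).source) (v : Model d) :
    tangentCoordChange 𝓘(ℝ, Model d) x m m (tangentCoordChange 𝓘(ℝ, Model d) m x m v) = v := by
  rw [tangentCoordChange_comp, tangentCoordChange_self]
  · simp
  · simp only [extChartAt_source]
    exact ⟨⟨mem_chart_source _ _, hm⟩, mem_chart_source _ _⟩

/-- The bidegree can be read off in the coordinates of any chart. -/
theorem bidegAt_iff (S : GenericCRSubmanifold n k X M) (x : M) {y : Model dM}
    (hy : y ∈ domF S x) {w : Model dM → Fin dM → ℂ}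
    (hdet : (cplxMatrix (fderiv ℝ w y)).det ≠ 0)
    (hw : ∀ u : Model dM × Model dM,
        (∀ i ∉ frameH n k, (cplxMatrix (fderiv ℝ w y)).mulVec (cvec u) i = 0) ↔
          fderiv ℝ (chartF S x) y u.1 + Complex.I • fderiv ℝ (chartF S x) y u.2 = 0)
    {m : ℕ} (q : ℤ) (α : Alt dM m ℂ) :
    BidegAt S ((chart x).symm y) q α ↔
      Bideg (fderiv ℝ w y) (frameH n k) q (α.compContinuousLinearMap
        (coordChange x ((chart x).symm y) ((chart x).symm y))) := by
  rw [bideg_iff hdet]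
  constructor
  · intro h ζ hζ
    choose u hu using fun j => cvec_surjective (ζ j)
    have h1 : ζ = fun j => cvec (u j) := funext fun j => (hu j).symm
    subst h1
    rw [← complexEval_eq, complexEval_comp]
    refine h _ (hζ.trans_le ?_)
    refine Nat.cast_le.2 (Set.ncard_le_ncard (fun j hj => ?_) (Set.toFinite _))
    exact (mem_H01_iff S x hy (u j)).2 ((hw (u j)).1 hj)
  · intro h ζ hζ
    have hm := (chart x).map_target hy.1
    let u : Fin m → Model dM × Model dM := fun j =>
      (coordChange ((chart x).symm y) x
            ((chart x).symm y) (ζ j).1,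
       coordChange ((chart x).symm y) x
            ((chart x).symm y) (ζ j).2)
    have hu : ∀ j, (coordChange x
          ((chart x).symm y) ((chart x).symm y) (u j).1,
        coordChange x ((chart x).symm y) ((chart x).symm y) (u j).2) = ζ j := fun j =>
      Prod.ext (tangentCoordChange_inverse hm _) (tangentCoordChange_inverse hm _)
    have h1 := h (fun j => cvec (u j)) (hζ.trans_le ?_)
    · rw [← complexEval_eq, complexEval_comp] at h1
      simpa only [hu] using h1
    · refine Nat.cast_le.2 (Set.ncard_le_ncard (fun j hj => ?_) (Set.toFinite _))
      refine (hw (u j)).2 ((mem_H01_iff S x hy (u j)).1 ?_)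
      rw [hu j]
      exact hj

/-- A coordinate patch around `x` on which the CR structure and the orientation have a normal form:
`fderiv ℝ w` is a smooth frame of complex `1`-forms adapted to `H_{0,1} M`, given by the
differentials of functions, and the sign of the orientation is constant. -/
structure Patch (S : GenericCRSubmanifold n k X M) (x : M) where
  /-- The patch, read in the chart centred at `x`. -/
  O : Set (Model dM)
  /-- The functions whose differentials form the frame. -/
  w : Model dM → Fin dM → ℂ
  /-- The orientation. -/
  σ : ℝ
  isOpen : IsOpen O
  mem : chart x x ∈ O
  subset : O ⊆ (chart x).target
  smooth : ContDiffOn ℝ ∞ w O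
  det_ne_zero : ∀ y ∈ O, (cplxMatrix (fderiv ℝ w y)).det ≠ 0
  sign_ne_zero : σ ≠ 0
  sign_eq : ∀ y ∈ O, orientSign S.Ω x y = σ
  bidegAt_iff : ∀ y ∈ O, ∀ {m : ℕ} (q : ℤ) (α : Alt dM m ℂ),
    BidegAt S ((chart x).symm y) q α ↔
      Bideg (fderiv ℝ w y) (frameH n k) q (α.compContinuousLinearMap
        (coordChange x ((chart x).symm y) ((chart x).symm y)))

theorem nonempty_patch (hk : k ≤ n) (S : GenericCRSubmanifold n k X M) (x : M) :
    Nonempty (Patch S x) := by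
  obtain ⟨w, hw1, hw2, hw3⟩ := exists_frame hk S x
  set y₀ := chart x x with hy₀
  have hx : y₀ ∈ domF S x := mem_domF S x
  have hxt : y₀ ∈ (chart x).target := hx.1
  have hD : ContinuousOn (fun y => (cplxMatrix (fderiv ℝ w y)).det) (domF S x) := by
    have h1 : ContinuousOn (fderiv ℝ w) (domF S x) :=
      hw1.continuousOn_fderiv_of_isOpen (isOpen_domF S x) (by simp)
    have h2 : Continuous fun B : Model dM →L[ℝ] (Fin dM → ℂ) =>
        (cplxMatrix B).det := by
      refine Continuous.matrix_det ?_
      refine continuous_matrix fun i j => ?_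
      exact (continuous_apply i).comp ((ContinuousLinearMap.apply ℝ _ (stdVec _ j)).continuous)
    exact h2.comp_continuousOn h1
  have hΩc : ContinuousOn (fun y => rep x S.Ω y (stdVec _)) (domF S x) :=
    (ContinuousAlternatingMap.apply ℝ (Model dM) ℝ _).continuous.comp_continuousOn
      ((S.isOrientationForm.1.isContForm x).mono inter_subset_left)
  have hΩ0 : rep x S.Ω y₀ (stdVec _) ≠ 0 := by
    intro h0
    apply S.isOrientationForm.2 x
    have h1 : rep x S.Ω y₀ = S.Ω x := by
      simp only [rep, hy₀]
      rw [(chart x).left_inv (mem_chart_source _ x)]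
      ext v
      simp only [ContinuousAlternatingMap.compContinuousLinearMap_apply, Function.comp_def]
      congr 1
      ext1 j
      rw [tangentCoordChange_self]
      simp
    rw [h1] at h0
    have h2 := AlternatingMap.eq_smul_basis_det (EuclideanSpace.basisFun _ ℝ).toBasis
      (S.Ω x).toAlternatingMap
    have h3 : (S.Ω x).toAlternatingMap (EuclideanSpace.basisFun _ ℝ).toBasis = 0 := by
      rw [← stdVec_eq_basisFun]; exact h0
    rw [h3, zero_smul] at h2
    exact ContinuousAlternatingMap.toAlternatingMap_injective h2
  have hs0 : SignType.sign (rep x S.Ω y₀ (stdVec _)) ≠ 0 := by simpa using hΩ0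
  -- the orientation has constant sign near `x`
  have hsgn : ∀ᶠ y in 𝓝 y₀, SignType.sign (rep x S.Ω y (stdVec _)) =
      SignType.sign (rep x S.Ω y₀ (stdVec _)) := by
    have hc := (hΩc.continuousAt ((isOpen_domF S x).mem_nhds hx))
    rcases lt_or_gt_of_ne hΩ0 with h | h
    · filter_upwards [hc.eventually (gt_mem_nhds h)] with y hy
      rw [sign_neg hy, sign_neg h]
    · filter_upwards [hc.eventually (lt_mem_nhds h)] with y hy
      rw [sign_pos hy, sign_pos h]
  have hdet : ∀ᶠ y in 𝓝 y₀, (cplxMatrix (fderiv ℝ w y)).det ≠ 0 :=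
    (hD.continuousAt ((isOpen_domF S x).mem_nhds hx)).eventually_ne hw2
  obtain ⟨O, hO, hOo, hxO⟩ := eventually_nhds_iff.1
    (hsgn.and (hdet.and ((isOpen_domF S x).eventually_mem hx)))
  refine ⟨⟨O, w, (SignType.sign (rep x S.Ω y₀ (stdVec _)) : ℝ), hOo, hxO,
    fun y hy => (hO y hy).2.2.1, hw1.mono fun y hy => (hO y hy).2.2, fun y hy => (hO y hy).2.1, ?_,
    fun y hy => ?_, fun y hy m q α => ?_⟩⟩
  · revert hs0
    cases SignType.sign (rep x S.Ω y₀ (stdVec _)) <;> simp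
  · rw [orientSign, (hO y hy).1]
  · exact bidegAt_iff S x (hO y hy).2.2 (hO y hy).2.1 (hw3 y (hO y hy).2.2) q α

end Patch

section PatchCalculus

/-- The form `dw_{κ 1} ∧ ⋯ ∧ dw_{κ m}`. -/
def Patch.frame (P : Patch S x) (κ : Fin m → Fin dM) (y : Model dM) :
    Alt dM m ℂ := coframe (fderiv ℝ P.w y) κ

theorem Patch.contDiffAt_fderiv (P : Patch S x) {y : Model dM} (hy : y ∈ P.O) :
    ContDiffAt ℝ ∞ (fderiv ℝ P.w) y :=
  (P.smooth.contDiffAt (P.isOpen.mem_nhds hy)).fderiv_right (by simp)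

theorem Patch.contDiffAt_frame (P : Patch S x) (κ : Fin m → Fin dM)
    {y : Model dM} (hy : y ∈ P.O) : ContDiffAt ℝ ∞ (P.frame κ) y := by
  refine contDiffAt_alt fun μ => ?_
  have h : (fun z => P.frame κ z fun j => stdVec _ (μ j)) =
      fun z => Matrix.det (fun i j => fderiv ℝ P.w z (stdVec _ (μ i)) (κ j)) := rfl
  rw [h]
  refine contDiffAt_det fun i j => ?_
  exact contDiffAt_pi.1 ((P.contDiffAt_fderiv hy).clm_apply contDiffAt_const) (κ j)

theorem Patch.extDeriv_frame (P : Patch S x) (κ : Fin m → Fin dM)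
    {y : Model dM} (hy : y ∈ P.O) : extDeriv (P.frame κ) y = 0 := by
  have h : extDeriv (fun z => (constDet κ).compContinuousLinearMap (fderiv ℝ P.w z)) y =
      (extDeriv (fun _ : Fin dM → ℂ => constDet κ) (P.w y)).compContinuousLinearMap
        (fderiv ℝ P.w y) :=
    extDeriv_pullback (r := ∞) (differentiableAt_const _)
      (P.smooth.contDiffAt (P.isOpen.mem_nhds hy)) (by
        rw [minSmoothness_of_isRCLikeNormedField]
        exact WithTop.coe_le_coe.2 (le_top : (2 : ℕ∞) ≤ ⊤))
  have h0 : extDeriv (fun _ : Fin dM → ℂ => constDet κ) (P.w y) = 0 := by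
    rw [extDeriv, fderiv_const_apply]
    exact (ContinuousAlternatingMap.alternatizeUncurryFinCLM ℝ _ ℂ).map_zero
  rw [h0] at h
  refine h.trans ?_
  ext v
  rfl

theorem Patch.contDiffAt_det (P : Patch S x) {y : Model dM} (hy : y ∈ P.O) :
    ContDiffAt ℝ ∞ (fun z => (cplxMatrix (fderiv ℝ P.w z)).det) y :=
  CRSerre.contDiffAt_det fun i _ =>
    contDiffAt_pi.1 ((P.contDiffAt_fderiv hy).clm_apply contDiffAt_const) i

/-- The coefficients with respect to the frame depend smoothly on the point. -/
theorem Patch.exists_coeff (P : Patch S x) (κ : Fin m → Fin dM) :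
    ∃ L : Model dM → Alt dM m ℂ →L[ℝ] ℂ,
      (∀ y ∈ P.O, ContDiffAt ℝ ∞ L y) ∧
      ∀ y ∈ P.O, ∀ α, L y α = coeff (fderiv ℝ P.w y) κ α := by
  by_cases hκ : Function.Injective κ
  swap
  · refine ⟨0, fun y _ => contDiffAt_const, fun y _ α => ?_⟩
    rw [coeff_eq_zero_of_not_injective _ hκ]
    rfl
  obtain ⟨b, hb⟩ : ∃ b, m + b = 2 * n - k := by
    have := Fintype.card_le_of_injective κ hκ
    simp only [Fintype.card_fin] at this
    exact ⟨2 * n - k - m, by omega⟩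
  obtain ⟨τ, hτ⟩ := exists_sum_equiv hb κ hκ
  obtain ⟨ε, hε, h⟩ := exists_wedgeTop_coframe hb τ
  refine ⟨fun y => (ContinuousLinearMap.mul ℝ ℂ (ε * (cplxMatrix (fderiv ℝ P.w y)).det)⁻¹).comp
    (wedgeTopR dM m b (P.frame (fun j => τ (Sum.inr j)) y)), fun y hy => ?_,
    fun y hy α => ?_⟩
  · have h1 : ContDiffAt ℝ ∞ (fun z => (ε * (cplxMatrix (fderiv ℝ P.w z)).det)⁻¹) y :=
      (contDiffAt_const.mul (P.contDiffAt_det hy)).inv (mul_ne_zero hε (P.det_ne_zero y hy))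
    have h0 : ContDiff ℝ ∞ fun β : Alt dM b ℂ => wedgeTopR dM m b β :=
      ContinuousLinearMap.contDiff (𝕜 := ℝ) (E := Alt dM b ℂ)
        (F := Alt dM m ℂ →L[ℝ] ℂ) (wedgeTopR dM m b)
    have h2 : ContDiffAt ℝ ∞ (fun z =>
        wedgeTopR dM m b (P.frame (fun j => τ (Sum.inr j)) z)) y :=
      h0.contDiffAt.comp y (P.contDiffAt_frame (fun j => τ (Sum.inr j)) hy)
    have h3 : ContDiffAt ℝ ∞ (fun z =>
        ContinuousLinearMap.mul ℝ ℂ (ε * (cplxMatrix (fderiv ℝ P.w z)).det)⁻¹) y :=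
      (ContinuousLinearMap.mul ℝ ℂ).contDiff.contDiffAt.comp y h1
    exact h3.clm_comp h2
  · have h1 := h (fderiv ℝ P.w y) (P.det_ne_zero y hy) α
    have h2 : ((ContinuousLinearMap.mul ℝ ℂ (ε * (cplxMatrix (fderiv ℝ P.w y)).det)⁻¹).comp
      (wedgeTopR dM m b (P.frame (fun j => τ (Sum.inr j)) y))) α =
      (ε * (cplxMatrix (fderiv ℝ P.w y)).det)⁻¹ *
        wedgeTop α (coframe (fderiv ℝ P.w y) fun j => τ (Sum.inr j)) := rfl
    rw [h2, h1, ← mul_assoc, inv_mul_cancel₀ (mul_ne_zero hε (P.det_ne_zero y hy)), one_mul]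
    congr 1
    funext i
    exact hτ i

theorem bidegAt_iff_rep (P : Patch S x) {y : Model dM} (hy : y ∈ P.O)
    (q : ℤ) (f : M → Alt dM m ℂ) :
    BidegAt S ((chart x).symm y) q (f ((chart x).symm y)) ↔
      Bideg (fderiv ℝ P.w y) (frameH n k) q (rep x f y) := P.bidegAt_iff y hy q _

theorem IsBidegree.bideg_rep {q : ℤ} {f : M → Alt dM m ℂ} (hf : IsBidegree S q f)
    (P : Patch S x) {y : Model dM} (hy : y ∈ P.O) :
    Bideg (fderiv ℝ P.w y) (frameH n k) q (rep x f y) :=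
  (bidegAt_iff_rep P hy q f).1 (hf _)

theorem bidegAt_zero (S : GenericCRSubmanifold n k X M) (y : M) (q : ℤ) :
    BidegAt S y q (0 : Alt dM m ℂ) := fun ζ _ => by simp [complexEval]

theorem isBidegree_of_patch [T2Space M] (P : Patch S x) {C : Set M}
    (hCx : C ⊆ (chart x).source) (hCO : chart x '' C ⊆ P.O)
    {q : ℤ} {f : M → Alt dM m ℂ} (hf0 : ∀ y ∉ C, f y = 0)
    (hf : ∀ y ∈ chart x '' C,
      Bideg (fderiv ℝ P.w y) (frameH n k) q (rep x f y)) : IsBidegree S q f := by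
  intro z
  show BidegAt S z q (f z)
  by_cases hz : z ∈ C
  · have h := (bidegAt_iff_rep P (hCO ⟨z, hz, rfl⟩) q f).2 (hf _ ⟨z, hz, rfl⟩)
    rwa [(chart x).left_inv (hCx hz)] at h
  · rw [hf0 z hz]
    exact bidegAt_zero S z q

theorem IsBidegree.mulSec {q : ℤ} {f : M → Alt dM m ℂ} (hf : IsBidegree S q f)
    (χ : M → ℝ) : IsBidegree S q (mulSec χ f) := fun y ζ h => by
  rw [CRSerre.mulSec, complexEval_smul, hf y ζ h, mul_zero]

theorem rep_eq_sum_frame (P : Patch S x) {q : ℤ} {f : M → Alt dM m ℂ}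
    (hf : IsBidegree S q f) {y : Model dM} (hy : y ∈ P.O) :
    rep x f y = ((m.factorial : ℂ))⁻¹ • ∑ κ : FrameIdx n k m q,
      coeff (fderiv ℝ P.w y) κ.1 (rep x f y) • P.frame κ.1 y := by
  conv_lhs => rw [alt_eq_sum_coframe (P.det_ne_zero y hy) (rep x f y)]
  congr 1
  rw [← Finset.sum_filter_add_sum_filter_not Finset.univ
    (fun κ : Fin m → Fin dM => (countH κ : ℤ) ≤ q)]
  have h0 : ∑ κ : Fin m → Fin dM with ¬ (countH κ : ℤ) ≤ q,
      coeff (fderiv ℝ P.w y) κ (rep x f y) • coframe (fderiv ℝ P.w y) κ = 0 := by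
    refine Finset.sum_eq_zero fun κ hκ => ?_
    rw [hf.bideg_rep P hy κ (not_le.1 (Finset.mem_filter.1 hκ).2), zero_smul]
  rw [h0, add_zero]
  exact Finset.sum_subtype _ (by simp) _

/-- The exterior derivative raises the bidegree at most by `(0, 1)`. -/
theorem IsBidegree.dForm (hS : ∀ x, Nonempty (Patch S x)) {q : ℤ} {f : M → Alt dM m ℂ}
    (hs : IsSmoothForm f) (hf : IsBidegree S q f) : IsBidegree S (q + 1) (dForm f) := by
  intro z
  show BidegAt S z (q + 1) (CRSerre.dForm f z)
  obtain ⟨P⟩ := hS z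
  have h1 := (bidegAt_iff_rep P P.mem (q + 1) (CRSerre.dForm f)).2
  rw [(chart z).left_inv (mem_chart_source _ z)] at h1
  apply h1
  rw [rep_dForm z hs (mem_chart_target _ z)]
  set y₀ := chart z z
  choose L hL hL' using fun κ : Fin m → Fin dM => P.exists_coeff κ
  have hfs : ContDiffAt ℝ ∞ (rep z f) y₀ :=
    (hs z).contDiffAt ((chart z).open_target.mem_nhds (mem_chart_target _ z))
  have hev : rep z f =ᶠ[𝓝 y₀] fun y => ∑ κ : FrameIdx n k m q,
      (((m.factorial : ℂ))⁻¹ * L κ.1 y (rep z f y)) • P.frame κ.1 y := by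
    filter_upwards [P.isOpen.mem_nhds P.mem] with y hy
    conv_lhs => rw [rep_eq_sum_frame P hf hy]
    rw [Finset.smul_sum]
    refine sum_ext fun κ => ?_
    rw [smul_smul, hL' κ.1 y hy]
  have hc : ∀ κ : Fin m → Fin dM,
      DifferentiableAt ℝ (fun y => ((m.factorial : ℂ))⁻¹ * L κ y (rep z f y)) y₀ := fun κ =>
    (contDiffAt_const.mul ((hL κ y₀ P.mem).clm_apply hfs)).differentiableAt (by simp)
  have he : ∀ κ : Fin m → Fin dM, DifferentiableAt ℝ (P.frame κ) y₀ := fun κ =>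
    (P.contDiffAt_frame κ P.mem).differentiableAt (by simp)
  have hsum : extDeriv (fun y => ∑ κ : FrameIdx n k m q,
      (((m.factorial : ℂ))⁻¹ * L κ.1 y (rep z f y)) • P.frame κ.1 y) y₀ =
      ∑ κ : FrameIdx n k m q,
        extDeriv (fun y => (((m.factorial : ℂ))⁻¹ * L κ.1 y (rep z f y)) • P.frame κ.1 y) y₀ := by
    unfold extDeriv
    rw [fderiv_fun_sum fun κ _ => (hc κ.1).smul (he κ.1)]
    exact map_sum (ContinuousAlternatingMap.alternatizeUncurryFinCLM ℝ (Model dM) ℂ) _ _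
  rw [hev.extDeriv_eq, hsum]
  refine Bideg.sum fun κ _ => ?_
  rw [extDeriv_smul_form (hc κ.1) (he κ.1), P.extDeriv_frame κ.1 P.mem, smul_zero, add_zero]
  exact (bideg_coframe (P.det_ne_zero _ P.mem) κ.2).wedgeLin _

end PatchCalculus

/-! ### Localization of the pairing -/

section Atlas

/-- Patches around all points, together with a subordinate smooth partition of unity by functions
with compact support. -/
structure PatchAtlas (S : GenericCRSubmanifold n k X M) where
  /-- The patch around `x`. -/
  patch : ∀ x, Patch S x
  /-- The partition of unity. -/
  χ : SmoothPartitionOfUnity M 𝓘(ℝ, Model dM) M univ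
  isCompact : ∀ x, IsCompact (tsupport (χ x))
  subset_source : ∀ x, tsupport (χ x) ⊆ (chart x).source
  image_subset : ∀ x, chart x '' tsupport (χ x) ⊆ (patch x).O

theorem nonempty_patchAtlas [T2Space M] [SigmaCompactSpace M]
    [IsManifold 𝓘(ℂ, ℂⁿ) ω X] (hk : k ≤ n)
    (S : GenericCRSubmanifold n k X M) : Nonempty (PatchAtlas S) := by
  let P : ∀ x, Patch S x := fun x => (nonempty_patch hk S x).some
  have hr : ∀ x, ∃ r : ℝ, 0 < r ∧
      Metric.closedBall (chart x x) r ⊆ (P x).O := fun x =>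
    Metric.nhds_basis_closedBall.mem_iff.1 ((P x).isOpen.mem_nhds (P x).mem)
  choose r hr0 hr using hr
  let U : M → Set M := fun x => (chart x).source ∩
    chart x ⁻¹' Metric.ball (chart x x) (r x)
  have hUo : ∀ x, IsOpen (U x) := fun x =>
    (chart x).isOpen_inter_preimage Metric.isOpen_ball
  have hxU : ∀ x, x ∈ U x := fun x => ⟨mem_chart_source _ x, Metric.mem_ball_self (hr0 x)⟩
  obtain ⟨χ, hχ⟩ := SmoothPartitionOfUnity.exists_isSubordinate 𝓘(ℝ, Model dM)
    (isClosed_univ (X := M)) U hUo fun x _ => mem_iUnion.2 ⟨x, hxU x⟩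
  refine ⟨⟨P, χ, fun x => ?_, fun x => (hχ x).trans inter_subset_left, fun x => ?_⟩⟩
  · have h1 : IsCompact ((chart x).symm ''
        Metric.closedBall (chart x x) (r x)) :=
      (isCompact_closedBall _ _).image_of_continuousOn
        ((chart x).continuousOn_symm.mono ((hr x).trans (P x).subset))
    refine h1.of_isClosed_subset (isClosed_tsupport _) fun y hy => ?_
    have h2 := hχ x hy
    exact ⟨_, Metric.ball_subset_closedBall h2.2, (chart x).left_inv h2.1⟩
  · rintro _ ⟨y, hy, rfl⟩
    exact hr x (Metric.ball_subset_closedBall (hχ x hy).2)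

/-- The support of the function `χ_x` of the partition of unity, read in the chart at `x`. -/
def PatchAtlas.K (𝒜 : PatchAtlas S) (x : M) : Set (Model dM) :=
  chart x '' tsupport (𝒜.χ x)

theorem PatchAtlas.isCompact_K (𝒜 : PatchAtlas S) (x : M) : IsCompact (𝒜.K x) :=
  isCompact_chart_image (𝒜.isCompact x) (𝒜.subset_source x)

theorem PatchAtlas.K_subset (𝒜 : PatchAtlas S) (x : M) : 𝒜.K x ⊆ (𝒜.patch x).O :=
  𝒜.image_subset x

theorem PatchAtlas.K_subset_target (𝒜 : PatchAtlas S) (x : M) :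
    𝒜.K x ⊆ (chart x).target := (𝒜.image_subset x).trans (𝒜.patch x).subset

/-- The function `χ_x` of the partition of unity, read in the chart at `x`, extended by `0`. -/
def PatchAtlas.cutoff (𝒜 : PatchAtlas S) (x : M) : Model dM → ℝ :=
  (chart x).target.indicator (𝒜.χ x ∘ (chart x).symm)

theorem PatchAtlas.cutoff_eq (𝒜 : PatchAtlas S) (x : M) {y : Model dM}
    (hy : y ∈ (chart x).target) :
    𝒜.cutoff x y = 𝒜.χ x ((chart x).symm y) := indicator_of_mem hy _

theorem PatchAtlas.cutoff_eq_zero (𝒜 : PatchAtlas S) (x : M) {y : Model dM}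
    (hy : y ∉ 𝒜.K x) : 𝒜.cutoff x y = 0 := by
  by_cases h : y ∈ (chart x).target
  · rw [𝒜.cutoff_eq x h]
    exact image_eq_zero_of_notMem_tsupport fun h2 =>
      hy ((mem_chart_image (𝒜.subset_source x) h).2 h2)
  · exact indicator_of_notMem h _

theorem PatchAtlas.tsupport_cutoff (𝒜 : PatchAtlas S) (x : M) : tsupport (𝒜.cutoff x) ⊆ 𝒜.K x := by
  have h : Function.support (𝒜.cutoff x) ⊆ 𝒜.K x := fun y hy => by
    by_contra h
    exact hy (𝒜.cutoff_eq_zero x h)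
  exact closure_minimal h (𝒜.isCompact_K x).isClosed

theorem PatchAtlas.hasCompactSupport_cutoff (𝒜 : PatchAtlas S) (x : M) :
    HasCompactSupport (𝒜.cutoff x) :=
  (𝒜.isCompact_K x).of_isClosed_subset (isClosed_tsupport _) (𝒜.tsupport_cutoff x)

theorem PatchAtlas.cutoff_eventuallyEq (𝒜 : PatchAtlas S) (x : M) {y : Model dM}
    (hy : y ∈ (chart x).target) :
    𝒜.cutoff x =ᶠ[𝓝 y] 𝒜.χ x ∘ (chart x).symm := by
  filter_upwards [(chart x).open_target.mem_nhds hy] with z hz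
  exact 𝒜.cutoff_eq x hz

theorem PatchAtlas.contDiff_cutoff (𝒜 : PatchAtlas S) (x : M) : ContDiff ℝ ∞ (𝒜.cutoff x) := by
  rw [contDiff_iff_contDiffAt]
  intro y
  by_cases h : y ∈ (chart x).target
  · exact ((contDiffOn_chart (𝒜.χ x).contMDiff x).contDiffAt
      ((chart x).open_target.mem_nhds h)).congr_of_eventuallyEq
        (𝒜.cutoff_eventuallyEq x h)
  · have h2 : y ∉ tsupport (𝒜.cutoff x) := fun h3 => h (𝒜.K_subset_target x (𝒜.tsupport_cutoff x h3))
    exact contDiffAt_const.congr_of_eventuallyEq (notMem_tsupport_iff_eventuallyEq.1 h2)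

section

variable [T2Space M] [SigmaCompactSpace M]

/-- The pairing of forms when the integrand is supported in a compact subset of a patch. -/
theorem Patch.pairing_eq {x : M} (P : Patch S x) (hpp' : p⁻¹ + p'⁻¹ = 1) {C : Set M} (hC : IsCompact C)
    (hCx : C ⊆ (chart x).source)
    (hCO : chart x '' C ⊆ P.O)
    {f : M → Alt dM a ℂ} {g : M → Alt dM b ℂ}
    (hf : MemLp (rep x f) p (volume.restrict (chart x '' C)))
    (hg : MemLp (rep x g) p' (volume.restrict (chart x '' C)))
    (h0 : ∀ y ∉ C, f y = 0 ∨ g y = 0) :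
    pairing S.Ω f g = P.σ * ∫ y in chart x '' C, wedgeTop (rep x f y) (rep x g y) := by
  have hK := isCompact_chart_image hC hCx
  rw [pairing_eq_chart S.isOrientationForm.1.isContForm hC hCx h0 (memLp_wedgeTop hpp' hf hg),
    ← integral_const_mul]
  refine setIntegral_congr_fun hK.measurableSet fun y hy => ?_
  rw [P.sign_eq y (hCO hy)]

theorem PatchAtlas.pairing_mulSec (𝒜 : PatchAtlas S) (x : M) (hpp' : p⁻¹ + p'⁻¹ = 1)
    {f : M → Alt dM a ℂ} {g : M → Alt dM b ℂ} (hf : IsLpLoc p f)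
    (hg : IsLpLoc p' g) :
    pairing S.Ω (mulSec (𝒜.χ x) f) g =
      (𝒜.patch x).σ * ∫ y, (𝒜.cutoff x y : ℂ) * wedgeTop (rep x f y) (rep x g y) := by
  have hf' := hf.mulSec (χ := 𝒜.χ x) (𝒜.χ x).contMDiff.continuous
  rw [(𝒜.patch x).pairing_eq hpp' (𝒜.isCompact x) (𝒜.subset_source x) (𝒜.image_subset x)
    (hf' x _ (𝒜.isCompact_K x) (𝒜.K_subset_target x)) (hg x _ (𝒜.isCompact_K x) (𝒜.K_subset_target x))
    (fun y hy => Or.inl (mulSec_eq_zero (Or.inl (image_eq_zero_of_notMem_tsupport hy))))]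
  congr 1
  refine Eq.trans ?_ (setIntegral_eq_integral_of_forall_compl_eq_zero (s := 𝒜.K x) ?_)
  · refine setIntegral_congr_fun (𝒜.isCompact_K x).measurableSet fun y hy => ?_
    rw [rep_mulSec, wedgeTop_smul, 𝒜.cutoff_eq x (𝒜.K_subset_target x hy)]
  · intro y hy
    rw [𝒜.cutoff_eq_zero x hy]
    simp

theorem wedgeLin_ofReal_comp {d m : ℕ} (l : Model d →L[ℝ] ℝ) (α : Alt d m ℂ) :
    wedgeLin (Complex.ofRealCLM.comp l) α = ∑ i, (l (stdVec d i) : ℂ) • wedgeLin (dCoord i) α := by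
  conv_lhs => rw [linearForm_eq_sum (Complex.ofRealCLM.comp l)]
  rw [← wedgeLinL_apply, map_sum, sum_apply]
  refine sum_ext fun i => ?_
  ext v
  simp [wedgeLinL_apply, wedgeLin_apply, Finset.mul_sum, mul_left_comm, mul_assoc]

theorem wedgeTop_sum_right {d a b : ℕ} {ι : Type*} (T : Finset ι) (α : Alt d a ℂ)
    (β : ι → Alt d b ℂ) : wedgeTop α (∑ i ∈ T, β i) = ∑ i ∈ T, wedgeTop α (β i) := by
  rw [← wedgeTopL_apply, map_sum]
  rfl

theorem wedgeTop_sum_left {d a b : ℕ} {ι : Type*} (T : Finset ι) (α : ι → Alt d a ℂ)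
    (β : Alt d b ℂ) : wedgeTop (∑ i ∈ T, α i) β = ∑ i ∈ T, wedgeTop (α i) β := by
  rw [← wedgeTopL_apply, map_sum, sum_apply]
  rfl

theorem PatchAtlas.pairing_dWedge (𝒜 : PatchAtlas S) (x : M) (hpp' : p⁻¹ + p'⁻¹ = 1)
    {f : M → Alt dM a ℂ} {g : M → Alt dM b ℂ} (hf : IsLpLoc p f)
    (hg : IsLpLoc p' g) :
    pairing S.Ω f (dWedge (𝒜.χ x) g) =
      (𝒜.patch x).σ * ∫ y, ∑ i, (pd i (𝒜.cutoff x) y : ℂ) *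
        wedgeTop (rep x f y) (wedgeLin (dCoord i) (rep x g y)) := by
  have hg' := hg.dWedge (χ := 𝒜.χ x) (𝒜.χ x).contMDiff
  rw [(𝒜.patch x).pairing_eq hpp' (𝒜.isCompact x) (𝒜.subset_source x) (𝒜.image_subset x)
    (hf x _ (𝒜.isCompact_K x) (𝒜.K_subset_target x)) (hg' x _ (𝒜.isCompact_K x) (𝒜.K_subset_target x))
    (fun y hy => Or.inr (dWedge_eq_zero_of_notMem_tsupport hy))]
  congr 1
  refine Eq.trans ?_ (setIntegral_eq_integral_of_forall_compl_eq_zero (s := 𝒜.K x) ?_)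
  · refine setIntegral_congr_fun (𝒜.isCompact_K x).measurableSet fun y hy => ?_
    have hyt := 𝒜.K_subset_target x hy
    rw [rep_dWedge (𝒜.χ x).contMDiff g x hyt, ← (𝒜.cutoff_eventuallyEq x hyt).fderiv_eq,
      wedgeLin_ofReal_comp, wedgeTop_sum_right]
    refine sum_ext fun i => ?_
    rw [wedgeTop_smul_right]
    rfl
  · intro y hy
    exact Finset.sum_eq_zero fun i _ => by simp [pd_eq_zero fun h => hy (𝒜.tsupport_cutoff x h)]

/-- A finite set of indices of the partition of unity with sum `1` near a compact set. -/
theorem PatchAtlas.exists_finset (𝒜 : PatchAtlas S) {C : Set M} (hC : IsCompact C) :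
    ∃ T : Finset M, (∀ x ∉ T, ∀ y ∈ C, y ∉ tsupport (𝒜.χ x)) ∧
      ∀ y ∈ C, ∀ᶠ z in 𝓝 y, ∑ x ∈ T, 𝒜.χ x z = 1 := by
  have hfin := (𝒜.χ.locallyFinite.closure).finite_nonempty_inter_compact hC
  refine ⟨hfin.toFinset, fun x hx y hy h => hx ?_, fun y hy => ?_⟩
  · rw [Set.Finite.mem_toFinset]
    exact ⟨y, h, hy⟩
  · filter_upwards [𝒜.χ.eventually_finsupport_subset y] with z hz
    refine 𝒜.χ.sum_finsupport' z (mem_univ z) (hz.trans fun x hx => ?_)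
    rw [Set.Finite.mem_toFinset]
    exact ⟨y, (𝒜.χ.mem_fintsupport_iff y x).1 hx, hy⟩

theorem PatchAtlas.pairing_eq_sum (𝒜 : PatchAtlas S) (hpp' : p⁻¹ + p'⁻¹ = 1)
    {f : M → Alt dM a ℂ} {g : M → Alt dM b ℂ} (hf : IsLpLoc p f)
    (hg : IsLpLoc p' g) {C : Set M} (hC : IsCompact C) (h0 : ∀ y ∉ C, f y = 0 ∨ g y = 0)
    {T : Finset M} (hT : ∀ y ∈ C, ∀ᶠ z in 𝓝 y, ∑ x ∈ T, 𝒜.χ x z = 1) :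
    pairing S.Ω f g = ∑ x ∈ T, pairing S.Ω (mulSec (𝒜.χ x) f) g := by
  have hfg : CompactlyPaired f g := ⟨C, hC, h0⟩
  rw [← pairing_sum_left S.isOrientationForm.1.isContForm hpp' T
    (fun x _ => hf.mulSec (𝒜.χ x).contMDiff.continuous) hg
    (fun x _ => hfg.mono (fun y hy => mulSec_eq_zero (Or.inr hy)) fun _ h => h)]
  refine pairing_congr _ fun c y => ?_
  have hrep : (chart c).symm y ∈ C ∨
      f ((chart c).symm y) = 0 →
      rep c (∑ x ∈ T, mulSec (𝒜.χ x) f) y = rep c f y := by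
    intro hy
    have hs : (∑ x ∈ T, mulSec (𝒜.χ x) f) ((chart c).symm y) =
        f ((chart c).symm y) := by
      rw [Finset.sum_apply]
      rcases hy with hy | hy
      · simp only [mulSec]
        rw [← Finset.sum_smul, ← Complex.ofReal_sum, (hT _ hy).self_of_nhds, Complex.ofReal_one,
          one_smul]
      · rw [hy]
        exact Finset.sum_eq_zero fun x _ => mulSec_eq_zero (Or.inr hy)
    rw [rep, rep, hs]
  by_cases hy : (chart c).symm y ∈ C
  · rw [hrep (Or.inl hy)]
  · rcases h0 _ hy with hz | hz
    · rw [hrep (Or.inr hz)]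
    · rw [rep_eq_zero c hz, wedgeTop_zero_right, wedgeTop_zero_right]

/-- Green's formula follows from its localized version, since the differentials of the functions of
a partition of unity add up to `0`. -/
theorem PatchAtlas.green_of_local (𝒜 : PatchAtlas S) (hpp' : p⁻¹ + p'⁻¹ = 1) {ε : ℂ}
    {f : M → Alt dM a ℂ} {g : M → Alt dM (a + 1) ℂ}
    {h : M → Alt dM b ℂ} {u : M → Alt dM (b + 1) ℂ}
    (hf : IsLpLoc p f) (hg : IsLpLoc p g) (hh : IsLpLoc p' h) (hu : IsLpLoc p' u)
    {C : Set M} (hC : IsCompact C)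
    (h0 : (∀ y ∉ C, f y = 0 ∧ g y = 0) ∨ ∀ y ∉ C, h y = 0 ∧ u y = 0)
    (hloc : ∀ x, pairing S.Ω (mulSec (𝒜.χ x) g) h - ε * pairing S.Ω (mulSec (𝒜.χ x) f) u =
      ε * pairing S.Ω f (dWedge (𝒜.χ x) h)) :
    pairing S.Ω g h = ε * pairing S.Ω f u := by
  obtain ⟨T, -, hT⟩ := 𝒜.exists_finset hC
  have hΩ := S.isOrientationForm.1.isContForm
  have hfh : CompactlyPaired f h := ⟨C, hC, fun y hy =>
    h0.imp (fun h => (h y hy).1) fun h => (h y hy).1⟩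
  have e1 := 𝒜.pairing_eq_sum hpp' hg hh hC (fun y hy => h0.imp (fun h => (h y hy).2)
    fun h => (h y hy).1) hT
  have e2 := 𝒜.pairing_eq_sum hpp' hf hu hC (fun y hy => h0.imp (fun h => (h y hy).1)
    fun h => (h y hy).2) hT
  have e3 : ∑ x ∈ T, pairing S.Ω f (dWedge (𝒜.χ x) h) = 0 := by
    rw [← pairing_sum_right hΩ hpp' T hf (fun x _ => hh.dWedge (𝒜.χ x).contMDiff)
      (fun x _ => hfh.mono (fun _ h => h) fun y hy => dWedge_eq_zero hy),
      ← pairing_zero_right S.Ω f (b := b + 1)]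
    refine pairing_congr _ fun c y => ?_
    have hz0 : rep c (0 : M → Alt dM (b + 1) ℂ) y = 0 := rep_eq_zero c rfl
    by_cases hy : (chart c).symm y ∈ C
    · have h1 : (∑ x ∈ T, dWedge (𝒜.χ x) h) ((chart c).symm y) = 0 := by
        rw [Finset.sum_apply]
        exact sum_dWedge_eq_zero T (fun x _ => (𝒜.χ x).contMDiff) (hT _ hy)
      rw [rep_eq_zero c h1, hz0]
    · rcases h0 with hz | hz
      · rw [rep_eq_zero c (hz _ hy).1, wedgeTop_zero_left, wedgeTop_zero_left]
      · have h1 : (∑ x ∈ T, dWedge (𝒜.χ x) h) ((chart c).symm y) = 0 := by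
          rw [Finset.sum_apply]
          exact Finset.sum_eq_zero fun x _ => dWedge_eq_zero (hz _ hy).1
        rw [rep_eq_zero c h1, hz0]
  have e4 : ∑ x ∈ T, (pairing S.Ω (mulSec (𝒜.χ x) g) h - ε * pairing S.Ω (mulSec (𝒜.χ x) f) u) = 0 := by
    rw [sum_ext fun x => hloc x, ← Finset.mul_sum, e3, mul_zero]
  rw [Finset.sum_sub_distrib, ← Finset.mul_sum, ← e1, ← e2] at e4
  exact sub_eq_zero.1 e4

end

end Atlas

/-! ### Green's formula in a patch -/

section Integrals

variable {d : ℕ} {p p' : ℝ≥0∞} {K : Set (Model d)}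

theorem memLp_of_continuousOn {E : Type*} [NormedAddCommGroup E] [NormedSpace ℝ E] [FiniteDimensional ℝ E]
    (hK : IsCompact K) {f : Model d → E} (hf : ContinuousOn f K) :
    MemLp f p (volume.restrict K) := by
  have : IsFiniteMeasure (volume.restrict K) := ⟨by simpa using hK.measure_lt_top⟩
  obtain ⟨C, hC⟩ := hK.exists_bound_of_continuousOn hf
  exact MemLp.of_bound (hf.aestronglyMeasurable_of_isCompact hK hK.measurableSet) C
    (ae_restrict_of_forall_mem hK.measurableSet hC)

theorem integrable_mul_of_memLp [hp : Fact (1 ≤ p)] (hK : IsCompact K) {F m : Model d → ℂ}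
    (hF : MemLp F p (volume.restrict K)) (hm : Continuous m) (hm0 : ∀ y ∉ K, m y = 0) :
    Integrable (fun y => F y * m y) := by
  have : IsFiniteMeasure (volume.restrict K) := ⟨by simpa using hK.measure_lt_top⟩
  refine (integrableOn_iff_integrable_of_support_subset (s := K) fun y hy => ?_).1 ?_
  · by_contra h
    exact hy (by simp [hm0 y h])
  · obtain ⟨C, hC⟩ := hK.exists_bound_of_continuousOn hm.continuousOn
    exact (hF.integrable hp.out).mul_bdd hm.aestronglyMeasurable
      (ae_restrict_of_forall_mem hK.measurableSet hC)

theorem integrable_mul_mul_of_memLp (hpp' : p⁻¹ + p'⁻¹ = 1) (hK : IsCompact K) {F G m : Model d → ℂ}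
    (hF : MemLp F p (volume.restrict K)) (hG : MemLp G p' (volume.restrict K)) (hm : Continuous m)
    (hm0 : ∀ y ∉ K, m y = 0) : Integrable (fun y => F y * G y * m y) := by
  have : ENNReal.HolderTriple p p' 1 := ⟨by rw [hpp', inv_one]⟩
  exact integrable_mul_of_memLp (p := 1) hK
    (memLp_one_iff_integrable.2 (MemLp.integrable_mul hF hG)) hm hm0

theorem exists_cutoff {O : Set (Model d)} (hO : IsOpen O) (hK : IsCompact K) (hKO : K ⊆ O) :
    ∃ ρ : Model d → ℝ, ContDiff ℝ ∞ ρ ∧ HasCompactSupport ρ ∧ tsupport ρ ⊆ O ∧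
      ∀ y ∈ K, ρ =ᶠ[𝓝 y] fun _ => 1 := by
  obtain ⟨K', hK', h1, h2⟩ := exists_compact_between hK hO hKO
  obtain ⟨ρ, hρ1, hρ0, -⟩ := exists_contMDiffMap_one_nhds_of_subset_interior (n := (⊤ : ℕ∞))
    𝓘(ℝ, Model d) hK.isClosed h1
  have hs : tsupport ρ ⊆ K' := closure_minimal (fun y hy => by
    by_contra h
    exact hy (hρ0 y h)) hK'.isClosed
  refine ⟨ρ, ρ.contMDiff.contDiff, hK'.of_isClosed_subset (isClosed_tsupport _) hs, hs.trans h2,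
    fun y hy => ?_⟩
  exact Filter.Eventually.filter_mono (nhds_le_nhdsSet hy) hρ1

/-- The integration by parts formula for forms given on a compact set. -/
theorem friedrichs_on [Fact (1 ≤ p)] [Fact (1 ≤ p')] {ια ιβ : Type} [Fintype ια] [Fintype ιβ]
    (hp' : p' ≠ ⊤) (hpp' : p⁻¹ + p'⁻¹ = 1) (hK : IsCompact K) {V : Set (Model d)} (hV : IsOpen V)
    (hVK : V ⊆ K)
    {χ : Model d → ℝ} (hχ : ContDiff ℝ ∞ χ) (hχc : HasCompactSupport χ) (hχV : tsupport χ ⊆ V)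
    {A : ια → ιβ → Fin d → Model d → ℂ} (hA : ∀ α β i, ContDiff ℝ ∞ (A α β i))
    (hAc : ∀ α β i, HasCompactSupport (A α β i))
    (hdiv : ∀ α β, ∀ y ∈ V, ∑ i, fderiv ℝ (A α β i) y (stdVec d i) = 0)
    {f u : ια → Model d → ℂ} {g h : ιβ → Model d → ℂ}
    (hf : ∀ α, MemLp (f α) p' (volume.restrict K)) (hu : ∀ α, MemLp (u α) p (volume.restrict K))
    (hg : ∀ β, MemLp (g β) p' (volume.restrict K)) (hh : ∀ β, MemLp (h β) p (volume.restrict K))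
    (H1 : ∀ η : Model d → ℝ, ContDiff ℝ ∞ η → HasCompactSupport η → tsupport η ⊆ V → ∀ β,
      ∫ y, (η y : ℂ) * g β y = ∑ α, ∑ i, ∫ y, f α y * A α β i y * (pd i η y : ℂ))
    (H2 : ∀ η : Model d → ℝ, ContDiff ℝ ∞ η → HasCompactSupport η → tsupport η ⊆ V → ∀ α,
      ∫ y, (η y : ℂ) * u α y = - ∑ β, ∑ i, ∫ y, h β y * A α β i y * (pd i η y : ℂ)) :
    (∑ β, ∫ y, (χ y : ℂ) * (g β y * h β y)) - ∑ α, ∫ y, (χ y : ℂ) * (f α y * u α y) =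
      ∑ α, ∑ β, ∑ i, ∫ y, f α y * h β y * (A α β i y * (pd i χ y : ℂ)) := by
  have hfin : IsFiniteMeasure (volume.restrict K) := ⟨by simpa using hK.measure_lt_top⟩
  have key : ∀ {ι : Type} {s : ℝ≥0∞} {F : ι → Model d → ℂ}, 1 ≤ s →
      (∀ α, MemLp (F α) s (volume.restrict K)) → ∃ F' : ι → Model d → ℂ,
      (∀ α, Measurable (F' α)) ∧ (∀ α, MemLp (F' α) s volume) ∧ (∀ α, Integrable (F' α)) ∧
      ∀ α, ∀ᵐ y, y ∈ K → F' α y = F α y := by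
    intro ι s F hs hF
    have hae : ∀ α, (hF α).1.mk (F α) =ᵐ[volume.restrict K] F α := fun α => (hF α).1.ae_eq_mk.symm
    refine ⟨fun α => K.indicator ((hF α).1.mk (F α)), fun α =>
      (hF α).1.stronglyMeasurable_mk.measurable.indicator hK.measurableSet, fun α => ?_, fun α => ?_,
      fun α => ?_⟩
    · rw [memLp_indicator_iff_restrict hK.measurableSet, memLp_congr_ae (hae α)]
      exact hF α
    · rw [integrable_indicator_iff hK.measurableSet, IntegrableOn, integrable_congr (hae α)]
      exact (hF α).integrable hs
    · filter_upwards [(ae_restrict_iff' hK.measurableSet).1 (hae α)] with y hy hyK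
      rw [indicator_of_mem hyK, hy hyK]
  obtain ⟨f', hfm, hfp, hfi, hfe⟩ := key Fact.out hf
  obtain ⟨u', hum, hup, hui, hue⟩ := key Fact.out hu
  obtain ⟨g', hgm, hgp, hgi, hge⟩ := key Fact.out hg
  obtain ⟨h', hhm, hhp, hhi, hhe⟩ := key Fact.out hh
  have h0 : ∀ {η : Model d → ℝ}, tsupport η ⊆ V → ∀ y ∉ K, η y = 0 ∧ ∀ i, pd i η y = 0 := by
    intro η hη y hy
    have h1 : y ∉ tsupport η := fun h => hy (hVK (hη h))
    exact ⟨image_eq_zero_of_notMem_tsupport h1, pd_eq_zero h1⟩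
  have e1 : ∀ {ι : Type} {F F' : ι → Model d → ℂ} (_ : ∀ α, ∀ᵐ y, y ∈ K → F' α y = F α y)
      {η : Model d → ℝ} (_ : tsupport η ⊆ V) (α : ι),
      ∫ y, (η y : ℂ) * F' α y = ∫ y, (η y : ℂ) * F α y := by
    intro ι F F' hF η hη α
    refine integral_congr_ae ?_
    filter_upwards [hF α] with y hy
    by_cases hyK : y ∈ K
    · rw [hy hyK]
    · simp [(h0 hη y hyK).1]
  have e2 : ∀ {ι : Type} {F F' : ι → Model d → ℂ} (_ : ∀ α, ∀ᵐ y, y ∈ K → F' α y = F α y)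
      {η : Model d → ℝ} (_ : tsupport η ⊆ V) (α : ι) (B : Model d → ℂ) (i : Fin d),
      ∫ y, F' α y * B y * (pd i η y : ℂ) = ∫ y, F α y * B y * (pd i η y : ℂ) := by
    intro ι F F' hF η hη α B i
    refine integral_congr_ae ?_
    filter_upwards [hF α] with y hy
    by_cases hyK : y ∈ K
    · rw [hy hyK]
    · simp [(h0 hη y hyK).2 i]
  have e3 : ∀ {ι : Type} {F F' G G' : ι → Model d → ℂ} (_ : ∀ α, ∀ᵐ y, y ∈ K → F' α y = F α y)
      (_ : ∀ α, ∀ᵐ y, y ∈ K → G' α y = G α y) (α : ι),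
      ∫ y, (χ y : ℂ) * (F' α y * G' α y) = ∫ y, (χ y : ℂ) * (F α y * G α y) := by
    intro ι F F' G G' hF hG α
    refine integral_congr_ae ?_
    filter_upwards [hF α, hG α] with y hy hy'
    by_cases hyK : y ∈ K
    · rw [hy hyK, hy' hyK]
    · simp [(h0 hχV y hyK).1]
  have hmain := friedrichs hp' hpp' hV hχ hχc hχV hA hAc hdiv hfm hum hgm hhm hfp hup hgp hhp hfi hui
    hgi hhi
    (fun η hη hηc hηV β => by
      rw [e1 hge hηV β, H1 η hη hηc hηV β]
      exact sum_ext fun α => sum_ext fun i =>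
        (e2 hfe hηV α (A α β i) i).symm)
    (fun η hη hηc hηV α => by
      rw [e1 hue hηV α, H2 η hη hηc hηV α]
      congr 1
      exact sum_ext fun β => sum_ext fun i =>
        (e2 hhe hηV β (A α β i) i).symm)
  rw [sum_ext fun β => e3 hge hhe β, sum_ext fun α => e3 hfe hue α]
    at hmain
  rw [hmain]
  refine sum_ext fun α => sum_ext fun β =>
    sum_ext fun i => integral_congr_ae ?_
  filter_upwards [hfe α, hhe β] with y hy hy'
  by_cases hyK : y ∈ K
  · rw [hy hyK, hy' hyK]
  · simp [(h0 hχV y hyK).2 i]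

end Integrals

section Tests

theorem IsContForm.isLpLoc {d m : ℕ} {M : Type*} [TopologicalSpace M] [ChartedSpace (Model d) M]
    [IsManifold 𝓘(ℝ, Model d) ∞ M] {p : ℝ≥0∞} {f : M → Alt d m ℂ} (hf : IsContForm f) :
    IsLpLoc p f := fun c _ hK hKt => memLp_of_continuousOn hK ((hf c).mono hKt)

/-- The form `η dw_{κ 1} ∧ ⋯ ∧ dw_{κ m}` for a function `η` with support in the patch. -/
def Patch.test (P : Patch S x) (κ : Fin m → Fin dM) (η : Model dM → ℝ) :
    M → Alt dM m ℂ := ofChart x fun y => (η y : ℂ) • P.frame κ y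

/-- The support of a function in the patch, as a subset of the manifold. -/
theorem Patch.exists_carrier (P : Patch S x) {η : Model dM → ℝ} (hηc : HasCompactSupport η)
    (hηO : tsupport η ⊆ P.O) : ∃ C : Set M, IsCompact C ∧
      C ⊆ (chart x).source ∧
      chart x '' C = tsupport η := by
  have ht := hηO.trans P.subset
  refine ⟨(chart x).symm '' tsupport η,
    hηc.isCompact.image_of_continuousOn
      ((chart x).continuousOn_symm.mono ht), ?_, ?_⟩
  · rintro _ ⟨y, hy, rfl⟩
    exact (chart x).map_target (ht hy)
  · rw [image_image]
    exact (image_congr fun y hy => (chart x).right_inv (ht hy)).trans (image_id _)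

variable [T2Space M]

theorem Patch.test_eq_zero (P : Patch S x) {κ : Fin m → Fin dM} {η : Model dM → ℝ}
    {C : Set M} (hCη : chart x '' C = tsupport η)
    (hCx : C ⊆ (chart x).source) :
    ∀ y ∉ C, P.test κ η y = 0 := by
  intro y hy
  refine ofChart_apply_eq_zero fun hyx => ?_
  have : chart x y ∉ tsupport η := by
    rw [← hCη]
    rintro ⟨z, hz, hzy⟩
    exact hy ((chart x).injOn (hCx hz) hyx hzy ▸ hz)
  rw [image_eq_zero_of_notMem_tsupport this]
  simp

theorem Patch.rep_test (P : Patch S x) (κ : Fin m → Fin dM) (η : Model dM → ℝ)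
    {y : Model dM} (hy : y ∈ P.O) : rep x (P.test κ η) y = (η y : ℂ) • P.frame κ y :=
  rep_ofChart x _ (P.subset hy)

theorem Patch.isTestForm (P : Patch S x) {κ : Fin m → Fin dM} {q : ℤ}
    (hκ : countH κ ≤ q) {η : Model dM → ℝ} (hη : ContDiff ℝ ∞ η)
    (hηc : HasCompactSupport η) (hηO : tsupport η ⊆ P.O) : IsTestForm S q (P.test κ η) := by
  obtain ⟨C, hC, hCx, hCη⟩ := P.exists_carrier hηc hηO
  have h0 := P.test_eq_zero (κ := κ) hCη hCx
  have hCO : chart x '' C ⊆ P.O := hCη ▸ hηO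
  refine ⟨isSmoothForm_of_chart hC hCx h0 fun y hy => ?_,
    HasCompactSupport.intro hC fun y hy => h0 y hy, isBidegree_of_patch P hCx hCO h0 fun y hy => ?_⟩
  · have hyO : chart x y ∈ P.O := hCO ⟨y, hy, rfl⟩
    have hev : rep x (P.test κ η) =ᶠ[𝓝 (chart x y)]
        fun z => (η z : ℂ) • P.frame κ z := by
      filter_upwards [P.isOpen.mem_nhds hyO] with z hz
      exact P.rep_test κ η hz
    refine ContDiffAt.congr_of_eventuallyEq ?_ hev
    exact (Complex.ofRealCLM.contDiff.comp hη).contDiffAt.smul (P.contDiffAt_frame κ hyO)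
  · rw [P.rep_test κ η (hCO hy)]
    exact (bideg_coframe (P.det_ne_zero _ (hCO hy)) hκ).smul _

/-- Only the coefficient is differentiated, since the frame is closed. -/
theorem Patch.rep_dForm_test (P : Patch S x) (κ : Fin m → Fin dM)
    {η : Model dM → ℝ} (hη : ContDiff ℝ ∞ η) (hs : IsSmoothForm (P.test κ η))
    {y : Model dM} (hy : y ∈ P.O) :
    rep x (dForm (P.test κ η)) y =
      ∑ i, (pd i η y : ℂ) • wedgeLin (dCoord i) (P.frame κ y) := by
  have hev : rep x (P.test κ η) =ᶠ[𝓝 y] fun z => (η z : ℂ) • P.frame κ z := by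
    filter_upwards [P.isOpen.mem_nhds hy] with z hz
    exact P.rep_test κ η hz
  have hd : HasFDerivAt (fun z => (η z : ℂ)) (Complex.ofRealCLM.comp (fderiv ℝ η y)) y :=
    Complex.ofRealCLM.hasFDerivAt.comp y (hη.differentiable (by simp) y).hasFDerivAt
  rw [rep_dForm x hs (P.subset hy), hev.extDeriv_eq, extDeriv_smul_form hd.differentiableAt
    ((P.contDiffAt_frame κ hy).differentiableAt (by simp)), P.extDeriv_frame κ hy, smul_zero,
    add_zero, hd.fderiv, wedgeLin_ofReal_comp]
  rfl

variable [SigmaCompactSpace M]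

theorem Patch.pairing_test (P : Patch S x) (hpp' : p⁻¹ + p'⁻¹ = 1) {f : M → Alt dM a ℂ}
    (hf : IsLpLoc p f) {κ : Fin m → Fin dM} {q : ℤ}
    (hκ : countH κ ≤ q) {η : Model dM → ℝ} (hη : ContDiff ℝ ∞ η)
    (hηc : HasCompactSupport η) (hηO : tsupport η ⊆ P.O) :
    pairing S.Ω f (P.test κ η) = P.σ * ∫ y, (η y : ℂ) * wedgeTop (rep x f y) (P.frame κ y) := by
  obtain ⟨C, hC, hCx, hCη⟩ := P.exists_carrier hηc hηO
  have h0 := P.test_eq_zero (κ := κ) hCη hCx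
  have hCO : chart x '' C ⊆ P.O := hCη ▸ hηO
  have hT := (P.isTestForm hκ hη hηc hηO).smooth
  have hK := isCompact_chart_image hC hCx
  have hKt := chart_image_subset hCx
  rw [P.pairing_eq hpp' hC hCx hCO (hf x _ hK hKt) (hT.isContForm.isLpLoc x _ hK hKt)
    fun y hy => Or.inr (h0 y hy)]
  congr 1
  refine Eq.trans ?_ (setIntegral_eq_integral_of_forall_compl_eq_zero
    (s := chart x '' C) ?_)
  · refine setIntegral_congr_fun hK.measurableSet fun y hy => ?_
    show wedgeTop (rep x f y) (rep x (P.test κ η) y) = _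
    rw [P.rep_test κ η (hCO hy), wedgeTop_smul_right]
  · intro y hy
    rw [hCη] at hy
    simp [image_eq_zero_of_notMem_tsupport hy]

theorem Patch.pairing_dForm_test (P : Patch S x) (hpp' : p⁻¹ + p'⁻¹ = 1)
    {f : M → Alt dM a ℂ} (hf : IsLpLoc p f) {κ : Fin m → Fin dM} {q : ℤ}
    (hκ : countH κ ≤ q) {η : Model dM → ℝ} (hη : ContDiff ℝ ∞ η)
    (hηc : HasCompactSupport η) (hηO : tsupport η ⊆ P.O) :
    pairing S.Ω f (dForm (P.test κ η)) = P.σ * ∫ y, ∑ i, (pd i η y : ℂ) *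
      wedgeTop (rep x f y) (wedgeLin (dCoord i) (P.frame κ y)) := by
  obtain ⟨C, hC, hCx, hCη⟩ := P.exists_carrier hηc hηO
  have h0 := P.test_eq_zero (κ := κ) hCη hCx
  have hCO : chart x '' C ⊆ P.O := hCη ▸ hηO
  have hT := (P.isTestForm hκ hη hηc hηO).smooth
  have hK := isCompact_chart_image hC hCx
  have hKt := chart_image_subset hCx
  have h0' : ∀ y ∉ C, dForm (P.test κ η) y = 0 := fun y hy => by
    by_contra h
    exact hy (closure_minimal (fun z hz => by
      by_contra hzC
      exact hz (h0 z hzC)) hC.isClosed (support_dForm_subset _ h))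
  rw [P.pairing_eq hpp' hC hCx hCO (hf x _ hK hKt) (hT.dForm.isContForm.isLpLoc x _ hK hKt)
    fun y hy => Or.inr (h0' y hy)]
  congr 1
  refine Eq.trans ?_ (setIntegral_eq_integral_of_forall_compl_eq_zero
    (s := chart x '' C) ?_)
  · refine setIntegral_congr_fun hK.measurableSet fun y hy => ?_
    show wedgeTop (rep x f y) (rep x (dForm (P.test κ η)) y) = _
    rw [P.rep_dForm_test κ hη hT (hCO hy), wedgeTop_sum_right]
    exact sum_ext fun i => wedgeTop_smul_right _ _ _
  · intro y hy
    rw [hCη] at hy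
    exact Finset.sum_eq_zero fun i _ => by simp [pd_eq_zero hy]

end Tests

/-! ### The weak equations as first order systems -/

section Green

theorem contDiffAt_wedgeTop {d a b : ℕ} {E : Type*} [NormedAddCommGroup E] [NormedSpace ℝ E]
    {α : E → Alt d a ℂ} {β : E → Alt d b ℂ} {y : E}
    (hα : ContDiffAt ℝ ∞ α y) (hβ : ContDiffAt ℝ ∞ β y) :
    ContDiffAt ℝ ∞ (fun z => wedgeTop (α z) (β z)) y := by
  have h0 : ContDiff ℝ ∞ fun γ : Alt d a ℂ => wedgeTopL d a b γ :=
    ContinuousLinearMap.contDiff (𝕜 := ℝ) (E := Alt d a ℂ) (F := Alt d b ℂ →L[ℝ] ℂ) (wedgeTopL d a b)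
  exact (h0.contDiffAt.comp y hα).clm_apply hβ

theorem contDiffAt_wedgeLin {d a : ℕ} {E : Type*} [NormedAddCommGroup E] [NormedSpace ℝ E]
    {α : E → Alt d a ℂ} {y : E} (l : Model d →L[ℝ] ℂ) (hα : ContDiffAt ℝ ∞ α y) :
    ContDiffAt ℝ ∞ (fun z => wedgeLin l (α z)) y := by
  have h0 : ContDiff ℝ ∞ fun γ : Alt d a ℂ => wedgeLinL d a l γ :=
    ContinuousLinearMap.contDiff (𝕜 := ℝ) (E := Alt d a ℂ) (F := Alt d (a + 1) ℂ) (wedgeLinL d a l)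
  exact h0.contDiffAt.comp y hα

theorem Patch.memLp_coeff (P : Patch S x) {K : Set (Model dM)} (hK : IsCompact K)
    (hKO : K ⊆ P.O) {f : M → Alt dM m ℂ} (hf : IsLpLoc p f) (κ : Fin m → Fin dM) :
    MemLp (fun y => coeff (fderiv ℝ P.w y) κ (rep x f y)) p (volume.restrict K) := by
  obtain ⟨L, hL, hL'⟩ := P.exists_coeff κ
  have h1 : MemLp (fun y => L y (rep x f y)) p (volume.restrict K) :=
    memLp_clm_apply hK (fun y hy => (hL y (hKO hy)).continuousAt.continuousWithinAt)
      (hf x K hK (hKO.trans P.subset))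
  refine (memLp_congr_ae ?_).1 h1
  exact ae_restrict_of_forall_mem hK.measurableSet fun y hy => hL' y (hKO hy) _

theorem Patch.memLp_wedgeTop_frame (P : Patch S x) {K : Set (Model dM)} (hK : IsCompact K)
    (hKO : K ⊆ P.O) {f : M → Alt dM a ℂ} (hf : IsLpLoc p f)
    (κ : Fin b → Fin dM) :
    MemLp (fun y => wedgeTop (rep x f y) (P.frame κ y)) p (volume.restrict K) := by
  have h0 : Continuous fun γ : Alt dM b ℂ => wedgeTopR dM a b γ :=
    (wedgeTopR dM a b).continuous
  exact memLp_clm_apply (L := fun y => wedgeTopR dM a b (P.frame κ y)) hK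
    (fun y hy => (h0.continuousAt.comp
      (P.contDiffAt_frame κ (hKO hy)).continuousAt).continuousWithinAt)
    (hf x K hK (hKO.trans P.subset))

theorem Patch.memLp_frame_wedgeTop (P : Patch S x) {K : Set (Model dM)} (hK : IsCompact K)
    (hKO : K ⊆ P.O) {f : M → Alt dM a ℂ} (hf : IsLpLoc p f)
    (κ : Fin b → Fin dM) :
    MemLp (fun y => wedgeTop (P.frame κ y) (rep x f y)) p (volume.restrict K) := by
  have h := (P.memLp_wedgeTop_frame hK hKO hf κ).const_mul ((-1 : ℂ) ^ (b * a))
  exact (memLp_congr_ae (.of_forall fun y => wedgeTop_comm (P.frame κ y) (rep x f y))).2 h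

theorem wedgeTop_dCoord_comm {d a b : ℕ} (l : Model d →L[ℝ] ℂ) (α : Alt d a ℂ) (β : Alt d b ℂ) :
    wedgeTop β (wedgeLin l α) = (-1) ^ (b * (a + 1) + a) * wedgeTop α (wedgeLin l β) := by
  rw [wedgeTop_comm, wedgeTop_wedgeLin, ← mul_assoc, ← pow_add]

variable [T2Space M] [SigmaCompactSpace M]

theorem Patch.wedgeTop_eq_sum_right (P : Patch S x) {h : M → Alt dM b ℂ}
    (hh : IsBidegree S t h) {y : Model dM} (hy : y ∈ P.O) (α : Alt dM a ℂ) :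
    wedgeTop α (rep x h y) = ∑ κ : FrameIdx n k b t,
      wedgeTop α (P.frame κ.1 y) *
        ((b.factorial : ℂ)⁻¹ * coeff (fderiv ℝ P.w y) κ.1 (rep x h y)) := by
  conv_lhs => rw [rep_eq_sum_frame P hh hy, wedgeTop_smul_right, wedgeTop_sum_right, Finset.mul_sum]
  refine sum_ext fun κ => ?_
  rw [wedgeTop_smul_right]
  ring

theorem Patch.wedgeTop_eq_sum_left (P : Patch S x) {f : M → Alt dM a ℂ}
    (hf : IsBidegree S s f) {y : Model dM} (hy : y ∈ P.O) (β : Alt dM b ℂ) :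
    wedgeTop (rep x f y) β = ∑ κ : FrameIdx n k a s,
      coeff (fderiv ℝ P.w y) κ.1 (rep x f y) *
        ((a.factorial : ℂ)⁻¹ * wedgeTop (P.frame κ.1 y) β) := by
  conv_lhs => rw [rep_eq_sum_frame P hf hy, wedgeTop_smul, wedgeTop_sum_left, Finset.mul_sum]
  refine sum_ext fun κ => ?_
  rw [wedgeTop_smul]
  ring

theorem wedgeTop_wedgeLin_sum {d a b : ℕ} {ι : Type*} (T : Finset ι) (α : Alt d a ℂ)
    (l : Model d →L[ℝ] ℂ) (c : ι → ℂ) (β : ι → Alt d b ℂ) :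
    wedgeTop α (wedgeLin l (∑ i ∈ T, c i • β i)) = ∑ i ∈ T, c i * wedgeTop α (wedgeLin l (β i)) := by
  rw [← wedgeLinL_apply, map_sum, wedgeTop_sum_right]
  refine sum_ext fun i => ?_
  rw [wedgeLinL_apply, wedgeLin_smul, wedgeTop_smul_right]

theorem Patch.wedgeTop_wedgeLin_eq_sum (P : Patch S x) {f : M → Alt dM a ℂ}
    (hf : IsBidegree S s f) {h : M → Alt dM b ℂ}
    (hh : IsBidegree S t h) {y : Model dM} (hy : y ∈ P.O) (l : Model dM →L[ℝ] ℂ) :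
    wedgeTop (rep x f y) (wedgeLin l (rep x h y)) =
      ∑ κ : FrameIdx n k a s,
      ∑ ν : FrameIdx n k b t,
      coeff (fderiv ℝ P.w y) κ.1 (rep x f y) *
        ((b.factorial : ℂ)⁻¹ * coeff (fderiv ℝ P.w y) ν.1 (rep x h y)) *
        ((a.factorial : ℂ)⁻¹ * wedgeTop (P.frame κ.1 y) (wedgeLin l (P.frame ν.1 y))) := by
  rw [P.wedgeTop_eq_sum_left hf hy]
  refine sum_ext fun κ => ?_
  conv_lhs => rw [rep_eq_sum_frame P hh hy, wedgeLin_smul, wedgeTop_smul_right, wedgeTop_wedgeLin_sum]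
  rw [Finset.mul_sum, Finset.mul_sum, Finset.mul_sum]
  refine sum_ext fun ν => ?_
  ring

/-- Green's formula, localized by a cutoff function `χ` with support in a patch.  Both weak
equations are tested with multiples of the closed forms of the frame, so that the integration by
parts formula for first order operators without terms of order zero applies. -/
theorem Patch.green_local [Fact (1 ≤ p)] [Fact (1 ≤ p')] (P : Patch S x) (hp' : p' ≠ ⊤)
    (hpp' : p⁻¹ + p'⁻¹ = 1)
    {f : M → Alt dM a ℂ} {g : M → Alt dM (a + 1) ℂ}
    {h : M → Alt dM b ℂ} {u : M → Alt dM (b + 1) ℂ}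
    (hf : IsLpLoc p' f) (hg : IsLpLoc p' g) (hh : IsLpLoc p h) (hu : IsLpLoc p u)
    (hfs : IsBidegree S s f) (hht : IsBidegree S t h)
    (h1 : ∀ φ : M → Alt dM b ℂ, IsTestForm S t φ →
      pairing S.Ω g φ = (-1) ^ (a + 1) * pairing S.Ω f (dForm φ))
    (h2 : ∀ φ : M → Alt dM a ℂ, IsTestForm S s φ →
      pairing S.Ω u φ = (-1) ^ (b + 1) * pairing S.Ω h (dForm φ))
    {χ : Model dM → ℝ} (hχ : ContDiff ℝ ∞ χ) (hχc : HasCompactSupport χ)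
    (hχO : tsupport χ ⊆ P.O) :
    (∫ y, (χ y : ℂ) * wedgeTop (rep x g y) (rep x h y)) -
      (-1) ^ (a + 1) * ∫ y, (χ y : ℂ) * wedgeTop (rep x f y) (rep x u y) =
      (-1) ^ (a + 1) * ∫ y, ∑ i, (pd i χ y : ℂ) *
        wedgeTop (rep x f y) (wedgeLin (dCoord i) (rep x h y)) := by
  obtain ⟨K, hK, hχK, hKO⟩ := exists_compact_between hχc.isCompact P.isOpen hχO
  obtain ⟨ρ, hρ, hρc, hρO, hρ1⟩ := exists_cutoff P.isOpen hK hKO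
  have hpp'2 : p'⁻¹ + p⁻¹ = 1 := by rw [add_comm, hpp']
  have hσ : (P.σ : ℂ) ≠ 0 := Complex.ofReal_ne_zero.2 P.sign_ne_zero
  set V := interior K with hVdef
  have hVK : V ⊆ K := interior_subset
  set ε : ℂ := (-1) ^ (a + 1) with hε
  have hεε : ε * ε = 1 := by rw [hε, ← mul_pow]; simp
  -- The coefficients of the operator, cut off away from `K`.
  let A₀ : (Fin a → Fin dM) → (Fin b → Fin dM) → Fin dM →
      Model dM → ℂ := fun κ ν i y =>
    ε * ((a.factorial : ℂ)⁻¹ * wedgeTop (P.frame κ y) (wedgeLin (dCoord i) (P.frame ν y)))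
  have hA₀ : ∀ κ ν i, ∀ y ∈ P.O, ContDiffAt ℝ ∞ (A₀ κ ν i) y := fun κ ν i y hy =>
    contDiffAt_const.mul (contDiffAt_const.mul (contDiffAt_wedgeTop (P.contDiffAt_frame κ hy)
      (contDiffAt_wedgeLin _ (P.contDiffAt_frame ν hy))))
  let A : FrameIdx n k a s →
      FrameIdx n k b t → Fin dM →
      Model dM → ℂ := fun κ ν i y => (ρ y : ℂ) * A₀ κ.1 ν.1 i y
  have hAK : ∀ κ ν i, ∀ y ∈ K, A κ ν i y = A₀ κ.1 ν.1 i y := fun κ ν i y hy => by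
    show (ρ y : ℂ) * _ = _
    rw [(hρ1 y hy).self_of_nhds, Complex.ofReal_one, one_mul]
  have hAs : ∀ κ ν i, Function.support (A κ ν i) ⊆ tsupport ρ := fun κ ν i y hy => by
    by_contra hn
    apply hy
    show (ρ y : ℂ) * _ = 0
    rw [image_eq_zero_of_notMem_tsupport hn, Complex.ofReal_zero, zero_mul]
  have hA : ∀ κ ν i, ContDiff ℝ ∞ (A κ ν i) := fun κ ν i => by
    rw [contDiff_iff_contDiffAt]
    intro y
    by_cases hy : y ∈ tsupport ρ
    · exact ((Complex.ofRealCLM.contDiff.comp hρ).contDiffAt).mul (hA₀ κ.1 ν.1 i y (hρO hy))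
    · refine (contDiffAt_const (c := (0 : ℂ))).congr_of_eventuallyEq ?_
      filter_upwards [(isClosed_tsupport ρ).isOpen_compl.mem_nhds hy] with z hz
      by_contra hn
      exact hz (hAs κ ν i hn)
  have hAc : ∀ κ ν i, HasCompactSupport (A κ ν i) := fun κ ν i => hρc.mono' (hAs κ ν i)
  have hdiv : ∀ κ ν, ∀ y ∈ V, ∑ i, fderiv ℝ (A κ ν i) y (stdVec dM i) = 0 := by
    intro κ ν y hy
    have hyK := hVK hy
    have hyO := hKO hyK
    have e : ∀ i, fderiv ℝ (A κ ν i) y (stdVec dM i) = ε * (a.factorial : ℂ)⁻¹ *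
        fderiv ℝ (fun z => wedgeTop (P.frame κ.1 z) (wedgeLin (dCoord i) (P.frame ν.1 z))) y
          (stdVec dM i) := by
      intro i
      have hd : DifferentiableAt ℝ
          (fun z => wedgeTop (P.frame κ.1 z) (wedgeLin (dCoord i) (P.frame ν.1 z))) y :=
        (contDiffAt_wedgeTop (P.contDiffAt_frame κ.1 hyO)
          (contDiffAt_wedgeLin _ (P.contDiffAt_frame ν.1 hyO))).differentiableAt (by simp)
      have hev : A κ ν i =ᶠ[𝓝 y] fun z => (ε * (a.factorial : ℂ)⁻¹) •
          wedgeTop (P.frame κ.1 z) (wedgeLin (dCoord i) (P.frame ν.1 z)) := by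
        filter_upwards [isOpen_interior.mem_nhds hy] with z hz
        rw [hAK κ ν i z (hVK hz), smul_eq_mul, mul_assoc]
      rw [hev.fderiv_eq, fderiv_fun_const_smul hd]
      rfl
    rw [sum_ext fun i => e i, ← Finset.mul_sum,
      sum_fderiv_wedgeTop ((P.contDiffAt_frame κ.1 hyO).differentiableAt (by simp))
        ((P.contDiffAt_frame ν.1 hyO).differentiableAt (by simp)),
      P.extDeriv_frame κ.1 hyO, P.extDeriv_frame ν.1 hyO, wedgeTop_zero_left, wedgeTop_zero_right]
    simp
  -- The components of the four forms.
  let F : FrameIdx n k a s → Model dM → ℂ :=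
    fun κ y => coeff (fderiv ℝ P.w y) κ.1 (rep x f y)
  let U : FrameIdx n k a s → Model dM → ℂ :=
    fun κ y => ε * ((a.factorial : ℂ)⁻¹ * wedgeTop (P.frame κ.1 y) (rep x u y))
  let G : FrameIdx n k b t → Model dM → ℂ :=
    fun κ y => wedgeTop (rep x g y) (P.frame κ.1 y)
  let H : FrameIdx n k b t → Model dM → ℂ :=
    fun κ y => (b.factorial : ℂ)⁻¹ * coeff (fderiv ℝ P.w y) κ.1 (rep x h y)
  have hF : ∀ κ, MemLp (F κ) p' (volume.restrict K) := fun κ => P.memLp_coeff hK hKO hf κ.1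
  have hU : ∀ κ, MemLp (U κ) p (volume.restrict K) := fun κ =>
    ((P.memLp_frame_wedgeTop hK hKO hu κ.1).const_mul _).const_mul _
  have hG : ∀ κ, MemLp (G κ) p' (volume.restrict K) := fun κ =>
    P.memLp_wedgeTop_frame hK hKO hg κ.1
  have hH : ∀ κ, MemLp (H κ) p (volume.restrict K) := fun κ =>
    (P.memLp_coeff hK hKO hh κ.1).const_mul _
  have hη0 : ∀ {η : Model dM → ℝ}, tsupport η ⊆ V → ∀ y ∉ K, η y = 0 ∧ ∀ i, pd i η y = 0 := by
    intro η hη y hy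
    have h1 : y ∉ tsupport η := fun h => hy (hVK (hη h))
    exact ⟨image_eq_zero_of_notMem_tsupport h1, pd_eq_zero h1⟩
  have hcont : ∀ {η : Model dM → ℝ}, ContDiff ℝ ∞ η → ∀ α β i,
      Continuous fun y => A α β i y * (pd i η y : ℂ) := fun hη α β i =>
    (hA α β i).continuous.mul (Complex.continuous_ofReal.comp (continuous_pd hη i))
  have H1 : ∀ η : Model dM → ℝ, ContDiff ℝ ∞ η → HasCompactSupport η → tsupport η ⊆ V →
      ∀ β, ∫ y, (η y : ℂ) * G β y = ∑ α, ∑ i, ∫ y, F α y * A α β i y * (pd i η y : ℂ) := by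
    intro η hη hηc hηV ν
    have hηO : tsupport η ⊆ P.O := hηV.trans (hVK.trans hKO)
    have e := h1 _ (P.isTestForm ν.2 hη hηc hηO)
    rw [P.pairing_test hpp'2 hg ν.2 hη hηc hηO, P.pairing_dForm_test hpp'2 hf ν.2 hη hηc hηO,
      mul_left_comm] at e
    have e := mul_left_cancel₀ hσ e
    refine e.trans ?_
    rw [← integral_const_mul]
    have hi : ∀ α i, Integrable fun y => F α y * A α ν i y * (pd i η y : ℂ) := fun α i => by
      have := integrable_mul_of_memLp (m := fun y => A α ν i y * (pd i η y : ℂ)) hK (hF α)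
        (hcont hη _ _ _) fun y hy => by simp [(hη0 hηV y hy).2 i]
      simpa only [mul_assoc] using this
    rw [sum_ext fun α => (integral_finsetSum Finset.univ fun i _ => hi α i).symm,
      ← integral_finsetSum Finset.univ fun α _ => integrable_finsetSum _ fun i _ => hi α i]
    refine integral_congr_ae (.of_forall fun y => ?_)
    by_cases hy : y ∈ K
    · show ε * ∑ i, (pd i η y : ℂ) * wedgeTop (rep x f y) (wedgeLin (dCoord i) (P.frame ν.1 y)) =
        ∑ α, ∑ i, F α y * A α ν i y * (pd i η y : ℂ)
      rw [Finset.sum_comm, Finset.mul_sum]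
      refine sum_ext fun i => ?_
      rw [P.wedgeTop_eq_sum_left hfs (hKO hy), Finset.mul_sum, Finset.mul_sum]
      refine sum_ext fun α => ?_
      rw [hAK α ν i y hy]
      show _ = coeff (fderiv ℝ P.w y) α.1 (rep x f y) * (ε * _) * _
      ring
    · simp [(hη0 hηV y hy).2]
  have H2 : ∀ η : Model dM → ℝ, ContDiff ℝ ∞ η → HasCompactSupport η → tsupport η ⊆ V →
      ∀ α, ∫ y, (η y : ℂ) * U α y = - ∑ β, ∑ i, ∫ y, H β y * A α β i y * (pd i η y : ℂ) := by
    intro η hη hηc hηV κ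
    have hηO : tsupport η ⊆ P.O := hηV.trans (hVK.trans hKO)
    have e := h2 _ (P.isTestForm κ.2 hη hηc hηO)
    rw [P.pairing_test hpp' hu κ.2 hη hηc hηO, P.pairing_dForm_test hpp' hh κ.2 hη hηc hηO,
      mul_left_comm] at e
    have e := mul_left_cancel₀ hσ e
    have e1 : ∫ y, (η y : ℂ) * U κ y = ε * ((a.factorial : ℂ)⁻¹ * ((-1) ^ (a * (b + 1)) *
        ∫ y, (η y : ℂ) * wedgeTop (rep x u y) (P.frame κ.1 y))) := by
      rw [← integral_const_mul, ← integral_const_mul, ← integral_const_mul]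
      refine integral_congr_ae (.of_forall fun y => ?_)
      show (η y : ℂ) * (ε * ((a.factorial : ℂ)⁻¹ * wedgeTop (P.frame κ.1 y) (rep x u y))) = _
      rw [wedgeTop_comm (P.frame κ.1 y) (rep x u y)]
      ring
    have hi : ∀ β i, Integrable fun y => H β y * A κ β i y * (pd i η y : ℂ) := fun β i => by
      have := integrable_mul_of_memLp (m := fun y => A κ β i y * (pd i η y : ℂ)) hK (hH β)
        (hcont hη _ _ _) fun y hy => by simp [(hη0 hηV y hy).2 i]
      simpa only [mul_assoc] using this
    rw [e1, e, sum_ext fun β => (integral_finsetSum Finset.univ fun i _ => hi β i).symm,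
      ← integral_finsetSum Finset.univ fun β _ => integrable_finsetSum _ fun i _ => hi β i,
      ← integral_neg, ← integral_const_mul, ← integral_const_mul, ← integral_const_mul,
      ← integral_const_mul]
    refine integral_congr_ae (.of_forall fun y => ?_)
    by_cases hy : y ∈ K
    · show ε * ((a.factorial : ℂ)⁻¹ * ((-1) ^ (a * (b + 1)) * ((-1) ^ (b + 1) *
        ∑ i, (pd i η y : ℂ) * wedgeTop (rep x h y) (wedgeLin (dCoord i) (P.frame κ.1 y))))) =
        - ∑ β, ∑ i, H β y * A κ β i y * (pd i η y : ℂ)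
      rw [Finset.sum_comm, ← Finset.sum_neg_distrib]
      simp only [Finset.mul_sum]
      refine sum_ext fun i => ?_
      have hs1 : ((-1 : ℂ)) ^ (a * (b + 1)) * ((-1) ^ (b + 1) * (-1) ^ (b * (a + 1) + a)) = -1 := by
        rw [← pow_add, ← pow_add]
        refine Odd.neg_one_pow ⟨a * b + a + b, by ring⟩
      have hexp : wedgeTop (P.frame κ.1 y) (wedgeLin (dCoord i) (rep x h y)) =
          ∑ ν : FrameIdx n k b t,
            H ν y * wedgeTop (P.frame κ.1 y) (wedgeLin (dCoord i) (P.frame ν.1 y)) := by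
        conv_lhs => rw [rep_eq_sum_frame P hht (hKO hy), wedgeLin_smul, wedgeTop_smul_right,
          wedgeTop_wedgeLin_sum, Finset.mul_sum]
        refine sum_ext fun ν => ?_
        show _ = (b.factorial : ℂ)⁻¹ * _ * _
        ring
      have hrhs : ∑ ν : FrameIdx n k b t,
          H ν y * A κ ν i y * (pd i η y : ℂ) = ε * ((a.factorial : ℂ)⁻¹ * ((pd i η y : ℂ) *
            wedgeTop (P.frame κ.1 y) (wedgeLin (dCoord i) (rep x h y)))) := by
        rw [hexp]
        simp only [Finset.mul_sum]
        refine sum_ext fun ν => ?_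
        rw [hAK κ ν i y hy]
        show H ν y * (ε * ((a.factorial : ℂ)⁻¹ *
          wedgeTop (P.frame κ.1 y) (wedgeLin (dCoord i) (P.frame ν.1 y)))) * (pd i η y : ℂ) = _
        ring
      rw [hrhs, wedgeTop_dCoord_comm]
      linear_combination (ε * ((a.factorial : ℂ)⁻¹ * ((pd i η y : ℂ) *
            wedgeTop (P.frame κ.1 y) (wedgeLin (dCoord i) (rep x h y))))) * hs1
    · simp [(hη0 hηV y hy).2]
  have main := friedrichs_on hp' hpp' hK isOpen_interior hVK hχ hχc hχK hA hAc hdiv hF hU hG hH H1 H2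
  have i1 : ∀ β, Integrable fun y => (χ y : ℂ) * (G β y * H β y) := fun β => by
    have := integrable_mul_mul_of_memLp (m := fun y => (χ y : ℂ)) hpp'2 hK (hG β) (hH β)
      (Complex.continuous_ofReal.comp hχ.continuous) fun y hy => by simp [(hη0 hχK y hy).1]
    simpa only [mul_comm] using this
  have i2 : ∀ β, Integrable fun y => (χ y : ℂ) * (F β y * U β y) := fun β => by
    have := integrable_mul_mul_of_memLp (m := fun y => (χ y : ℂ)) hpp'2 hK (hF β) (hU β)
      (Complex.continuous_ofReal.comp hχ.continuous) fun y hy => by simp [(hη0 hχK y hy).1]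
    simpa only [mul_comm] using this
  have i3 : ∀ α β i, Integrable fun y => F α y * H β y * (A α β i y * (pd i χ y : ℂ)) :=
    fun α β i => integrable_mul_mul_of_memLp (m := fun y => A α β i y * (pd i χ y : ℂ)) hpp'2 hK
      (hF α) (hH β) (hcont hχ _ _ _) fun y hy => by
        simp [(hη0 hχK y hy).2 i]
  rw [← integral_finsetSum Finset.univ fun β _ => i1 β,
    ← integral_finsetSum Finset.univ fun β _ => i2 β,
    sum_ext fun α => sum_ext fun β =>
      (integral_finsetSum Finset.univ fun i _ => i3 α β i).symm,
    sum_ext fun α => (integral_finsetSum Finset.univ fun β _ =>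
      integrable_finsetSum _ fun i _ => i3 α β i).symm,
    ← integral_finsetSum Finset.univ fun α _ => integrable_finsetSum _ fun β _ =>
      integrable_finsetSum _ fun i _ => i3 α β i] at main
  rw [← integral_const_mul, ← integral_const_mul]
  refine Eq.trans (congrArg₂ _ ?_ ?_) (main.trans ?_)
  · refine integral_congr_ae (.of_forall fun y => ?_)
    by_cases hy : y ∈ K
    · show (χ y : ℂ) * _ = ∑ β, (χ y : ℂ) * (G β y * H β y)
      rw [P.wedgeTop_eq_sum_right hht (hKO hy), Finset.mul_sum]
    · simp [(hη0 hχK y hy).1]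
  · refine integral_congr_ae (.of_forall fun y => ?_)
    by_cases hy : y ∈ K
    · show ε * ((χ y : ℂ) * _) = ∑ β, (χ y : ℂ) * (F β y * U β y)
      rw [P.wedgeTop_eq_sum_left hfs (hKO hy), Finset.mul_sum, Finset.mul_sum]
      refine sum_ext fun κ => ?_
      show _ = (χ y : ℂ) * (coeff (fderiv ℝ P.w y) κ.1 (rep x f y) *
        (ε * ((a.factorial : ℂ)⁻¹ * wedgeTop (P.frame κ.1 y) (rep x u y))))
      ring
    · simp [(hη0 hχK y hy).1]
  · refine integral_congr_ae (.of_forall fun y => ?_)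
    by_cases hy : y ∈ K
    · show ∑ α, ∑ β, ∑ i, F α y * H β y * (A α β i y * (pd i χ y : ℂ)) =
        ε * ∑ i, (pd i χ y : ℂ) * wedgeTop (rep x f y) (wedgeLin (dCoord i) (rep x h y))
      rw [sum_ext fun α => Finset.sum_comm, Finset.sum_comm, Finset.mul_sum]
      refine sum_ext fun i => ?_
      rw [P.wedgeTop_wedgeLin_eq_sum hfs hht (hKO hy)]
      simp only [Finset.mul_sum]
      refine sum_ext fun κ => sum_ext fun ν => ?_
      rw [hAK κ ν i y hy]
      show coeff (fderiv ℝ P.w y) κ.1 (rep x f y) *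
        ((b.factorial : ℂ)⁻¹ * coeff (fderiv ℝ P.w y) ν.1 (rep x h y)) * (ε * _ * _) = _
      ring
    · simp [(hη0 hχK y hy).2]

end Green

/-! ### Green's formula on the manifold -/

section GlobalGreen

theorem integral_fderiv_eq_zero {d : ℕ} {F : Model d → ℂ} (hF : ContDiff ℝ ∞ F)
    (hFc : HasCompactSupport F) (v : Model d) : ∫ y, fderiv ℝ F y v = 0 := by
  have hF1 : Continuous fun y => fderiv ℝ F y v :=
    (hF.continuous_fderiv (by simp)).clm_apply continuous_const
  have hF2 : HasCompactSupport fun y => fderiv ℝ F y v := (hFc.fderiv (𝕜 := ℝ)).comp_left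
    (g := fun L : Model d →L[ℝ] ℂ => L v) rfl
  have h := integral_mul_fderiv_eq_neg_fderiv_mul_of_integrable (μ := (volume : Measure (Model d)))
    (f := fun _ => (1 : ℂ)) (g := F) (v := v) (by simp)
    (by simpa using hF1.integrable_of_hasCompactSupport hF2)
    (by simpa using hF.continuous.integrable_of_hasCompactSupport hFc)
    (fun _ _ => differentiableAt_const _) (fun y _ => hF.differentiable (by simp) y)
  simpa using h

variable [T2Space M] [SigmaCompactSpace M]

/-- Stokes' formula for smooth forms, localized by a cutoff function. -/
theorem stokes_local (x : M)
    {f : M → Alt dM a ℂ} {h : M → Alt dM b ℂ}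
    (hf : IsSmoothForm f) (hh : IsSmoothForm h)
    {χ : Model dM → ℝ} (hχ : ContDiff ℝ ∞ χ) (hχc : HasCompactSupport χ)
    (hχO : tsupport χ ⊆ (chart x).target) :
    (∫ y, (χ y : ℂ) * wedgeTop (rep x (dForm f) y) (rep x h y)) -
      (-1) ^ (a + 1) * ∫ y, (χ y : ℂ) * wedgeTop (rep x f y) (rep x (dForm h) y) =
      (-1) ^ (a + 1) * ∫ y, ∑ i, (pd i χ y : ℂ) *
        wedgeTop (rep x f y) (wedgeLin (dCoord i) (rep x h y)) := by
  let W : Fin dM → Model dM → ℂ := fun i y =>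
    wedgeTop (rep x f y) (wedgeLin (dCoord i) (rep x h y))
  have hO := (chart x).open_target
  have hfa : ∀ y ∈ tsupport χ, ContDiffAt ℝ ∞ (rep x f) y := fun y hy =>
    (hf x).contDiffAt (hO.mem_nhds (hχO hy))
  have hha : ∀ y ∈ tsupport χ, ContDiffAt ℝ ∞ (rep x h) y := fun y hy =>
    (hh x).contDiffAt (hO.mem_nhds (hχO hy))
  have hdfa : ∀ y ∈ tsupport χ, ContDiffAt ℝ ∞ (rep x (dForm f)) y := fun y hy =>
    (hf.dForm x).contDiffAt (hO.mem_nhds (hχO hy))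
  have hdha : ∀ y ∈ tsupport χ, ContDiffAt ℝ ∞ (rep x (dForm h)) y := fun y hy =>
    (hh.dForm x).contDiffAt (hO.mem_nhds (hχO hy))
  -- Functions on the patch, multiplied by a function with support in that of `χ`.
  have key : ∀ {c W : Model dM → ℂ}, ContDiff ℝ ∞ c → tsupport c ⊆ tsupport χ →
      (∀ y ∈ tsupport χ, ContDiffAt ℝ ∞ W y) →
      ContDiff ℝ ∞ (fun y => c y * W y) ∧ HasCompactSupport fun y => c y * W y := by
    intro c W hc hs hW
    have hcc : HasCompactSupport c := hχc.of_isClosed_subset (isClosed_tsupport _) hs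
    refine ⟨contDiff_iff_contDiffAt.2 fun y => ?_, hcc.mul_right⟩
    by_cases hy : y ∈ tsupport c
    · exact hc.contDiffAt.mul (hW y (hs hy))
    · refine (contDiffAt_const (c := (0 : ℂ))).congr_of_eventuallyEq ?_
      filter_upwards [(isClosed_tsupport c).isOpen_compl.mem_nhds hy] with z hz
      rw [image_eq_zero_of_notMem_tsupport hz, zero_mul]
  have hχs : ContDiff ℝ ∞ fun y => (χ y : ℂ) := Complex.ofRealCLM.contDiff.comp hχ
  have hχt : tsupport (fun y => (χ y : ℂ)) ⊆ tsupport χ :=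
    closure_mono fun y hy h => hy (by simp [h])
  have hpd : ∀ i, ContDiff ℝ ∞ fun y => (pd i χ y : ℂ) := fun i =>
    Complex.ofRealCLM.contDiff.comp ((hχ.fderiv_right (by simp)).clm_apply contDiff_const)
  have hpdt : ∀ i, tsupport (fun y => (pd i χ y : ℂ)) ⊆ tsupport χ := fun i =>
    (closure_mono (s := Function.support fun y => (pd i χ y : ℂ))
      (t := Function.support (fderiv ℝ χ)) fun y hy h => hy (by simp [pd, h])).trans
      (tsupport_fderiv_subset ℝ)
  have i1 := key hχs hχt fun y hy => contDiffAt_wedgeTop (hdfa y hy) (hha y hy)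
  have i2 := key hχs hχt fun y hy => contDiffAt_wedgeTop (hfa y hy) (hdha y hy)
  have i3 := fun i => key (hpd i) (hpdt i) fun y hy =>
    contDiffAt_wedgeTop (hfa y hy) (contDiffAt_wedgeLin (dCoord i) (hha y hy))
  have i4 := fun i => key hχs hχt fun y hy =>
    contDiffAt_wedgeTop (hfa y hy) (contDiffAt_wedgeLin (dCoord i) (hha y hy))
  have hd4 := fun i => integral_fderiv_eq_zero (i4 i).1 (i4 i).2 (stdVec dM i)
  have hci : ∀ {W : Model dM → ℂ}, ContDiff ℝ ∞ W ∧ HasCompactSupport W → Integrable W :=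
    fun hW => hW.1.continuous.integrable_of_hasCompactSupport hW.2
  have hdi : ∀ i, Integrable fun y => fderiv ℝ (fun y => (χ y : ℂ) * W i y) y (stdVec dM i) := fun i =>
    (((i4 i).1.continuous_fderiv (by simp)).clm_apply continuous_const).integrable_of_hasCompactSupport
      (((i4 i).2.fderiv (𝕜 := ℝ)).comp_left
        (g := fun L : Model dM →L[ℝ] ℂ => L (stdVec dM i)) rfl)
  have hpt : ∀ y, ∑ i, fderiv ℝ (fun y => (χ y : ℂ) * W i y) y (stdVec dM i) =
      (∑ i, (pd i χ y : ℂ) * W i y) +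
      ((-1) ^ a * ((χ y : ℂ) * wedgeTop (rep x (dForm f) y) (rep x h y)) +
        (χ y : ℂ) * wedgeTop (rep x f y) (rep x (dForm h) y)) := by
    intro y
    by_cases hy : y ∈ tsupport χ
    · have hdW : ∀ i, DifferentiableAt ℝ (W i) y := fun i =>
        (contDiffAt_wedgeTop (hfa y hy)
          (contDiffAt_wedgeLin (dCoord i) (hha y hy))).differentiableAt (by simp)
      have hdχ : HasFDerivAt (fun z => (χ z : ℂ)) (Complex.ofRealCLM.comp (fderiv ℝ χ y)) y :=
        Complex.ofRealCLM.hasFDerivAt.comp y (hχ.differentiable (by simp) y).hasFDerivAt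
      have e : ∀ i, fderiv ℝ (fun y => (χ y : ℂ) * W i y) y (stdVec dM i) =
          (pd i χ y : ℂ) * W i y +
          (χ y : ℂ) * fderiv ℝ (W i) y (stdVec dM i) := by
        intro i
        have hm : HasFDerivAt (fun y => (χ y : ℂ) * W i y) _ y := hdχ.mul (hdW i).hasFDerivAt
        rw [hm.fderiv]
        show (χ y : ℂ) * fderiv ℝ (W i) y (stdVec dM i) + W i y * (pd i χ y : ℂ) = _
        ring
      rw [sum_ext fun i => e i, Finset.sum_add_distrib, ← Finset.mul_sum,
        show ∑ i, fderiv ℝ (W i) y (stdVec dM i) = _ from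
          sum_fderiv_wedgeTop ((hfa y hy).differentiableAt (by simp))
            ((hha y hy).differentiableAt (by simp)), rep_dForm x hf (hχO hy), rep_dForm x hh (hχO hy)]
      ring
    · have h1 : ∀ i, fderiv ℝ (fun y => (χ y : ℂ) * W i y) y = 0 := fun i => by
        have : (fun y => (χ y : ℂ) * W i y) =ᶠ[𝓝 y] fun _ => 0 := by
          filter_upwards [(isClosed_tsupport χ).isOpen_compl.mem_nhds hy] with z hz
          rw [image_eq_zero_of_notMem_tsupport hz, Complex.ofReal_zero, zero_mul]
        rw [this.fderiv_eq, fderiv_const_apply]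
      simp [h1, pd_eq_zero hy, image_eq_zero_of_notMem_tsupport hy]
  have htot : ∫ y, ((∑ i, (pd i χ y : ℂ) * W i y) +
      ((-1) ^ a * ((χ y : ℂ) * wedgeTop (rep x (dForm f) y) (rep x h y)) +
        (χ y : ℂ) * wedgeTop (rep x f y) (rep x (dForm h) y))) = 0 := by
    rw [← integral_congr_ae (.of_forall hpt), integral_finsetSum _ fun i _ => hdi i]
    exact Finset.sum_eq_zero fun i _ => hd4 i
  have hi12 : Integrable fun y =>
      (-1) ^ a * ((χ y : ℂ) * wedgeTop (rep x (dForm f) y) (rep x h y)) +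
        (χ y : ℂ) * wedgeTop (rep x f y) (rep x (dForm h) y) :=
    ((hci i1).const_mul _).add (hci i2)
  rw [integral_add (integrable_finsetSum _ fun i _ => hci (i3 i)) hi12,
    integral_add ((hci i1).const_mul _) (hci i2), integral_const_mul] at htot
  have hsq : ((-1 : ℂ) ^ a) * (-1) ^ a = 1 := by rw [← mul_pow]; simp
  rw [pow_succ]
  show _ = _ * ∫ y, ∑ i, (pd i χ y : ℂ) * W i y
  linear_combination ((-1 : ℂ) ^ a) * htot -
    (∫ y, (χ y : ℂ) * wedgeTop (rep x (dForm f) y) (rep x h y)) * hsq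

/-- The terms of the local Green formula, as pairings on `M`. -/
theorem PatchAtlas.green_mulSec (𝒜 : PatchAtlas S) (x : M) (hpp' : p⁻¹ + p'⁻¹ = 1) {ε : ℂ}
    {f : M → Alt dM a ℂ} {g : M → Alt dM (a + 1) ℂ}
    {h : M → Alt dM b ℂ} {u : M → Alt dM (b + 1) ℂ}
    (hf : IsLpLoc p f) (hg : IsLpLoc p g) (hh : IsLpLoc p' h) (hu : IsLpLoc p' u)
    (H : (∫ y, (𝒜.cutoff x y : ℂ) * wedgeTop (rep x g y) (rep x h y)) -
      ε * ∫ y, (𝒜.cutoff x y : ℂ) * wedgeTop (rep x f y) (rep x u y) =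
      ε * ∫ y, ∑ i, (pd i (𝒜.cutoff x) y : ℂ) *
        wedgeTop (rep x f y) (wedgeLin (dCoord i) (rep x h y))) :
    pairing S.Ω (mulSec (𝒜.χ x) g) h - ε * pairing S.Ω (mulSec (𝒜.χ x) f) u =
      ε * pairing S.Ω f (dWedge (𝒜.χ x) h) := by
  rw [𝒜.pairing_mulSec x hpp' hg hh, 𝒜.pairing_mulSec x hpp' hf hu, 𝒜.pairing_dWedge x hpp' hf hh]
  linear_combination ((𝒜.patch x).σ : ℂ) * H

/-- Stokes' formula for smooth forms, one of which has compact support. -/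
theorem PatchAtlas.stokes (𝒜 : PatchAtlas S)
    {f : M → Alt dM a ℂ} {h : M → Alt dM b ℂ}
    (hf : IsSmoothForm f) (hh : IsSmoothForm h) (hc : HasCompactSupport h) :
    pairing S.Ω (dForm f) h = (-1) ^ (a + 1) * pairing S.Ω f (dForm h) := by
  have h22 : (2 : ℝ≥0∞)⁻¹ + 2⁻¹ = 1 := ENNReal.inv_two_add_inv_two
  refine 𝒜.green_of_local h22 hf.isContForm.isLpLoc hf.dForm.isContForm.isLpLoc
    hh.isContForm.isLpLoc hh.dForm.isContForm.isLpLoc hc.isCompact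
    (Or.inr fun y hy => ⟨image_eq_zero_of_notMem_tsupport hy, ?_⟩) fun x =>
    𝒜.green_mulSec x h22 hf.isContForm.isLpLoc hf.dForm.isContForm.isLpLoc
    hh.isContForm.isLpLoc hh.dForm.isContForm.isLpLoc
    (stokes_local x hf hh (𝒜.contDiff_cutoff x) (𝒜.hasCompactSupport_cutoff x)
      ((𝒜.tsupport_cutoff x).trans (𝒜.K_subset_target x)))
  by_contra hn
  exact hy (support_dForm_subset h hn)

/-- Green's formula for the weak operator: it extends from smooth forms to forms with coefficients
in `L^p`, without any regularity of the boundary or approximation on `M`. -/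
theorem PatchAtlas.green (𝒜 : PatchAtlas S) [Fact (1 ≤ p)] [Fact (1 ≤ p')] (hp' : p' ≠ ⊤)
    (hpp' : p⁻¹ + p'⁻¹ = 1) {c e : ℕ} (hc : a + 1 = c) (he : b + 1 = e)
    {f : M → Alt dM a ℂ} {g : M → Alt dM c ℂ}
    {h : M → Alt dM b ℂ} {u : M → Alt dM e ℂ}
    (hf : IsLpLoc p' f) (hg : IsLpLoc p' g) (hh : IsLpLoc p h) (hu : IsLpLoc p u)
    (hfs : IsBidegree S s f) (hht : IsBidegree S t h)
    (h1 : ∀ φ : M → Alt dM b ℂ, IsTestForm S t φ →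
      pairing S.Ω g φ = (-1) ^ (a + 1) * pairing S.Ω f (dForm φ))
    (h2 : ∀ φ : M → Alt dM a ℂ, IsTestForm S s φ →
      pairing S.Ω u φ = (-1) ^ (b + 1) * pairing S.Ω h (dForm φ))
    (hhc : HasCompactSupport h) (huc : HasCompactSupport u) :
    pairing S.Ω g h = (-1) ^ (a + 1) * pairing S.Ω f u := by
  subst hc he
  have hpp'2 : p'⁻¹ + p⁻¹ = 1 := by rw [add_comm, hpp']
  refine 𝒜.green_of_local hpp'2 hf hg hh hu (hhc.isCompact.union huc.isCompact)
    (Or.inr fun y hy => ⟨image_eq_zero_of_notMem_tsupport fun h => hy (Or.inl h),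
      image_eq_zero_of_notMem_tsupport fun h => hy (Or.inr h)⟩) fun x =>
    𝒜.green_mulSec x hpp'2 hf hg hh hu ((𝒜.patch x).green_local hp' hpp' hf hg hh hu hfs hht h1 h2
      (𝒜.contDiff_cutoff x) (𝒜.hasCompactSupport_cutoff x)
      ((𝒜.tsupport_cutoff x).trans (𝒜.K_subset x)))

/-- A form which annihilates the test forms in a subbundle annihilates all sections of this
subbundle. -/
theorem PatchAtlas.pairing_eq_zero_of_tests (𝒜 : PatchAtlas S) [Fact (1 ≤ p)] [Fact (1 ≤ p')]
    (hp' : p' ≠ ⊤) (hpp' : p⁻¹ + p'⁻¹ = 1)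
    {g : M → Alt dM a ℂ} {h : M → Alt dM b ℂ}
    (hg : IsLpLoc p' g) (hh : IsLpLoc p h) (hht : IsBidegree S t h)
    (h1 : ∀ φ : M → Alt dM b ℂ, IsTestForm S t φ → pairing S.Ω g φ = 0)
    {C : Set M} (hC : IsCompact C) (h0 : ∀ y ∉ C, g y = 0 ∨ h y = 0) :
    pairing S.Ω g h = 0 := by
  have hpp'2 : p'⁻¹ + p⁻¹ = 1 := by rw [add_comm, hpp']
  obtain ⟨T, -, hT⟩ := 𝒜.exists_finset hC
  rw [𝒜.pairing_eq_sum hpp'2 hg hh hC h0 hT]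
  refine Finset.sum_eq_zero fun x _ => ?_
  rw [𝒜.pairing_mulSec x hpp'2 hg hh]
  set P := 𝒜.patch x
  have hσ : (P.σ : ℂ) ≠ 0 := Complex.ofReal_ne_zero.2 P.sign_ne_zero
  obtain ⟨K, hK, hχK, hKO⟩ := exists_compact_between (𝒜.isCompact_K x) P.isOpen (𝒜.K_subset x)
  let G : FrameIdx n k b t → Model dM → ℂ :=
    fun κ y => wedgeTop (rep x g y) (P.frame κ.1 y)
  let H : FrameIdx n k b t → Model dM → ℂ :=
    fun κ y => (b.factorial : ℂ)⁻¹ * coeff (fderiv ℝ P.w y) κ.1 (rep x h y)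
  have hG : ∀ κ, MemLp (G κ) p' (volume.restrict K) := fun κ =>
    P.memLp_wedgeTop_frame hK hKO hg κ.1
  have hH : ∀ κ, MemLp (H κ) p (volume.restrict K) := fun κ =>
    (P.memLp_coeff hK hKO hh κ.1).const_mul _
  have hχ0 : ∀ y ∉ K, 𝒜.cutoff x y = 0 := fun y hy =>
    𝒜.cutoff_eq_zero x fun h => hy (interior_subset (hχK h))
  have main := friedrichs_on (ια := Empty) hp' hpp' hK isOpen_interior interior_subset
    (𝒜.contDiff_cutoff x) (𝒜.hasCompactSupport_cutoff x) ((𝒜.tsupport_cutoff x).trans hχK)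
    (A := fun e => e.elim) (fun e => e.elim) (fun e => e.elim) (fun e => e.elim)
    (f := fun e => e.elim) (u := fun e => e.elim) (fun e => e.elim) (fun e => e.elim) hG hH
    (fun η hη hηc hηV ν => by
      have hηO : tsupport η ⊆ P.O := hηV.trans (interior_subset.trans hKO)
      have e := h1 _ (P.isTestForm ν.2 hη hηc hηO)
      rw [P.pairing_test hpp'2 hg ν.2 hη hηc hηO] at e
      simpa using (mul_eq_zero.1 e).resolve_left hσ) (fun _ _ _ _ e => e.elim)
  have i1 : ∀ β, Integrable fun y => (𝒜.cutoff x y : ℂ) * (G β y * H β y) := fun β => by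
    have := integrable_mul_mul_of_memLp (m := fun y => (𝒜.cutoff x y : ℂ)) hpp'2 hK (hG β) (hH β)
      (Complex.continuous_ofReal.comp (𝒜.contDiff_cutoff x).continuous) fun y hy => by
        simp [hχ0 y hy]
    simpa only [mul_comm] using this
  rw [← integral_finsetSum Finset.univ fun β _ => i1 β, Fintype.sum_empty, Fintype.sum_empty,
    sub_zero] at main
  refine mul_eq_zero_of_right _ (Eq.trans (integral_congr_ae (.of_forall fun y => ?_)) main)
  by_cases hy : y ∈ K
  · show (𝒜.cutoff x y : ℂ) * _ = ∑ β, (𝒜.cutoff x y : ℂ) * (G β y * H β y)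
    rw [P.wedgeTop_eq_sum_right hht (hKO hy), Finset.mul_sum]
  · simp [hχ0 y hy]

end GlobalGreen

/-! ### Gluing forms with a partition of unity -/

section Glue

theorem eLpNorm_sum_le_sum {α E ι : Type*} [MeasurableSpace α] {μ : Measure α} [NormedAddCommGroup E]
    {p : ℝ≥0∞} (hp : 1 ≤ p) (T : Finset ι) {f : ι → α → E} (hf : ∀ i, MemLp (f i) p μ) :
    MemLp (fun y => ∑ i ∈ T, f i y) p μ ∧
      eLpNorm (fun y => ∑ i ∈ T, f i y) p μ ≤ ∑ i ∈ T, eLpNorm (f i) p μ := by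
  have h : (fun y => ∑ i ∈ T, f i y) = ∑ i ∈ T, f i := by
    funext y
    rw [Finset.sum_apply]
  rw [h]
  exact ⟨memLp_finsetSum' _ fun i _ => hf i, eLpNorm_sum_le (fun i _ => (hf i).1) hp⟩

/-- The section `∑_x χ_x w_x`. -/
def PatchAtlas.glue (𝒜 : PatchAtlas S) (w : M → M → Alt dM m ℂ) (y : M) :
    Alt dM m ℂ := ∑ᶠ x, mulSec (𝒜.χ x) (w x) y

theorem PatchAtlas.glue_eq_sum (𝒜 : PatchAtlas S) (w : M → M → Alt dM m ℂ) {T : Finset M}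
    {y : M} (hT : ∀ x ∉ T, y ∉ tsupport (𝒜.χ x)) :
    𝒜.glue w y = ∑ x ∈ T, mulSec (𝒜.χ x) (w x) y := by
  refine finsum_eq_sum_of_support_subset _ fun x hx => ?_
  by_contra hn
  exact hx (mulSec_eq_zero (Or.inl (image_eq_zero_of_notMem_tsupport (hT x hn))))

theorem PatchAtlas.glue_const [T2Space M] [SigmaCompactSpace M] (𝒜 : PatchAtlas S)
    (f : M → Alt dM m ℂ) : 𝒜.glue (fun _ => f) = f := by
  funext y
  obtain ⟨T, hT, hT1⟩ := 𝒜.exists_finset (isCompact_singleton (x := y))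
  rw [𝒜.glue_eq_sum _ fun x hx => hT x hx y rfl]
  simp only [mulSec]
  rw [← Finset.sum_smul, ← Complex.ofReal_sum, (hT1 y rfl).self_of_nhds, Complex.ofReal_one,
    one_smul]

theorem BidegAt.add {y : M} {q : ℤ} {α β : Alt dM m ℂ} (hα : BidegAt S y q α)
    (hβ : BidegAt S y q β) : BidegAt S y q (α + β) := fun ζ h => by
  rw [complexEval_add, hα ζ h, hβ ζ h, add_zero]

theorem PatchAtlas.isBidegree_glue [T2Space M] [SigmaCompactSpace M] (𝒜 : PatchAtlas S)
    {w : M → M → Alt dM m ℂ} (hw : ∀ x, IsBidegree S s (w x)) :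
    IsBidegree S s (𝒜.glue w) := by
  intro y
  obtain ⟨T, hT, -⟩ := 𝒜.exists_finset (isCompact_singleton (x := y))
  show BidegAt S y s (𝒜.glue w y)
  rw [𝒜.glue_eq_sum _ fun x hx => hT x hx y rfl]
  exact Finset.sum_induction _ (BidegAt S y s) (fun _ _ h h' => h.add h') (bidegAt_zero S y s)
    fun x _ => (hw x).mulSec (𝒜.χ x) y

theorem PatchAtlas.exists_eLpNorm_glue_le [T2Space M] [SigmaCompactSpace M] (𝒜 : PatchAtlas S)
    (hp1 : 1 ≤ p) (hp : p ≠ ⊤) (c : M) {K : Set (Model dM)} (hK : IsCompact K)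
    (hKc : K ⊆ (chart c).target) (m : ℕ) :
    ∃ (T : Finset M) (A : ℝ≥0∞), A ≠ ⊤ ∧ ∀ w : M → M → Alt dM m ℂ,
      (∀ x, IsLpLoc p (w x)) → MemLp (rep c (𝒜.glue w)) p (volume.restrict K) ∧
      eLpNorm (rep c (𝒜.glue w)) p (volume.restrict K) ≤
        A * ∑ x ∈ T, eLpNorm (rep x (w x)) p (volume.restrict (𝒜.K x)) := by
  obtain ⟨T, hT, -⟩ := 𝒜.exists_finset (hK.image_of_continuousOn
    ((chart c).continuousOn_symm.mono hKc))
  choose A hA hA' using fun x => exists_eLpNorm_rep_le hp c x hK hKc (𝒜.isCompact x)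
    (𝒜.subset_source x) m
  refine ⟨T, ∑ x ∈ T, A x, ENNReal.sum_ne_top.2 fun x _ => hA x, fun w hw => ?_⟩
  have hmem : ∀ x, IsLpLoc p (mulSec (𝒜.χ x) (w x)) := fun x =>
    (hw x).mulSec (𝒜.χ x).contMDiff.continuous
  have heq : ∀ y ∈ K, rep c (𝒜.glue w) y = ∑ x ∈ T, rep c (mulSec (𝒜.χ x) (w x)) y := by
    intro y hy
    have h1 := 𝒜.glue_eq_sum w fun x hx => hT x hx _ (mem_image_of_mem _ hy)
    ext v
    simp [rep, h1]
  have hae : rep c (𝒜.glue w) =ᵐ[volume.restrict K]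
      fun y => ∑ x ∈ T, rep c (mulSec (𝒜.χ x) (w x)) y :=
    ae_restrict_of_forall_mem hK.measurableSet heq
  have hsum := eLpNorm_sum_le_sum hp1 T fun x => hmem x c K hK hKc
  refine ⟨(memLp_congr_ae hae).2 hsum.1, ?_⟩
  rw [eLpNorm_congr_ae hae]
  refine hsum.2.trans ?_
  rw [Finset.mul_sum]
  refine Finset.sum_le_sum fun x hx => ?_
  have h1 := (hA' x (mulSec (𝒜.χ x) (w x)) (fun y hy => mulSec_eq_zero
    (Or.inl (image_eq_zero_of_notMem_tsupport hy)))
    (hmem x x _ (𝒜.isCompact_K x) (𝒜.K_subset_target x)).1).2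
  refine h1.trans (mul_le_mul' (Finset.single_le_sum (f := A) (fun _ _ => zero_le) hx)
    (eLpNorm_mono fun y => ?_))
  rw [rep_mulSec, norm_smul]
  refine mul_le_of_le_one_left (norm_nonneg _) ?_
  rw [Complex.norm_real, Real.norm_eq_abs, abs_of_nonneg (𝒜.χ.nonneg x _)]
  exact 𝒜.χ.le_one x _

theorem PatchAtlas.isLpLoc_glue [T2Space M] [SigmaCompactSpace M] (𝒜 : PatchAtlas S)
    (hp1 : 1 ≤ p) (hp : p ≠ ⊤) {w : M → M → Alt dM m ℂ} (hw : ∀ x, IsLpLoc p (w x)) :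
    IsLpLoc p (𝒜.glue w) := fun c _ hK hKc => by
  obtain ⟨T, A, -, h⟩ := 𝒜.exists_eLpNorm_glue_le hp1 hp c hK hKc m
  exact (h w hw).1

end Glue

/-! ### The topology of `(L^p_loc)^{r,q}(M)` -/

section Topology

theorem induced_lp {A ι Y E : Type*} [AddCommGroup A] [Module ℂ A] [MeasurableSpace Y]
    [NormedAddCommGroup E] [NormedSpace ℂ E] {p : ℝ≥0∞} [Fact (1 ≤ p)] {μ : ι → Measure Y}
    (R : A →ₗ[ℂ] ∀ i, Lp E p (μ i)) :
    @IsTopologicalAddGroup A (.induced R Pi.topologicalSpace) _ ∧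
    @ContinuousSMul ℂ A _ _ (.induced R Pi.topologicalSpace) ∧
    @LocallyConvexSpace ℝ A _ _ _ _ (.induced R Pi.topologicalSpace) :=
  ⟨topologicalAddGroup_induced R, continuousSMul_induced R,
    LocallyConvexSpace.induced (R.restrictScalars ℝ)⟩

variable [Fact (1 ≤ p)]

variable (S p r s) in
/-- The restrictions of forms to all compact sets in charts. -/
def LpLoc.restrictₗ : LpLoc S p r s →ₗ[ℂ] ∀ i : ChartCompact dM M,
    Lp (Alt dM (deg r s) ℂ) p (volume.restrict i.1.2) where
  toFun f i := f.restrict i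
  map_add' f g := by
    funext i
    refine Eq.trans ?_ (MemLp.toLp_add (f.2.2 i.1.1 i.1.2 i.2.1 i.2.2) (g.2.2 i.1.1 i.1.2 i.2.1 i.2.2))
    exact MemLp.toLp_congr _ _ (.of_forall fun y => rep_add i.1.1 f.form g.form y)
  map_smul' z f := by
    funext i
    refine Eq.trans ?_ (MemLp.toLp_const_smul z (f.2.2 i.1.1 i.1.2 i.2.1 i.2.2))
    exact MemLp.toLp_congr _ _ (.of_forall fun y => rep_smul i.1.1 z f.form y)

instance : IsTopologicalAddGroup (LpLoc S p r s) := (induced_lp (LpLoc.restrictₗ S p r s)).1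

instance : ContinuousSMul ℂ (LpLoc S p r s) := (induced_lp (LpLoc.restrictₗ S p r s)).2.1

instance : LocallyConvexSpace ℝ (LpLoc S p r s) :=
  (induced_lp (LpLoc.restrictₗ S p r s)).2.2

theorem LpLoc.isInducing : IsInducing (LpLoc.restrictₗ S p r s) := ⟨rfl⟩

theorem LpLoc.continuous_restrict (i : ChartCompact dM M) :
    Continuous fun f : LpLoc S p r s => f.restrict i :=
  (continuous_apply i).comp LpLoc.isInducing.continuous

theorem LpLoc.norm_restrict (f : LpLoc S p r s) (i : ChartCompact dM M) :
    ‖f.restrict i‖ = (eLpNorm (rep i.1.1 f.form) p (volume.restrict i.1.2)).toReal :=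
  Lp.norm_toLp _ _

theorem LpLoc.restrict_sub (f g : LpLoc S p r s) (i : ChartCompact dM M) :
    (f - g).restrict i = f.restrict i - g.restrict i :=
  congrFun (map_sub (LpLoc.restrictₗ S p r s) f g) i

/-- The support of a function of the partition of unity as a compact set in a chart. -/
def PatchAtlas.idx (𝒜 : PatchAtlas S) (x : M) : ChartCompact dM M :=
  ⟨(x, 𝒜.K x), 𝒜.isCompact_K x, 𝒜.K_subset_target x⟩

variable [T2Space M] [SigmaCompactSpace M]

/-- Finitely many of the seminorms given by the atlas dominate each of the seminorms. -/
theorem PatchAtlas.exists_norm_restrict_le (𝒜 : PatchAtlas S) (hp : p ≠ ⊤) (r : ℕ) (s : ℤ)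
    (i : ChartCompact dM M) : ∃ (T : Finset M) (A : ℝ), 0 ≤ A ∧ ∀ f : LpLoc S p r s,
      ‖f.restrict i‖ ≤ A * ∑ x ∈ T, ‖f.restrict (𝒜.idx x)‖ := by
  obtain ⟨T, A, hA, h⟩ := 𝒜.exists_eLpNorm_glue_le Fact.out hp i.1.1 i.2.1 i.2.2 (deg r s)
  refine ⟨T, A.toReal, ENNReal.toReal_nonneg, fun f => ?_⟩
  have h1 := (h (fun _ => f.form) fun _ => f.2.2).2
  rw [𝒜.glue_const] at h1
  have hfin : ∀ x ∈ T, eLpNorm (rep x f.form) p (volume.restrict (𝒜.K x)) ≠ ⊤ := fun x _ =>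
    (f.2.2 x _ (𝒜.isCompact_K x) (𝒜.K_subset_target x)).2.ne
  rw [LpLoc.norm_restrict]
  refine (ENNReal.toReal_mono (ENNReal.mul_ne_top hA (ENNReal.sum_ne_top.2 hfin)) h1).trans ?_
  rw [ENNReal.toReal_mul, ENNReal.toReal_sum hfin]
  exact le_of_eq (congrArg _ (sum_ext fun x => (LpLoc.norm_restrict f (𝒜.idx x)).symm))

/-- Convergence in `L^p_loc` is convergence on the supports of the partition of unity. -/
theorem PatchAtlas.tendsto_iff (𝒜 : PatchAtlas S) (hp : p ≠ ⊤) {ι : Type*} {l : Filter ι}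
    {u : ι → LpLoc S p r s} {f : LpLoc S p r s}
    (h : ∀ x, Tendsto (fun j => ‖(u j - f).restrict (𝒜.idx x)‖) l (𝓝 0)) : Tendsto u l (𝓝 f) := by
  rw [LpLoc.isInducing.tendsto_nhds_iff, tendsto_pi_nhds]
  intro i
  rw [tendsto_iff_norm_sub_tendsto_zero]
  obtain ⟨T, A, -, hT⟩ := 𝒜.exists_norm_restrict_le hp r s i
  have h1 : Tendsto (fun j => A * ∑ x ∈ T, ‖(u j - f).restrict (𝒜.idx x)‖) l (𝓝 0) := by
    have := (tendsto_finsetSum T fun x _ => h x).const_mul A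
    simpa using this
  refine squeeze_zero (fun _ => norm_nonneg _) (fun j => ?_) h1
  show ‖(u j).restrict i - f.restrict i‖ ≤ _
  rw [← LpLoc.restrict_sub]
  exact hT _

/-- As `M` is `σ`-compact, countably many charts define the topology. -/
theorem LpLoc.firstCountableTopology (𝒜 : PatchAtlas S) (hp : p ≠ ⊤) :
    FirstCountableTopology (LpLoc S p r s) := by
  let J := {x : M // (Function.support (𝒜.χ x)).Nonempty}
  have hJ : Countable J := by
    have hlf : LocallyFinite fun x : J => Function.support (𝒜.χ x.1) :=
      𝒜.χ.locallyFinite.comp_injective Subtype.val_injective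
    exact countable_univ_iff.1 (hlf.countable_univ fun x => x.2)
  let R : LpLoc S p r s → ∀ x : J, Lp (Alt dM (deg r s) ℂ) p (volume.restrict (𝒜.K x.1)) :=
    fun f x => f.restrict (𝒜.idx x.1)
  have hR : IsInducing R := by
    rw [isInducing_iff_nhds]
    intro f
    refine le_antisymm (continuous_pi fun x : J =>
      LpLoc.continuous_restrict (𝒜.idx x.1)).continuousAt.tendsto.le_comap ?_
    have : Tendsto (fun g : LpLoc S p r s => g) (comap R (𝓝 (R f))) (𝓝 f) := by
      refine 𝒜.tendsto_iff hp fun x => ?_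
      by_cases hx : (Function.support (𝒜.χ x)).Nonempty
      · have h1 := tendsto_iff_norm_sub_tendsto_zero.1
          (tendsto_pi_nhds.1 (tendsto_comap (f := R) (x := 𝓝 (R f))) ⟨x, hx⟩)
        refine h1.congr fun g => ?_
        rw [LpLoc.restrict_sub]
        rfl
      · have h0 : 𝒜.K x = ∅ := by
          rw [PatchAtlas.K, tsupport, not_nonempty_iff_eq_empty.1 hx, closure_empty, image_empty]
        refine tendsto_const_nhds.congr fun g => ?_
        rw [LpLoc.norm_restrict]
        show 0 = (eLpNorm _ p (volume.restrict (𝒜.K x))).toReal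
        rw [h0, Measure.restrict_empty, eLpNorm_measure_zero, ENNReal.toReal_zero]
    exact this
  exact hR.firstCountableTopology

/-- The fibrewise projection to the forms of bidegree `(m - s, s)`, along the remaining forms of the
frame. -/
theorem Patch.exists_proj (P : Patch S x) (m : ℕ) (s : ℤ) :
    ∃ Q : Model dM → Alt dM m ℂ →L[ℝ] Alt dM m ℂ,
      (∀ y ∈ P.O, ContinuousAt Q y) ∧
      (∀ y ∈ P.O, ∀ α, Bideg (fderiv ℝ P.w y) (frameH n k) s (Q y α)) ∧
      ∀ f : M → Alt dM m ℂ, IsBidegree S s f → ∀ y ∈ P.O, Q y (rep x f y) = rep x f y := by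
  choose L hL hL' using fun κ : Fin m → Fin dM => P.exists_coeff κ
  refine ⟨fun y => ∑ κ : FrameIdx n k m s,
    ((ContinuousLinearMap.lsmul ℝ ℂ).flip ((m.factorial : ℂ)⁻¹ • P.frame κ.1 y)).comp (L κ.1 y),
    fun y hy => ?_, fun y hy α => ?_, fun f hf y hy => ?_⟩
  · refine tendsto_finsetSum _ fun κ _ => ?_
    have h0 : Continuous fun β : Alt dM m ℂ => ContinuousLinearMap.flip
        (ContinuousLinearMap.lsmul ℝ ℂ : ℂ →L[ℝ] Alt dM m ℂ →L[ℝ] Alt dM m ℂ) β :=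
      ContinuousLinearMap.continuous _
    have h1 : ContinuousAt (fun z => (m.factorial : ℂ)⁻¹ • P.frame κ.1 z) y :=
      Tendsto.const_smul (P.contDiffAt_frame κ.1 hy).continuousAt.tendsto _
    exact (h0.continuousAt.comp h1).clm_comp (hL κ.1 y hy).continuousAt
  · rw [sum_apply]
    refine Bideg.sum fun κ _ => ?_
    exact ((bideg_coframe (P.det_ne_zero y hy) κ.2).smul _).smul _
  · conv_rhs => rw [rep_eq_sum_frame P hf hy]
    rw [sum_apply, Finset.smul_sum]
    refine sum_ext fun κ => ?_
    show L κ.1 y (rep x f y) • (m.factorial : ℂ)⁻¹ • P.frame κ.1 y = _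
    rw [hL' κ.1 y hy, smul_comm]

end Topology

/-! ### Completeness of `(L^p_loc)^{r,q}(M)` -/

section Complete

theorem exists_opNorm_bound {Y E F : Type*} [TopologicalSpace Y] [NormedAddCommGroup E] [NormedSpace ℝ E]
    [NormedAddCommGroup F] [NormedSpace ℝ F] {K : Set Y} (hK : IsCompact K) {L : Y → E →L[ℝ] F}
    (hL : ContinuousOn L K) : ∃ B : ℝ, ∀ y ∈ K, ∀ v, ‖L y v‖ ≤ B * ‖v‖ := by
  obtain ⟨B, hB⟩ := hK.exists_bound_of_continuousOn hL
  exact ⟨B, fun y hy v => (L y).le_of_opNorm_le (hB y hy) v⟩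

theorem eLpNorm_sub_eq_ofReal_norm {Y E : Type*} [MeasurableSpace Y] {μ : Measure Y}
    [NormedAddCommGroup E] {p : ℝ≥0∞} {f : Y → E} (hf : MemLp f p μ) (g : Lp E p μ) :
    eLpNorm (fun y => f y - g y) p μ = ENNReal.ofReal ‖hf.toLp f - g‖ := by
  have h1 : hf.toLp f - g = (hf.sub (Lp.memLp g)).toLp _ := by
    rw [MemLp.toLp_sub hf (Lp.memLp g), Lp.toLp_coeFn]
  rw [h1, Lp.norm_toLp, ENNReal.ofReal_toReal (hf.sub (Lp.memLp g)).2.ne]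
  rfl

variable [Fact (1 ≤ p)] [T2Space M] [SigmaCompactSpace M]

/-- A form on the support of `χ_x`, projected to the bundle of forms of bidegree given by `s`. -/
theorem Patch.exists_form_of_memLp (P : Patch S x) (hp : p ≠ ⊤) {C : Set M} (hC : IsCompact C)
    (hCx : C ⊆ (chart x).source)
    (hCO : chart x '' C ⊆ P.O) (m : ℕ) (s : ℤ) :
    ∃ B : ℝ, ∀ u : Model dM → Alt dM m ℂ,
      MemLp u p (volume.restrict (chart x '' C)) →
      ∃ v : M → Alt dM m ℂ, IsBidegree S s v ∧ IsLpLoc p v ∧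
        ∀ f : M → Alt dM m ℂ, IsBidegree S s f →
          eLpNorm (fun y => rep x f y - rep x v y) p
            (volume.restrict (chart x '' C)) ≤
          ENNReal.ofReal B * eLpNorm (fun y => rep x f y - u y) p
            (volume.restrict (chart x '' C)) := by
  obtain ⟨Q, hQ, hQs, hQf⟩ := P.exists_proj m s
  have hK := isCompact_chart_image hC hCx
  have hQK : ContinuousOn Q (chart x '' C) := fun y hy =>
    (hQ y (hCO hy)).continuousWithinAt
  obtain ⟨B, hB⟩ := exists_opNorm_bound hK hQK
  refine ⟨B, fun u hu => ?_⟩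
  let v : M → Alt dM m ℂ := C.indicator (ofChart x fun y => Q y (u y))
  have hv0 : ∀ y ∉ C, v y = 0 := fun y hy => indicator_of_notMem hy _
  have hvr : ∀ y ∈ chart x '' C, rep x v y = Q y (u y) := by
    intro y hy
    have hyt := chart_image_subset hCx hy
    rw [← rep_ofChart x (fun y => Q y (u y)) hyt]
    have h1 : v ((chart x).symm y) =
        ofChart x (fun y => Q y (u y)) ((chart x).symm y) :=
      indicator_of_mem ((mem_chart_image hCx hyt).1 hy) _
    rw [rep, rep, h1]
  refine ⟨v, isBidegree_of_patch P hCx hCO hv0 fun y hy => ?_, isLpLoc_of_chart hp hC hCx hv0 ?_,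
    fun f hf => ?_⟩
  · rw [hvr y hy]
    exact hQs y (hCO hy) _
  · refine (memLp_congr_ae ?_).2 (memLp_clm_apply hK hQK hu)
    exact ae_restrict_of_forall_mem hK.measurableSet hvr
  · refine eLpNorm_le_mul_eLpNorm_of_ae_le_mul ?_ p
    refine ae_restrict_of_forall_mem hK.measurableSet fun y hy => ?_
    rw [hvr y hy, ← hQf f hf y (hCO hy), ← map_sub, hQf f hf y (hCO hy)]
    exact hB y hy _

/-- The limits in the charts are glued with the partition of unity; they need not agree everywhere on
overlaps. -/
theorem LpLoc.exists_tendsto (𝒜 : PatchAtlas S) (hp : p ≠ ⊤) {u : ℕ → LpLoc S p r s}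
    (hu : ∀ x, CauchySeq fun j => (u j).restrict (𝒜.idx x)) :
    ∃ f : LpLoc S p r s, Tendsto u atTop (𝓝 f) := by
  choose g hg using fun x => cauchySeq_tendsto_of_complete (hu x)
  choose B hB using fun x => (𝒜.patch x).exists_form_of_memLp hp (𝒜.isCompact x)
    (𝒜.subset_source x) (𝒜.image_subset x) (deg r s) s
  choose v hvs hvp hv using fun x => hB x (g x) (Lp.memLp (g x))
  let f : LpLoc S p r s := ⟨𝒜.glue v, 𝒜.isBidegree_glue hvs, 𝒜.isLpLoc_glue Fact.out hp hvp⟩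
  refine ⟨f, ?_⟩
  rw [LpLoc.isInducing.tendsto_nhds_iff, tendsto_pi_nhds]
  intro i
  rw [tendsto_iff_norm_sub_tendsto_zero]
  obtain ⟨T, A, hA, hT⟩ := 𝒜.exists_eLpNorm_glue_le (p := p) Fact.out hp i.1.1 i.2.1 i.2.2 (deg r s)
  -- The difference `u_j - f` is glued from the forms `u_j - v_x`.
  have hglue : ∀ j, 𝒜.glue (fun x => (u j).form - v x) = (u j - f).form := by
    intro j
    funext y
    obtain ⟨T', hT', -⟩ := 𝒜.exists_finset (isCompact_singleton (x := y))
    have h1 : (u j).form y = 𝒜.glue (fun _ => (u j).form) y := by rw [𝒜.glue_const]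
    show _ = (u j).form y - 𝒜.glue v y
    rw [h1, 𝒜.glue_eq_sum _ fun x hx => hT' x hx y rfl, 𝒜.glue_eq_sum _ fun x hx => hT' x hx y rfl,
      𝒜.glue_eq_sum _ fun x hx => hT' x hx y rfl, ← Finset.sum_sub_distrib]
    refine sum_ext fun x => ?_
    simp only [mulSec, Pi.sub_apply, smul_sub]
  have hsub : ∀ j x, IsLpLoc p ((u j).form - v x) := fun j x => by
    have := (u j).2.2.add ((hvp x).smul (-1))
    rwa [neg_one_smul, ← sub_eq_add_neg] at this
  have hrs : ∀ j x, rep x ((u j).form - v x) = fun y => rep x (u j).form y - rep x (v x) y := by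
    intro j x
    funext y
    ext w
    simp [rep]
  have hnorm : ∀ j x, eLpNorm (fun y => rep x (u j).form y - g x y) p (volume.restrict (𝒜.K x)) =
      ENNReal.ofReal ‖(u j).restrict (𝒜.idx x) - g x‖ := by
    intro j x
    exact eLpNorm_sub_eq_ofReal_norm ((u j).2.2 x _ (𝒜.isCompact_K x) (𝒜.K_subset_target x)) (g x)
  have hbound : ∀ j, eLpNorm (rep i.1.1 (u j - f).form) p (volume.restrict i.1.2) ≤
      A * ∑ x ∈ T, ENNReal.ofReal (B x) *
        ENNReal.ofReal ‖(u j).restrict (𝒜.idx x) - g x‖ := by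
    intro j
    rw [← hglue j]
    refine ((hT _ fun x => hsub j x).2).trans (mul_le_mul_right (Finset.sum_le_sum fun x _ => ?_) _)
    rw [hrs j x, ← hnorm j x]
    exact hv x _ (u j).2.1
  have hlim : Tendsto (fun j => A * ∑ x ∈ T, ENNReal.ofReal (B x) *
        ENNReal.ofReal ‖(u j).restrict (𝒜.idx x) - g x‖) atTop (𝓝 0) := by
    have h1 : ∀ x, Tendsto (fun j => ENNReal.ofReal (B x) *
        ENNReal.ofReal ‖(u j).restrict (𝒜.idx x) - g x‖) atTop (𝓝 0) := fun x => by
      have h2 := ENNReal.tendsto_ofReal (tendsto_iff_norm_sub_tendsto_zero.1 (hg x))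
      have h3 := ENNReal.Tendsto.const_mul h2 (a := ENNReal.ofReal (B x))
        (Or.inr ENNReal.ofReal_ne_top)
      simpa using h3
    have h4 := ENNReal.Tendsto.const_mul (tendsto_finsetSum T fun x _ => h1 x) (a := A) (Or.inr hA)
    simpa using h4
  have h5 := (ENNReal.tendsto_toReal ENNReal.zero_ne_top).comp
    (tendsto_of_tendsto_of_tendsto_of_le_of_le tendsto_const_nhds hlim (fun _ => zero_le) hbound)
  refine h5.congr fun j => ?_
  rw [Function.comp_apply, ← LpLoc.norm_restrict]
  exact congrArg _ (LpLoc.restrict_sub (u j) f i)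

theorem LpLoc.complete (𝒜 : PatchAtlas S) (hp : p ≠ ⊤) :
    letI : UniformSpace (LpLoc S p r s) := IsTopologicalAddGroup.rightUniformSpace _
    (uniformity (LpLoc S p r s)).IsCountablyGenerated ∧ CompleteSpace (LpLoc S p r s) := by
  let : UniformSpace (LpLoc S p r s) := IsTopologicalAddGroup.rightUniformSpace _
  have hU : IsUniformAddGroup (LpLoc S p r s) := isUniformAddGroup_of_addCommGroup
  have hf := LpLoc.firstCountableTopology (r := r) (s := s) 𝒜 hp
  have hc : (uniformity (LpLoc S p r s)).IsCountablyGenerated :=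
    IsUniformAddGroup.uniformity_countably_generated
  refine ⟨hc, UniformSpace.complete_of_cauchySeq_tendsto fun u hu => ?_⟩
  refine LpLoc.exists_tendsto 𝒜 hp fun x => ?_
  have h1 : UniformContinuous fun f : LpLoc S p r s => f.restrict (𝒜.idx x) :=
    uniformContinuous_addMonoidHom_of_continuous
      (f := ((LinearMap.proj (𝒜.idx x)).comp (LpLoc.restrictₗ S p r s)).toAddMonoidHom)
      (LpLoc.continuous_restrict (𝒜.idx x))
  exact hu.map h1

end Complete

/-! ### The inductive limit topology of `(L^p_c)^{r,q}(M)` -/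

section CompTopology

variable [Fact (1 ≤ p)]

theorem LpLoc.isLpLoc (f : LpLoc S p r s) : IsLpLoc p f.form := f.2.2

theorem LpLoc.isBidegree (f : LpLoc S p r s) : IsBidegree S s f.form := f.2.1

theorem LpComp.isLpLoc (f : LpComp S p r s) : IsLpLoc p f.form := f.2.1.2

theorem LpComp.isBidegree (f : LpComp S p r s) : IsBidegree S s f.form := f.2.1.1

theorem LpComp.hasCompactSupport (f : LpComp S p r s) : HasCompactSupport f.form := f.2.2

instance : IsTopologicalAddGroup (LpComp S p r s) := topologicalAddGroup_sInf fun _ h => h.2.1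

theorem LpComp.continuousSMul_real : ContinuousSMul ℝ (LpComp S p r s) :=
  continuousSMul_sInf fun _ h => h.2.2.1

instance : LocallyConvexSpace ℝ (LpComp S p r s) := LocallyConvexSpace.sInf fun _ h => h.2.2.2

/-- A linear map on `(L^p_c)^{r,q}(M)` is continuous if it is continuous on the spaces of forms with
support in a fixed compact set. -/
theorem LpComp.continuous_of_linear {E : Type*} [AddCommGroup E] [Module ℝ E] [TopologicalSpace E]
    [IsTopologicalAddGroup E] [ContinuousSMul ℝ E] [LocallyConvexSpace ℝ E]
    (l : LpComp S p r s →ₗ[ℝ] E)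
    (h : ∀ (K : Set M) (hK : IsCompact K), Continuous fun f => l (LpOn.incl S p r s hK f)) :
    Continuous l :=
  continuous_iff_le_induced.2 (sInf_le ⟨fun K hK => continuous_induced_rng.2 (h K hK),
    topologicalAddGroup_induced l, continuousSMul_induced l, LocallyConvexSpace.induced l⟩)

theorem LpComp.continuous_incl {K : Set M} (hK : IsCompact K) :
    Continuous (LpOn.incl S p r s hK) := continuous_sInf_rng.2 fun _ h => h.1 K hK

instance : ContinuousSMul ℂ (LpComp S p r s) := by
  have hR := LpComp.continuousSMul_real (S := S) (p := p) (r := r) (s := s)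
  have hI : Continuous fun f : LpComp S p r s => Complex.I • f := by
    refine LpComp.continuous_of_linear (LinearMap.lsmul ℂ _ Complex.I |>.restrictScalars ℝ)
      fun K hK => ?_
    have h1 : Continuous fun f : LpOn S p r s K => Complex.I • f.1 :=
      (continuous_const_smul Complex.I).comp continuous_subtype_val
    have hsupp : ∀ f : LpOn S p r s K, tsupport (Complex.I • f.1).form ⊆ K := fun f =>
      (closure_mono (s := Function.support (Complex.I • f.1).form)
        (t := Function.support f.1.form) fun y hy h => hy (by
          show Complex.I • f.1.form y = 0
          rw [h, smul_zero])).trans f.2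
    have h2 : Continuous fun f : LpOn S p r s K => (⟨Complex.I • f.1, hsupp f⟩ : LpOn S p r s K) :=
      h1.subtype_mk hsupp
    exact (LpComp.continuous_incl hK).comp h2
  refine ⟨?_⟩
  have h1 : (fun q : ℂ × LpComp S p r s => q.1 • q.2) =
      fun q => q.1.re • q.2 + q.1.im • Complex.I • q.2 := by
    funext q
    conv_lhs => rw [← Complex.re_add_im q.1, add_smul, mul_smul]
    rfl
  rw [h1]
  exact ((Complex.continuous_re.comp continuous_fst).smul continuous_snd).add
    ((Complex.continuous_im.comp continuous_fst).smul (hI.comp continuous_snd))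

/-- The inclusion of the forms with compact support. -/
def LpComp.toLoc : LpComp S p r s →ₗ[ℂ] LpLoc S p r s where
  toFun f := ⟨f.form, f.2.1⟩
  map_add' _ _ := rfl
  map_smul' _ _ := rfl

theorem LpComp.continuous_toLoc : Continuous (LpComp.toLoc (S := S) (p := p) (r := r) (s := s)) := by
  have hR : ContinuousSMul ℝ (LpLoc S p r s) := IsScalarTower.continuousSMul ℂ
  exact LpComp.continuous_of_linear (LpComp.toLoc.restrictScalars ℝ) fun K hK => continuous_subtype_val

end CompTopology

/-! ### The duality between `(L^p_loc)^{r,q}(M)` and `(L^{p'}_c)^{n-r,n-k-q}(M)` -/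

section Pairing

/-- Hölder's inequality for a bilinear expression, as continuity in one of its arguments. -/
theorem exists_integral_bilin_bound {Y E F : Type*} [MeasurableSpace Y] {μ : Measure Y}
    [NormedAddCommGroup E] [NormedSpace ℝ E] [NormedAddCommGroup F] [NormedSpace ℝ F]
    {p p' : ℝ≥0∞} [Fact (1 ≤ p)] [Fact (1 ≤ p')]
    (hpp' : p⁻¹ + p'⁻¹ = 1) (B : E →L[ℝ] F →L[ℝ] ℂ) {b : Y → F} (hb : MemLp b p' μ) :
    ∃ C : ℝ, ∀ (f : Y → E) (hf : MemLp f p μ), ‖∫ y, B (f y) (b y) ∂μ‖ ≤ C * ‖hf.toLp f‖ := by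
  have : ENNReal.HolderConjugate p p' := ⟨by rw [hpp', inv_one]⟩
  let L : Lp E p μ →L[ℝ] ℂ := (B.lpPairing μ p p').flip (hb.toLp b)
  refine ⟨‖L‖, fun f hf => ?_⟩
  refine le_trans (le_of_eq ?_) (L.le_opNorm (hf.toLp f))
  congr 1
  show _ = B.lpPairing μ p p' (hf.toLp f) (hb.toLp b)
  rw [ContinuousLinearMap.lpPairing_eq_integral]
  refine integral_congr_ae ?_
  filter_upwards [hf.coeFn_toLp, hb.coeFn_toLp] with y h1 h2
  rw [h1, h2]

variable [Fact (1 ≤ p)] [Fact (1 ≤ p')] [T2Space M] [SigmaCompactSpace M]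

theorem PatchAtlas.continuous_pairing (𝒜 : PatchAtlas S) (hpp' : p⁻¹ + p'⁻¹ = 1)
    {g : M → Alt dM b ℂ} (hg : IsLpLoc p' g) (hgc : HasCompactSupport g) :
    Continuous fun f : LpLoc S p r s => pairing S.Ω f.form g := by
  obtain ⟨T, -, hT⟩ := 𝒜.exists_finset hgc.isCompact
  have h0 : ∀ f : LpLoc S p r s, pairing S.Ω f.form g =
      ∑ x ∈ T, pairing S.Ω (mulSec (𝒜.χ x) f.form) g := fun f =>
    𝒜.pairing_eq_sum hpp' f.2.2 hg hgc.isCompact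
      (fun y hy => Or.inr (image_eq_zero_of_notMem_tsupport hy)) hT
  have hΩ := S.isOrientationForm.1.isContForm
  -- Each term is bounded by the norm on the support of `χ_x`.
  have hb : ∀ x, ∃ C : ℝ, ∀ f : LpLoc S p r s, ‖pairing S.Ω (mulSec (𝒜.χ x) f.form) g‖ ≤
      C * ‖f.restrict (𝒜.idx x)‖ := by
    intro x
    obtain ⟨C, hC⟩ := exists_integral_bilin_bound (p := p) hpp'
      (wedgeTopL dM (deg r s) b)
      (hg.mulSec (𝒜.χ x).contMDiff.continuous x _ (𝒜.isCompact_K x) (𝒜.K_subset_target x))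
    refine ⟨‖((𝒜.patch x).σ : ℂ)‖ * C, fun f => ?_⟩
    have hf := f.isLpLoc x _ (𝒜.isCompact_K x) (𝒜.K_subset_target x)
    have e : pairing S.Ω (mulSec (𝒜.χ x) f.form) g = (𝒜.patch x).σ * ∫ y in 𝒜.K x,
        wedgeTop (rep x f.form y) (rep x (mulSec (𝒜.χ x) g) y) := by
      rw [𝒜.pairing_mulSec x hpp' f.isLpLoc hg]
      congr 1
      refine Eq.trans (setIntegral_eq_integral_of_forall_compl_eq_zero (s := 𝒜.K x) ?_).symm ?_
      · intro y hy
        rw [𝒜.cutoff_eq_zero x hy]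
        simp
      · refine setIntegral_congr_fun (𝒜.isCompact_K x).measurableSet fun y hy => ?_
        show (𝒜.cutoff x y : ℂ) * _ = _
        rw [rep_mulSec, wedgeTop_smul_right, 𝒜.cutoff_eq x (𝒜.K_subset_target x hy)]
    rw [e, norm_mul, mul_assoc]
    exact mul_le_mul_of_nonneg_left (hC _ hf) (norm_nonneg _)
  choose C hC using hb
  let l : LpLoc S p r s →+ ℂ :=
    { toFun := fun f => pairing S.Ω f.form g
      map_zero' := pairing_zero_left _ _
      map_add' := fun f f' => pairing_add_left_of_memLp hΩ hpp' f.2.2 f'.2.2 hg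
        (compactlyPaired_right _ hgc) (compactlyPaired_right _ hgc) }
  refine continuous_of_continuousAt_zero l ?_
  rw [ContinuousAt, map_zero, tendsto_zero_iff_norm_tendsto_zero]
  have h1 : Tendsto (fun f : LpLoc S p r s => ∑ x ∈ T, C x * ‖f.restrict (𝒜.idx x)‖) (𝓝 0) (𝓝 0) := by
    have h2 : Continuous fun f : LpLoc S p r s => ∑ x ∈ T, C x * ‖f.restrict (𝒜.idx x)‖ :=
      continuous_finsetSum _ fun x _ => continuous_const.mul (LpLoc.continuous_restrict _).norm
    have h3 := h2.tendsto 0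
    have h4 : ∀ x, (0 : LpLoc S p r s).restrict (𝒜.idx x) = 0 := fun x =>
      congrFun (map_zero (LpLoc.restrictₗ S p r s)) (𝒜.idx x)
    simpa [h4] using h3
  refine squeeze_zero (fun _ => norm_nonneg _) (fun f => ?_) h1
  show ‖pairing S.Ω f.form g‖ ≤ _
  rw [h0 f]
  exact (norm_sum_le _ _).trans (Finset.sum_le_sum fun x _ => hC x f)

theorem PatchAtlas.continuous_pairing_comp (𝒜 : PatchAtlas S) (hpp' : p⁻¹ + p'⁻¹ = 1)
    {g : M → Alt dM b ℂ} (hg : IsLpLoc p' g) :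
    Continuous fun f : LpComp S p r s => pairing S.Ω f.form g := by
  have hΩ := S.isOrientationForm.1.isContForm
  let l : LpComp S p r s →ₗ[ℂ] ℂ :=
    { toFun := fun f => pairing S.Ω f.form g
      map_smul' := fun z f => pairing_smul_left _ _ _ _
      map_add' := fun f f' => pairing_add_left_of_memLp hΩ hpp' f.2.1.2 f'.2.1.2 hg
        (compactlyPaired_left f.2.2 g) (compactlyPaired_left f'.2.2 g) }
  refine LpComp.continuous_of_linear (l.restrictScalars ℝ) fun K hK => ?_
  obtain ⟨T, hT0, hT⟩ := 𝒜.exists_finset hK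
  have hc : ∀ x, HasCompactSupport (mulSec (𝒜.χ x) g) := fun x =>
    HasCompactSupport.intro (𝒜.isCompact x) fun y hy =>
      mulSec_eq_zero (Or.inl (image_eq_zero_of_notMem_tsupport hy))
  have hcont : Continuous fun f : LpOn S p r s K =>
      ∑ x ∈ T, pairing S.Ω f.1.form (mulSec (𝒜.χ x) g) :=
    continuous_finsetSum _ fun x _ => (𝒜.continuous_pairing hpp'
      (hg.mulSec (𝒜.χ x).contMDiff.continuous) (hc x)).comp continuous_subtype_val
  refine hcont.congr fun f => ?_
  show _ = pairing S.Ω f.1.form g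
  rw [𝒜.pairing_eq_sum hpp' f.1.isLpLoc hg hK (fun y hy => Or.inl (image_eq_zero_of_notMem_tsupport
    fun h => hy (f.2 h))) hT]
  refine sum_ext fun x => pairing_congr _ fun c y => ?_
  rw [rep_mulSec, rep_mulSec, wedgeTop_smul, wedgeTop_smul_right]

end Pairing

/-! ### Representation of continuous functionals by forms -/

section Representation

variable [Fact (1 ≤ p)] [Fact (1 ≤ p')] [T2Space M] [SigmaCompactSpace M]

/-- A functional that is continuous on the forms with support in `supp χ_x` is bounded by the `L^p`
norm in the chart at `x`. -/
theorem PatchAtlas.exists_bound (𝒜 : PatchAtlas S) (hp : p ≠ ⊤) (l : LpComp S p r s →L[ℂ] ℂ) (x : M) :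
    ∃ C : ℝ, ∀ f : LpComp S p r s, (∀ y ∉ tsupport (𝒜.χ x), f.form y = 0) →
      ‖l f‖ ≤ C * ‖(LpComp.toLoc f).restrict (𝒜.idx x)‖ := by
  let N : LpOn S p r s (tsupport (𝒜.χ x)) → ℝ := fun f => ‖f.1.restrict (𝒜.idx x)‖
  have h0 : tsupport (0 : LpLoc S p r s).form ⊆ tsupport (𝒜.χ x) := by
    have : (0 : LpLoc S p r s).form = 0 := rfl
    simp [this, tsupport]
  have hN : comap N (𝓝 0) ≤ 𝓝 (⟨0, h0⟩ : LpOn S p r s (tsupport (𝒜.χ x))) := by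
    refine tendsto_id'.1 (tendsto_subtype_rng.2 ?_)
    rw [LpLoc.isInducing.tendsto_nhds_iff, tendsto_pi_nhds]
    intro i
    obtain ⟨A, hA, h⟩ := exists_eLpNorm_rep_le (p := p) hp i.1.1 x i.2.1 i.2.2 (𝒜.isCompact x)
      (𝒜.subset_source x) (deg r s)
    rw [map_zero, Pi.zero_apply, tendsto_zero_iff_norm_tendsto_zero]
    have h1 : Tendsto (fun f => A.toReal * N f) (comap N (𝓝 0)) (𝓝 0) := by
      simpa using (tendsto_comap (f := N) (x := 𝓝 0)).const_mul A.toReal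
    refine squeeze_zero (fun _ => norm_nonneg _) (fun f => ?_) h1
    have hm := f.1.isLpLoc x _ (𝒜.isCompact_K x) (𝒜.K_subset_target x)
    show ‖f.1.restrict i‖ ≤ A.toReal * ‖f.1.restrict (𝒜.idx x)‖
    rw [LpLoc.norm_restrict, LpLoc.norm_restrict, ← ENNReal.toReal_mul]
    exact ENNReal.toReal_mono (ENNReal.mul_ne_top hA hm.2.ne)
      (h _ (fun y hy => image_eq_zero_of_notMem_tsupport fun h => hy (f.2 h)) hm.1).2
  have hl : ∀ᶠ f in 𝓝 (⟨0, h0⟩ : LpOn S p r s (tsupport (𝒜.χ x))),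
      ‖l (LpOn.incl S p r s (𝒜.isCompact x) f)‖ < 1 := by
    refine (l.continuous.comp (LpComp.continuous_incl (𝒜.isCompact x))).norm.continuousAt.eventually_lt
      continuousAt_const ?_
    show ‖l 0‖ < 1
    simp
  obtain ⟨δ, hδ, hδ'⟩ := (Metric.nhds_basis_ball.comap N).mem_iff.1 (hN hl)
  refine ⟨δ⁻¹, fun f hf => le_of_forall_gt_imp_ge_of_dense fun c hc => ?_⟩
  set ν := ‖(LpComp.toLoc f).restrict (𝒜.idx x)‖ with hν
  have hν0 : 0 ≤ ν := norm_nonneg _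
  have hc0 : 0 < c := lt_of_le_of_lt (mul_nonneg (inv_nonneg.2 hδ.le) hν0) hc
  -- The form `c⁻¹ f` lies in the `δ`-ball, where the functional is bounded by `1`.
  have hs : tsupport (((c⁻¹ : ℝ) : ℂ) • LpComp.toLoc f).form ⊆ tsupport (𝒜.χ x) := by
    refine closure_minimal (fun y hy => ?_) (isClosed_tsupport _)
    by_contra h
    refine hy ?_
    show ((c⁻¹ : ℝ) : ℂ) • f.form y = 0
    rw [hf y h, smul_zero]
  have h1 : N ⟨((c⁻¹ : ℝ) : ℂ) • LpComp.toLoc f, hs⟩ = c⁻¹ * ν := by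
    have : (((c⁻¹ : ℝ) : ℂ) • LpComp.toLoc f).restrict (𝒜.idx x) =
        ((c⁻¹ : ℝ) : ℂ) • (LpComp.toLoc f).restrict (𝒜.idx x) :=
      congrFun (map_smul (LpLoc.restrictₗ S p r s) _ (LpComp.toLoc f)) (𝒜.idx x)
    show ‖(((c⁻¹ : ℝ) : ℂ) • LpComp.toLoc f).restrict (𝒜.idx x)‖ = _
    rw [this, norm_smul, Complex.norm_real, Real.norm_of_nonneg (inv_nonneg.2 hc0.le)]
  have h2 : ‖l (((c⁻¹ : ℝ) : ℂ) • f)‖ < 1 := by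
    refine hδ' (a := ⟨((c⁻¹ : ℝ) : ℂ) • LpComp.toLoc f, hs⟩) ?_
    rw [mem_preimage, h1, Metric.mem_ball, dist_zero_right,
      Real.norm_of_nonneg (mul_nonneg (inv_nonneg.2 hc0.le) hν0), inv_mul_lt_iff₀ hc0]
    rwa [inv_mul_lt_iff₀ hδ, mul_comm] at hc
  rw [map_smul, norm_smul, Complex.norm_real, Real.norm_of_nonneg (inv_nonneg.2 hc0.le),
    inv_mul_lt_iff₀ hc0, mul_one] at h2
  exact h2.le

/-- The form `v dw_{κ 1} ∧ ⋯ ∧ dw_{κ m}` on the support of `χ_x`, extended by `0`. -/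
def PatchAtlas.block (𝒜 : PatchAtlas S) (x : M) (κ : Fin m → Fin dM)
    (v : Model dM → ℂ) : M → Alt dM m ℂ :=
  (tsupport (𝒜.χ x)).indicator (ofChart x fun y => v y • (𝒜.patch x).frame κ y)

variable (𝒜 : PatchAtlas S) (x : M)

theorem PatchAtlas.block_eq_zero {κ : Fin m → Fin dM} {v : Model dM → ℂ} :
    ∀ y ∉ tsupport (𝒜.χ x), 𝒜.block x κ v y = 0 := fun _ hy => indicator_of_notMem hy _

theorem PatchAtlas.rep_block {κ : Fin m → Fin dM} {v : Model dM → ℂ} :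
    ∀ y ∈ 𝒜.K x, rep x (𝒜.block x κ v) y = v y • (𝒜.patch x).frame κ y := by
  intro y hy
  have hyt := 𝒜.K_subset_target x hy
  rw [← rep_ofChart x (fun y => v y • (𝒜.patch x).frame κ y) hyt]
  have h1 : 𝒜.block x κ v ((chart x).symm y) =
      ofChart x (fun y => v y • (𝒜.patch x).frame κ y) ((chart x).symm y) :=
    indicator_of_mem ((mem_chart_image (𝒜.subset_source x) hyt).1 hy) _
  rw [rep, rep, h1]

theorem PatchAtlas.isBidegree_block {κ : Fin m → Fin dM} {v : Model dM → ℂ}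
    (hκ : countH κ ≤ s) : IsBidegree S s (𝒜.block x κ v) :=
  isBidegree_of_patch (𝒜.patch x) (𝒜.subset_source x) (𝒜.image_subset x) (𝒜.block_eq_zero x)
    fun y hy => by
      rw [𝒜.rep_block x y hy]
      exact (bideg_coframe ((𝒜.patch x).det_ne_zero y (𝒜.K_subset x hy)) hκ).smul _

theorem PatchAtlas.exists_block_bound (κ : Fin m → Fin dM) :
    ∃ B : ℝ, 0 ≤ B ∧ ∀ v : Model dM → ℂ, MemLp v p (volume.restrict (𝒜.K x)) →
      MemLp (rep x (𝒜.block x κ v)) p (volume.restrict (𝒜.K x)) ∧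
      (eLpNorm (rep x (𝒜.block x κ v)) p (volume.restrict (𝒜.K x))).toReal ≤
        B * (eLpNorm v p (volume.restrict (𝒜.K x))).toReal := by
  have hK := 𝒜.isCompact_K x
  have hfr : ContinuousOn ((𝒜.patch x).frame κ) (𝒜.K x) := fun y hy =>
    ((𝒜.patch x).contDiffAt_frame κ (𝒜.K_subset x hy)).continuousAt.continuousWithinAt
  obtain ⟨B, hB⟩ := hK.exists_bound_of_continuousOn hfr
  refine ⟨max B 0, le_max_right _ _, fun v hv => ?_⟩
  have hae : rep x (𝒜.block x κ v) =ᵐ[volume.restrict (𝒜.K x)]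
      fun y => v y • (𝒜.patch x).frame κ y :=
    ae_restrict_of_forall_mem hK.measurableSet (𝒜.rep_block x)
  have hm := (hv.1.smul (hfr.aestronglyMeasurable_of_isCompact hK hK.measurableSet)).congr hae.symm
  have hle : ∀ᵐ y ∂(volume.restrict (𝒜.K x)), ‖rep x (𝒜.block x κ v) y‖ ≤ max B 0 * ‖v y‖ := by
    refine ae_restrict_of_forall_mem hK.measurableSet fun y hy => ?_
    rw [𝒜.rep_block x y hy, norm_smul, mul_comm]
    exact mul_le_mul_of_nonneg_right ((hB y hy).trans (le_max_left _ _)) (norm_nonneg _)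
  refine ⟨hv.of_le_mul hm hle, ?_⟩
  rw [← ENNReal.toReal_ofReal (le_max_right B 0), ← ENNReal.toReal_mul]
  exact ENNReal.toReal_mono (ENNReal.mul_ne_top ENNReal.ofReal_ne_top hv.2.ne)
    (eLpNorm_le_mul_eLpNorm_of_ae_le_mul hle p)

theorem PatchAtlas.isLpLoc_block (hp : p ≠ ⊤) {κ : Fin m → Fin dM}
    {v : Model dM → ℂ} (hv : MemLp v p (volume.restrict (𝒜.K x))) :
    IsLpLoc p (𝒜.block x κ v) := by
  obtain ⟨B, -, hB⟩ := 𝒜.exists_block_bound (p := p) x κ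
  exact isLpLoc_of_chart hp (𝒜.isCompact x) (𝒜.subset_source x) (𝒜.block_eq_zero x) (hB v hv).1

/-- `PatchAtlas.block` as an element of `(L^p_c)^{r,q}(M)`. -/
def PatchAtlas.blockComp (hp : p ≠ ⊤) {κ : Fin (deg r s) → Fin dM}
    (hκ : countH κ ≤ s) {v : Model dM → ℂ}
    (hv : MemLp v p (volume.restrict (𝒜.K x))) : LpComp S p r s :=
  ⟨𝒜.block x κ v, ⟨𝒜.isBidegree_block x hκ, 𝒜.isLpLoc_block x hp hv⟩,
    HasCompactSupport.intro (𝒜.isCompact x) (𝒜.block_eq_zero x)⟩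

/-- On forms supported in `supp χ_x`, a functional only depends on the class in the chart. -/
theorem PatchAtlas.map_congr (hp : p ≠ ⊤) (l : LpComp S p r s →L[ℂ] ℂ) {f g : LpComp S p r s}
    (hf : ∀ y ∉ tsupport (𝒜.χ x), f.form y = 0) (hg : ∀ y ∉ tsupport (𝒜.χ x), g.form y = 0)
    (h : ∀ᵐ y ∂(volume.restrict (𝒜.K x)), rep x f.form y = rep x g.form y) : l f = l g := by
  obtain ⟨C, hC⟩ := 𝒜.exists_bound hp l x
  have h1 := hC (f - g) fun y hy => by
    show f.form y - g.form y = 0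
    rw [hf y hy, hg y hy, sub_zero]
  have h2 : (LpComp.toLoc (f - g)).restrict (𝒜.idx x) = 0 := by
    rw [map_sub, LpLoc.restrict_sub, sub_eq_zero]
    exact MemLp.toLp_congr _ _ h
  rw [h2, norm_zero, mul_zero, map_sub] at h1
  exact sub_eq_zero.1 (norm_le_zero_iff.1 h1)

/-- The functional is given by an `L^{p'}` density on the multiples of an element of the frame. -/
theorem PatchAtlas.exists_density (hp : p ≠ ⊤) (hp' : p' ≠ ⊤) (hpp' : p⁻¹ + p'⁻¹ = 1)
    (l : LpComp S p r s →L[ℂ] ℂ) {κ : Fin (deg r s) → Fin dM}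
    (hκ : countH κ ≤ s) :
    ∃ G : Model dM → ℂ, MemLp G p' (volume.restrict (𝒜.K x)) ∧
      ∀ v (hv : MemLp v p (volume.restrict (𝒜.K x))),
        l (𝒜.blockComp x hp hκ hv) = ∫ y in 𝒜.K x, v y * G y := by
  have hfin : IsFiniteMeasure (volume.restrict (𝒜.K x)) :=
    ⟨by simpa using (𝒜.isCompact_K x).measure_lt_top⟩
  obtain ⟨C, hC⟩ := 𝒜.exists_bound hp l x
  obtain ⟨B, hB0, hB⟩ := 𝒜.exists_block_bound (p := p) x κ
  have hcongr : ∀ {v : Model dM → ℂ} (hv : MemLp v p (volume.restrict (𝒜.K x)))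
      (f : LpComp S p r s), (∀ y ∉ tsupport (𝒜.χ x), f.form y = 0) →
      (∀ᵐ y ∂(volume.restrict (𝒜.K x)), rep x f.form y = v y • (𝒜.patch x).frame κ y) →
      l (𝒜.blockComp x hp hκ hv) = l f := fun hv f h0 h => by
    refine 𝒜.map_congr x hp l (𝒜.block_eq_zero x) h0 ?_
    filter_upwards [h, ae_restrict_mem (𝒜.isCompact_K x).measurableSet] with y h1 h2
    rw [h1]
    exact 𝒜.rep_block x y h2
  have hz : ∀ w : Lp ℂ p (volume.restrict (𝒜.K x)), ∀ y ∉ tsupport (𝒜.χ x),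
      (𝒜.blockComp x hp hκ (Lp.memLp w) : LpComp S p r s).form y = 0 := fun w =>
    𝒜.block_eq_zero x
  let L : Lp ℂ p (volume.restrict (𝒜.K x)) →ₗ[ℂ] ℂ :=
    { toFun := fun w => l (𝒜.blockComp x hp hκ (Lp.memLp w))
      map_add' := fun w w' => by
        rw [← map_add]
        refine hcongr _ _ (fun y hy => ?_) ?_
        · exact (congrArg₂ _ (hz w y hy) (hz w' y hy)).trans (add_zero _)
        · filter_upwards [Lp.coeFn_add w w', ae_restrict_mem (𝒜.isCompact_K x).measurableSet]
            with y h1 h2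
          rw [h1, Pi.add_apply, add_smul, ← 𝒜.rep_block x y h2, ← 𝒜.rep_block x y h2, ← rep_add]
          rfl
      map_smul' := fun z w => by
        rw [← map_smul]
        refine hcongr _ _ (fun y hy => ?_) ?_
        · exact (congrArg (z • ·) (hz w y hy)).trans (smul_zero z)
        · filter_upwards [Lp.coeFn_smul z w, ae_restrict_mem (𝒜.isCompact_K x).measurableSet]
            with y h1 h2
          rw [h1, Pi.smul_apply, smul_assoc, ← 𝒜.rep_block x y h2, ← rep_smul]
          rfl }
  obtain ⟨G, hG, h⟩ := exists_memLp_eq_integral hp hp' hpp' (L.mkContinuous (max C 0 * B) fun w => by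
    refine (hC _ (hz w)).trans ?_
    rw [LpLoc.norm_restrict, mul_assoc]
    exact mul_le_mul (le_max_left _ _) (hB _ (Lp.memLp w)).2 ENNReal.toReal_nonneg (le_max_right _ _))
  refine ⟨G, hG, fun v hv => ?_⟩
  rw [← h v hv]
  refine hcongr hv _ (hz _) ?_
  filter_upwards [hv.coeFn_toLp, ae_restrict_mem (𝒜.isCompact_K x).measurableSet] with y h1 h2
  rw [← h1]
  exact 𝒜.rep_block x y h2

end Representation

/-! ### Functionals on the two spaces of forms -/

section Representation

variable [Fact (1 ≤ p)] [Fact (1 ≤ p')] [T2Space M] [SigmaCompactSpace M] (𝒜 : PatchAtlas S)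

/-- The value at a point, as an additive map. -/
def LpComp.evalHom (S : GenericCRSubmanifold n k X M) (p : ℝ≥0∞) [Fact (1 ≤ p)] (r : ℕ) (s : ℤ)
    (y : M) : LpComp S p r s →+ Alt dM (deg r s) ℂ where
  toFun f := f.form y
  map_zero' := rfl
  map_add' _ _ := rfl

theorem LpComp.form_sum {ι : Type*} (T : Finset ι) (f : ι → LpComp S p r s) (y : M) :
    (∑ i ∈ T, f i).form y = ∑ i ∈ T, (f i).form y := map_sum (LpComp.evalHom S p r s y) f T

/-- A functional that vanishes on the forms with zero pairing is, on the forms with support in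
`supp χ_x`, the pairing with a form.  The density belonging to `dw_κ`, where `κ` contains exactly
`s` indices in `H`, is the coefficient of the complementary element of the frame. -/
theorem PatchAtlas.exists_local_repr (x : M) (hp : p ≠ ⊤) (hp' : p' ≠ ⊤) (hpp' : p⁻¹ + p'⁻¹ = 1)
    (hst : s + t = (frameH n k).card) (hdeg : 0 ≤ s → 0 ≤ t → deg r s + b = 2 * n - k)
    (l : LpComp S p r s →L[ℂ] ℂ)
    (h0 : ∀ f : LpComp S p r s, (∀ g : M → Alt dM b ℂ, IsLpLoc p' g → IsBidegree S t g →
      pairing S.Ω f.form g = 0) → l f = 0) :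
    ∃ v : M → Alt dM b ℂ, IsLpLoc p' v ∧ IsBidegree S t v ∧ ∀ f : LpComp S p r s,
      (∀ y ∉ tsupport (𝒜.χ x), f.form y = 0) → l f = pairing S.Ω f.form v := by
  set P := 𝒜.patch x with hPdef
  have hK := 𝒜.isCompact_K x
  have hKO := 𝒜.K_subset x
  have hΩ := S.isOrientationForm.1.isContForm
  have hσ : (P.σ : ℂ) ≠ 0 := Complex.ofReal_ne_zero.2 P.sign_ne_zero
  let c : (Fin (deg r s) → Fin dM) → LpComp S p r s → Model dM → ℂ :=
    fun κ f y => ((deg r s).factorial : ℂ)⁻¹ * coeff (fderiv ℝ P.w y) κ (rep x f.form y)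
  have hc : ∀ κ f, MemLp (c κ f) p (volume.restrict (𝒜.K x)) := fun κ f =>
    (P.memLp_coeff hK hKO f.isLpLoc κ).const_mul _
  have key : ∀ κ : {κ : Fin (deg r s) → Fin dM // countH κ ≤ s},
      ∃ v : M → Alt dM b ℂ, IsLpLoc p' v ∧ IsBidegree S t v ∧ ∀ f : LpComp S p r s,
        (∀ y ∉ tsupport (𝒜.χ x), f.form y = 0) →
        l (𝒜.blockComp x hp κ.2 (hc κ.1 f)) = pairing S.Ω f.form v := by
    rintro ⟨κ, hκ⟩
    by_cases hgood : 0 ≤ t ∧ Function.Injective κ ∧ (countH κ : ℤ) = s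
    · obtain ⟨ht, hinj, hs⟩ := hgood
      have hd := hdeg (by omega) ht
      obtain ⟨τ, hτ⟩ := exists_sum_equiv hd κ hinj
      obtain ⟨ε, hε, hw⟩ := exists_wedgeTop_coframe hd τ
      have hcount := countIn_add (frameH n k) τ
      simp only [hτ] at hcount hw
      have hcount' : (countH fun j => τ (Sum.inr j)) ≤ t := by
        have : (countH fun i => κ i) = countH κ := rfl
        omega
      obtain ⟨G, hG, hGl⟩ := 𝒜.exists_density x hp hp' hpp' l hκ
      let a : Model dM → ℂ := fun y =>
        (ε * (cplxMatrix (fderiv ℝ P.w y)).det)⁻¹ * ((P.σ : ℂ)⁻¹ * ((deg r s).factorial : ℂ)⁻¹)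
      have hac : ContinuousOn (fun y => ContinuousLinearMap.mul ℝ ℂ (a y)) (𝒜.K x) := by
        refine (ContinuousLinearMap.mul ℝ ℂ).continuous.comp_continuousOn fun y hy => ?_
        exact ((((contDiffAt_const.mul (P.contDiffAt_det (hKO hy))).inv
          (mul_ne_zero hε (P.det_ne_zero y (hKO hy)))).continuousAt).mul
            continuousAt_const).continuousWithinAt
      have hu : MemLp (fun y => a y * G y) p' (volume.restrict (𝒜.K x)) :=
        memLp_clm_apply hK hac hG
      refine ⟨𝒜.block x (fun j => τ (Sum.inr j)) fun y => a y * G y, 𝒜.isLpLoc_block x hp' hu,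
        𝒜.isBidegree_block x hcount', fun f hf => ?_⟩
      rw [hGl, P.pairing_eq hpp' (𝒜.isCompact x) (𝒜.subset_source x) (𝒜.image_subset x)
        (f.isLpLoc x _ hK (𝒜.K_subset_target x))
        (𝒜.isLpLoc_block x hp' hu x _ hK (𝒜.K_subset_target x)) (fun y hy => Or.inl (hf y hy)),
        ← integral_const_mul]
      refine setIntegral_congr_fun hK.measurableSet fun y hy => ?_
      have hdet := P.det_ne_zero y (hKO hy)
      simp only []
      rw [𝒜.rep_block x y hy, wedgeTop_smul_right]
      have := hw (fderiv ℝ P.w y) hdet (rep x f.form y)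
      rw [Patch.frame, this]
      simp only [c, a]
      field_simp
    · -- The element of the frame is orthogonal to all forms of bidegree given by `t`.
      refine ⟨0, IsLpLoc.zero, fun y => bidegAt_zero S y t, fun f hf => ?_⟩
      rw [pairing_zero_right]
      by_cases hinj : Function.Injective κ
      swap
      · have e : 𝒜.blockComp x hp hκ (hc κ f) = 0 := by
          refine Subtype.ext (funext fun y => ?_)
          by_cases hy : y ∈ tsupport (𝒜.χ x)
          · refine (indicator_of_mem hy _).trans (ofChart_apply_eq_zero fun _ => ?_)
            simp only [c]
            rw [coeff_eq_zero_of_not_injective _ hinj, mul_zero, zero_smul]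
          · exact 𝒜.block_eq_zero x y hy
        rw [e, map_zero]
      refine h0 _ fun g hg hgt => ?_
      rw [P.pairing_eq hpp' (𝒜.isCompact x) (𝒜.subset_source x) (𝒜.image_subset x)
        ((𝒜.blockComp x hp hκ (hc κ f)).isLpLoc x _ hK (𝒜.K_subset_target x))
        (hg x _ hK (𝒜.K_subset_target x)) (fun y hy => Or.inl (𝒜.block_eq_zero x y hy)),
        setIntegral_eq_zero_of_forall_eq_zero fun y hy => ?_, mul_zero]
      show wedgeTop (rep x (𝒜.block x κ (c κ f)) y) _ = 0
      rw [𝒜.rep_block x y hy, wedgeTop_smul]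
      refine mul_eq_zero_of_right _ ?_
      have hdet := P.det_ne_zero y (hKO hy)
      by_cases hs : (countH κ : ℤ) = s
      · have ht : t < 0 := by
          by_contra h
          exact hgood ⟨not_lt.1 h, hinj, hs⟩
        have e : rep x g y = 0 := by
          rw [rep_eq_sum_frame P hgt (hKO hy)]
          refine smul_eq_zero_of_right _ (Finset.sum_eq_zero fun μ _ => ?_)
          exact absurd μ.2 (by omega)
        rw [e, wedgeTop_zero_right]
      · exact wedgeTop_eq_zero_of_bideg hdet (bideg_coframe hdet (s := s - 1) (by omega))
          (hgt.bideg_rep P (hKO hy)) (by omega)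
  choose v hv1 hv2 hv3 using key
  refine ⟨∑ κ, v κ, IsLpLoc.sum _ fun κ _ => hv1 κ, fun y => ?_, fun f hf => ?_⟩
  · show BidegAt S y t ((∑ κ, v κ) y)
    rw [Finset.sum_apply]
    exact Finset.sum_induction _ (BidegAt S y t) (fun _ _ h h' => h.add h') (bidegAt_zero S y t)
      fun κ _ => hv2 κ y
  rw [pairing_sum_right hΩ hpp' _ f.isLpLoc (fun κ _ => hv1 κ)
    fun κ _ => compactlyPaired_left f.hasCompactSupport _, ← sum_ext fun κ => hv3 κ f hf,
    ← map_sum]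
  refine 𝒜.map_congr x hp l hf (fun y hy => ?_) ?_
  · rw [LpComp.form_sum]
    exact Finset.sum_eq_zero fun κ _ => 𝒜.block_eq_zero x y hy
  · refine ae_restrict_of_forall_mem hK.measurableSet fun y hy => ?_
    let R : LpComp S p r s →+ Alt dM (deg r s) ℂ :=
      { toFun := fun f => rep x f.form y
        map_zero' := rep_eq_zero x rfl
        map_add' := fun f g => rep_add x f.form g.form y }
    show _ = R (∑ κ : {κ : Fin (deg r s) → Fin dM // countH κ ≤ s},
      𝒜.blockComp x hp κ.2 (hc κ.1 f))
    rw [map_sum, rep_eq_sum_frame P f.isBidegree (hKO hy), Finset.smul_sum]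
    refine sum_ext fun κ => ?_
    rw [smul_smul]
    exact (𝒜.rep_block x (κ := κ.1) (v := c κ.1 f) y hy).symm

/-- Multiplication by `χ_x`. -/
def PatchAtlas.mulComp (x : M) (f : LpLoc S p r s) : LpComp S p r s :=
  ⟨mulSec (𝒜.χ x) f.form, ⟨f.isBidegree.mulSec _, f.isLpLoc.mulSec (𝒜.χ x).contMDiff.continuous⟩,
    HasCompactSupport.intro (𝒜.isCompact x) fun _ hy =>
      mulSec_eq_zero (Or.inl (image_eq_zero_of_notMem_tsupport hy))⟩

theorem PatchAtlas.form_sum_mulComp (T : Finset M) (f : LpLoc S p r s) {y : M}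
    (h : ∑ x ∈ T, 𝒜.χ x y = 1) : (∑ x ∈ T, 𝒜.mulComp x f).form y = f.form y := by
  rw [LpComp.form_sum]
  show ∑ x ∈ T, ((𝒜.χ x y : ℝ) : ℂ) • f.form y = f.form y
  rw [← Finset.sum_smul, ← Complex.ofReal_sum, h, Complex.ofReal_one, one_smul]

/-- The localizations of a functional are given by forms. -/
theorem PatchAtlas.exists_repr (hp : p ≠ ⊤) (hp' : p' ≠ ⊤) (hpp' : p⁻¹ + p'⁻¹ = 1)
    (hst : s + t = (frameH n k).card) (hdeg : 0 ≤ s → 0 ≤ t → deg r s + b = 2 * n - k)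
    (l : LpComp S p r s →L[ℂ] ℂ)
    (h0 : ∀ f : LpComp S p r s, (∀ g : M → Alt dM b ℂ, IsLpLoc p' g → IsBidegree S t g →
      pairing S.Ω f.form g = 0) → l f = 0) :
    ∃ v : M → M → Alt dM b ℂ, ∀ x, IsLpLoc p' (v x) ∧ IsBidegree S t (v x) ∧
      ∀ f : LpLoc S p r s, l (𝒜.mulComp x f) = pairing S.Ω f.form (mulSec (𝒜.χ x) (v x)) := by
  choose v hv1 hv2 hv3 using fun x => 𝒜.exists_local_repr x hp hp' hpp' hst hdeg l h0
  refine ⟨v, fun x => ⟨hv1 x, hv2 x, fun f => ?_⟩⟩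
  rw [hv3 x (𝒜.mulComp x f) fun y hy =>
    mulSec_eq_zero (f := f.form) (Or.inl (image_eq_zero_of_notMem_tsupport hy))]
  refine pairing_congr _ fun c y => ?_
  show wedgeTop (rep c (mulSec (𝒜.χ x) f.form) y) _ = _
  rw [rep_mulSec, rep_mulSec, wedgeTop_smul, wedgeTop_smul_right]

/-- Functionals on `(L^p_c)^{r,q}(M)` are pairings with forms in `L^{p'}_loc`. -/
theorem PatchAtlas.exists_repr_comp (𝒜 : PatchAtlas S) (hp : p ≠ ⊤) (hp' : p' ≠ ⊤) (hpp' : p⁻¹ + p'⁻¹ = 1)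
    (hst : s + t = (frameH n k).card) (hdeg : 0 ≤ s → 0 ≤ t → deg r s + deg r' t = 2 * n - k)
    (l : LpComp S p r s →L[ℂ] ℂ)
    (h0 : ∀ f : LpComp S p r s, (∀ g : LpLoc S p' r' t, pairing S.Ω f.form g.form = 0) → l f = 0) :
    ∃ g : LpLoc S p' r' t, ∀ f, l f = pairing S.Ω f.form g.form := by
  obtain ⟨v, hv⟩ := 𝒜.exists_repr hp hp' hpp' hst hdeg l fun f hf => h0 f fun g =>
    hf g.form g.isLpLoc g.isBidegree
  refine ⟨⟨𝒜.glue v, 𝒜.isBidegree_glue fun x => (hv x).2.1, 𝒜.isLpLoc_glue Fact.out hp'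
    fun x => (hv x).1⟩, fun f => ?_⟩
  obtain ⟨T, hT0, hT⟩ := 𝒜.exists_finset f.hasCompactSupport.isCompact
  have hf : f = ∑ x ∈ T, 𝒜.mulComp x (LpComp.toLoc f) := by
    refine Subtype.ext (funext fun y => ?_)
    by_cases hy : y ∈ tsupport f.form
    · exact (𝒜.form_sum_mulComp T (LpComp.toLoc f) (hT y hy).self_of_nhds).symm
    · have hy0 : f.form y = 0 := image_eq_zero_of_notMem_tsupport hy
      refine hy0.trans (Eq.symm ((LpComp.form_sum T _ y).trans ?_))
      exact Finset.sum_eq_zero fun x _ => mulSec_eq_zero (Or.inr hy0)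
  conv_lhs => rw [hf, map_sum]
  rw [sum_ext fun x => (hv x).2.2 _, ← pairing_sum_right
    S.isOrientationForm.1.isContForm hpp' T (LpComp.toLoc f).isLpLoc
    (fun x _ => (hv x).1.mulSec (𝒜.χ x).contMDiff.continuous)
    (fun x _ => compactlyPaired_left f.hasCompactSupport _)]
  refine pairing_congr _ fun c y => ?_
  by_cases hy : (chart c).symm y ∈ tsupport f.form
  · congr 1
    show rep c _ y = rep c (𝒜.glue v) y
    rw [rep, rep, 𝒜.glue_eq_sum v fun x hx => hT0 x hx _ hy, Finset.sum_apply]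
  · have e : rep c f.form y = 0 := rep_eq_zero c (image_eq_zero_of_notMem_tsupport hy)
    show wedgeTop (rep c f.form y) _ = wedgeTop (rep c f.form y) _
    rw [e, wedgeTop_zero_left, wedgeTop_zero_left]

/-- A functional on `(L^p_loc)^{r,q}(M)` only depends on the form over a finite number of compact
sets in charts. -/
theorem LpLoc.exists_finite (l : LpLoc S p r s →L[ℂ] ℂ) :
    ∃ I : Set (ChartCompact dM M), I.Finite ∧ ∀ f g : LpLoc S p r s,
      (∀ i ∈ I, f.restrict i = g.restrict i) → l f = l g := by
  have h1 : ∀ᶠ f in 𝓝 (0 : LpLoc S p r s), ‖l f‖ < 1 :=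
    l.continuous.norm.continuousAt.eventually_lt continuousAt_const (by simp)
  rw [LpLoc.isInducing.nhds_eq_comap, nhds_pi, Filter.Eventually, mem_comap] at h1
  obtain ⟨U, hU, hUs⟩ := h1
  obtain ⟨I, hI, V, hV, hVU⟩ := Filter.mem_pi.1 hU
  refine ⟨I, hI, fun f g h => ?_⟩
  by_contra hne
  have hne' : l (f - g) ≠ 0 := by rwa [map_sub, sub_ne_zero]
  have h2 : ‖l ((l (f - g))⁻¹ • (f - g))‖ < 1 := by
    refine hUs (hVU fun i hi => ?_)
    have e : LpLoc.restrictₗ S p r s ((l (f - g))⁻¹ • (f - g)) i =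
        LpLoc.restrictₗ S p r s 0 i := by
      rw [map_smul, Pi.smul_apply, map_zero]
      refine smul_eq_zero_of_right _ ?_
      exact (LpLoc.restrict_sub f g i).trans (sub_eq_zero.2 (h i hi))
    rw [e]
    exact mem_of_mem_nhds (hV i)
  rw [map_smul, smul_eq_mul, inv_mul_cancel₀ hne', norm_one] at h2
  exact lt_irrefl _ h2

/-- Functionals on `(L^p_loc)^{r,q}(M)` are pairings with forms in `L^{p'}_c`. -/
theorem PatchAtlas.exists_repr_loc (𝒜 : PatchAtlas S) (hp : p ≠ ⊤) (hp' : p' ≠ ⊤) (hpp' : p⁻¹ + p'⁻¹ = 1)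
    (hst : s + t = (frameH n k).card) (hdeg : 0 ≤ s → 0 ≤ t → deg r s + deg r' t = 2 * n - k)
    (l : LpLoc S p r s →L[ℂ] ℂ)
    (h0 : ∀ f : LpLoc S p r s, (∀ g : LpComp S p' r' t, pairing S.Ω f.form g.form = 0) → l f = 0) :
    ∃ g : LpComp S p' r' t, ∀ f, l f = pairing S.Ω f.form g.form := by
  let Λ : LpComp S p r s →L[ℂ] ℂ := ⟨l.toLinearMap.comp LpComp.toLoc,
    l.continuous.comp LpComp.continuous_toLoc⟩
  obtain ⟨v, hv⟩ := 𝒜.exists_repr hp hp' hpp' hst hdeg Λ fun f hf => h0 (LpComp.toLoc f) fun g =>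
    hf g.form g.isLpLoc g.isBidegree
  obtain ⟨I, hI, hl⟩ := LpLoc.exists_finite l
  obtain ⟨T, -, hT⟩ := 𝒜.exists_finset (hI.isCompact_biUnion fun i _ =>
    i.2.1.image_of_continuousOn ((chart i.1.1).continuousOn_symm.mono i.2.2))
  let w : M → LpLoc S p' r' t := fun x => ⟨v x, (hv x).2.1, (hv x).1⟩
  refine ⟨∑ x ∈ T, 𝒜.mulComp x (w x), fun f => ?_⟩
  have h1 : l f = Λ (∑ x ∈ T, 𝒜.mulComp x f) := by
    refine hl _ _ fun i hi => MemLp.toLp_congr _ _ ?_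
    refine ae_restrict_of_forall_mem i.2.1.measurableSet fun y hy => ?_
    have e := 𝒜.form_sum_mulComp T f
      (hT _ (mem_biUnion hi (mem_image_of_mem _ hy))).self_of_nhds
    show rep i.1.1 f.form y = rep i.1.1 (∑ x ∈ T, 𝒜.mulComp x f).form y
    rw [rep, rep, e]
  have h2 : (∑ x ∈ T, 𝒜.mulComp x (w x)).form = ∑ x ∈ T, mulSec (𝒜.χ x) (v x) := by
    funext y
    rw [LpComp.form_sum, Finset.sum_apply]
    rfl
  rw [h1, h2, map_sum, sum_ext fun x => (hv x).2.2 f,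
    pairing_sum_right S.isOrientationForm.1.isContForm hpp' T f.isLpLoc
    (fun x _ => (hv x).1.mulSec (𝒜.χ x).contMDiff.continuous)
    (fun x _ => compactlyPaired_right _ (𝒜.mulComp x (w x)).hasCompactSupport)]

end Representation

/-! ### The weak operator and its transpose -/

section WeakDbar

variable [Fact (1 ≤ p)] [Fact (1 ≤ p')] [T2Space M] [SigmaCompactSpace M]

variable (S r s r' t) in
/-- The pairing of `(L^{p'}_loc)^{r,s}(M)` with `(L^p_c)^{r',t}(M)`, as a bilinear map. -/
def pairLoc (hpp' : p⁻¹ + p'⁻¹ = 1) : LpLoc S p' r s →ₗ[ℂ] LpComp S p r' t →ₗ[ℂ] ℂ :=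
  LinearMap.mk₂ ℂ (fun f g => pairing S.Ω f.form g.form)
    (fun f f' g => pairing_add_left_of_memLp S.isOrientationForm.1.isContForm
      (by rwa [add_comm] at hpp') f.isLpLoc f'.isLpLoc g.isLpLoc
      (compactlyPaired_right _ g.hasCompactSupport) (compactlyPaired_right _ g.hasCompactSupport))
    (fun z f g => pairing_smul_left _ z f.form g.form)
    (fun f g g' => pairing_add_right_of_memLp S.isOrientationForm.1.isContForm
      (by rwa [add_comm] at hpp') f.isLpLoc g.isLpLoc g'.isLpLoc
      (compactlyPaired_right _ g.hasCompactSupport) (compactlyPaired_right _ g'.hasCompactSupport))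
    (fun z f g => pairing_smul_right _ z f.form g.form)

theorem pairing_swap (f : M → Alt dM a ℂ) (g : M → Alt dM b ℂ) :
    (-1) ^ (a * b) * pairing S.Ω f g = pairing S.Ω g f := by
  rw [pairing_comm S.Ω g f, mul_comm b a]

theorem pairing_eq_zero_comm {f : M → Alt dM a ℂ} {g : M → Alt dM b ℂ} :
    pairing S.Ω f g = 0 ↔ pairing S.Ω g f = 0 := by
  rw [← pairing_swap f g]
  simp

variable (S r s r' t) in
/-- The pairing of `(L^p_c)^{r',t}(M)` with `(L^{p'}_loc)^{r,s}(M)`, as a bilinear map. -/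
def pairComp (hpp' : p⁻¹ + p'⁻¹ = 1) : LpComp S p r' t →ₗ[ℂ] LpLoc S p' r s →ₗ[ℂ] ℂ :=
  ((-1 : ℂ) ^ (deg r s * deg r' t)) • (pairLoc S r r' s t hpp').flip

theorem pairComp_apply (hpp' : p⁻¹ + p'⁻¹ = 1) (g : LpComp S p r' t) (f : LpLoc S p' r s) :
    pairComp S r r' s t hpp' g f = pairing S.Ω g.form f.form := pairing_swap f.form g.form

theorem pairing_transpose {c e : ℕ} (hc : a + 1 = c) (he : b + 1 = e)
    {f : M → Alt dM a ℂ} {g : M → Alt dM c ℂ} {h : M → Alt dM b ℂ}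
    {u : M → Alt dM e ℂ} (H : pairing S.Ω g h = (-1) ^ (a + 1) * pairing S.Ω f u) :
    pairing S.Ω u f = (-1) ^ (b + 1) * pairing S.Ω h g := by
  subst hc he
  rw [← pairing_swap f u, ← pairing_swap g h, H]
  have h2 : ((-1 : ℂ) ^ (b + 1)) ^ 2 = 1 := by rw [← pow_mul, mul_comm, pow_mul]; norm_num
  linear_combination (-(-1) ^ (a * (b + 1)) * pairing S.Ω f u) * h2

theorem PatchAtlas.representsDual_loc (𝒜 : PatchAtlas S) (hp : p ≠ ⊤) (hp' : p' ≠ ⊤)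
    (hpp' : p⁻¹ + p'⁻¹ = 1) (hst : s + t = (frameH n k).card)
    (hdeg : 0 ≤ s → 0 ≤ t → deg r s + deg r' t = 2 * n - k) {c : ℂ} (hc : c ≠ 0)
    {P : LpLoc S p' r s →ₗ[ℂ] LpComp S p r' t →ₗ[ℂ] ℂ}
    (hP : ∀ f g, P f g = c * pairing S.Ω f.form g.form) : RepresentsDual P where
  cont g := by
    simp only [hP]
    exact continuous_const.mul (𝒜.continuous_pairing (by rwa [add_comm] at hpp') g.isLpLoc
      g.hasCompactSupport)
  repr l hl := by
    obtain ⟨g, hg⟩ := 𝒜.exists_repr_loc hp' hp (by rwa [add_comm] at hpp') hst hdeg l fun f hf =>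
      hl f fun g => by rw [hP, hf, mul_zero]
    exact ⟨c⁻¹ • g, fun f => by rw [hg, map_smul, hP, smul_eq_mul, inv_mul_cancel_left₀ hc]⟩

theorem PatchAtlas.representsDual_comp (𝒜 : PatchAtlas S) (hp : p ≠ ⊤) (hp' : p' ≠ ⊤)
    (hpp' : p⁻¹ + p'⁻¹ = 1) (hst : s + t = (frameH n k).card)
    (hdeg : 0 ≤ s → 0 ≤ t → deg r s + deg r' t = 2 * n - k) {c : ℂ} (hc : c ≠ 0)
    {P : LpComp S p r' t →ₗ[ℂ] LpLoc S p' r s →ₗ[ℂ] ℂ}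
    (hP : ∀ f g, P f g = c * pairing S.Ω f.form g.form) : RepresentsDual P where
  cont g := by
    simp only [hP]
    exact continuous_const.mul (𝒜.continuous_pairing_comp hpp' g.isLpLoc)
  repr l hl := by
    obtain ⟨g, hg⟩ := 𝒜.exists_repr_comp hp hp' hpp' (t := s) (by omega)
      (fun h h' => by rw [add_comm]; exact hdeg h' h) l fun f hf =>
      hl f fun g => by rw [hP, hf, mul_zero]
    exact ⟨c⁻¹ • g, fun f => by rw [hg, map_smul, hP, smul_eq_mul, inv_mul_cancel_left₀ hc]⟩

theorem isWeakDbar_iff (hr : n - r = r') (ht : (n : ℤ) - k - s = t)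
    {f : M → Alt dM a ℂ} {g : M → Alt dM b ℂ} :
    IsWeakDbar S r s f g ↔ ∀ φ : M → Alt dM (deg r' t) ℂ, IsTestForm S t φ →
      pairing S.Ω g φ = (-1) ^ (a + 1) * pairing S.Ω f (dForm φ) := by
  subst hr
  subst ht
  rfl

theorem isWeakDbar_zero_iff (h : s = t) {f : M → Alt dM m ℂ} :
    IsWeakDbar S r s f (0 : M → Alt dM a ℂ) ↔
      IsWeakDbar S r t f (0 : M → Alt dM b ℂ) := by
  subst h
  simp only [IsWeakDbar, pairing_zero_left]

theorem PatchAtlas.eq_zero_of_neg (𝒜 : PatchAtlas S) (hs : s < 0) {f : M → Alt dM m ℂ}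
    (hf : IsBidegree S s f) : f = 0 := by
  funext y
  refine (rep_eq_zero_iff y f (mem_chart_source _ y)).1 ?_
  rw [rep_eq_sum_frame (𝒜.patch y) hf (𝒜.patch y).mem]
  exact smul_eq_zero_of_right _ (Finset.sum_eq_zero fun κ _ => absurd κ.2 (by omega))

theorem dForm_zero : dForm (0 : M → Alt dM m ℂ) = 0 := by
  funext y
  by_contra h
  simpa [tsupport] using support_dForm_subset (0 : M → Alt dM m ℂ) h

/-- A test form as an element of `(L^p_c)^{r,q}(M)`. -/
def IsTestForm.toComp (p : ℝ≥0∞) [Fact (1 ≤ p)] {φ : M → Alt dM (deg r s) ℂ}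
    (hφ : IsTestForm S s φ) : LpComp S p r s :=
  ⟨φ, ⟨hφ.bidegree, hφ.smooth.isContForm.isLpLoc⟩, hφ.compact⟩

/-- The exterior derivative of a test form, as a test form of a degree that is only propositionally
equal to the degree of the derivative. -/
theorem PatchAtlas.exists_dForm (𝒜 : PatchAtlas S) (hs : s + 1 = t)
    {φ : M → Alt dM (deg r s) ℂ} (hφ : IsTestForm S s φ) :
    ∃ u : M → Alt dM (deg r t) ℂ, IsTestForm S t u ∧
      (∀ (a : ℕ) (f : M → Alt dM a ℂ), pairing S.Ω f u = pairing S.Ω f (dForm φ) ∧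
        pairing S.Ω f (dForm u) = 0 ∧ (IsSmoothForm f →
          pairing S.Ω u f = (-1) ^ (deg r s + 1) * pairing S.Ω φ (dForm f))) := by
  subst hs
  by_cases h0 : s < 0
  · have hz := 𝒜.eq_zero_of_neg h0 hφ.bidegree
    refine ⟨0, ⟨fun c => ?_, HasCompactSupport.zero, fun y => bidegAt_zero S y _⟩, fun a f => ?_⟩
    · have : rep c (0 : M → Alt dM (deg r (s + 1)) ℂ) = 0 :=
        funext fun y => rep_eq_zero c rfl
      rw [this]
      exact contDiffOn_const
    · simp only [hz, dForm_zero, pairing_zero_right, pairing_zero_left, mul_zero, implies_true,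
        and_self]
  · have key : ∀ e, deg r s + 1 = e → ∃ u : M → Alt dM e ℂ, IsTestForm S (s + 1) u ∧
      (∀ (a : ℕ) (f : M → Alt dM a ℂ), pairing S.Ω f u = pairing S.Ω f (dForm φ) ∧
        pairing S.Ω f (dForm u) = 0 ∧ (IsSmoothForm f →
          pairing S.Ω u f = (-1) ^ (deg r s + 1) * pairing S.Ω φ (dForm f))) := by
      rintro e rfl
      refine ⟨dForm φ, ⟨hφ.smooth.dForm, hasCompactSupport_dForm hφ.compact,
        hφ.bidegree.dForm (fun x => ⟨𝒜.patch x⟩) hφ.smooth⟩, fun a f => ⟨rfl, ?_, fun hf => ?_⟩⟩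
      · rw [dForm_dForm hφ.smooth, pairing_zero_right]
      · have h1 := 𝒜.stokes hf hφ.smooth hφ.compact
        exact pairing_transpose rfl rfl h1
    exact key _ (by unfold deg; omega)

/-- Green's formula for the weak operators, in all degrees. -/
theorem PatchAtlas.pairing_weak (𝒜 : PatchAtlas S) (hp : p ≠ ⊤) (hp' : p' ≠ ⊤)
    (hpp' : p⁻¹ + p'⁻¹ = 1) (hrr : r + r' = n) (hs : s₀ + 1 = s) (ht : t₀ + 1 = t)
    (hst : s₀ + t = (n : ℤ) - k) {f : LpLoc S p' r s₀} {g : LpLoc S p' r s}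
    (hfg : IsWeakDbar S r s f.form g.form) {h : LpComp S p r' t₀} {u : LpComp S p r' t}
    (hhu : IsWeakDbar S r' t h.form u.form) :
    pairing S.Ω g.form h.form = (-1) ^ (deg r s₀ + 1) * pairing S.Ω f.form u.form := by
  rw [isWeakDbar_iff (t := t₀) (r' := r') (by omega) (by omega)] at hfg
  rw [isWeakDbar_iff (t := s₀) (r' := r) (by omega) (by omega)] at hhu
  by_cases h1 : s₀ < 0
  · have hf := 𝒜.eq_zero_of_neg h1 f.isBidegree
    rw [hf, pairing_zero_left, mul_zero]
    refine 𝒜.pairing_eq_zero_of_tests hp' hpp' g.isLpLoc h.isLpLoc h.isBidegree (fun φ hφ => ?_)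
      h.hasCompactSupport.isCompact fun y hy => Or.inr (image_eq_zero_of_notMem_tsupport hy)
    rw [hfg φ hφ, hf, pairing_zero_left, mul_zero]
  by_cases h2 : t₀ < 0
  · have hh := 𝒜.eq_zero_of_neg h2 h.isBidegree
    rw [hh, pairing_zero_right, ← pairing_swap u.form f.form,
      𝒜.pairing_eq_zero_of_tests hp (by rwa [add_comm] at hpp') u.isLpLoc f.isLpLoc f.isBidegree
      (fun φ hφ => ?_) u.hasCompactSupport.isCompact
      fun y hy => Or.inl (image_eq_zero_of_notMem_tsupport hy), mul_zero, mul_zero]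
    rw [hhu φ hφ, hh, pairing_zero_left, mul_zero]
  exact 𝒜.green hp' hpp' (by unfold deg; omega) (by unfold deg; omega) f.isLpLoc g.isLpLoc h.isLpLoc
    u.isLpLoc f.isBidegree h.isBidegree hfg hhu h.hasCompactSupport u.hasCompactSupport

/-- The weak operator on `L^{p'}_loc` is the transpose of the weak operator on `L^p_c`. -/
theorem PatchAtlas.isWeakDbar_loc_iff (𝒜 : PatchAtlas S) (hp : p ≠ ⊤) (hp' : p' ≠ ⊤)
    (hpp' : p⁻¹ + p'⁻¹ = 1) (hrr : r + r' = n) (hs : s₀ + 1 = s) (ht : t₀ + 1 = t)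
    (hst : s₀ + t = (n : ℤ) - k) {f : LpLoc S p' r s₀} {g : LpLoc S p' r s} :
    IsWeakDbar S r s f.form g.form ↔ ∀ (h : LpComp S p r' t₀) (u : LpComp S p r' t),
      IsWeakDbar S r' t h.form u.form →
        pairing S.Ω g.form h.form = (-1) ^ (deg r s₀ + 1) * pairing S.Ω f.form u.form := by
  refine ⟨fun hfg h u hhu => 𝒜.pairing_weak hp hp' hpp' hrr hs ht hst hfg hhu, fun H => ?_⟩
  rw [isWeakDbar_iff (t := t₀) (r' := r') (by omega) (by omega)]
  intro φ hφ
  obtain ⟨u, hu, h⟩ := 𝒜.exists_dForm ht hφ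
  rw [← (h _ f.form).1]
  refine H (hφ.toComp p) (hu.toComp p) ?_
  rw [isWeakDbar_iff (t := s₀) (r' := r) (by omega) (by omega)]
  exact fun ψ hψ => (h _ ψ).2.2 hψ.smooth

/-- The weak operator on `L^p_c` is the transpose of the weak operator on `L^{p'}_loc`. -/
theorem PatchAtlas.isWeakDbar_comp_iff (𝒜 : PatchAtlas S) (hp : p ≠ ⊤) (hp' : p' ≠ ⊤)
    (hpp' : p⁻¹ + p'⁻¹ = 1) (hrr : r + r' = n) (hs : s₀ + 1 = s) (ht : t₀ + 1 = t)
    (hst : s₀ + t = (n : ℤ) - k) {h : LpComp S p r' t₀} {u : LpComp S p r' t} :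
    IsWeakDbar S r' t h.form u.form ↔ ∀ (f : LpLoc S p' r s₀) (g : LpLoc S p' r s),
      IsWeakDbar S r s f.form g.form →
        pairing S.Ω g.form h.form = (-1) ^ (deg r s₀ + 1) * pairing S.Ω f.form u.form := by
  refine ⟨fun hhu f g hfg => 𝒜.pairing_weak hp hp' hpp' hrr hs ht hst hfg hhu, fun H => ?_⟩
  rw [isWeakDbar_iff (t := s₀) (r' := r) (by omega) (by omega)]
  intro φ hφ
  obtain ⟨g, hg, hg'⟩ := 𝒜.exists_dForm hs hφ
  have h1 : pairing S.Ω g h.form = (-1) ^ (deg r s₀ + 1) * pairing S.Ω φ u.form := H (LpComp.toLoc (hφ.toComp p')) (LpComp.toLoc (hg.toComp p')) (by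
    rw [isWeakDbar_iff (t := t₀) (r' := r') (by omega) (by omega)]
    exact fun ψ hψ => (hg' _ ψ).2.2 hψ.smooth)
  rw [← (hg' _ h.form).1]
  by_cases h2 : s₀ < 0
  · rw [(hg' _ h.form).1, 𝒜.eq_zero_of_neg h2 hφ.bidegree, dForm_zero, pairing_zero_right,
      pairing_zero_right, mul_zero]
  by_cases h3 : t₀ < 0
  · have hh := 𝒜.eq_zero_of_neg h3 h.isBidegree
    rw [hh, pairing_zero_right] at h1
    rw [hh, pairing_zero_left, mul_zero, ← pairing_swap,
      (mul_eq_zero.1 h1.symm).resolve_left (by simp), mul_zero]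
  exact pairing_transpose (by unfold deg; omega) (by unfold deg; omega) h1

/-- Elements of the range of `∂̄_b` are closed. -/
theorem PatchAtlas.isWeakDbar_zero (𝒜 : PatchAtlas S) {f : M → Alt dM a ℂ}
    {g : M → Alt dM b ℂ} (h : IsWeakDbar S r s f g) :
    IsWeakDbar S r (s + 1) g (0 : M → Alt dM m ℂ) := by
  intro φ hφ
  obtain ⟨u, hu, hu'⟩ := 𝒜.exists_dForm (t := (n : ℤ) - k - s) (by omega) hφ
  rw [pairing_zero_left, ← (hu' _ g).1, h u hu, (hu' _ f).2.1, mul_zero, mul_zero]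

end WeakDbar

/-! ### Closed range and cohomology -/

section Cohomology

variable [Fact (1 ≤ p)] [Fact (1 ≤ p')] [T2Space M] [SigmaCompactSpace M]

theorem mem_ELoc_iff (hs : s₀ + 1 = s) {g : LpLoc S p r s} :
    g ∈ ELoc S p r s ↔ ∃ f : LpLoc S p r s₀, IsWeakDbar S r s f.form g.form := by
  obtain rfl : s₀ = s - 1 := by omega
  rfl

variable (S p r s₀ s) in
/-- The graph of the weak operator on `L^p_loc`. -/
def graphLoc : Submodule ℂ (LpLoc S p r s₀ × LpLoc S p r s) where
  carrier := {q | IsWeakDbar S r s q.1.form q.2.form}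
  add_mem' := fun {q q'} h h' =>
    IsWeakDbar.add (Fact.out : 1 ≤ p) h h' q.1.2.2 q'.1.2.2 q.2.2.2 q'.2.2.2
  zero_mem' := IsWeakDbar.zero S r s
  smul_mem' := fun z _ h => IsWeakDbar.smul z h

variable (S p r s₀ s) in
/-- The graph of the weak operator on `L^p_c`. -/
def graphComp : Submodule ℂ (LpComp S p r s₀ × LpComp S p r s) where
  carrier := {q | IsWeakDbar S r s q.1.form q.2.form}
  add_mem' := fun {q q'} h h' =>
    IsWeakDbar.add (Fact.out : 1 ≤ p) h h' q.1.2.1.2 q'.1.2.1.2 q.2.2.1.2 q'.2.2.1.2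
  zero_mem' := IsWeakDbar.zero S r s
  smul_mem' := fun z _ h => IsWeakDbar.smul z h

theorem PatchAtlas.mem_ZLoc_iff (𝒜 : PatchAtlas S) (hp : p ≠ ⊤) (hp' : p' ≠ ⊤)
    (hpp' : p⁻¹ + p'⁻¹ = 1) (hrr : r + r' = n) (hst : s + t = (n : ℤ) - k) {f : LpLoc S p' r s} :
    f ∈ ZLoc S p' r s ↔ ∀ u ∈ EComp S p r' t, pairing S.Ω f.form u.form = 0 := by
  have h1 := 𝒜.isWeakDbar_loc_iff hp hp' hpp' hrr rfl (sub_add_cancel t 1) hst (f := f) (g := 0)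
  refine Iff.trans h1 ⟨fun H u hu => ?_, fun H h u hu => ?_⟩
  · obtain ⟨h, hh⟩ := hu
    have h2 := H h u hh
    rw [show (0 : LpLoc S p' r (s + 1)).form = 0 from rfl, pairing_zero_left] at h2
    exact (mul_eq_zero.1 h2.symm).resolve_left (by simp)
  · rw [H u ⟨h, hu⟩, mul_zero]
    exact pairing_zero_left _ _

theorem PatchAtlas.mem_ZComp_iff (𝒜 : PatchAtlas S) (hp : p ≠ ⊤) (hp' : p' ≠ ⊤)
    (hpp' : p⁻¹ + p'⁻¹ = 1) (hrr : r + r' = n) (hst : s + t = (n : ℤ) - k) {h : LpComp S p r' t} :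
    h ∈ ZComp S p r' t ↔ ∀ g ∈ ELoc S p' r s, pairing S.Ω g.form h.form = 0 := by
  have h1 := 𝒜.isWeakDbar_comp_iff hp hp' hpp' hrr (sub_add_cancel s 1) rfl (by omega) (h := h)
    (u := 0)
  refine Iff.trans h1 ⟨fun H g hg => ?_, fun H f g hg => ?_⟩
  · obtain ⟨f, hf⟩ := hg
    exact (H f g hf).trans (mul_eq_zero_of_right _ (pairing_zero_right _ _))
  · rw [H g ⟨f, hg⟩]
    exact (mul_eq_zero_of_right _ (pairing_zero_right _ _)).symm

theorem PatchAtlas.ELoc_le (𝒜 : PatchAtlas S) : ELoc S p r s ≤ ZLoc S p r s :=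
  fun _ ⟨_, hf⟩ => 𝒜.isWeakDbar_zero hf

theorem PatchAtlas.EComp_le (𝒜 : PatchAtlas S) : EComp S p r s ≤ ZComp S p r s :=
  fun _ ⟨_, hf⟩ => 𝒜.isWeakDbar_zero hf

/-- A form with zero pairing is in the range of `∂̄_b`, as it represents `0`. -/
theorem mem_ELoc_of_pairing (hrr : r + r' = n) (hst : s + t = (n : ℤ) - k) {g : LpLoc S p' r s}
    (h : ∀ u : LpComp S p r' t, pairing S.Ω g.form u.form = 0) : g ∈ ELoc S p' r s := by
  refine ⟨0, (isWeakDbar_iff (r' := r') (t := t) (by omega) (by omega)).2 fun φ hφ => ?_⟩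
  rw [show (0 : LpLoc S p' r (s - 1)).form = 0 from rfl, pairing_zero_left, mul_zero]
  exact h (hφ.toComp p)

theorem mem_EComp_of_pairing (hrr : r + r' = n) (hst : s + t = (n : ℤ) - k) {g : LpComp S p r' t}
    (h : ∀ u : LpLoc S p' r s, pairing S.Ω g.form u.form = 0) : g ∈ EComp S p r' t := by
  refine ⟨0, (isWeakDbar_iff (r' := r) (t := s) (by omega) (by omega)).2 fun φ hφ => ?_⟩
  rw [show (0 : LpComp S p r' (t - 1)).form = 0 from rfl, pairing_zero_left, mul_zero]
  exact h (LpComp.toLoc (hφ.toComp p'))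

/-- A subspace `E` of a closed subspace `Z` is closed iff `Z / E` is Hausdorff. -/
theorem t2Space_quotient_iff {A : Type*} [AddCommGroup A] [Module ℂ A] [TopologicalSpace A]
    [IsTopologicalAddGroup A] {E Z : Submodule ℂ A} (hZ : IsClosed (Z : Set A)) (hEZ : E ≤ Z) :
    T2Space (Z ⧸ E.submoduleOf Z) ↔ IsClosed (E : Set A) := by
  have h1 : (E : Set A) = Subtype.val '' (E.submoduleOf Z : Set Z) := by
    ext a
    exact ⟨fun h => ⟨⟨a, hEZ h⟩, h, rfl⟩, fun ⟨_, h, e⟩ => e ▸ h⟩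
  rw [h1]
  refine Iff.trans ?_ hZ.isClosedEmbedding_subtypeVal.isClosed_iff_image_isClosed
  constructor
  · intro h
    have h2 : (E.submoduleOf Z : Set Z) = (E.submoduleOf Z).mkQ ⁻¹' {0} := by
      ext a
      exact (Submodule.Quotient.mk_eq_zero _).symm
    rw [h2]
    have hc : Continuous (E.submoduleOf Z).mkQ := continuous_quot_mk
    exact isClosed_singleton.preimage hc
  · intro h
    infer_instance

theorem PatchAtlas.isClosed_ZLoc (𝒜 : PatchAtlas S) (hp : p ≠ ⊤) (hp' : p' ≠ ⊤)
    (hpp' : p⁻¹ + p'⁻¹ = 1) (hrr : r + r' = n) (hst : s + t = (n : ℤ) - k) :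
    IsClosed (ZLoc S p' r s : Set (LpLoc S p' r s)) := by
  have h : (ZLoc S p' r s : Set (LpLoc S p' r s)) =
      ⋂ u ∈ EComp S p r' t, {f | pairing S.Ω f.form u.form = 0} := by
    ext f
    simp only [mem_iInter]
    exact 𝒜.mem_ZLoc_iff hp hp' hpp' hrr hst
  rw [h]
  exact isClosed_biInter fun u _ => isClosed_eq (𝒜.continuous_pairing (by rwa [add_comm] at hpp')
    u.isLpLoc u.hasCompactSupport) continuous_const

theorem PatchAtlas.isClosed_ZComp (𝒜 : PatchAtlas S) (hp : p ≠ ⊤) (hp' : p' ≠ ⊤)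
    (hpp' : p⁻¹ + p'⁻¹ = 1) (hrr : r + r' = n) (hst : s + t = (n : ℤ) - k) :
    IsClosed (ZComp S p r' t : Set (LpComp S p r' t)) := by
  have h : (ZComp S p r' t : Set (LpComp S p r' t)) =
      ⋂ g ∈ ELoc S p' r s, {h | pairing S.Ω h.form g.form = 0} := by
    ext h
    simp only [mem_iInter]
    refine (𝒜.mem_ZComp_iff hp hp' hpp' hrr hst).trans (forall₂_congr fun g _ => ?_)
    exact pairing_eq_zero_comm
  rw [h]
  exact isClosed_biInter fun u _ => isClosed_eq (𝒜.continuous_pairing_comp hpp' u.isLpLoc)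
    continuous_const

/-- A closed subspace of a Fréchet space is a Baire space, hence barrelled. -/
theorem PatchAtlas.barrelledSpace_ZLoc (𝒜 : PatchAtlas S) (hp' : p' ≠ ⊤)
    (hZ : IsClosed (ZLoc S p' r s : Set (LpLoc S p' r s))) : BarrelledSpace ℂ (ZLoc S p' r s) := by
  let : UniformSpace (LpLoc S p' r s) := IsTopologicalAddGroup.rightUniformSpace _
  obtain ⟨h1, h2⟩ := LpLoc.complete (r := r) (s := s) 𝒜 hp'
  have h3 : CompleteSpace (ZLoc S p' r s) := hZ.completeSpace_coe
  have h5 : (uniformity (ZLoc S p' r s)).IsCountablyGenerated := Filter.comap.isCountablyGenerated _ _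
  have h4 : BaireSpace (ZLoc S p' r s) := baireSpace_of_complete
  exact BaireSpace.instBarrelledSpace

/-- The degrees of forms of complementary bidegrees add up to the dimension. -/
theorem deg_add_deg (hk : k ≤ n) (hrr : r + r' = n) (hst : s + t = (n : ℤ) - k) (hs : 0 ≤ s)
    (ht : 0 ≤ t) : deg r s + deg r' t = 2 * n - k := by
  unfold deg
  omega

/-- The closed range theorem for the weak operators. -/
theorem PatchAtlas.isClosed_ELoc_iff (𝒜 : PatchAtlas S) (hk : k ≤ n) (hp : p ≠ ⊤) (hp' : p' ≠ ⊤)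
    (hpp' : p⁻¹ + p'⁻¹ = 1) (hrr : r + r' = n) (hs : s₀ + 1 = s)
    (hst : s₀ + t = (n : ℤ) - k) :
    IsClosed (ELoc S p' r s : Set (LpLoc S p' r s)) ↔
      (EComp S p r' t : Set (LpComp S p r' t)) =
        {g | ∀ f ∈ ZLoc S p' r s₀, pairing S.Ω g.form f.form = 0} := by
  have hcard : ((frameH n k).card : ℤ) = (n : ℤ) - k := by
    rw [card_frameH hk]
    omega
  have hst1 : s + (t - 1) = (n : ℤ) - k := by omega
  let : UniformSpace (LpLoc S p' r s₀) := IsTopologicalAddGroup.rightUniformSpace _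
  let : UniformSpace (LpLoc S p' r s) := IsTopologicalAddGroup.rightUniformSpace _
  have : IsUniformAddGroup (LpLoc S p' r s₀) := isUniformAddGroup_of_addCommGroup
  have : IsUniformAddGroup (LpLoc S p' r s) := isUniformAddGroup_of_addCommGroup
  obtain ⟨_, _⟩ := LpLoc.complete (r := r) (s := s₀) 𝒜 hp'
  obtain ⟨_, _⟩ := LpLoc.complete (r := r) (s := s) 𝒜 hp'
  have hP₀ : RepresentsDual (pairLoc S r r' s₀ t hpp') := 𝒜.representsDual_loc hp hp' hpp'
    (by omega) (deg_add_deg hk hrr hst) one_ne_zero fun f g => (one_mul _).symm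
  have hP₁ : RepresentsDual (pairLoc S r r' s (t - 1) hpp') := 𝒜.representsDual_loc hp hp' hpp'
    (by omega) (deg_add_deg hk hrr hst1) one_ne_zero fun f g => (one_mul _).symm
  have hE : (ELoc S p' r s : Set (LpLoc S p' r s)) =
      {g | ∃ f, (f, g) ∈ graphLoc S p' r s s₀} := ext fun g => mem_ELoc_iff hs
  have hT : ∀ f g, (f, g) ∈ graphLoc S p' r s s₀ ↔ ∀ h u, (h, u) ∈ graphComp S p r' t (t - 1) →
      pairLoc S r r' s (t - 1) hpp' g h =
        (-1) ^ (deg r s₀ + 1) * pairLoc S r r' s₀ t hpp' f u := fun f g =>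
    𝒜.isWeakDbar_loc_iff hp hp' hpp' hrr hs (sub_add_cancel t 1) hst
  have hT' : ∀ h u, (h, u) ∈ graphComp S p r' t (t - 1) ↔ ∀ f g, (f, g) ∈ graphLoc S p' r s s₀ →
      pairLoc S r r' s (t - 1) hpp' g h =
        (-1) ^ (deg r s₀ + 1) * pairLoc S r r' s₀ t hpp' f u := fun h u =>
    𝒜.isWeakDbar_comp_iff hp hp' hpp' hrr hs (sub_add_cancel t 1) hst
  have hZ : ∀ f : LpLoc S p' r s₀, (f, 0) ∈ graphLoc S p' r s s₀ ↔ f ∈ ZLoc S p' r s₀ := fun f =>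
    isWeakDbar_zero_iff hs.symm
  have hswap : ∀ (f : LpLoc S p' r s₀) (g : LpComp S p r' t),
      pairing S.Ω g.form f.form = 0 ↔ pairLoc S r r' s₀ t hpp' f g = 0 := fun _ _ =>
    pairing_eq_zero_comm
  have hsub : ∀ g ∈ EComp S p r' t, ∀ f ∈ ZLoc S p' r s₀, pairing S.Ω g.form f.form = 0 :=
    fun g hg f hf => (hswap f g).2 ((𝒜.mem_ZLoc_iff hp hp' hpp' hrr hst).1 hf g hg)
  constructor
  · intro h
    refine Subset.antisymm (fun g hg => hsub g hg) fun g hg => ?_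
    rw [hE] at h
    exact exists_transpose_of_isClosed_range hP₀ hP₁ hT hT' h fun f hf =>
      (hswap f g).1 (hg f ((hZ f).1 hf))
  · intro h
    rw [hE]
    refine isClosed_range_of_exists_transpose (by simp) hP₀ hP₁ hT fun g hg => ?_
    have h1 : g ∈ (EComp S p r' t : Set (LpComp S p r' t)) := by
      rw [h]
      exact fun f hf => (hswap f g).2 (hg f ((hZ f).2 hf))
    exact h1

end Cohomology

end CR

end CRSerre

end

open CRSerre
theorem mainTheorem6 {n k : ℕ} (hk : k ≤ n)
    {X : Type*} [TopologicalSpace X] [T2Space X]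
    [ChartedSpace (EuclideanSpace ℂ (Fin n)) X] [IsManifold 𝓘(ℂ, EuclideanSpace ℂ (Fin n)) ω X]
    {M : Type*} [TopologicalSpace M] [T2Space M] [SigmaCompactSpace M]
    [ChartedSpace (Model (2 * n - k)) M] [IsManifold 𝓘(ℝ, Model (2 * n - k)) ∞ M]
    (S : GenericCRSubmanifold n k X M)
    (r q : ℕ) (hr : r ≤ n) (hq : q ≤ n - k)
    (p p' : ℝ≥0∞) [Fact (1 ≤ p)] [Fact (1 ≤ p')] (hp : p ≠ ⊤) (hp' : p' ≠ ⊤)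
    (hpp' : p⁻¹ + p'⁻¹ = 1) :
    List.TFAE [
      (EComp S p (n - r) ((n : ℤ) - k - q) : Set (LpComp S p (n - r) ((n : ℤ) - k - q))) =
        {g | ∀ f ∈ ZLoc S p' r q, pairing S.Ω g.form f.form = 0},
      T2Space (HComp S p (n - r) ((n : ℤ) - k - q)),
      (ELoc S p' r (q + 1) : Set (LpLoc S p' r (q + 1))) =
        {g | ∀ f ∈ ZComp S p (n - r) ((n : ℤ) - k - q - 1), pairing S.Ω g.form f.form = 0},
      T2Space (HLoc S p' r (q + 1))] ∧
    (T2Space (HLoc S p' r (q + 1)) →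
      (∃ e : HComp S p (n - r) ((n : ℤ) - k - q) ≃ₗ[ℂ] (HLoc S p' r q →L[ℂ] ℂ),
        Continuous e.symm ∧
        ∀ (g : ZComp S p (n - r) ((n : ℤ) - k - q)) (f : ZLoc S p' r q),
          e (Submodule.Quotient.mk g) (Submodule.Quotient.mk f) =
            pairing S.Ω g.1.form f.1.form) ∧
      (∃ e : HLoc S p' r (q + 1) ≃L[ℂ] (HComp S p (n - r) ((n : ℤ) - k - q - 1) →L[ℂ] ℂ),
        ∀ (g : ZLoc S p' r (q + 1)) (f : ZComp S p (n - r) ((n : ℤ) - k - q - 1)),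
          e (Submodule.Quotient.mk g) (Submodule.Quotient.mk f) =
            pairing S.Ω g.1.form f.1.form)) := by
  obtain ⟨𝒜⟩ := nonempty_patchAtlas hk S
  have hcard : ((frameH n k).card : ℤ) = (n : ℤ) - k := by
    rw [card_frameH hk]
    omega
  have hrr : r + (n - r) = n := by omega
  have h0 : (q : ℤ) + ((n : ℤ) - k - q) = (n : ℤ) - k := by omega
  have h1 : ((q : ℤ) + 1) + ((n : ℤ) - k - q - 1) = (n : ℤ) - k := by omega
  have hd0 := deg_add_deg hk hrr h0
  have hd1 := deg_add_deg hk hrr h1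
  -- The duality between the forms of bidegrees `(r, q)` and `(n - r, n - k - q)`.
  set φ := (pairComp S r (n - r) q ((n : ℤ) - k - q) hpp').flip with hφ
  have hφa : ∀ f g, φ f g = pairing S.Ω g.form f.form := fun f g => pairComp_apply hpp' g f
  have hφ1 : RepresentsDual φ := 𝒜.representsDual_loc hp hp' hpp' (by omega) hd0
    (c := (-1) ^ (deg r q * deg (n - r) ((n : ℤ) - k - q))) (by simp) fun f g => rfl
  have hφ2 : RepresentsDual φ.flip := 𝒜.representsDual_comp hp hp' hpp' (by omega) hd0 one_ne_zero
    fun g f => (hφa f g).trans (one_mul _).symm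
  -- The duality between the forms of bidegrees `(n - r, n - k - q - 1)` and `(r, q + 1)`.
  set ψ := (pairLoc S r (n - r) ((q : ℤ) + 1) ((n : ℤ) - k - q - 1) hpp').flip with hψ
  have hψa : ∀ g f, ψ g f = pairing S.Ω f.form g.form := fun g f => rfl
  have hψ1 : RepresentsDual ψ := 𝒜.representsDual_comp hp hp' hpp' (by omega) hd1
    (c := (-1) ^ (deg (n - r) ((n : ℤ) - k - q - 1) * deg r ((q : ℤ) + 1))) (by simp)
    fun g f => (pairing_swap g.form f.form).symm
  have hψ2 : RepresentsDual ψ.flip := 𝒜.representsDual_loc hp hp' hpp' (by omega) hd1 one_ne_zero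
    fun f g => (one_mul _).symm
  have hZ0 : ∀ g, g ∈ ZComp S p (n - r) ((n : ℤ) - k - q) ↔ ∀ f ∈ ELoc S p' r q, φ f g = 0 :=
    fun g => (𝒜.mem_ZComp_iff hp hp' hpp' hrr h0).trans (forall₂_congr fun f _ => by
      rw [hφa, pairing_eq_zero_comm])
  have hZ0' : ∀ f, f ∈ ZLoc S p' r q ↔ ∀ g ∈ EComp S p (n - r) ((n : ℤ) - k - q), φ f g = 0 :=
    fun f => (𝒜.mem_ZLoc_iff hp hp' hpp' hrr h0).trans (forall₂_congr fun g _ => by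
      rw [hφa, pairing_eq_zero_comm])
  have hZ1 : ∀ f, f ∈ ZLoc S p' r ((q : ℤ) + 1) ↔
      ∀ g ∈ EComp S p (n - r) ((n : ℤ) - k - q - 1), ψ g f = 0 :=
    fun f => 𝒜.mem_ZLoc_iff hp hp' hpp' hrr h1
  have hZ1' : ∀ g, g ∈ ZComp S p (n - r) ((n : ℤ) - k - q - 1) ↔
      ∀ f ∈ ELoc S p' r ((q : ℤ) + 1), ψ g f = 0 :=
    fun g => 𝒜.mem_ZComp_iff hp hp' hpp' hrr h1
  have hclosed := 𝒜.isClosed_ZLoc hp hp' hpp' hrr h1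
  have h41 := (t2Space_quotient_iff hclosed 𝒜.ELoc_le).trans
    (𝒜.isClosed_ELoc_iff hk hp hp' hpp' hrr rfl h0)
  have h34 := (isClosed_iff_eq_annihilator hψ2 hZ1' fun f hf =>
    mem_ELoc_of_pairing hrr h1 hf).trans (t2Space_quotient_iff hclosed 𝒜.ELoc_le).symm
  have h12 := (isClosed_iff_eq_annihilator hφ2 hZ0' fun g hg =>
    mem_EComp_of_pairing hrr h0 fun f => (hφa f g).symm.trans (hg f)).trans
    (t2Space_quotient_iff (𝒜.isClosed_ZComp hp hp' hpp' hrr h0) 𝒜.EComp_le).symm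
  have h12' : (EComp S p (n - r) ((n : ℤ) - k - q) : Set (LpComp S p (n - r) ((n : ℤ) - k - q))) =
      {g | ∀ f ∈ ZLoc S p' r q, pairing S.Ω g.form f.form = 0} ↔
      T2Space (HComp S p (n - r) ((n : ℤ) - k - q)) := by
    simpa only [LinearMap.flip_apply, hφa] using h12
  refine ⟨?_, fun h4 => ⟨?_, ?_⟩⟩
  · tfae_have 1 ↔ 2 := h12'
    tfae_have 4 ↔ 1 := h41
    tfae_have 3 ↔ 4 := h34
    tfae_finish
  · have hE := h41.1 h4
    obtain ⟨e, he, hea, -⟩ := exists_equiv_quotient_dual hφ1 hφ2 hZ0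
      (E' := EComp S p (n - r) ((n : ℤ) - k - q)) (Z := ZLoc S p' r q)
      (fun g => by
        rw [← SetLike.mem_coe, hE]
        exact forall₂_congr fun f _ => by rw [hφa])
      (fun f hf => (hZ0' f).2 hf) 𝒜.ELoc_le
      fun f hf => mem_ELoc_of_pairing hrr h0 fun g => pairing_eq_zero_comm.1 ((hφa f g).symm.trans (hf g))
    exact ⟨e, he, fun g f => (hea g f).trans (hφa _ _)⟩
  · have hE := h34.2 h4
    obtain ⟨e, he, hea, hb⟩ := exists_equiv_quotient_dual hψ1 hψ2 hZ1
      (E' := ELoc S p' r ((q : ℤ) + 1)) (Z := ZComp S p (n - r) ((n : ℤ) - k - q - 1))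
      (fun f => by
        rw [← SetLike.mem_coe, hE]
        rfl)
      (fun g hg => (hZ1' g).2 hg) 𝒜.EComp_le
      fun g hg => mem_EComp_of_pairing hrr h1 fun f => pairing_eq_zero_comm.1 (hg f)
    exact ⟨⟨e, hb (𝒜.barrelledSpace_ZLoc hp' hclosed), he⟩, hea⟩
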